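/- Let $\lambda\in\mathbb R$, $N(u)=\lambda|u|u$, $\square=\partial_t^2-\partial_{x_1}^2-\partial_{x_2}^2$ on $\mathbb R^{1+2}$, $\langle r\rangle=(1+|r|^2)^{1/2}$, and $\|f\|_{H^{k,s}}=\sum_{|\alpha|\le k}\|\langle x\rangle^s\partial^\alpha f\|_{L^2(\mathbb R^2)}$ (weak derivatives). For $n\in\mathbb Z$ and $\zeta>0$ put $$L_n(\zeta)=\frac1{2\pi}\int_0^{2\pi}|1+\zeta e^{-i\Theta}|(1+\zeta e^{-i\Theta})e^{-in\Theta}\,d\Theta .$$ **Assumption 1** (with constant $\rho_0\ge1$). $A_1,B_1\in H^{2,2}(\mathbb R^2)$ are complex-valued (continuous representatives) and $\rho_0^{-1}|A_1(\xi)|\le|B_1(\xi)|\le\rho_0|A_1(\xi)|$ for all $\xi\in\mathbb R^2$. The function $\zeta(\xi)=|B_1(\xi)|/|A_1(\xi)|$ if $A_1(\xi)\ne0$, $\zeta(\xi)=\lim_{z\to\xi,\,A_1(z)\neq0}|B_1(z)|/|A_1(z)|$ if $A_1(\xi)=0$, is well defined on $\operatorname{supp}A_1$ and has an extension to $\mathbb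 R^2$, again called $\zeta$, with $\rho_0^{-1}\le\zeta\le\rho_0$, $\partial_j\zeta\in L^4+L^\infty$ and $\partial_j\partial_k\zeta\in L^2+L^\infty$ for $j,k=1,2$. For $t\ge1$ and $|x|<t$ let $\theta=-\sqrt{t^2-|x|^2}$, $\mu=x/\sqrt{t^2-|x|^2}$, and let $$S_A(z)=\tfrac\lambda2\langle z\rangle^{-1}L_0(\zeta(z))|A_1(z)|,\qquad S_B(z)=-\tfrac\lambda2\langle z\rangle^{-1}L_0(1/\zeta(z))|B_1(z)|,$$ $e^{i\alpha}=A_1\overline{B_1}/(|A_1||B_1|)$, and for $n\ge2$ $$A_n=\tfrac{\lambda}{1-(2n-1)^2}L_{n-1}(\zeta)|A_1|A_1e^{i(n-1)\alpha},\qquad B_n=\tfrac{\lambda}{1-(2n-1)^2}L_{n-1}(1/\zeta)|B_1|B_1e^{-i(n-1)\alpha}$$ (read as $0$ where $A_1=B_1=0$). Define $\tilde u=u_{\mathrm{ap}}+v_{\mathrm{ap}}$ with $$u_{\mathrm{ap}}(t,x)=t^{-1}\mathbf 1_{\{|x|<t\}}\big[A_1(\mu)e^{i\theta+iS_A(\mu)\log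 t}+B_1(\mu)e^{-i\theta+iS_B(\mu)\log t}\big],$$ $$v_{\mathrm{ap}}(t,x)=t^{-2}\mathbf 1_{\{|x|<t\}}\sum_{n=2}^\infty\Big\{A_n(\mu)e^{i(2n-1)\theta+inS_A(\mu)\log t-i(n-1)S_B(\mu)\log t}+B_n(\mu)e^{-i(2n-1)\theta-i(n-1)S_A(\mu)\log t+inS_B(\mu)\log t}\Big\}.$$ **Proposition.** Let $\lambda\in\mathbb R$ and $\rho_0\ge1$. 1. There is a constant $C=C(\lambda,\rho_0)$ such that, for all $A_1,B_1,\zeta$ satisfying Assumption 1 with $\rho_0$, the series defining $v_{\mathrm{ap}}$ converges for all $t\ge1$, $|x|<t$, and for $t\ge3$ $$\|\tilde u(t)\|_{L^\infty}\le C\,t^{-1}m\,\langle m\rangle^2,\qquad m=\|A_1\|_{L^\infty}+\|B_1\|_{L^\infty},$$ $$\|((\square+1)\tilde u-N(\tilde u))(t)\|_{L^2}\le C\,t^{-2}(\log t)^2M\,\langle M\rangle^3,\qquad M=\|A_1\|_{H^{2,2}}+\|B_1\|_{H^{2,2}},$$ where $(\square+1)\tilde u$ is taken in the sense of distributions on $(1,\infty)\times\mathbb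 R^2$ and is a locally integrable function. 2. In particular, for every $\varepsilon_0>0$ there is $\eta=\eta(\lambda,\rho_0,\varepsilon_0)>0$ such that if, in addition, $\|A_1\|_{L^\infty}+\|B_1\|_{L^\infty}\le\eta$, then for every $\delta_0<1$ there is $T\ge1$ with $\|\tilde u(t)\|_{L^\infty}\le\varepsilon_0t^{-1}$ and $\|((\square+1)\tilde u-N(\tilde u))(t)\|_{L^2}\le\varepsilon_0t^{-1-\delta_0}$ for all $t\ge T$. 3. If Assumption 1 holds and $\{\xi:|A_1(\xi)|\neq|B_1(\xi)|\}$ has positive measure, then $\liminf_{t\to\infty}\|\operatorname{Im}\tilde u(t)\|_{L^2}>0$. 4. For $\zeta>0$, $L_0(\zeta)-\zeta L_0(1/\zeta)=0$ if and only if $\zeta=1$. -/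

import Mathlib

open MeasureTheory Filter Topology
open scoped ENNReal ContDiff

noncomputable section

namespace KG

/-- The plane with its Euclidean norm. -/
abbrev Plane : Type := EuclideanSpace ℝ (Fin 2)

/-- The Japanese bracket `⟨r⟩ = (1 + r²)^{1/2}`. -/
def jap (r : ℝ) : ℝ := Real.sqrt (1 + r ^ 2)

/-- The Japanese bracket of an extended non-negative real (used for norms). -/
def japE (r : ℝ≥0∞) : ℝ≥0∞ := (1 + r ^ 2) ^ (1 / 2 : ℝ)

/-! ### Weak derivatives and weighted Sobolev spaces -/

/-- Classical derivative of a test function in the direction `v`. -/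
def dirDeriv {V : Type*} [NormedAddCommGroup V] [NormedSpace ℝ V] (v : V) (φ : V → ℝ) : V → ℝ :=
  fun x => fderiv ℝ φ x v

/-- The `i`-th coordinate vector of the plane. -/
def basisVec (i : Fin 2) : Plane := EuclideanSpace.single i 1

/-- The classical derivative `∂^α φ`, `α = (α₁, α₂)`, of a test function on the plane. -/
def multiDeriv (α : ℕ × ℕ) (φ : Plane → ℝ) : Plane → ℝ :=
  (dirDeriv (basisVec 0))^[α.1] ((dirDeriv (basisVec 1))^[α.2] φ)

/-- `g` is the weak derivative `∂^α f` on the plane. -/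
def HasWeakDeriv {F : Type*} [NormedAddCommGroup F] [NormedSpace ℝ F]
    (α : ℕ × ℕ) (f g : Plane → F) : Prop :=
  LocallyIntegrable f ∧ LocallyIntegrable g ∧
    ∀ φ : Plane → ℝ, ContDiff ℝ ∞ φ → HasCompactSupport φ →
      ∫ x, multiDeriv α φ x • f x = (-1 : ℝ) ^ (α.1 + α.2) • ∫ x, φ x • g x

/-- The norm `∑_{|α| ≤ k} ‖⟨x⟩^s ∂^α f‖_{L²}` of `H^{k,s}(ℝ²)`, with value `∞` if some weak
derivative `∂^α f` does not exist. A weak derivative is unique almost everywhere, so each infimum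
below is over an empty family or over a family of equal values. -/
def sobolevNorm (k : ℕ) (s : ℝ) (f : Plane → ℂ) : ℝ≥0∞ :=
  ∑ j ∈ Finset.range (k + 1), ∑ α ∈ Finset.HasAntidiagonal.antidiagonal j,
    ⨅ (g : Plane → ℂ) (_ : HasWeakDeriv α f g),
      eLpNorm (fun x => (jap ‖x‖ ^ s) • g x) 2 volume

/-- Membership in the weighted Sobolev space `H^{k,s}(ℝ²)`. -/
def MemSobolev (k : ℕ) (s : ℝ) (f : Plane → ℂ) : Prop :=
  MemLp f 2 volume ∧ sobolevNorm k s f < ⊤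

/-- Membership in `L^p(ℝ²) + L^q(ℝ²)`. -/
def MemLpAdd (p q : ℝ≥0∞) (g : Plane → ℝ) : Prop :=
  ∃ g₁ g₂ : Plane → ℝ, MemLp g₁ p volume ∧ MemLp g₂ q volume ∧ g =ᵐ[volume] g₁ + g₂

/-! ### The assumption on the final data -/

/-- The standing assumption on the pair `(A₁, B₁)` with constant `ρ₀` and (extended) ratio
function `ζ`. Elements of `H^{2,2}(ℝ²)` are represented by their continuous representatives, to
which the pointwise conditions refer. -/
structure Admissible (ρ₀ : ℝ) (A B : Plane → ℂ) (ζ : Plane → ℝ) : Prop where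
  continuous_A : Continuous A
  continuous_B : Continuous B
  mem_A : MemSobolev 2 2 A
  mem_B : MemSobolev 2 2 B
  comparable : ∀ ξ, ρ₀⁻¹ * ‖A ξ‖ ≤ ‖B ξ‖ ∧ ‖B ξ‖ ≤ ρ₀ * ‖A ξ‖
  ratio : ∀ ξ, A ξ ≠ 0 → ζ ξ = ‖B ξ‖ / ‖A ξ‖
  ratio_limit : ∀ ξ ∈ tsupport A, A ξ = 0 →
    Tendsto (fun z => ‖B z‖ / ‖A z‖) (𝓝[{z | A z ≠ 0}] ξ) (𝓝 (ζ ξ))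
  first_deriv : ∀ α : ℕ × ℕ, α.1 + α.2 = 1 → ∃ g, HasWeakDeriv α ζ g ∧ MemLpAdd 4 ⊤ g
  second_deriv : ∀ α : ℕ × ℕ, α.1 + α.2 = 2 → ∃ g, HasWeakDeriv α ζ g ∧ MemLpAdd 2 ⊤ g
  bounds : ∀ ξ, ρ₀⁻¹ ≤ ζ ξ ∧ ζ ξ ≤ ρ₀

/-! ### The profile -/

/-- The nonlinearity `N(u) = λ |u| u`. -/
def nonlin (lam : ℝ) (u : ℂ) : ℂ := (lam : ℂ) * (‖u‖ : ℂ) * u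

/-- The Fourier coefficients
`L_n(ζ) = (2π)⁻¹ ∫₀^{2π} |1 + ζ e^{-iΘ}| (1 + ζ e^{-iΘ}) e^{-inΘ} dΘ`. -/
def fourierL (n : ℤ) (ζ : ℝ) : ℂ :=
  (1 / (2 * Real.pi) : ℂ) * ∫ Θ in (0 : ℝ)..(2 * Real.pi),
    (‖1 + (ζ : ℂ) * Complex.exp (-(Complex.I * Θ))‖ : ℂ) *
      (1 + (ζ : ℂ) * Complex.exp (-(Complex.I * Θ))) * Complex.exp (-(Complex.I * n * Θ))

/-- `θ = -√(t² - |x|²)`. -/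
def theta (t : ℝ) (x : Plane) : ℝ := -Real.sqrt (t ^ 2 - ‖x‖ ^ 2)

/-- `μ = x / √(t² - |x|²)`. -/
def mu (t : ℝ) (x : Plane) : Plane := (Real.sqrt (t ^ 2 - ‖x‖ ^ 2))⁻¹ • x

/-- `S_A(z) = (λ/2) ⟨z⟩⁻¹ L₀(ζ(z)) |A₁(z)|`. -/
def phaseA (lam : ℝ) (A : Plane → ℂ) (ζ : Plane → ℝ) (z : Plane) : ℂ :=
  (lam / 2 : ℂ) * ((jap ‖z‖)⁻¹ : ℝ) * fourierL 0 (ζ z) * (‖A z‖ : ℂ)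

/-- `S_B(z) = -(λ/2) ⟨z⟩⁻¹ L₀(1/ζ(z)) |B₁(z)|`. -/
def phaseB (lam : ℝ) (B : Plane → ℂ) (ζ : Plane → ℝ) (z : Plane) : ℂ :=
  -(lam / 2 : ℂ) * ((jap ‖z‖)⁻¹ : ℝ) * fourierL 0 (1 / ζ z) * (‖B z‖ : ℂ)

/-- `u_ap(t,x) = t⁻¹ 1_{|x|<t} [A₁(μ) e^{iθ + i S_A(μ) log t} + B₁(μ) e^{-iθ + i S_B(μ) log t}]`. -/
def uap (lam : ℝ) (A B : Plane → ℂ) (ζ : Plane → ℝ) (t : ℝ) (x : Plane) : ℂ :=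
  open Classical in
  if ‖x‖ < t then
    (t : ℂ)⁻¹ *
      (A (mu t x) * Complex.exp
          (Complex.I * theta t x + Complex.I * phaseA lam A ζ (mu t x) * Real.log t) +
        B (mu t x) * Complex.exp
          (-(Complex.I * theta t x) + Complex.I * phaseB lam B ζ (mu t x) * Real.log t))
  else 0

/-- The unimodular factor `e^{iα} = A₁ \bar B₁ / (|A₁| |B₁|)`. Where `A₁` or `B₁` vanishes its
value is immaterial, as it only occurs multiplied by `A₁` or `B₁`, which vanish simultaneously. -/
def relPhase (A B : Plane → ℂ) (z : Plane) : ℂ :=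
  A z * (starRingEnd ℂ) (B z) / ((‖A z‖ : ℂ) * (‖B z‖ : ℂ))

/-- `A_n = λ / (1 - (2n-1)²) · L_{n-1}(ζ) |A₁| A₁ e^{i(n-1)α}`, used for `n ≥ 2`. -/
def ampA (lam : ℝ) (A B : Plane → ℂ) (ζ : Plane → ℝ) (n : ℕ) (z : Plane) : ℂ :=
  (lam : ℂ) / (1 - (2 * (n : ℂ) - 1) ^ 2) * fourierL ((n : ℤ) - 1) (ζ z) *
    (‖A z‖ : ℂ) * A z * relPhase A B z ^ ((n : ℤ) - 1)

/-- `B_n = λ / (1 - (2n-1)²) · L_{n-1}(1/ζ) |B₁| B₁ e^{-i(n-1)α}`, used for `n ≥ 2`. -/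
def ampB (lam : ℝ) (A B : Plane → ℂ) (ζ : Plane → ℝ) (n : ℕ) (z : Plane) : ℂ :=
  (lam : ℂ) / (1 - (2 * (n : ℂ) - 1) ^ 2) * fourierL ((n : ℤ) - 1) (1 / ζ z) *
    (‖B z‖ : ℂ) * B z * relPhase A B z ^ (-((n : ℤ) - 1))

/-- The `n`-th term of the series of higher harmonics, `n ≥ 2`. -/
def harmonic (lam : ℝ) (A B : Plane → ℂ) (ζ : Plane → ℝ) (n : ℕ) (t : ℝ) (x : Plane) : ℂ :=
  ampA lam A B ζ n (mu t x) * Complex.exp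
      (Complex.I * (2 * (n : ℂ) - 1) * theta t x
        + Complex.I * n * phaseA lam A ζ (mu t x) * Real.log t
        - Complex.I * ((n : ℂ) - 1) * phaseB lam B ζ (mu t x) * Real.log t) +
    ampB lam A B ζ n (mu t x) * Complex.exp
      (-(Complex.I * (2 * (n : ℂ) - 1) * theta t x)
        - Complex.I * ((n : ℂ) - 1) * phaseA lam A ζ (mu t x) * Real.log t
        + Complex.I * n * phaseB lam B ζ (mu t x) * Real.log t)

/-- `v_ap(t,x) = t⁻² 1_{|x|<t} ∑_{n ≥ 2} (n-th harmonic)`. -/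
def vap (lam : ℝ) (A B : Plane → ℂ) (ζ : Plane → ℝ) (t : ℝ) (x : Plane) : ℂ :=
  open Classical in
  if ‖x‖ < t then ((t : ℂ) ^ 2)⁻¹ * ∑' n : ℕ, harmonic lam A B ζ (n + 2) t x else 0

/-- `ũ = u_ap + v_ap`. -/
def profile (lam : ℝ) (A B : Plane → ℂ) (ζ : Plane → ℝ) (t : ℝ) (x : Plane) : ℂ :=
  uap lam A B ζ t x + vap lam A B ζ t x

/-! ### The Klein-Gordon operator in the sense of distributions -/

/-- The classical d'Alembertian `∂_t² - ∂_{x₁}² - ∂_{x₂}²` of a test function on space-time. -/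
def boxTest (φ : ℝ × Plane → ℝ) : ℝ × Plane → ℝ := fun p =>
  dirDeriv ((1 : ℝ), (0 : Plane)) (dirDeriv ((1 : ℝ), (0 : Plane)) φ) p -
    ∑ i : Fin 2, dirDeriv ((0 : ℝ), basisVec i) (dirDeriv ((0 : ℝ), basisVec i) φ) p

/-- `(□ + 1) u = F` in the sense of distributions on `(1, ∞) × ℝ²`. -/
def IsKleinGordonOf (u F : ℝ → Plane → ℂ) : Prop :=
  LocallyIntegrableOn (fun p : ℝ × Plane => u p.1 p.2) {p | 1 < p.1} volume ∧
  LocallyIntegrableOn (fun p : ℝ × Plane => F p.1 p.2) {p | 1 < p.1} volume ∧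
  ∀ φ : ℝ × Plane → ℝ, ContDiff ℝ ∞ φ → HasCompactSupport φ → tsupport φ ⊆ {p | 1 < p.1} →
    ∫ p : ℝ × Plane, (boxTest φ p + φ p) • u p.1 p.2 = ∫ p : ℝ × Plane, φ p • F p.1 p.2

end KG

end

open MeasureTheory Filter Topology
open scoped ENNReal ContDiff

noncomputable section

namespace KG

open ENNReal (ofReal ofReal_mul ofReal_pow ofReal_le_ofReal ofReal_add ofReal_ne_top mul_ne_top add_ne_top ofReal_toReal)
open Complex (I exp norm_real exp_add normSq normSq_eq_norm_sq real_smul norm_I)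
open ContinuousLinearMap (fst snd lsmul compL opNorm_comp_le le_opNorm opNorm_le_bound lsmul_apply)
open Real (log sqrt norm_eq_abs cos norm_of_nonneg)

set_option maxSynthPendingDepth 3

/-! ### The quadratic nonlinearity `|z| z` -/

/-- The function `z ↦ |z| z`. -/
def absMul (z : ℂ) : ℂ := (‖z‖ : ℂ) * z

/-- The real derivative of `z ↦ |z| z`. -/
def absMulDeriv (z : ℂ) : ℂ →L[ℝ] ℂ :=
  ‖z‖ • ContinuousLinearMap.id ℝ ℂ + (innerSL ℝ z).smulRight ((‖z‖⁻¹ : ℝ) • z)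

lemma absMul_eq_smul : absMul = fun z => ‖z‖ • z := by
  ext1 z; simp [absMul]

lemma norm_absMul (z : ℂ) : ‖absMul z‖ = ‖z‖ ^ 2 := by
  simp [absMul, pow_two]

lemma nonlin_eq (lam : ℝ) (u : ℂ) : nonlin lam u = lam * absMul u := by
  simp [nonlin, absMul, mul_assoc]

lemma absMul_mul (w z : ℂ) : absMul (w * z) = ‖w‖ * w * absMul z := by
  simp only [absMul, norm_mul, Complex.ofReal_mul]; ring

lemma absMul_mul_of_norm_one {w : ℂ} (hw : ‖w‖ = 1) (z : ℂ) : absMul (w * z) = w * absMul z := by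
  simp [absMul_mul, hw]

lemma contDiffAt_absMul {z : ℂ} (hz : z ≠ 0) {n : WithTop ℕ∞} : ContDiffAt ℝ n absMul z := by
  rw [absMul_eq_smul]
  exact (contDiffAt_norm ℝ hz).smul contDiffAt_id

lemma hasFDerivAt_absMul (z : ℂ) : HasFDerivAt absMul (absMulDeriv z) z := by
  rcases eq_or_ne z 0 with rfl | hz
  · have h0 : absMulDeriv 0 = 0 := by ext w <;> simp [absMulDeriv]
    rw [h0, hasFDerivAt_iff_isLittleO_nhds_zero]
    have : (fun h : ℂ => absMul (0 + h) - absMul 0 - (0 : ℂ →L[ℝ] ℂ) h) = fun h => ‖h‖ • h := by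
      ext1 h; simp [absMul]
    rw [this]
    have h1 : (fun h : ℂ => ‖h‖ • h) =o[𝓝 0] fun h : ℂ => (1 : ℝ) • h := by
      refine Asymptotics.IsLittleO.smul_isBigO ?_ (Asymptotics.isBigO_refl _ _)
      rw [Asymptotics.isLittleO_one_iff]
      exact tendsto_norm_zero
    simpa using h1
  · rw [absMul_eq_smul]
    have h1 : HasFDerivAt (fun z : ℂ => ‖z‖) (‖z‖⁻¹ • innerSL ℝ z) z := by
      have h2 : HasFDerivAt (fun z : ℂ => ‖z‖ ^ 2) (2 • innerSL ℝ z) z := hasStrictFDerivAt_norm_sq z |>.hasFDerivAt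
      have h3 := h2.sqrt (by positivity)
      have h4 : (fun z : ℂ => sqrt (‖z‖ ^ 2)) = fun z => ‖z‖ := by
        ext1 w; rw [Real.sqrt_sq (norm_nonneg _)]
      rw [h4] at h3
      refine h3.congr_fderiv ?_
      rw [Real.sqrt_sq (norm_nonneg _)]
      ext w
      simp only [smul_apply, smul_eq_mul, nsmul_eq_mul, Nat.cast_ofNat]
      have : ‖z‖ ≠ 0 := by simpa using hz
      field_simp
    refine (h1.smul (hasFDerivAt_id z)).congr_fderiv ?_
    ext w <;> simp [absMulDeriv] <;> ring

lemma norm_absMulDeriv_le (z : ℂ) : ‖absMulDeriv z‖ ≤ 2 * ‖z‖ := by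
  refine opNorm_le_bound _ (by positivity) fun w => ?_
  simp only [absMulDeriv, add_apply, smul_apply,
    ContinuousLinearMap.id_apply, ContinuousLinearMap.smulRight_apply, innerSL_apply_apply]
  refine (norm_add_le _ _).trans ?_
  rw [norm_smul, norm_smul, norm_smul, norm_norm, norm_inv, norm_norm]
  rcases eq_or_ne z 0 with rfl | hz
  · simp
  · have hz' : ‖z‖ ≠ 0 := by simpa using hz
    rw [inv_mul_cancel₀ hz', mul_one]
    have := norm_inner_le_norm (𝕜 := ℝ) z w
    linarith

lemma norm_inner_smul_unit_sub_le (z y w : ℂ) :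
    ‖inner ℝ z w • ((‖z‖⁻¹ : ℝ) • z) - inner ℝ y w • ((‖y‖⁻¹ : ℝ) • y)‖ ≤ 3 * ‖z - y‖ * ‖w‖ := by
  rcases eq_or_ne z 0 with rfl | hz
  · simp only [inner_zero_left, zero_smul, zero_sub, norm_neg]
    rcases eq_or_ne y 0 with rfl | hy
    · simp
    · rw [norm_smul, norm_smul, norm_inv, norm_norm, inv_mul_cancel₀ (by simpa using hy), mul_one]
      refine (norm_inner_le_norm (𝕜 := ℝ) y w).trans ?_
      nlinarith [norm_nonneg y, norm_nonneg w, mul_nonneg (norm_nonneg y) (norm_nonneg w)]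
  rcases eq_or_ne y 0 with rfl | hy
  · simp only [inner_zero_left, zero_smul, sub_zero]
    rw [norm_smul, norm_smul, norm_inv, norm_norm, inv_mul_cancel₀ (by simpa using hz), mul_one]
    refine (norm_inner_le_norm (𝕜 := ℝ) z w).trans ?_
    nlinarith [norm_nonneg z, norm_nonneg w, mul_nonneg (norm_nonneg z) (norm_nonneg w)]
  have hz' : ‖z‖ ≠ 0 := by simpa using hz
  have hy' : ‖y‖ ≠ 0 := by simpa using hy
  have hyp : 0 < ‖y‖ := by positivity
  have hzp : 0 < ‖z‖ := by positivity
  have key : inner ℝ z w • ((‖z‖⁻¹ : ℝ) • z) - inner ℝ y w • ((‖y‖⁻¹ : ℝ) • y)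
      = inner ℝ (z - y) w • ((‖z‖⁻¹ : ℝ) • z)
        + inner ℝ y w • ((‖z‖⁻¹ : ℝ) • z - (‖y‖⁻¹ : ℝ) • y) := by
    rw [inner_sub_left]; module
  have hu : ‖y‖ * ‖(‖z‖⁻¹ : ℝ) • z - (‖y‖⁻¹ : ℝ) • y‖ ≤ 2 * ‖z - y‖ := by
    have e : (‖y‖ : ℝ) • ((‖z‖⁻¹ : ℝ) • z - (‖y‖⁻¹ : ℝ) • y)
        = (z - y) + ((‖y‖ - ‖z‖) * ‖z‖⁻¹) • z := by
      rw [smul_sub, smul_smul, smul_smul, mul_inv_cancel₀ hy', sub_mul, mul_inv_cancel₀ hz']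
      module
    have : ‖y‖ * ‖(‖z‖⁻¹ : ℝ) • z - (‖y‖⁻¹ : ℝ) • y‖
        = ‖(‖y‖ : ℝ) • ((‖z‖⁻¹ : ℝ) • z - (‖y‖⁻¹ : ℝ) • y)‖ := by
      rw [norm_smul, norm_norm]
    rw [this, e]
    refine (norm_add_le _ _).trans ?_
    rw [norm_smul, norm_mul, norm_inv, norm_norm, mul_assoc, inv_mul_cancel₀ hz', mul_one]
    have := abs_norm_sub_norm_le y z
    rw [norm_sub_rev y z] at this
    rw [norm_eq_abs]; linarith
  rw [key]
  refine (norm_add_le _ _).trans ?_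
  rw [norm_smul, norm_smul, norm_smul, norm_inv, norm_norm, inv_mul_cancel₀ hz', mul_one]
  have h1 := norm_inner_le_norm (𝕜 := ℝ) (z - y) w
  have h2 := norm_inner_le_norm (𝕜 := ℝ) y w
  have h3 : ‖inner ℝ y w‖ * ‖(‖z‖⁻¹ : ℝ) • z - (‖y‖⁻¹ : ℝ) • y‖ ≤ 2 * ‖z - y‖ * ‖w‖ := by
    calc _ ≤ ‖y‖ * ‖w‖ * ‖(‖z‖⁻¹ : ℝ) • z - (‖y‖⁻¹ : ℝ) • y‖ := by gcongr
      _ = (‖y‖ * ‖(‖z‖⁻¹ : ℝ) • z - (‖y‖⁻¹ : ℝ) • y‖) * ‖w‖ := by ring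
      _ ≤ _ := by gcongr
  linarith

lemma lipschitzWith_absMulDeriv : LipschitzWith 4 absMulDeriv := by
  refine LipschitzWith.of_dist_le_mul fun z y => ?_
  rw [dist_eq_norm, dist_eq_norm]
  refine opNorm_le_bound _ (by positivity) fun w => ?_
  have e : (absMulDeriv z - absMulDeriv y) w = (‖z‖ - ‖y‖) • w
      + (inner ℝ z w • ((‖z‖⁻¹ : ℝ) • z) - inner ℝ y w • ((‖y‖⁻¹ : ℝ) • y)) := by
    simp only [absMulDeriv, sub_apply, add_apply,
      smul_apply,
      ContinuousLinearMap.id_apply, ContinuousLinearMap.smulRight_apply, innerSL_apply_apply]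
    module
  rw [e]
  refine (norm_add_le _ _).trans ?_
  have h1 := norm_inner_smul_unit_sub_le z y w
  have h2 : ‖(‖z‖ - ‖y‖) • w‖ ≤ ‖z - y‖ * ‖w‖ := by
    rw [norm_smul, norm_eq_abs]
    gcongr
    exact abs_norm_sub_norm_le z y
  push_cast
  linarith

lemma contDiffAt_absMulDeriv {z : ℂ} (hz : z ≠ 0) : ContDiffAt ℝ 1 absMulDeriv z := by
  have h : absMulDeriv = fderiv ℝ absMul := by
    ext1 w; exact (hasFDerivAt_absMul w).fderiv.symm
  rw [h]
  exact (contDiffAt_absMul (n := 2) hz).fderiv_right (by norm_num)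

lemma norm_absMul_sub_le (z y : ℂ) : ‖absMul z - absMul y‖ ≤ (‖z‖ + ‖y‖) * ‖z - y‖ := by
  have e : absMul z - absMul y = (‖z‖ : ℂ) * (z - y) + ((‖z‖ : ℂ) - ‖y‖) * y := by
    simp only [absMul]; ring
  rw [e]
  refine (norm_add_le _ _).trans ?_
  rw [norm_mul, norm_mul, ← Complex.ofReal_sub, norm_real, norm_real, norm_norm,
    norm_eq_abs]
  nlinarith [abs_norm_sub_norm_le z y, norm_nonneg y]

lemma continuous_absMul : Continuous absMul := by
  unfold absMul; fun_prop

/-! ### Averages of `|a + b e^{-iΘ}| (a + b e^{-iΘ})` against a continuous kernel -/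

/-- The real-linear map `(a, b) ↦ a + e^{-iΘ} b`. -/
def rotSum (Θ : ℝ) : ℂ × ℂ →L[ℝ] ℂ :=
  fst ℝ ℂ ℂ +
    (ContinuousLinearMap.mul ℝ ℂ (exp (-(I * Θ)))).comp
      (snd ℝ ℂ ℂ)

lemma rotSum_apply (Θ : ℝ) (p : ℂ × ℂ) :
    rotSum Θ p = p.1 + exp (-(I * Θ)) * p.2 := by
  simp [rotSum]

lemma norm_exp_neg_I_mul (Θ : ℝ) : ‖exp (-(I * Θ))‖ = 1 := by
  rw [← mul_neg, ← Complex.ofReal_neg, mul_comm]; exact Complex.norm_exp_ofReal_mul_I _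

lemma norm_rotSum_apply_le (Θ : ℝ) (p : ℂ × ℂ) : ‖rotSum Θ p‖ ≤ 2 * ‖p‖ := by
  rw [rotSum_apply]
  refine (norm_add_le _ _).trans ?_
  rw [norm_mul, norm_exp_neg_I_mul, one_mul]
  have := norm_fst_le p; have := norm_snd_le p; linarith

lemma norm_rotSum_le (Θ : ℝ) : ‖rotSum Θ‖ ≤ 2 :=
  opNorm_le_bound _ (by norm_num) (norm_rotSum_apply_le Θ)

lemma continuous_rotSum : Continuous rotSum := by
  unfold rotSum
  have : Continuous fun Θ : ℝ => exp (-(I * Θ)) := by fun_prop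
  refine continuous_const.add ?_
  exact ((ContinuousLinearMap.mul ℝ ℂ).continuous.comp this).clm_comp continuous_const

lemma ae_rotSum_ne_zero {p : ℂ × ℂ} (hp : p ≠ 0) : ∀ᵐ Θ : ℝ, rotSum Θ p ≠ 0 := by
  by_cases hb : p.2 = 0
  · refine .of_forall fun Θ h => hp ?_
    rw [rotSum_apply, hb, mul_zero, add_zero] at h
    exact Prod.ext h hb
  · rw [ae_iff]
    push Not
    rcases Set.eq_empty_or_nonempty {Θ : ℝ | rotSum Θ p = 0} with h | ⟨Θ₀, h₀⟩
    · simp [h]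
    refine Set.Countable.measure_zero ?_ _
    have : {Θ : ℝ | rotSum Θ p = 0} ⊆ Set.range fun n : ℤ => Θ₀ - n * (2 * Real.pi) := by
      intro Θ h
      simp only [Set.mem_ofPred_eq, rotSum_apply] at h h₀
      have h1 : exp (-(I * Θ)) = exp (-(I * Θ₀)) := by
        have : (exp (-(I * Θ)) - exp (-(I * Θ₀))) * p.2 = 0 := by
          linear_combination h - h₀
        rcases mul_eq_zero.1 this with h | h
        · exact sub_eq_zero.1 h
        · exact absurd h hb
      rw [Complex.exp_eq_exp_iff_exists_int] at h1
      obtain ⟨n, hn⟩ := h1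
      refine ⟨n, ?_⟩
      have h2 := congrArg Complex.im hn
      simp at h2
      simp only
      linarith
    exact (Set.countable_range _).mono this

/-- The average `∫₀^{2π} k(Θ) |a + b e^{-iΘ}| (a + b e^{-iΘ}) dΘ`. -/
def kernelAvg (k : ℝ → ℂ) (p : ℂ × ℂ) : ℂ :=
  ∫ Θ in (0 : ℝ)..(2 * Real.pi), k Θ * absMul (rotSum Θ p)

/-- The integrand of the derivative of `kernelAvg`. -/
def kernelAvgDerivAux (k : ℝ → ℂ) (p : ℂ × ℂ) (Θ : ℝ) : ℂ × ℂ →L[ℝ] ℂ :=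
  k Θ • (absMulDeriv (rotSum Θ p)).comp (rotSum Θ)

lemma continuous_kernelAvgDerivAux {k : ℝ → ℂ} (hk : Continuous k) (p : ℂ × ℂ) :
    Continuous (kernelAvgDerivAux k p) := by
  refine hk.smul (Continuous.clm_comp ?_ continuous_rotSum)
  exact lipschitzWith_absMulDeriv.continuous.comp (continuous_rotSum.clm_apply continuous_const)

lemma hasFDerivAt_kernelAvg {k : ℝ → ℂ} (hk : Continuous k) (p : ℂ × ℂ) :
    HasFDerivAt (kernelAvg k) (∫ Θ in (0 : ℝ)..(2 * Real.pi), kernelAvgDerivAux k p Θ) p := by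
  have hc : ∀ q : ℂ × ℂ, Continuous fun Θ => k Θ * absMul (rotSum Θ q) := fun q =>
    hk.mul (continuous_absMul.comp (continuous_rotSum.clm_apply continuous_const))
  refine intervalIntegral.hasFDerivAt_integral_of_dominated_of_fderiv_le
    (F := fun q Θ => k Θ * absMul (rotSum Θ q)) (F' := kernelAvgDerivAux k)
    (bound := fun Θ => ‖k Θ‖ * (2 * (2 * (‖p‖ + 1)) * 2)) (Metric.ball_mem_nhds p one_pos)
    (.of_forall fun q => (hc q).aestronglyMeasurable)
    ((hc p).intervalIntegrable _ _) (continuous_kernelAvgDerivAux hk p).aestronglyMeasurable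
    (.of_forall fun Θ _ q hq => ?_)
    ((by fun_prop : Continuous fun Θ => ‖k Θ‖ * (2 * (2 * (‖p‖ + 1)) * 2)).intervalIntegrable _ _)
    (.of_forall fun Θ _ q hq => ?_)
  · rw [kernelAvgDerivAux, norm_smul]
    gcongr
    refine (opNorm_comp_le _ _).trans ?_
    have hq' : ‖q‖ ≤ ‖p‖ + 1 := by
      rw [mem_ball_iff_norm] at hq
      have := norm_le_norm_add_norm_sub' q p
      linarith
    gcongr
    · exact (norm_absMulDeriv_le _).trans (by have := norm_rotSum_apply_le Θ q; linarith)
    · exact norm_rotSum_le Θ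
  · exact ((hasFDerivAt_absMul _).comp q (rotSum Θ).hasFDerivAt).const_mul (k Θ)

/-- The second derivative of `p ↦ |rotSum Θ p| rotSum Θ p` off the zero set of `rotSum Θ`. -/
def absMulHess (k : ℝ → ℂ) (p : ℂ × ℂ) (Θ : ℝ) : ℂ × ℂ →L[ℝ] ℂ × ℂ →L[ℝ] ℂ :=
  (compL ℝ (ℂ × ℂ) ℂ ℂ (ContinuousLinearMap.mul ℝ ℂ (k Θ))).comp
    (((compL ℝ (ℂ × ℂ) ℂ ℂ).flip (rotSum Θ)).comp
      ((fderiv ℝ absMulDeriv (rotSum Θ p)).comp (rotSum Θ)))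

lemma aestronglyMeasurable_absMulHess {k : ℝ → ℂ} (hk : Continuous k) (p : ℂ × ℂ)
    (m : Measure ℝ) : AEStronglyMeasurable (absMulHess k p) m := by
  have h1 : Continuous fun X : ℝ × (ℂ →L[ℝ] ℂ →L[ℝ] ℂ) =>
      (compL ℝ (ℂ × ℂ) ℂ ℂ (ContinuousLinearMap.mul ℝ ℂ (k X.1))).comp
      (((compL ℝ (ℂ × ℂ) ℂ ℂ).flip (rotSum X.1)).comp
        (X.2.comp (rotSum X.1))) := by
    refine Continuous.clm_comp ?_ (Continuous.clm_comp ?_ (continuous_snd.clm_comp ?_))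
    · exact (compL ℝ (ℂ × ℂ) ℂ ℂ).continuous.comp
        ((ContinuousLinearMap.mul ℝ ℂ).continuous.comp (hk.comp continuous_fst))
    · exact ((compL ℝ (ℂ × ℂ) ℂ ℂ).flip).continuous.comp
        (continuous_rotSum.comp continuous_fst)
    · exact continuous_rotSum.comp continuous_fst
  have h2 : Measurable fun Θ : ℝ => (Θ, fderiv ℝ absMulDeriv (rotSum Θ p)) :=
    measurable_id.prodMk ((measurable_fderiv ℝ absMulDeriv).comp
      (continuous_rotSum.clm_apply continuous_const).measurable)
  exact (h1.comp_stronglyMeasurable h2.stronglyMeasurable).aestronglyMeasurable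

lemma norm_absMulHess_le (k : ℝ → ℂ) (p : ℂ × ℂ) (Θ : ℝ) :
    ‖absMulHess k p Θ‖ ≤ ‖k Θ‖ * 16 := by
  have h0 : ‖compL ℝ (ℂ × ℂ) ℂ ℂ (ContinuousLinearMap.mul ℝ ℂ (k Θ))‖
      ≤ ‖k Θ‖ := by
    refine opNorm_le_bound _ (by positivity) fun X => ?_
    simp only [ContinuousLinearMap.compL_apply]
    refine (opNorm_comp_le _ _).trans ?_
    gcongr; exact ContinuousLinearMap.opNorm_mul_apply_le ℝ ℂ (k Θ)
  refine (opNorm_comp_le _ _).trans ?_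
  refine mul_le_mul h0 ?_ (by positivity) (by positivity)
  refine (opNorm_comp_le _ _).trans ?_
  have h1 : ‖(compL ℝ (ℂ × ℂ) ℂ ℂ).flip (rotSum Θ)‖ ≤ 2 := by
    refine opNorm_le_bound _ (by norm_num) fun X => ?_
    simp only [ContinuousLinearMap.flip_apply, ContinuousLinearMap.compL_apply]
    refine (opNorm_comp_le _ _).trans ?_
    rw [mul_comm]; gcongr; exact norm_rotSum_le Θ
  have h2 : ‖(fderiv ℝ absMulDeriv (rotSum Θ p)).comp (rotSum Θ)‖ ≤ 4 * 2 := by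
    refine (opNorm_comp_le _ _).trans ?_
    gcongr
    · exact norm_fderiv_le_of_lipschitz ℝ lipschitzWith_absMulDeriv
    · exact norm_rotSum_le Θ
  calc _ ≤ 2 * (4 * 2 : ℝ) := by gcongr
    _ = 16 := by norm_num

lemma hasFDerivAt_kernelAvgDeriv {k : ℝ → ℂ} (hk : Continuous k) {p : ℂ × ℂ} (hp : p ≠ 0) :
    HasFDerivAt (fun q => ∫ Θ in (0 : ℝ)..(2 * Real.pi), kernelAvgDerivAux k q Θ)
      (∫ Θ in (0 : ℝ)..(2 * Real.pi), absMulHess k p Θ) p := by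
  refine (hasFDerivAt_integral_of_dominated_loc_of_lip_interval
    (bound := fun Θ => ‖k Θ‖ * 16) univ_mem
    (.of_forall fun q => (continuous_kernelAvgDerivAux hk q).aestronglyMeasurable)
    ((continuous_kernelAvgDerivAux hk p).intervalIntegrable _ _)
    (aestronglyMeasurable_absMulHess hk p _) (.of_forall fun Θ => ?_)
    ((by fun_prop : Continuous fun Θ => ‖k Θ‖ * 16).intervalIntegrable _ _)
    ((ae_restrict_of_ae (ae_rotSum_ne_zero hp)).mono fun Θ hΘ => ?_)).2
  · refine LipschitzOnWith.of_dist_le_mul fun q _ q' _ => ?_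
    rw [dist_eq_norm, dist_eq_norm, Real.coe_nnabs, abs_of_nonneg (by positivity)]
    have e : kernelAvgDerivAux k q Θ - kernelAvgDerivAux k q' Θ
        = k Θ • (absMulDeriv (rotSum Θ q) - absMulDeriv (rotSum Θ q')).comp (rotSum Θ) := by
      simp [kernelAvgDerivAux, smul_sub, ContinuousLinearMap.sub_comp]
    rw [e, norm_smul, mul_assoc]
    gcongr
    refine (opNorm_comp_le _ _).trans ?_
    have h1 := lipschitzWith_absMulDeriv.dist_le_mul (rotSum Θ q) (rotSum Θ q')
    rw [dist_eq_norm, dist_eq_norm, ← map_sub] at h1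
    have h2 := norm_rotSum_apply_le Θ (q - q')
    calc _ ≤ (8 * ‖q - q'‖) * 2 := by
          gcongr
          · push_cast at h1; linarith
          · exact norm_rotSum_le Θ
      _ = _ := by ring
  · have h1 : HasFDerivAt (fun q => absMulDeriv (rotSum Θ q))
        ((fderiv ℝ absMulDeriv (rotSum Θ p)).comp (rotSum Θ)) p :=
      ((contDiffAt_absMulDeriv hΘ).differentiableAt one_ne_zero).hasFDerivAt.comp p
        (rotSum Θ).hasFDerivAt
    have h2 := (((compL ℝ (ℂ × ℂ) ℂ ℂ).flip (rotSum Θ)).hasFDerivAt.comp p h1)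
    refine ((compL ℝ (ℂ × ℂ) ℂ ℂ
      (ContinuousLinearMap.mul ℝ ℂ (k Θ))).hasFDerivAt.comp p h2).congr_of_eventuallyEq
      (.of_forall fun q => ?_)
    ext w <;> simp [kernelAvgDerivAux]

lemma continuousAt_integral_absMulHess {k : ℝ → ℂ} (hk : Continuous k) {p : ℂ × ℂ} (hp : p ≠ 0) :
    ContinuousAt (fun q => ∫ Θ in (0 : ℝ)..(2 * Real.pi), absMulHess k q Θ) p := by
  refine intervalIntegral.continuousAt_of_dominated_interval (bound := fun Θ => ‖k Θ‖ * 16)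
    (.of_forall fun q => aestronglyMeasurable_absMulHess hk q _)
    (.of_forall fun q => Eventually.of_forall fun Θ _ => norm_absMulHess_le k q Θ)
    ((by fun_prop : Continuous fun Θ => ‖k Θ‖ * 16).intervalIntegrable _ _)
    ((ae_rotSum_ne_zero hp).mono fun Θ hΘ _ => ?_)
  have h1 : ContinuousAt (fun q => fderiv ℝ absMulDeriv (rotSum Θ q)) p := by
    have h3 : ContinuousAt (fderiv ℝ absMulDeriv) (rotSum Θ p) :=
      ((contDiffAt_absMulDeriv hΘ).fderiv_right (m := 0) (by norm_num)).continuousAt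
    exact ContinuousAt.comp (f := fun q => rotSum Θ q) h3 (rotSum Θ).continuous.continuousAt
  exact continuousAt_const.clm_comp
    (continuousAt_const.clm_comp (h1.clm_comp continuousAt_const))

lemma contDiffAt_kernelAvg {k : ℝ → ℂ} (hk : Continuous k) {p : ℂ × ℂ} (hp : p ≠ 0) :
    ContDiffAt ℝ 2 (kernelAvg k) p := by
  rw [show (2 : WithTop ℕ∞) = (1 : ℕ) + 1 by norm_num, contDiffAt_succ_iff_hasFDerivAt]
  refine ⟨_, ⟨Set.univ, univ_mem, fun q _ => hasFDerivAt_kernelAvg hk q⟩, ?_⟩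
  rw [Nat.cast_one, contDiffAt_one_iff]
  exact ⟨_, {0}ᶜ, isOpen_compl_singleton.mem_nhds hp,
    fun q hq => (continuousAt_integral_absMulHess hk hq).continuousWithinAt,
    fun q hq => hasFDerivAt_kernelAvgDeriv hk hq⟩

lemma kernelAvg_smul (k : ℝ → ℂ) {c : ℝ} (hc : 0 ≤ c) (p : ℂ × ℂ) :
    kernelAvg k (c • p) = (c ^ 2 : ℝ) • kernelAvg k p := by
  simp only [kernelAvg]
  rw [← intervalIntegral.integral_smul]
  congr 1; ext Θ
  rw [map_smul, real_smul, absMul_mul, norm_real, norm_of_nonneg hc,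
    real_smul]
  push_cast; ring

/-! ### Fourier coefficients of `Θ ↦ |a + b e^{-iΘ}| (a + b e^{-iΘ})` -/

lemma integral_add_eq_of_periodic {h : ℝ → ℂ} (hh : Function.Periodic h (2 * Real.pi)) (c : ℝ) :
    ∫ Θ in (0 : ℝ)..(2 * Real.pi), h (Θ + c) = ∫ Θ in (0 : ℝ)..(2 * Real.pi), h Θ := by
  rw [intervalIntegral.integral_comp_add_right, zero_add, add_comm (2 * Real.pi) c,
    hh.intervalIntegral_add_eq c 0, zero_add]

lemma exp_int_mul_two_pi_I (n : ℤ) : exp (-(I * n * (2 * Real.pi))) = 1 := by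
  rw [Complex.exp_eq_one_iff]
  exact ⟨-n, by push_cast; ring⟩

/-- The kernel `(2π)⁻¹ e^{-inΘ}`. -/
def harmKernel (n : ℤ) (Θ : ℝ) : ℂ := (1 / (2 * Real.pi) : ℂ) * exp (-(I * n * Θ))

lemma continuous_harmKernel (n : ℤ) : Continuous (harmKernel n) := by
  unfold harmKernel; fun_prop

lemma norm_harmKernel (n : ℤ) (Θ : ℝ) : ‖harmKernel n Θ‖ = (2 * Real.pi)⁻¹ := by
  have h := norm_exp_neg_I_mul (n * Θ)
  push_cast at h
  rw [← mul_assoc] at h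
  rw [harmKernel, norm_mul, h]
  simp [abs_of_pos Real.pi_pos]

lemma periodic_harmKernel (n : ℤ) : Function.Periodic (harmKernel n) (2 * Real.pi) := by
  intro Θ
  simp only [harmKernel]
  push_cast
  rw [mul_add, neg_add, exp_add, exp_int_mul_two_pi_I, mul_one]

lemma exp_neg_I_periodic (Θ : ℝ) :
    exp (-(I * ((Θ + 2 * Real.pi : ℝ) : ℂ))) = exp (-(I * Θ)) := by
  have h := exp_int_mul_two_pi_I 1
  push_cast at h ⊢
  rw [mul_one] at h
  rw [mul_add, neg_add, exp_add, h, mul_one]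

lemma periodic_absMul_rotSum (p : ℂ × ℂ) :
    Function.Periodic (fun Θ => absMul (rotSum Θ p)) (2 * Real.pi) := by
  intro Θ
  simp only [rotSum_apply, exp_neg_I_periodic]

/-- The `n`-th Fourier coefficient of `Θ ↦ |a + b e^{-iΘ}| (a + b e^{-iΘ})`. -/
def harmCoeff (n : ℤ) (p : ℂ × ℂ) : ℂ := kernelAvg (harmKernel n) p

lemma norm_kernelAvg_le {k : ℝ → ℂ} {K : ℝ} (hk : ∀ Θ, ‖k Θ‖ ≤ K) (p : ℂ × ℂ) :
    ‖kernelAvg k p‖ ≤ 2 * Real.pi * K * (4 * ‖p‖ ^ 2) := by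
  have h : ∀ Θ ∈ Set.uIoc (0 : ℝ) (2 * Real.pi), ‖k Θ * absMul (rotSum Θ p)‖ ≤ K * (4 * ‖p‖ ^ 2) := by
    intro Θ _
    rw [norm_mul, norm_absMul]
    have h1 := norm_rotSum_apply_le Θ p
    have : ‖rotSum Θ p‖ ^ 2 ≤ (2 * ‖p‖) ^ 2 := by gcongr
    have hK : 0 ≤ K := (norm_nonneg _).trans (hk Θ)
    calc _ ≤ K * (2 * ‖p‖) ^ 2 := by gcongr; exact hk Θ
      _ = _ := by ring
  refine (intervalIntegral.norm_integral_le_of_norm_le_const h).trans (le_of_eq ?_)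
  rw [sub_zero, abs_of_pos Real.two_pi_pos]; ring

lemma norm_harmCoeff_le (n : ℤ) (p : ℂ × ℂ) : ‖harmCoeff n p‖ ≤ 4 * ‖p‖ ^ 2 := by
  refine (norm_kernelAvg_le (fun Θ => (norm_harmKernel n Θ).le) p).trans (le_of_eq ?_)
  field_simp

lemma fourierL_eq_harmCoeff (n : ℤ) (z : ℝ) : fourierL n z = harmCoeff n (1, (z : ℂ)) := by
  simp only [fourierL, harmCoeff, kernelAvg, harmKernel, rotSum_apply, absMul]
  rw [← intervalIntegral.integral_const_mul]
  congr 1; ext Θ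
  rw [mul_comm (z : ℂ)]; ring

lemma harmCoeff_rotate (n : ℤ) (α β : ℝ) (a b : ℂ) :
    harmCoeff n (exp (I * α) * a, exp (I * β) * b) =
      exp (I * (α + n * (α - β))) * harmCoeff n (a, b) := by
  have hper : Function.Periodic (fun Θ => harmKernel n Θ * absMul (rotSum Θ (a, b)))
      (2 * Real.pi) := (periodic_harmKernel n).mul (periodic_absMul_rotSum (a, b))
  simp only [harmCoeff, kernelAvg]
  rw [← integral_add_eq_of_periodic hper (α - β), ← intervalIntegral.integral_const_mul]
  congr 1; ext Θ
  have h1 : rotSum Θ (exp (I * α) * a, exp (I * β) * b)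
      = exp (I * α) * rotSum (Θ + (α - β)) (a, b) := by
    simp only [rotSum_apply]
    rw [mul_add, ← mul_assoc, ← mul_assoc, ← exp_add, ← exp_add]
    congr 3; push_cast; ring
  have h2 : ‖exp (I * α)‖ = 1 := by
    rw [mul_comm]; exact Complex.norm_exp_ofReal_mul_I _
  rw [h1, absMul_mul_of_norm_one h2]
  have h3 : harmKernel n Θ * exp (I * α)
      = exp (I * (α + n * (α - β))) * harmKernel n (Θ + (α - β)) := by
    simp only [harmKernel]
    rw [mul_assoc, mul_left_comm (exp _), ← exp_add, ← exp_add]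
    congr 2; push_cast; ring
  rw [← mul_assoc, h3]; ring

lemma harmCoeff_smul (n : ℤ) {c : ℝ} (hc : 0 ≤ c) (p : ℂ × ℂ) :
    harmCoeff n (c • p) = (c ^ 2 : ℝ) • harmCoeff n p := kernelAvg_smul _ hc p

lemma eq_exp_arg_mul_norm (a : ℂ) : a = exp (I * a.arg) * ‖a‖ := by
  conv_lhs => rw [← Complex.norm_mul_exp_arg_mul_I a]
  ring_nf

lemma harmCoeff_eq_fourierL (n : ℤ) {a b : ℂ} (ha : a ≠ 0) (hb : b ≠ 0) :
    harmCoeff n (a, b) = fourierL n (‖b‖ / ‖a‖) * ‖a‖ * a *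
      (a * (starRingEnd ℂ) b / ((‖a‖ : ℂ) * (‖b‖ : ℂ))) ^ n := by
  have ha' : ‖a‖ ≠ 0 := by simpa using ha
  have hb' : ‖b‖ ≠ 0 := by simpa using hb
  have hc : (‖a‖ : ℂ) ≠ 0 := by exact_mod_cast ha'
  have hd : (‖b‖ : ℂ) ≠ 0 := by exact_mod_cast hb'
  have h1 : harmCoeff n (a, b)
      = exp (I * (a.arg + n * (a.arg - b.arg))) * harmCoeff n ((‖a‖ : ℂ), (‖b‖ : ℂ)) := by
    rw [← harmCoeff_rotate, ← eq_exp_arg_mul_norm, ← eq_exp_arg_mul_norm]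
  have h2 : ((‖a‖ : ℂ), (‖b‖ : ℂ)) = ‖a‖ • ((1 : ℂ), ((‖b‖ / ‖a‖ : ℝ) : ℂ)) := by
    ext1
    · simp
    · simp only [Prod.smul_mk, real_smul]; push_cast; field_simp
  have h3 : a * (starRingEnd ℂ) b / ((‖a‖ : ℂ) * (‖b‖ : ℂ))
      = exp (I * (a.arg - b.arg)) := by
    conv_lhs => rw [eq_exp_arg_mul_norm a, eq_exp_arg_mul_norm b]
    rw [map_mul, ← Complex.exp_conj]
    simp only [map_mul, Complex.conj_I, Complex.conj_ofReal, norm_mul, norm_real, norm_norm]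
    have h4 : ∀ x : ℝ, ‖exp (I * x)‖ = 1 := fun x => by
      rw [mul_comm]; exact Complex.norm_exp_ofReal_mul_I _
    rw [h4, h4, one_mul, one_mul, mul_sub, sub_eq_add_neg, exp_add, neg_mul]
    field_simp
  rw [h1, h2, harmCoeff_smul n (norm_nonneg a), ← fourierL_eq_harmCoeff, h3, ← Complex.exp_int_mul]
  rw [mul_add, exp_add]
  conv_rhs => rw [mul_assoc (fourierL _ _ * _), mul_comm a]
  conv_rhs => rhs; rhs; rw [eq_exp_arg_mul_norm a]
  rw [real_smul]
  rw [show I * (↑n * ((a.arg : ℂ) - b.arg)) = ↑n * (I * ((a.arg : ℂ) - b.arg)) by ring]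
  push_cast; ring

lemma harmCoeff_neg (m : ℤ) (a b : ℂ) : harmCoeff (-m) (a, b) = harmCoeff (m - 1) (b, a) := by
  simp only [harmCoeff, kernelAvg]
  have h := intervalIntegral.integral_comp_sub_left (a := (0 : ℝ)) (b := 2 * Real.pi)
    (fun Θ => harmKernel (m - 1) Θ * absMul (rotSum Θ (b, a))) (2 * Real.pi)
  rw [sub_self, sub_zero] at h
  rw [← h]
  congr 1; ext Θ
  have e1 : exp (-(I * ((2 * Real.pi - Θ : ℝ) : ℂ))) = exp (I * Θ) := by
    have := exp_neg_I_periodic (-Θ)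
    rw [neg_add_eq_sub] at this
    rw [this]; push_cast; ring_nf
  have e2 : rotSum Θ (a, b) = exp (-(I * Θ)) * rotSum (2 * Real.pi - Θ) (b, a) := by
    rw [rotSum_apply, rotSum_apply, e1, mul_add, ← mul_assoc, ← exp_add]
    simp; ring
  have e3 : harmKernel (m - 1) (2 * Real.pi - Θ) = harmKernel (m - 1) (-Θ) := by
    have := periodic_harmKernel (m - 1) (-Θ)
    rwa [neg_add_eq_sub] at this
  rw [e2, absMul_mul_of_norm_one (norm_exp_neg_I_mul Θ), e3]
  simp only [harmKernel]
  rw [← mul_assoc, mul_assoc _ (exp _) (exp _), ← exp_add]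
  congr 3; push_cast; ring

/-- The derivative of `Θ ↦ |a + b e^{-iΘ}| (a + b e^{-iΘ})`. -/
def rotDeriv (p : ℂ × ℂ) (Θ : ℝ) : ℂ :=
  absMulDeriv (rotSum Θ p) (-I * exp (-(I * Θ)) * p.2)

lemma hasDerivAt_exp_neg_I (Θ : ℝ) : HasDerivAt (fun Θ : ℝ => exp (-(I * Θ)))
    (-I * exp (-(I * Θ))) Θ := by
  have h := (((Complex.ofRealCLM.hasDerivAt (x := Θ)).const_mul I).neg).cexp
  simpa [mul_comm] using h

lemma hasDerivAt_absMul_rotSum (p : ℂ × ℂ) (Θ : ℝ) :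
    HasDerivAt (fun Θ => absMul (rotSum Θ p)) (rotDeriv p Θ) Θ := by
  have h1 : HasDerivAt (fun Θ => rotSum Θ p)
      (-I * exp (-(I * Θ)) * p.2) Θ := by
    simp only [rotSum_apply]
    exact ((hasDerivAt_exp_neg_I Θ).mul_const p.2).const_add p.1
  exact (hasFDerivAt_absMul (rotSum Θ p)).comp_hasDerivAt Θ h1

lemma periodic_rotDeriv (p : ℂ × ℂ) : Function.Periodic (rotDeriv p) (2 * Real.pi) := by
  intro Θ
  simp only [rotDeriv, rotSum_apply, exp_neg_I_periodic]

lemma norm_exp_neg_I_sub_le (x y : ℝ) :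
    ‖exp (-(I * x)) - exp (-(I * y))‖ ≤ |x - y| := by
  have h := convex_univ.norm_image_sub_le_of_norm_hasDerivWithin_le (𝕜 := ℝ) (C := 1)
    (fun Θ _ => (hasDerivAt_exp_neg_I Θ).hasDerivWithinAt) (fun Θ _ => by
      rw [norm_mul, norm_exp_neg_I_mul]; simp) (Set.mem_univ y) (Set.mem_univ x)
  simpa using h

lemma norm_rotDeriv_sub_le (p : ℂ × ℂ) (x y : ℝ) :
    ‖rotDeriv p x - rotDeriv p y‖ ≤ 8 * ‖p‖ ^ 2 * |x - y| := by
  set u : ℝ → ℂ := fun Θ => -I * exp (-(I * Θ)) * p.2 with hu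
  have hsnd := norm_snd_le p
  have h0 := norm_nonneg p
  have h00 := norm_nonneg p.2
  have hu1 : ∀ Θ, ‖u Θ‖ ≤ ‖p‖ := fun Θ => by
    simp only [hu, norm_mul, norm_exp_neg_I_mul, norm_neg, norm_I, one_mul]; exact hsnd
  have hu2 : ‖u x - u y‖ ≤ |x - y| * ‖p‖ := by
    have : u x - u y
        = -I * (exp (-(I * x)) - exp (-(I * y))) * p.2 := by
      simp only [hu]; ring
    rw [this, norm_mul, norm_mul, norm_neg, norm_I, one_mul]
    have := norm_exp_neg_I_sub_le x y
    gcongr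
  have hr : ‖rotSum x p - rotSum y p‖ ≤ |x - y| * ‖p‖ := by
    have : rotSum x p - rotSum y p
        = (exp (-(I * x)) - exp (-(I * y))) * p.2 := by
      simp only [rotSum_apply]; ring
    rw [this, norm_mul]
    have := norm_exp_neg_I_sub_le x y
    gcongr
  have key : rotDeriv p x - rotDeriv p y
      = (absMulDeriv (rotSum x p) - absMulDeriv (rotSum y p)) (u x)
        + absMulDeriv (rotSum y p) (u x - u y) := by
    simp [rotDeriv, hu]
  rw [key]
  refine (norm_add_le _ _).trans ?_
  have h1 : ‖(absMulDeriv (rotSum x p) - absMulDeriv (rotSum y p)) (u x)‖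
      ≤ (4 * (|x - y| * ‖p‖)) * ‖p‖ := by
    refine (le_opNorm _ _).trans ?_
    have h2 := lipschitzWith_absMulDeriv.dist_le_mul (rotSum x p) (rotSum y p)
    rw [dist_eq_norm, dist_eq_norm] at h2
    push_cast at h2
    have := hu1 x
    gcongr
    linarith
  have h2 : ‖absMulDeriv (rotSum y p) (u x - u y)‖ ≤ (2 * (2 * ‖p‖)) * (|x - y| * ‖p‖) := by
    refine (le_opNorm _ _).trans ?_
    gcongr
    exact (norm_absMulDeriv_le _).trans (by have := norm_rotSum_apply_le y p; linarith)
  linarith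

lemma continuous_rotDeriv (p : ℂ × ℂ) : Continuous (rotDeriv p) := by
  have : LipschitzWith (Real.toNNReal (8 * ‖p‖ ^ 2)) (rotDeriv p) :=
    LipschitzWith.of_dist_le_mul fun x y => by
      rw [dist_eq_norm, Real.dist_eq, Real.coe_toNNReal _ (by positivity)]
      exact norm_rotDeriv_sub_le p x y
  exact this.continuous

lemma hasDerivAt_harmKernel (n : ℤ) (Θ : ℝ) :
    HasDerivAt (harmKernel n) (-(I * n) * harmKernel n Θ) Θ := by
  have h := ((((Complex.ofRealCLM.hasDerivAt (x := Θ)).const_mul (I * n)).neg).cexp).const_mul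
    (1 / (2 * Real.pi) : ℂ)
  have e : (-(I * n) * harmKernel n Θ)
      = 1 / (2 * Real.pi) * (exp (-(I * n * Complex.ofRealCLM Θ))
        * -(I * n * Complex.ofRealCLM 1)) := by
    simp [harmKernel]; ring
  rw [e]; exact h

lemma integral_harmKernel_mul_rotDeriv (n : ℤ) (p : ℂ × ℂ) :
    ∫ Θ in (0 : ℝ)..(2 * Real.pi), harmKernel n Θ * rotDeriv p Θ
      = I * n * harmCoeff n p := by
  have h := intervalIntegral.integral_mul_deriv_eq_deriv_mul (a := 0) (b := 2 * Real.pi)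
    (u := harmKernel n) (v := fun Θ => absMul (rotSum Θ p))
    (fun Θ _ => hasDerivAt_harmKernel n Θ) (fun Θ _ => hasDerivAt_absMul_rotSum p Θ)
    ((continuous_const.mul (continuous_harmKernel n)).intervalIntegrable _ _)
    ((continuous_rotDeriv p).intervalIntegrable _ _)
  have h1 := periodic_harmKernel n 0
  have h2 := periodic_absMul_rotSum p 0
  simp only [zero_add] at h1 h2
  rw [h, h1, h2, sub_self, zero_sub, harmCoeff, kernelAvg, ← intervalIntegral.integral_const_mul,
    ← intervalIntegral.integral_neg]
  congr 1; ext Θ; ring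

lemma norm_harmCoeff_le_div (n : ℤ) (hn : n ≠ 0) (p : ℂ × ℂ) :
    ‖harmCoeff n p‖ ≤ 4 * Real.pi * ‖p‖ ^ 2 * (1 / (n : ℝ) ^ 2) := by
  have hn' : (n : ℝ) ≠ 0 := by exact_mod_cast hn
  have hnc : (n : ℂ) ≠ 0 := by exact_mod_cast hn
  have hper : Function.Periodic (fun Θ => harmKernel n Θ * rotDeriv p Θ) (2 * Real.pi) :=
    (periodic_harmKernel n).mul (periodic_rotDeriv p)
  have hshift := integral_add_eq_of_periodic hper (Real.pi / n)
  have hk : ∀ Θ, harmKernel n (Θ + Real.pi / n) = -harmKernel n Θ := fun Θ => by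
    simp only [harmKernel]
    have : -(I * n * ((Θ + Real.pi / n : ℝ) : ℂ))
        = -(I * n * Θ) - Real.pi * I := by
      push_cast; field_simp; ring
    rw [this, Complex.exp_sub, Complex.exp_pi_mul_I]; ring
  simp only [hk] at hshift
  have hc := continuous_harmKernel n
  have hd := continuous_rotDeriv p
  have h2 : 2 * ∫ Θ in (0 : ℝ)..(2 * Real.pi), harmKernel n Θ * rotDeriv p Θ
      = ∫ Θ in (0 : ℝ)..(2 * Real.pi),
        harmKernel n Θ * (rotDeriv p Θ - rotDeriv p (Θ + Real.pi / n)) := by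
    rw [two_mul]
    nth_rewrite 2 [← hshift]
    rw [← intervalIntegral.integral_add]
    · congr 1; ext Θ; ring
    · exact (hc.mul hd).intervalIntegrable _ _
    · exact (by fun_prop : Continuous fun Θ =>
        -harmKernel n Θ * rotDeriv p (Θ + Real.pi / n)).intervalIntegrable _ _
  have hb : ‖∫ Θ in (0 : ℝ)..(2 * Real.pi),
        harmKernel n Θ * (rotDeriv p Θ - rotDeriv p (Θ + Real.pi / n))‖
      ≤ ((2 * Real.pi)⁻¹ * (8 * ‖p‖ ^ 2 * (Real.pi / |(n : ℝ)|))) * |2 * Real.pi - 0| := by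
    refine intervalIntegral.norm_integral_le_of_norm_le_const fun Θ _ => ?_
    rw [norm_mul, norm_harmKernel]
    gcongr
    refine (norm_rotDeriv_sub_le p _ _).trans (le_of_eq ?_)
    rw [sub_add_cancel_left, abs_neg, abs_div, abs_of_pos Real.pi_pos]
  rw [← h2, integral_harmKernel_mul_rotDeriv, norm_mul, norm_mul, norm_mul, norm_I,
    sub_zero, abs_of_pos Real.two_pi_pos] at hb
  have hnn : ‖(n : ℂ)‖ = |(n : ℝ)| := by simp
  rw [hnn] at hb
  have hp : 0 < |(n : ℝ)| := abs_pos.2 hn'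
  rw [← sq_abs (n : ℝ)]
  have e : (2 * Real.pi)⁻¹ * (8 * ‖p‖ ^ 2 * (Real.pi / |(n : ℝ)|)) * (2 * Real.pi)
      = 8 * Real.pi * ‖p‖ ^ 2 / |(n : ℝ)| := by field_simp
  rw [e, RCLike.norm_ofNat, one_mul, le_div_iff₀ hp] at hb
  rw [mul_one_div, le_div_iff₀ (by positivity)]
  nlinarith

lemma summable_norm_harmCoeff (p : ℂ × ℂ) : Summable fun n : ℤ => ‖harmCoeff n p‖ := by
  have h : Summable fun n : ℤ => 4 * Real.pi * ‖p‖ ^ 2 * (1 / (n : ℝ) ^ 2) :=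
    (Real.summable_one_div_int_pow.2 one_lt_two).mul_left _
  refine h.of_norm_bounded_eventually ?_
  have : {n : ℤ | ¬ n ≠ 0}.Finite := by simp
  filter_upwards [this.compl_mem_cofinite] with n hn
  rw [norm_norm]
  exact norm_harmCoeff_le_div n (by simpa using hn) p

lemma hasSum_harmCoeff (p : ℂ × ℂ) : HasSum (fun n : ℤ => harmCoeff n p) (absMul (p.1 + p.2)) := by
  have : Fact (0 < 2 * Real.pi) := ⟨Real.two_pi_pos⟩
  have hg : Continuous fun Θ => absMul (rotSum Θ p) :=
    continuous_absMul.comp (continuous_rotSum.clm_apply continuous_const)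
  set f : C(AddCircle (2 * Real.pi), ℂ) :=
    ⟨(periodic_absMul_rotSum p).lift, continuous_coinduced_dom.mpr hg⟩ with hf
  have hcoef : ∀ n : ℤ, fourierCoeff f n = harmCoeff n p := by
    intro n
    rw [fourierCoeff_eq_intervalIntegral f n 0, zero_add, harmCoeff, kernelAvg,
      ← intervalIntegral.integral_smul]
    congr 1; ext Θ
    have h1 : f (Θ : AddCircle (2 * Real.pi)) = absMul (rotSum Θ p) :=
      (periodic_absMul_rotSum p).lift_coe Θ
    rw [h1, fourier_coe_apply, harmKernel, real_smul, smul_eq_mul, ← mul_assoc]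
    have hpi : (Real.pi : ℂ) ≠ 0 := by exact_mod_cast Real.pi_ne_zero
    congr 2
    · push_cast; ring
    · congr 1; push_cast; field_simp
  have hs : Summable (fourierCoeff f) := by
    refine Summable.of_norm ?_
    simpa only [hcoef] using summable_norm_harmCoeff p
  have h := has_pointwise_sum_fourier_series_of_summable hs ((0 : ℝ) : AddCircle (2 * Real.pi))
  have h1 : f ((0 : ℝ) : AddCircle (2 * Real.pi)) = absMul (p.1 + p.2) := by
    have : f ((0 : ℝ) : AddCircle (2 * Real.pi)) = absMul (rotSum 0 p) :=
      (periodic_absMul_rotSum p).lift_coe 0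
    rw [this, rotSum_apply]; simp
  rw [h1] at h
  refine h.congr_fun ?_
  intro n
  rw [hcoef, fourier_coe_apply]; simp

/-! ### The correction by higher harmonics -/

/-- The weight `λ / (1 - (2n+1)²)`, which is `0` for the resonant `n = 0, -1`. -/
def harmWeight (lam : ℝ) (n : ℤ) : ℂ := (lam : ℂ) / (1 - (2 * (n : ℂ) + 1) ^ 2)

lemma harmWeight_zero (lam : ℝ) : harmWeight lam 0 = 0 := by simp [harmWeight]

lemma harmWeight_neg_one (lam : ℝ) : harmWeight lam (-1) = 0 := by norm_num [harmWeight]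

lemma norm_harmWeight_mul_le (lam : ℝ) (n : ℤ) :
    ‖harmWeight lam n‖ * (2 * (n : ℝ) + 1) ^ 2 ≤ 2 * |lam| := by
  by_cases h : n = 0 ∨ n = -1
  · rcases h with rfl | rfl
    · simp [harmWeight_zero]
    · rw [harmWeight_neg_one]; simp
  push Not at h
  have h2 : (2 : ℤ) ≤ n * (n + 1) := by
    rcases lt_trichotomy n 0 with h1 | h1 | h1
    · have : n ≤ -2 := by have := h.2; omega
      nlinarith
    · exact absurd h1 h.1
    · nlinarith
  have h3 : (2 : ℝ) ≤ n * (n + 1) := by exact_mod_cast h2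
  have e : ‖(1 : ℂ) - (2 * (n : ℂ) + 1) ^ 2‖ = (2 * (n : ℝ) + 1) ^ 2 - 1 := by
    have : (1 : ℂ) - (2 * (n : ℂ) + 1) ^ 2 = ((1 - (2 * (n : ℝ) + 1) ^ 2 : ℝ) : ℂ) := by push_cast; ring
    rw [this, norm_real, norm_eq_abs, abs_of_nonpos (by nlinarith)]; ring
  rw [harmWeight, norm_div, e, norm_real, norm_eq_abs, div_mul_eq_mul_div,
    div_le_iff₀ (by nlinarith)]
  nlinarith [abs_nonneg lam]

lemma one_le_odd_sq (n : ℤ) : (1 : ℝ) ≤ (2 * (n : ℝ) + 1) ^ 2 := by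
  have : (1 : ℤ) ≤ (2 * n + 1) ^ 2 := by
    have : (2 * n + 1) ≠ 0 := by omega
    have := sq_pos_of_ne_zero this
    omega
  exact_mod_cast this

lemma norm_harmWeight_le (lam : ℝ) (n : ℤ) : ‖harmWeight lam n‖ ≤ 2 * |lam| := by
  have h := norm_harmWeight_mul_le lam n
  nlinarith [norm_nonneg (harmWeight lam n), one_le_odd_sq n]

lemma norm_harmWeight_mul_abs_le (lam : ℝ) (n : ℤ) :
    ‖harmWeight lam n‖ * |2 * (n : ℝ) + 1| ≤ 2 * |lam| := by
  have h := norm_harmWeight_mul_le lam n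
  have h1 := one_le_odd_sq n
  rw [← sq_abs] at h h1
  have h2 : 1 ≤ |2 * (n : ℝ) + 1| := by nlinarith [abs_nonneg (2 * (n : ℝ) + 1)]
  have h3 : |2 * (n : ℝ) + 1| ≤ |2 * (n : ℝ) + 1| ^ 2 := by nlinarith
  exact (mul_le_mul_of_nonneg_left h3 (norm_nonneg _)).trans h

lemma summable_norm_harmWeight (lam : ℝ) : Summable fun n : ℤ => ‖harmWeight lam n‖ := by
  have h : Summable fun n : ℤ => 2 * |lam| * (1 / (n : ℝ) ^ 2) :=
    (Real.summable_one_div_int_pow.2 one_lt_two).mul_left _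
  refine Summable.of_nonneg_of_le (fun _ => norm_nonneg _) (fun n => ?_) h
  rcases eq_or_ne n 0 with rfl | hn
  · simp [harmWeight_zero]
  have hn' : (0 : ℝ) < (n : ℝ) ^ 2 := by positivity
  rw [mul_one_div, le_div_iff₀ hn']
  refine le_trans ?_ (norm_harmWeight_mul_le lam n)
  gcongr ?_ * ?_
  have : (n : ℤ) ^ 2 ≤ (2 * n + 1) ^ 2 := by
    rcases lt_trichotomy n 0 with h1 | h1 | h1 <;> nlinarith
  exact_mod_cast this

/-- The kernel whose average against `|a + b e^{-iΘ}| (a + b e^{-iΘ})` is the correction. -/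
def corrKernel (lam : ℝ) (Θ : ℝ) : ℂ := ∑' n : ℤ, harmWeight lam n * harmKernel n Θ

/-- The correction `∑ λ / (1 - (2n+1)²) F_n(a, b)` by the nonresonant harmonics. -/
def corr (lam : ℝ) (p : ℂ × ℂ) : ℂ := kernelAvg (corrKernel lam) p

lemma continuous_corrKernel (lam : ℝ) : Continuous (corrKernel lam) := by
  refine continuous_tsum (u := fun n => ‖harmWeight lam n‖ * (2 * Real.pi)⁻¹)
    (fun n => continuous_const.mul (continuous_harmKernel n))
    ((summable_norm_harmWeight lam).mul_right _) fun n Θ => ?_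
  rw [norm_mul, norm_harmKernel]

lemma hasSum_corr (lam : ℝ) (p : ℂ × ℂ) :
    HasSum (fun n : ℤ => harmWeight lam n * harmCoeff n p) (corr lam p) := by
  have hc : Continuous fun Θ => absMul (rotSum Θ p) :=
    continuous_absMul.comp (continuous_rotSum.clm_apply continuous_const)
  have h := intervalIntegral.hasSum_integral_of_dominated_convergence
    (μ := volume) (a := 0) (b := 2 * Real.pi)
    (F := fun (n : ℤ) Θ => harmWeight lam n * harmKernel n Θ * absMul (rotSum Θ p))
    (f := fun Θ => corrKernel lam Θ * absMul (rotSum Θ p))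
    (fun n _ => ‖harmWeight lam n‖ * ((2 * Real.pi)⁻¹ * (2 * ‖p‖) ^ 2))
    (fun n => ((continuous_const.mul (continuous_harmKernel n)).mul hc).aestronglyMeasurable)
    (fun n => Eventually.of_forall fun Θ _ => by
      rw [norm_mul, norm_mul, norm_harmKernel, norm_absMul, mul_assoc]
      have := norm_rotSum_apply_le Θ p
      gcongr)
    (.of_forall fun Θ _ => (summable_norm_harmWeight lam).mul_right _)
    (by exact continuous_const.intervalIntegrable _ _)
    (.of_forall fun Θ _ => by
      refine HasSum.mul_right _ (Summable.hasSum ?_)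
      refine Summable.of_norm ?_
      simp only [norm_mul, norm_harmKernel]
      exact (summable_norm_harmWeight lam).mul_right _)
  refine h.congr_fun fun n => ?_
  rw [harmCoeff, kernelAvg, ← intervalIntegral.integral_const_mul]
  congr 1; ext Θ; ring

lemma norm_exp_neg_odd (n : ℤ) (τ : ℝ) :
    ‖exp (-(I * (2 * n + 1)) * τ)‖ = 1 := by
  have h := norm_exp_neg_I_mul ((2 * n + 1) * τ)
  push_cast at h
  rw [← h]; congr 2; ring

lemma hasDerivAt_exp_neg_odd (n : ℤ) (τ : ℝ) :
    HasDerivAt (fun τ : ℝ => exp (-(I * (2 * n + 1)) * τ))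
      (-(I * (2 * n + 1)) * exp (-(I * (2 * n + 1)) * τ)) τ := by
  have h := ((Complex.ofRealCLM.hasDerivAt (x := τ)).const_mul (-(I * (2 * n + 1)))).cexp
  simpa [mul_comm] using h

lemma norm_I_mul_odd (n : ℤ) : ‖-(I * (2 * (n : ℂ) + 1))‖ = |2 * (n : ℝ) + 1| := by
  have : (2 * (n : ℂ) + 1) = ((2 * (n : ℝ) + 1 : ℝ) : ℂ) := by push_cast; ring
  rw [norm_neg, norm_mul, norm_I, one_mul, this, norm_real, norm_eq_abs]

/-- Along the rotation `(e^{-iτ} a, e^{iτ} b)` the correction solves an oscillator equation whose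
forcing is the nonresonant part of the nonlinearity. -/
lemma exists_hasDerivAt_corr_rotate (lam : ℝ) (a b : ℂ) : ∃ y₁ : ℝ → ℂ,
    (∀ τ : ℝ, HasDerivAt (fun τ : ℝ => corr lam
      (exp (I * (-τ : ℝ)) * a, exp (I * τ) * b)) (y₁ τ) τ) ∧
    HasDerivAt y₁ (lam * (absMul (a + b) - harmCoeff 0 (a, b) - harmCoeff (-1) (a, b))
      - corr lam (a, b)) 0 := by
  set H : ℤ → ℂ := fun n => harmCoeff n (a, b)
  set E : ℤ → ℝ → ℂ := fun n τ => exp (-(I * (2 * n + 1)) * τ) with hE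
  set q : ℤ → ℂ := fun n => -(I * (2 * (n : ℂ) + 1)) with hq
  have hsH : Summable fun n => 2 * |lam| * ‖H n‖ := (summable_norm_harmCoeff (a, b)).mul_left _
  have hy : (fun τ : ℝ => corr lam
      (exp (I * (-τ : ℝ)) * a, exp (I * τ) * b))
      = fun τ => ∑' n, harmWeight lam n * H n * E n τ := by
    ext τ
    rw [← (hasSum_corr lam _).tsum_eq]
    congr 1; ext n
    rw [harmCoeff_rotate, mul_assoc, mul_comm (H n)]
    congr 3; push_cast; ring
  have hb0 : ∀ n, ‖harmWeight lam n * H n * E n 0‖ ≤ 2 * |lam| * ‖H n‖ := fun n => by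
    rw [norm_mul, norm_mul, norm_exp_neg_odd, mul_one]
    gcongr; exact norm_harmWeight_le lam n
  have hb1 : ∀ n τ, ‖harmWeight lam n * H n * (q n * E n τ)‖ ≤ 2 * |lam| * ‖H n‖ := fun n τ => by
    rw [norm_mul, norm_mul, norm_mul, norm_exp_neg_odd, mul_one, norm_I_mul_odd]
    have := norm_harmWeight_mul_abs_le lam n
    nlinarith [norm_nonneg (H n)]
  have hb2 : ∀ n τ, ‖harmWeight lam n * H n * (q n * (q n * E n τ))‖ ≤ 2 * |lam| * ‖H n‖ :=
    fun n τ => by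
    rw [norm_mul, norm_mul, norm_mul, norm_mul, norm_exp_neg_odd, mul_one, norm_I_mul_odd]
    have := norm_harmWeight_mul_le lam n
    rw [← sq_abs] at this
    nlinarith [norm_nonneg (H n)]
  refine ⟨fun τ => ∑' n, harmWeight lam n * H n * (q n * E n τ), fun τ => ?_, ?_⟩
  · rw [hy]
    exact hasDerivAt_tsum (y₀ := (0 : ℝ)) hsH
      (fun n τ => (hasDerivAt_exp_neg_odd n τ).const_mul _) hb1 (hsH.of_norm_bounded hb0) τ
  · have h := hasDerivAt_tsum (y₀ := (0 : ℝ)) hsH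
      (fun n τ => ((hasDerivAt_exp_neg_odd n τ).const_mul (q n)).const_mul (harmWeight lam n * H n))
      hb2 (hsH.of_norm_bounded fun n => hb1 n 0) 0
    convert! h using 1
    have s1 : HasSum (fun n => harmWeight lam n * H n * (q n * (q n * E n 0)))
        (∑' n, harmWeight lam n * H n * (q n * (q n * E n 0))) :=
      (hsH.of_norm_bounded fun n => hb2 n 0).hasSum
    have s2 := s1.add (hasSum_corr lam (a, b))
    have s3 : HasSum (fun n : ℤ => (lam : ℂ) * (H n - (if n = 0 then H 0 else 0)
        - if n = -1 then H (-1) else 0)) (lam * (absMul (a + b) - H 0 - H (-1))) :=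
      (((hasSum_harmCoeff (a, b)).sub (hasSum_ite_eq 0 _)).sub (hasSum_ite_eq (-1) _)).mul_left _
    have e : (fun n => harmWeight lam n * H n * (q n * (q n * E n 0)) + harmWeight lam n * harmCoeff n (a, b))
        = fun n : ℤ => (lam : ℂ) * (H n - (if n = 0 then H 0 else 0)
        - if n = -1 then H (-1) else 0) := by
      ext n
      rcases eq_or_ne n 0 with rfl | h0
      · simp [harmWeight_zero]
      rcases eq_or_ne n (-1) with rfl | h1
      · rw [harmWeight_neg_one]; simp
      have hE0 : E n 0 = 1 := by simp [hE]
      have hne : (1 : ℂ) - (2 * (n : ℂ) + 1) ^ 2 ≠ 0 := by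
        have : (1 : ℂ) - (2 * (n : ℂ) + 1) ^ 2 = (-4 * (n * (n + 1)) : ℤ) := by push_cast; ring
        rw [this, Int.cast_ne_zero]
        have : n + 1 ≠ 0 := fun h => h1 (by omega)
        simp [h0, this]
      simp only [hE0, hq, h0, h1, if_false, sub_zero, harmWeight]
      field_simp
      ring_nf
      simp only [Complex.I_sq]
      ring
    rw [e] at s2
    have := s2.unique s3
    linear_combination -this

/-! ### The coefficient `L₀` -/

lemma one_add_mul_exp (z Θ : ℝ) : 1 + (z : ℂ) * exp (-(I * Θ))
    = ((1 + z * cos Θ : ℝ) : ℂ) + ((-(z * Real.sin Θ) : ℝ) : ℂ) * I := by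
  rw [← mul_neg, ← Complex.ofReal_neg, mul_comm I, Complex.exp_mul_I]
  push_cast
  rw [Complex.cos_neg, Complex.sin_neg]; ring

lemma norm_one_add_mul_exp (z Θ : ℝ) : ‖1 + (z : ℂ) * exp (-(I * Θ))‖
    = sqrt (1 + 2 * z * cos Θ + z ^ 2) := by
  rw [one_add_mul_exp, Complex.norm_add_mul_I]
  congr 1
  nlinarith [Real.sin_sq_add_cos_sq Θ]

lemma fourierL_zero_eq (z : ℝ) : fourierL 0 z = (((2 * Real.pi)⁻¹ * ∫ Θ in (0 : ℝ)..(2 * Real.pi),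
    sqrt (1 + 2 * z * cos Θ + z ^ 2) * (1 + z * cos Θ) : ℝ) : ℂ) := by
  have h0 : ∫ Θ in (0 : ℝ)..(2 * Real.pi),
      sqrt (1 + 2 * z * cos Θ + z ^ 2) * (z * Real.sin Θ) = 0 := by
    have h := intervalIntegral.integral_comp_sub_left (a := (0 : ℝ)) (b := 2 * Real.pi)
      (fun Θ => sqrt (1 + 2 * z * cos Θ + z ^ 2) * (z * Real.sin Θ)) (2 * Real.pi)
    simp only [Real.cos_two_pi_sub, Real.sin_two_pi_sub, sub_self, sub_zero, mul_neg,
      intervalIntegral.integral_neg] at h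
    linarith
  rw [fourierL]
  simp only [norm_one_add_mul_exp]
  simp only [one_add_mul_exp]
  have e : ∀ Θ : ℝ, (sqrt (1 + 2 * z * cos Θ + z ^ 2) : ℂ)
      * (((1 + z * cos Θ : ℝ) : ℂ) + ((-(z * Real.sin Θ) : ℝ) : ℂ) * I)
      * exp (-(I * ((0 : ℤ) : ℂ) * Θ))
      = ((sqrt (1 + 2 * z * cos Θ + z ^ 2) * (1 + z * cos Θ) : ℝ) : ℂ)
        - ((sqrt (1 + 2 * z * cos Θ + z ^ 2) * (z * Real.sin Θ) : ℝ) : ℂ) * I := by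
    intro Θ
    simp only [Int.cast_zero, mul_zero, zero_mul, neg_zero, Complex.exp_zero, mul_one]
    push_cast; ring
  simp only [e]
  rw [intervalIntegral.integral_sub, intervalIntegral.integral_mul_const,
    intervalIntegral.integral_ofReal, intervalIntegral.integral_ofReal, h0]
  · push_cast; simp
  · exact (by fun_prop : Continuous fun Θ : ℝ =>
      ((sqrt (1 + 2 * z * cos Θ + z ^ 2) * (1 + z * cos Θ) : ℝ) : ℂ)).intervalIntegrable _ _
  · exact (by fun_prop : Continuous fun Θ : ℝ =>
      ((sqrt (1 + 2 * z * cos Θ + z ^ 2) * (z * Real.sin Θ) : ℝ) : ℂ)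
        * I).intervalIntegrable _ _

lemma fourierL_zero_sub (z : ℝ) (hz : 0 < z) :
    fourierL 0 z - (z : ℂ) * fourierL 0 (1 / z) =
      (((2 * Real.pi)⁻¹ * ((z - 1 / z) * ∫ Θ in (0 : ℝ)..(2 * Real.pi),
        sqrt (1 + 2 * z * cos Θ + z ^ 2) * cos Θ) : ℝ) : ℂ) := by
  rw [fourierL_zero_eq, fourierL_zero_eq, ← Complex.ofReal_mul, ← Complex.ofReal_sub]
  congr 1
  have h1 : ∀ Θ : ℝ, sqrt (1 + 2 * (1 / z) * cos Θ + (1 / z) ^ 2)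
      = (1 / z) * sqrt (1 + 2 * z * cos Θ + z ^ 2) := by
    intro Θ
    have : 1 + 2 * (1 / z) * cos Θ + (1 / z) ^ 2
        = (1 / z) ^ 2 * (1 + 2 * z * cos Θ + z ^ 2) := by field_simp; ring
    rw [this, Real.sqrt_mul (by positivity), Real.sqrt_sq (by positivity)]
  simp only [h1]
  rw [← intervalIntegral.integral_const_mul (z - 1 / z), mul_left_comm z, ← mul_sub,
    ← intervalIntegral.integral_const_mul z, ← intervalIntegral.integral_sub]
  · congr 2; ext Θ; field_simp; ring
  · exact (by fun_prop : Continuous _).intervalIntegrable _ _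
  · exact (by fun_prop : Continuous _).intervalIntegrable _ _

lemma integral_sqrt_mul_cos_pos (z : ℝ) (hz : 0 < z) :
    0 < ∫ Θ in (0 : ℝ)..(2 * Real.pi), sqrt (1 + 2 * z * cos Θ + z ^ 2) * cos Θ := by
  have h1 : ∫ Θ in (0 : ℝ)..(2 * Real.pi), sqrt (1 + 2 * z * cos Θ + z ^ 2) * cos Θ
      = ∫ Θ in (0 : ℝ)..(2 * Real.pi),
        (sqrt (1 + 2 * z * cos Θ + z ^ 2) - sqrt (1 + z ^ 2)) * cos Θ := by
    simp only [sub_mul]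
    rw [intervalIntegral.integral_sub, intervalIntegral.integral_const_mul, integral_cos]
    · simp
    · exact (by fun_prop : Continuous _).intervalIntegrable _ _
    · exact (by fun_prop : Continuous _).intervalIntegrable _ _
  rw [h1]
  refine intervalIntegral.integral_pos Real.two_pi_pos
    (by fun_prop : Continuous _).continuousOn (fun Θ _ => ?_) ⟨0, ⟨le_rfl, Real.two_pi_pos.le⟩, ?_⟩
  · rcases le_total 0 (cos Θ) with h | h
    · refine mul_nonneg (sub_nonneg.2 (Real.sqrt_le_sqrt ?_)) h
      nlinarith [mul_nonneg hz.le h]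
    · refine mul_nonneg_of_nonpos_of_nonpos (sub_nonpos.2 (Real.sqrt_le_sqrt ?_)) h
      nlinarith [mul_nonneg hz.le (neg_nonneg.2 h)]
  · rw [Real.cos_zero, mul_one]
    exact sub_pos.2 (Real.sqrt_lt_sqrt (by positivity) (by nlinarith))

/-- For `z > 0` one has `L₀(z) = z L₀(1/z)` only at `z = 1`. -/
lemma fourierL_zero_sub_eq_zero_iff (z : ℝ) (hz : 0 < z) :
    fourierL 0 z - (z : ℂ) * fourierL 0 (1 / z) = 0 ↔ z = 1 := by
  rw [fourierL_zero_sub z hz, Complex.ofReal_eq_zero, mul_eq_zero, mul_eq_zero]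
  have h1 := (integral_sqrt_mul_cos_pos z hz).ne'
  have h2 : (2 * Real.pi)⁻¹ ≠ 0 := inv_ne_zero Real.two_pi_pos.ne'
  simp only [h1, h2, or_false, false_or]
  rw [sub_eq_zero, eq_div_iff hz.ne']
  constructor
  · intro h; nlinarith
  · rintro rfl; norm_num

/-! ### The profile as a function of slow variables -/

/-- The variables `(s, log t, (⟨μ⟩⁻¹, (a, b)))`. -/
abbrev Slow : Type := ℝ × ℝ × ℝ × ℂ × ℂ

/-- Phase corrections and quadratic correction entering the profile. -/
structure Symb where
  /-- phase of the first wave -/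
  phA : ℂ × ℂ → ℝ
  /-- phase of the second wave -/
  phB : ℂ × ℂ → ℝ
  /-- quadratic correction -/
  cor : ℂ × ℂ → ℂ

/-- The pair of waves `(a e^{-is + i r ℓ σ_A}, b e^{is + i r ℓ σ_B})`. -/
def Symb.wave (S : Symb) (e : Slow) : ℂ × ℂ :=
  (exp (I * (-e.1 + e.2.2.1 * e.2.1 * S.phA e.2.2.2 : ℝ)) * e.2.2.2.1,
    exp (I * (e.1 + e.2.2.1 * e.2.1 * S.phB e.2.2.2 : ℝ)) * e.2.2.2.2)

/-- The profile in the slow variables. -/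
def Symb.prof (S : Symb) (e : Slow) : ℂ :=
  (Real.exp (-e.2.1) : ℂ) * ((S.wave e).1 + (S.wave e).2)
    + (Real.exp (-(2 * e.2.1)) : ℂ) * S.cor (S.wave e)

/-- The squared Euclidean norm on `ℂ × ℂ`. -/
def sqNorm (p : ℂ × ℂ) : ℝ := normSq p.1 + normSq p.2

/-- A positive function that equals `|a|²` on the cone `|b| ≤ ρ |a|`. -/
def coneDen (ρ : ℝ) (p : ℂ × ℂ) : ℝ :=
  normSq p.1 +
    sqNorm p * (1 - Real.smoothTransition ((1 + ρ ^ 2) * normSq p.1 / sqNorm p))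

/-- The resonant phase `σ(a, b) = (λ/2) F₀(a, b) / a` on the cone `|b| ≤ ρ |a|`, extended off it. -/
def resPhase (lam ρ : ℝ) (p : ℂ × ℂ) : ℝ :=
  lam / 2 * (harmCoeff 0 p * (starRingEnd ℂ) p.1).re / coneDen ρ p

/-- The phases and the correction in the asymptotic profile. -/
def mainSymb (lam ρ : ℝ) : Symb where
  phA := resPhase lam ρ
  phB := fun p => -resPhase lam ρ (p.2, p.1)
  cor := corr lam

/-- The cone `ρ⁻¹ |a| ≤ |b| ≤ ρ |a|`. -/
def InCone (ρ : ℝ) (p : ℂ × ℂ) : Prop := ‖p.2‖ ≤ ρ * ‖p.1‖ ∧ ‖p.1‖ ≤ ρ * ‖p.2‖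

lemma sqNorm_nonneg (p : ℂ × ℂ) : 0 ≤ sqNorm p :=
  add_nonneg (Complex.normSq_nonneg _) (Complex.normSq_nonneg _)

lemma sqNorm_pos {p : ℂ × ℂ} (hp : p ≠ 0) : 0 < sqNorm p := by
  rcases (sqNorm_nonneg p).lt_or_eq with h | h
  · exact h
  · exfalso; apply hp
    have h1 := Complex.normSq_nonneg p.1
    have h2 := Complex.normSq_nonneg p.2
    unfold sqNorm at h
    exact Prod.ext (Complex.normSq_eq_zero.1 (by linarith)) (Complex.normSq_eq_zero.1 (by linarith))

lemma InCone.fst_eq_zero_iff {ρ : ℝ} {p : ℂ × ℂ} (hp : InCone ρ p) : p.1 = 0 ↔ p.2 = 0 := by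
  constructor
  · intro h; have := hp.1; rw [h] at this; simpa using this
  · intro h; have := hp.2; rw [h] at this; simpa using this

lemma coneDen_eq {ρ : ℝ} {p : ℂ × ℂ} (hp : InCone ρ p) : coneDen ρ p = ‖p.1‖ ^ 2 := by
  rw [coneDen, normSq_eq_norm_sq]
  rcases eq_or_ne p 0 with rfl | h0
  · simp [sqNorm]
  have hs := sqNorm_pos h0
  rw [Real.smoothTransition.one_of_one_le, sub_self, mul_zero, add_zero]
  rw [le_div_iff₀ hs, one_mul, sqNorm, normSq_eq_norm_sq, normSq_eq_norm_sq]
  have : ‖p.2‖ ^ 2 ≤ (ρ * ‖p.1‖) ^ 2 := by have := hp.1; gcongr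
  nlinarith

lemma resPhase_eq (lam : ℝ) {ρ : ℝ} {a b : ℂ} (hp : InCone ρ (a, b)) :
    ((resPhase lam ρ (a, b) : ℝ) : ℂ) = lam / 2 * fourierL 0 (‖b‖ / ‖a‖) * ‖a‖ := by
  rcases eq_or_ne a 0 with rfl | ha
  · simp [resPhase]
  have hb : b ≠ 0 := fun h => ha (hp.fst_eq_zero_iff.2 h)
  have ha' : ‖a‖ ≠ 0 := by simpa using ha
  have h : harmCoeff 0 (a, b) * (starRingEnd ℂ) a
      = (((2 * Real.pi)⁻¹ * ∫ Θ in (0 : ℝ)..(2 * Real.pi),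
    sqrt (1 + 2 * (‖b‖ / ‖a‖) * cos Θ + (‖b‖ / ‖a‖) ^ 2) * (1 + (‖b‖ / ‖a‖) * cos Θ)) * ‖a‖ * ‖a‖ ^ 2 : ℝ) := by
    rw [harmCoeff_eq_fourierL 0 ha hb, zpow_zero, mul_one, mul_assoc _ a, Complex.mul_conj,
      normSq_eq_norm_sq, fourierL_zero_eq]
    push_cast; ring
  rw [resPhase, coneDen_eq hp]
  simp only
  rw [h, Complex.ofReal_re, fourierL_zero_eq]
  push_cast
  have : (‖a‖ : ℂ) ≠ 0 := by exact_mod_cast ha'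
  field_simp

lemma InCone.swap {ρ : ℝ} {p : ℂ × ℂ} (hp : InCone ρ p) : InCone ρ (p.2, p.1) := ⟨hp.2, hp.1⟩

lemma Admissible.inCone {ρ : ℝ} {A B : Plane → ℂ} {ζ : Plane → ℝ} (hρ : 1 ≤ ρ)
    (h : Admissible ρ A B ζ) (z : Plane) : InCone ρ (A z, B z) := by
  have := h.comparable z
  refine ⟨this.2, ?_⟩
  have h1 := this.1
  rwa [inv_mul_le_iff₀ (by linarith)] at h1

lemma Admissible.phaseA_eq {ρ : ℝ} {A B : Plane → ℂ} {ζ : Plane → ℝ} (hρ : 1 ≤ ρ)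
    (h : Admissible ρ A B ζ) (lam : ℝ) (z : Plane) :
    phaseA lam A ζ z = (((jap ‖z‖)⁻¹ * resPhase lam ρ (A z, B z) : ℝ) : ℂ) := by
  rcases eq_or_ne (A z) 0 with h0 | h0
  · rw [phaseA, h0]; simp [resPhase]
  · rw [phaseA, h.ratio z h0, Complex.ofReal_mul, resPhase_eq lam (h.inCone hρ z)]; ring

lemma Admissible.phaseB_eq {ρ : ℝ} {A B : Plane → ℂ} {ζ : Plane → ℝ} (hρ : 1 ≤ ρ)
    (h : Admissible ρ A B ζ) (lam : ℝ) (z : Plane) :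
    phaseB lam B ζ z = (((jap ‖z‖)⁻¹ * -resPhase lam ρ (B z, A z) : ℝ) : ℂ) := by
  have hc := h.inCone hρ z
  rcases eq_or_ne (A z) 0 with h0 | h0
  · have hb : B z = 0 := hc.fst_eq_zero_iff.1 h0
    rw [phaseB, hb]; simp [resPhase]
  · rw [phaseB, h.ratio z h0, Complex.ofReal_mul, Complex.ofReal_neg, resPhase_eq lam hc.swap,
      one_div_div]; ring

/-- The slow variables at a space-time point of the forward cone. -/
def slowAt (P : Plane → ℂ × ℂ) (t : ℝ) (x : Plane) : Slow :=
  (sqrt (t ^ 2 - ‖x‖ ^ 2), log t, (jap ‖mu t x‖)⁻¹, P (mu t x))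

lemma norm_exp_I_mul (x : ℝ) : ‖exp (I * x)‖ = 1 := by
  rw [mul_comm]; exact Complex.norm_exp_ofReal_mul_I _

lemma harmCoeff_zero_right (n : ℤ) : harmCoeff n (0, 0) = 0 := by
  have := norm_harmCoeff_le n (0, 0)
  simpa using this

lemma Admissible.harmonic_eq {ρ : ℝ} {A B : Plane → ℂ} {ζ : Plane → ℝ} (hρ : 1 ≤ ρ)
    (h : Admissible ρ A B ζ) (lam : ℝ) (n : ℕ) (t : ℝ) (x : Plane) :
    harmonic lam A B ζ n t x = harmWeight lam ((n : ℤ) - 1) *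
      harmCoeff ((n : ℤ) - 1) ((mainSymb lam ρ).wave (slowAt (fun z => (A z, B z)) t x)) +
      harmWeight lam ((n : ℤ) - 1) *
      harmCoeff ((n : ℤ) - 1) (((mainSymb lam ρ).wave (slowAt (fun z => (A z, B z)) t x)).swap) := by
  set z := mu t x with hz
  have hc := h.inCone hρ z
  simp only [harmonic, Symb.wave, slowAt, mainSymb, Prod.swap_prod_mk, ← hz]
  rw [harmCoeff_rotate, harmCoeff_rotate]
  have hw : harmWeight lam ((n : ℤ) - 1) = (lam : ℂ) / (1 - (2 * (n : ℂ) - 1) ^ 2) := by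
    rw [harmWeight]; push_cast; ring_nf
  have hA : ampA lam A B ζ n z = harmWeight lam ((n : ℤ) - 1) * harmCoeff ((n : ℤ) - 1) (A z, B z) := by
    rcases eq_or_ne (A z) 0 with h0 | h0
    · have hb : B z = 0 := hc.fst_eq_zero_iff.1 h0
      rw [ampA, h0, hb, harmCoeff_zero_right]; simp
    · have hb : B z ≠ 0 := fun hb => h0 (hc.fst_eq_zero_iff.2 hb)
      rw [ampA, harmCoeff_eq_fourierL _ h0 hb, hw, h.ratio z h0, relPhase]; ring
  have hB : ampB lam A B ζ n z = harmWeight lam ((n : ℤ) - 1) * harmCoeff ((n : ℤ) - 1) (B z, A z) := by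
    rcases eq_or_ne (A z) 0 with h0 | h0
    · have hb : B z = 0 := hc.fst_eq_zero_iff.1 h0
      rw [ampB, h0, hb, harmCoeff_zero_right]; simp
    · have hb : B z ≠ 0 := fun hb => h0 (hc.fst_eq_zero_iff.2 hb)
      have hr : (B z * (starRingEnd ℂ) (A z) / ((‖B z‖ : ℂ) * (‖A z‖ : ℂ))) = (relPhase A B z)⁻¹ := by
        have h1 : (‖A z‖ : ℂ) ≠ 0 := by simpa using h0
        have h2 : (‖B z‖ : ℂ) ≠ 0 := by simpa using hb
        have h3 : (starRingEnd ℂ) (A z) ≠ 0 := by simpa using h0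
        have h4 : (starRingEnd ℂ) (B z) ≠ 0 := by simpa using hb
        rw [relPhase, inv_div, div_eq_div_iff (by positivity) (by positivity)]
        have h5 := Complex.mul_conj (A z)
        have h6 := Complex.mul_conj (B z)
        rw [normSq_eq_norm_sq] at h5 h6
        push_cast at h5 h6
        linear_combination (B z * (starRingEnd ℂ) (B z)) * h5 + (‖A z‖ : ℂ) ^ 2 * h6
      rw [ampB, harmCoeff_eq_fourierL _ hb h0, hr, hw, h.ratio z h0, one_div_div, inv_zpow', neg_sub]
      ring
  rw [hA, hB, h.phaseA_eq hρ, h.phaseB_eq hρ, mul_comm (exp _), mul_comm (exp _),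
    ← mul_assoc, ← mul_assoc]
  congr 3
  · simp only [theta]; push_cast; ring
  · simp only [theta]; push_cast; ring

lemma norm_wave_fst (S : Symb) (e : Slow) : ‖(S.wave e).1‖ = ‖e.2.2.2.1‖ := by
  rw [Symb.wave, norm_mul, norm_exp_I_mul, one_mul]

lemma norm_wave_snd (S : Symb) (e : Slow) : ‖(S.wave e).2‖ = ‖e.2.2.2.2‖ := by
  rw [Symb.wave, norm_mul, norm_exp_I_mul, one_mul]

lemma norm_wave (S : Symb) (e : Slow) : ‖S.wave e‖ = ‖e.2.2.2‖ := by
  rw [Prod.norm_def, Prod.norm_def, norm_wave_fst, norm_wave_snd]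

lemma hasSum_nat_add_neg_add_one {f : ℤ → ℂ} {v : ℂ} (hf : HasSum f v) :
    HasSum (fun n : ℕ => f n + f (-(n + 1 : ℤ))) v := by
  have s1 : Summable fun n : ℕ => f n := hf.summable.comp_injective Nat.cast_injective
  have s2 : Summable fun n : ℕ => f (-(n + 1 : ℤ)) :=
    hf.summable.comp_injective (i := fun n : ℕ => -(n + 1 : ℤ)) fun a b hab => by simpa using hab
  have h := s1.hasSum.add s2.hasSum
  rwa [← hf.unique (HasSum.of_nat_of_neg_add_one s1.hasSum s2.hasSum)] at h

lemma hasSum_corr_nat (lam : ℝ) (q : ℂ × ℂ) :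
    HasSum (fun n : ℕ => harmWeight lam ((n : ℤ) + 1) * harmCoeff ((n : ℤ) + 1) q
      + harmWeight lam ((n : ℤ) + 1) * harmCoeff ((n : ℤ) + 1) q.swap) (corr lam q) := by
  have h2 := hasSum_nat_add_neg_add_one (hasSum_corr lam q)
  rw [← hasSum_nat_add_iff' 1] at h2
  have h0 : ∑ i ∈ Finset.range 1, (harmWeight lam (i : ℤ) * harmCoeff (i : ℤ) q
      + harmWeight lam (-((i : ℤ) + 1)) * harmCoeff (-((i : ℤ) + 1)) q) = 0 := by
    rw [Finset.sum_range_one, Nat.cast_zero, zero_add, harmWeight_zero, harmWeight_neg_one]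
    simp
  rw [h0, sub_zero] at h2
  refine h2.congr_fun fun n => ?_
  have e1 : ((n + 1 : ℕ) : ℤ) = (n : ℤ) + 1 := by push_cast; ring
  have e2 : harmWeight lam (-((n : ℤ) + 1 + 1)) = harmWeight lam ((n : ℤ) + 1) := by
    simp only [harmWeight]; push_cast; ring_nf
  have e3 : harmCoeff (-((n : ℤ) + 1 + 1)) q = harmCoeff ((n : ℤ) + 1) q.swap := by
    have := harmCoeff_neg ((n : ℤ) + 1 + 1) q.1 q.2
    rw [add_sub_cancel_right] at this
    exact this
  rw [e1, e2, e3]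

lemma Admissible.hasSum_harmonic {ρ : ℝ} {A B : Plane → ℂ} {ζ : Plane → ℝ} (hρ : 1 ≤ ρ)
    (h : Admissible ρ A B ζ) (lam : ℝ) (t : ℝ) (x : Plane) :
    HasSum (fun n : ℕ => harmonic lam A B ζ (n + 2) t x)
      (corr lam ((mainSymb lam ρ).wave (slowAt (fun z => (A z, B z)) t x))) := by
  refine (hasSum_corr_nat lam _).congr_fun fun n => ?_
  rw [h.harmonic_eq hρ]
  have e1 : ((n + 2 : ℕ) : ℤ) - 1 = (n : ℤ) + 1 := by push_cast; ring
  rw [e1]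

lemma Admissible.profile_eq {ρ : ℝ} {A B : Plane → ℂ} {ζ : Plane → ℝ} (hρ : 1 ≤ ρ)
    (h : Admissible ρ A B ζ) (lam : ℝ) {t : ℝ} {x : Plane} (hx : ‖x‖ < t) :
    profile lam A B ζ t x = (mainSymb lam ρ).prof (slowAt (fun z => (A z, B z)) t x) := by
  have ht : 0 < t := (norm_nonneg x).trans_lt hx
  rw [profile, uap, vap, if_pos hx, if_pos hx, (h.hasSum_harmonic hρ lam t x).tsum_eq, Symb.prof]
  have e1 : Real.exp (-(slowAt (fun z => (A z, B z)) t x).2.1) = t⁻¹ := by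
    simp only [slowAt]; rw [Real.exp_neg, Real.exp_log ht]
  have e2 : Real.exp (-(2 * (slowAt (fun z => (A z, B z)) t x).2.1)) = (t ^ 2)⁻¹ := by
    simp only [slowAt]
    rw [Real.exp_neg, two_mul, Real.exp_add, Real.exp_log ht, pow_two]
  rw [e1, e2]
  push_cast
  congr 2
  rw [h.phaseA_eq hρ, h.phaseB_eq hρ]
  simp only [Symb.wave, slowAt, mainSymb, theta]
  rw [mul_comm (A _), mul_comm (B _)]
  congr 3
  · push_cast; ring
  · push_cast; ring

/-! ### Regularized symbols -/

lemma contDiff_normSq {n : WithTop ℕ∞} : ContDiff ℝ n normSq := by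
  have : normSq = fun z : ℂ => ‖z‖ ^ 2 := by
    ext z; exact normSq_eq_norm_sq z
  show ContDiff ℝ n fun z : ℂ => normSq z
  simp only [normSq_eq_norm_sq]
  exact contDiff_norm_sq ℝ

lemma contDiff_sqNorm {n : WithTop ℕ∞} : ContDiff ℝ n sqNorm :=
  (contDiff_normSq.comp contDiff_fst).add (contDiff_normSq.comp contDiff_snd)

lemma sqNorm_smul (c : ℝ) (p : ℂ × ℂ) : sqNorm (c • p) = c ^ 2 * sqNorm p := by
  simp [sqNorm, normSq_eq_norm_sq, mul_pow]; ring

lemma sq_norm_le_sqNorm (p : ℂ × ℂ) : ‖p‖ ^ 2 ≤ sqNorm p := by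
  rw [sqNorm, normSq_eq_norm_sq, normSq_eq_norm_sq, Prod.norm_def]
  rcases max_cases ‖p.1‖ ‖p.2‖ with h | h <;> rw [h.1] <;> nlinarith [sq_nonneg ‖p.1‖, sq_nonneg ‖p.2‖]

lemma sqNorm_le (p : ℂ × ℂ) : sqNorm p ≤ 2 * ‖p‖ ^ 2 := by
  rw [sqNorm, normSq_eq_norm_sq, normSq_eq_norm_sq]
  have h1 : ‖p.1‖ ^ 2 ≤ ‖p‖ ^ 2 := by have := norm_fst_le p; gcongr
  have h2 : ‖p.2‖ ^ 2 ≤ ‖p‖ ^ 2 := by have := norm_snd_le p; gcongr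
  linarith

/-- A smooth cutoff vanishing for `|p| ≤ ε` and equal to `1` for `|p|² ≥ 2ε²`. -/
def cut (ε : ℝ) (p : ℂ × ℂ) : ℝ := Real.smoothTransition (sqNorm p / ε ^ 2 - 1)

lemma contDiff_cut (ε : ℝ) {n : ℕ∞} : ContDiff ℝ n (cut ε) :=
  Real.smoothTransition.contDiff.comp ((contDiff_sqNorm.div_const _).sub contDiff_const)

lemma cut_eq_zero {ε : ℝ} (hε : 0 < ε) {p : ℂ × ℂ} (hp : sqNorm p ≤ ε ^ 2) : cut ε p = 0 :=
  Real.smoothTransition.zero_of_nonpos (by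
    rw [sub_nonpos, div_le_one (by positivity)]; exact hp)

lemma cut_eq_one {ε : ℝ} (hε : 0 < ε) {p : ℂ × ℂ} (hp : 2 * ε ^ 2 ≤ sqNorm p) : cut ε p = 1 :=
  Real.smoothTransition.one_of_one_le (by
    rw [le_sub_iff_add_le, le_div_iff₀ (by positivity)]; linarith)

lemma cut_smul {c : ℝ} (hc : 0 < c) (ε : ℝ) (p : ℂ × ℂ) : cut (c * ε) (c • p) = cut ε p := by
  rw [cut, cut, sqNorm_smul, mul_pow, mul_div_mul_left _ _ (by positivity)]

lemma cut_congr (ε : ℝ) {p q : ℂ × ℂ} (h1 : ‖p.1‖ = ‖q.1‖) (h2 : ‖p.2‖ = ‖q.2‖) :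
    cut ε p = cut ε q := by
  simp only [cut, sqNorm, normSq_eq_norm_sq, h1, h2]

section Scaling

variable {F : Type*} [NormedAddCommGroup F] [NormedSpace ℝ F]

lemma fderiv_scale {g h : ℂ × ℂ → F} {c : ℝ} {k : ℝ} {p : ℂ × ℂ}
    (hg : g =ᶠ[𝓝 p] fun q => k • h (c • q)) (hh : ContDiff ℝ 2 h) :
    fderiv ℝ g p = (k * c) • fderiv ℝ h (c • p) := by
  rw [hg.fderiv_eq, fderiv_fun_const_smul, fderiv_comp_smul, smul_smul]
  exact (hh.differentiable two_ne_zero).differentiableAt.comp _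
    (differentiableAt_id.const_smul c)

lemma fderiv_fderiv_scale {g h : ℂ × ℂ → F} {c : ℝ} {k : ℝ} {p : ℂ × ℂ}
    (hg : g =ᶠ[𝓝 p] fun q => k • h (c • q)) (hh : ContDiff ℝ 2 h) :
    fderiv ℝ (fderiv ℝ g) p = (k * c * c) • fderiv ℝ (fderiv ℝ h) (c • p) := by
  have h1 : fderiv ℝ g =ᶠ[𝓝 p] fun q => (k * c) • fderiv ℝ h (c • q) := by
    filter_upwards [hg.eventuallyEq_nhds] with q hq
    exact fderiv_scale hq hh
  have h2 : ContDiff ℝ 1 (fderiv ℝ h) := hh.fderiv_right (by norm_num)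
  have h3 : DifferentiableAt ℝ (fun q => fderiv ℝ h (c • q)) p :=
    (h2.differentiable one_ne_zero).differentiableAt.comp _ (differentiableAt_id.const_smul c)
  have h4 : fderiv ℝ (fun q => fderiv ℝ h (c • q)) p = c • fderiv ℝ (fderiv ℝ h) (c • p) :=
    fderiv_comp_smul c
  have h5 := h3.hasFDerivAt.const_smul (k * c)
  rw [h4, smul_smul] at h5
  rw [h1.fderiv_eq]
  exact h5.fderiv

lemma eventually_cut_eq_zero {ε : ℝ} (hε : 0 < ε) : ∀ᶠ p in 𝓝 (0 : ℂ × ℂ), cut ε p = 0 := by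
  have h : ∀ᶠ p in 𝓝 (0 : ℂ × ℂ), sqNorm p < ε ^ 2 := by
    refine (contDiff_sqNorm (n := 0)).continuous.continuousAt.eventually_lt
      continuousAt_const ?_
    simp [sqNorm]; positivity
  filter_upwards [h] with q hq
  exact cut_eq_zero hε hq.le

lemma contDiff_cut_smul {f : ℂ × ℂ → F} (hf : ∀ p, p ≠ 0 → ContDiffAt ℝ 2 f p) {ε : ℝ}
    (hε : 0 < ε) : ContDiff ℝ 2 fun p => cut ε p • f p := by
  rw [contDiff_iff_contDiffAt]
  intro p
  rcases eq_or_ne p 0 with rfl | hp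
  · have : (fun p => cut ε p • f p) =ᶠ[𝓝 0] fun _ => 0 := by
      filter_upwards [eventually_cut_eq_zero hε] with q hq
      rw [hq, zero_smul]
    exact contDiffAt_const.congr_of_eventuallyEq this
  · exact ((contDiff_cut ε (n := 2)).contDiffAt).smul (hf p hp)

/-- Cutoffs near the origin of a homogeneous function of degree `d` that is `C²` off the origin
satisfy symbol bounds uniformly in the cutoff parameter. -/
lemma exists_bound_cut_smul {f : ℂ × ℂ → F} (hf : ∀ p, p ≠ 0 → ContDiffAt ℝ 2 f p) (d : ℕ)
    (hom : ∀ (c : ℝ), 0 < c → ∀ p, f (c • p) = c ^ d • f p) :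
    ∃ C : ℝ, 0 < C ∧ ∀ ε : ℝ, 0 < ε → ∀ p : ℂ × ℂ,
      ‖cut ε p • f p‖ ≤ C * ‖p‖ ^ d ∧
      ‖fderiv ℝ (fun q => cut ε q • f q) p‖ * ‖p‖ ≤ C * ‖p‖ ^ d ∧
      ‖fderiv ℝ (fderiv ℝ fun q => cut ε q • f q) p‖ * ‖p‖ ^ 2 ≤ C * ‖p‖ ^ d := by
  set h : ℂ × ℂ → F := fun q => cut 1 q • f q with hdef
  have hh : ContDiff ℝ 2 h := contDiff_cut_smul hf one_pos
  have hh1 : ContDiff ℝ 1 (fderiv ℝ h) := hh.fderiv_right (by norm_num)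
  have hh2 : Continuous (fderiv ℝ (fderiv ℝ h)) := hh1.continuous_fderiv one_ne_zero
  have hK : IsCompact (Metric.closedBall (0 : ℂ × ℂ) 2) := isCompact_closedBall 0 2
  obtain ⟨C₀, hC₀⟩ := hK.exists_bound_of_continuousOn hh.continuous.continuousOn
  obtain ⟨C₁, hC₁⟩ := hK.exists_bound_of_continuousOn hh1.continuous.continuousOn
  obtain ⟨C₂, hC₂⟩ := hK.exists_bound_of_continuousOn
    (f := fderiv ℝ (fderiv ℝ h)) hh2.continuousOn
  set D := max 1 (max C₀ (max C₁ C₂))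
  have hD1 : 1 ≤ D := le_max_left _ _
  have hD0 : C₀ ≤ D := (le_max_left _ _).trans (le_max_right _ _)
  have hDa : C₁ ≤ D := (le_max_left _ _).trans ((le_max_right _ _).trans (le_max_right _ _))
  have hDb : C₂ ≤ D := (le_max_right _ _).trans ((le_max_right _ _).trans (le_max_right _ _))
  refine ⟨D * 2 ^ d * 4, by positivity, fun ε hε p => ?_⟩
  -- the rescaled function coincides with the reference one on a ball of radius two
  obtain ⟨c, hc, hcp, hloc⟩ : ∃ c : ℝ, 0 < c ∧ ‖c⁻¹ • p‖ ≤ 2 ∧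
      (fun q => cut ε q • f q) =ᶠ[𝓝 p] fun q => c ^ d • h (c⁻¹ • q) := by
    have hfc : ∀ c : ℝ, 0 < c → ∀ q, f q = c ^ d • f (c⁻¹ • q) := fun c hc q => by
      rw [← hom c hc, smul_smul, mul_inv_cancel₀ hc.ne', one_smul]
    by_cases hp : ‖p‖ ≤ 2 * ε
    · refine ⟨ε, hε, ?_, Eventually.of_forall fun q => ?_⟩
      · rw [norm_smul, norm_inv, norm_of_nonneg hε.le, inv_mul_le_iff₀ hε]; linarith
      · simp only [hdef]
        have : cut ε q = cut 1 (ε⁻¹ • q) := by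
          rw [← cut_smul hε 1, smul_smul, mul_inv_cancel₀ hε.ne', one_smul, mul_one]
        rw [this, smul_comm, ← hfc ε hε]
    · push Not at hp
      have hp0 : 0 < ‖p‖ := by linarith
      refine ⟨‖p‖ / 2, by positivity, ?_, ?_⟩
      · rw [norm_smul, norm_inv, norm_of_nonneg (by positivity)]
        refine le_of_eq ?_; field_simp
      · have h1 : ∀ᶠ q in 𝓝 p, max (2 * ε) (3 / 4 * ‖p‖) < ‖q‖ :=
          continuousAt_const.eventually_lt continuousAt_id.norm (max_lt hp (by linarith))
        filter_upwards [h1] with q hq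
        have hq1 : 2 * ε < ‖q‖ := (le_max_left _ _).trans_lt hq
        have hq2 : 3 / 4 * ‖p‖ < ‖q‖ := (le_max_right _ _).trans_lt hq
        have e1 : cut ε q = 1 := cut_eq_one hε (by nlinarith [sq_norm_le_sqNorm q])
        have e2 : cut 1 ((‖p‖ / 2)⁻¹ • q) = 1 := by
          refine cut_eq_one one_pos (le_trans ?_ (sq_norm_le_sqNorm _))
          rw [norm_smul, norm_inv, norm_of_nonneg (by positivity)]
          have : 3 / 2 ≤ (‖p‖ / 2)⁻¹ * ‖q‖ := by
            rw [inv_mul_eq_div, le_div_iff₀ (by positivity)]; linarith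
          nlinarith
        simp only [hdef]
        rw [e1, e2, one_smul, one_smul, ← hfc _ (by positivity)]
  set q := c⁻¹ • p with hq
  have hpq : ‖p‖ = c * ‖q‖ := by
    rw [hq, norm_smul, norm_inv, norm_of_nonneg hc.le, mul_inv_cancel_left₀ hc.ne']
  have hqm : q ∈ Metric.closedBall (0 : ℂ × ℂ) 2 := by simpa using hcp
  have hv := hloc.self_of_nhds
  simp only at hv
  rw [hv, fderiv_scale hloc hh, fderiv_fderiv_scale hloc hh, ← hq, norm_smul (c ^ d) (h q),
    norm_smul (c ^ d * c⁻¹) (fderiv ℝ h q),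
    norm_smul (c ^ d * c⁻¹ * c⁻¹) (fderiv ℝ (fderiv ℝ h) q),
    norm_of_nonneg (by positivity : 0 ≤ c ^ d),
    norm_of_nonneg (by positivity : 0 ≤ c ^ d * c⁻¹),
    norm_of_nonneg (by positivity : 0 ≤ c ^ d * c⁻¹ * c⁻¹), hpq, mul_pow, mul_pow]
  have hA : ∀ (X : ℝ) (j : ℕ), j ≤ 2 → (X ≤ D) → (‖q‖ < 1 / 2 → X = 0) → 0 ≤ X →
      c ^ d * X * ‖q‖ ^ j ≤ D * 2 ^ d * 4 * (c ^ d * ‖q‖ ^ d) := by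
    intro X j hj hX hX0 hX'
    rcases lt_or_ge ‖q‖ (1 / 2) with h1 | h1
    · rw [hX0 h1]; simp only [mul_zero, zero_mul]; positivity
    · have h2 : (1 : ℝ) ≤ (2 * ‖q‖) ^ d := one_le_pow₀ (by linarith)
      have h3 : ‖q‖ ^ j ≤ 4 := by
        interval_cases j
        · norm_num
        · linarith
        · nlinarith [norm_nonneg q]
      calc c ^ d * X * ‖q‖ ^ j ≤ c ^ d * D * 4 := by gcongr
        _ ≤ c ^ d * D * 4 * (2 * ‖q‖) ^ d := le_mul_of_one_le_right (by positivity) h2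
        _ = _ := by rw [mul_pow]; ring
  have hzero : ‖q‖ < 1 / 2 → h =ᶠ[𝓝 q] fun _ => 0 := fun h1 => by
    filter_upwards [continuousAt_id.norm.eventually_lt continuousAt_const h1] with w hw
    have hw' : ‖w‖ < 1 / 2 := hw
    simp only [hdef]
    rw [cut_eq_zero one_pos, zero_smul]
    nlinarith [sqNorm_le w, norm_nonneg w]
  have hzero1 : ‖q‖ < 1 / 2 → fderiv ℝ h =ᶠ[𝓝 q] fun _ => 0 := fun h1 => by
    filter_upwards [(hzero h1).eventuallyEq_nhds] with w hw
    rw [hw.fderiv_eq]; simp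
  refine ⟨?_, ?_, ?_⟩
  · have := hA ‖h q‖ 0 (by norm_num) ((hC₀ q hqm).trans hD0)
      (fun h1 => by rw [(hzero h1).self_of_nhds]; simp) (norm_nonneg _)
    rwa [pow_zero, mul_one] at this
  · have := hA ‖fderiv ℝ h q‖ 1 (by norm_num) ((hC₁ q hqm).trans hDa)
      (fun h1 => by rw [(hzero1 h1).self_of_nhds]; simp) (norm_nonneg _)
    refine le_trans (le_of_eq ?_) this
    field_simp
  · have := hA ‖fderiv ℝ (fderiv ℝ h) q‖ 2 (by norm_num) ((hC₂ q hqm).trans hDb)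
      (fun h1 => by
        rw [(hzero1 h1).fderiv_eq, fderiv_fun_const]
        exact norm_zero (E := ℂ × ℂ →L[ℝ] ℂ × ℂ →L[ℝ] F)) (norm_nonneg _)
    refine le_trans (le_of_eq ?_) this
    field_simp

end Scaling

lemma coneDen_pos (ρ : ℝ) {p : ℂ × ℂ} (hp : p ≠ 0) : 0 < coneDen ρ p := by
  have hs := sqNorm_pos hp
  rw [coneDen]
  have h1 := Complex.normSq_nonneg p.1
  have h2 := Real.smoothTransition.le_one ((1 + ρ ^ 2) * normSq p.1 / sqNorm p)
  rcases lt_or_ge ((1 + ρ ^ 2) * normSq p.1 / sqNorm p) 1 with h | h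
  · have := Real.smoothTransition.lt_one_of_lt_one h
    have : 0 < sqNorm p * (1 - Real.smoothTransition ((1 + ρ ^ 2) * normSq p.1 / sqNorm p)) :=
      mul_pos hs (by linarith)
    linarith
  · have h3 : 0 < normSq p.1 := by
      rw [le_div_iff₀ hs, one_mul] at h
      by_contra hc
      have : normSq p.1 = 0 := le_antisymm (not_lt.1 hc) h1
      rw [this] at h; linarith
    have : 0 ≤ sqNorm p * (1 - Real.smoothTransition ((1 + ρ ^ 2) * normSq p.1 / sqNorm p)) :=
      mul_nonneg hs.le (by linarith)
    linarith

lemma coneDen_smul (ρ : ℝ) {c : ℝ} (hc : 0 < c) (p : ℂ × ℂ) :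
    coneDen ρ (c • p) = c ^ 2 * coneDen ρ p := by
  have h1 : normSq (c • p).1 = c ^ 2 * normSq p.1 := by
    simp [normSq_eq_norm_sq, mul_pow]
  rw [coneDen, coneDen, h1, sqNorm_smul, mul_left_comm (1 + ρ ^ 2),
    mul_div_mul_left _ _ (by positivity)]
  ring

lemma contDiffAt_resPhase (lam ρ : ℝ) {p : ℂ × ℂ} (hp : p ≠ 0) :
    ContDiffAt ℝ 2 (resPhase lam ρ) p := by
  have hs := (sqNorm_pos hp).ne'
  have hn : ContDiffAt ℝ 2 (fun p : ℂ × ℂ => normSq p.1) p :=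
    (contDiff_normSq.comp contDiff_fst).contDiffAt
  have hd : ContDiffAt ℝ 2 (coneDen ρ) p := by
    refine hn.add (contDiff_sqNorm.contDiffAt.mul (contDiffAt_const.sub ?_))
    refine (Real.smoothTransition.contDiff (n := 2)).contDiffAt.comp p ?_
    exact (contDiffAt_const.mul hn).div contDiff_sqNorm.contDiffAt hs
  refine ContDiffAt.div (contDiffAt_const.mul ?_) hd (coneDen_pos ρ hp).ne'
  have h1 : ContDiffAt ℝ 2 (fun p => harmCoeff 0 p) p :=
    contDiffAt_kernelAvg (continuous_harmKernel 0) hp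
  have h2 : ContDiffAt ℝ 2 (fun p : ℂ × ℂ => (starRingEnd ℂ) p.1) p :=
    (Complex.conjCLE.contDiff.comp contDiff_fst).contDiffAt
  exact (Complex.reCLM.contDiff.contDiffAt).comp p (h1.mul h2)

lemma resPhase_smul (lam ρ : ℝ) (c : ℝ) (hc : 0 < c) (p : ℂ × ℂ) :
    resPhase lam ρ (c • p) = c ^ 1 • resPhase lam ρ p := by
  have h : (harmCoeff 0 (c • p) * (starRingEnd ℂ) (c • p).1).re
      = c ^ 3 * (harmCoeff 0 p * (starRingEnd ℂ) p.1).re := by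
    rw [harmCoeff_smul 0 hc.le]
    have : (c ^ 2 • harmCoeff 0 p) * (starRingEnd ℂ) (c • p).1
        = ((c ^ 3 : ℝ) : ℂ) * (harmCoeff 0 p * (starRingEnd ℂ) p.1) := by
      simp; ring
    rw [this, Complex.re_ofReal_mul]
  rw [resPhase, resPhase, h, coneDen_smul ρ hc, smul_eq_mul]
  have := hc.ne'
  field_simp

/-- Symbol bounds of a triple of phases and correction. -/
structure Symb.Good (C : ℝ) (S : Symb) : Prop where
  contDiff_phA : ContDiff ℝ 2 S.phA
  contDiff_phB : ContDiff ℝ 2 S.phB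
  contDiff_cor : ContDiff ℝ 2 S.cor
  phA_le : ∀ p, |S.phA p| ≤ C * ‖p‖
  phB_le : ∀ p, |S.phB p| ≤ C * ‖p‖
  cor_le : ∀ p, ‖S.cor p‖ ≤ C * ‖p‖ ^ 2
  fderiv_phA_le : ∀ p, ‖fderiv ℝ S.phA p‖ ≤ C
  fderiv_phB_le : ∀ p, ‖fderiv ℝ S.phB p‖ ≤ C
  fderiv_cor_le : ∀ p, ‖fderiv ℝ S.cor p‖ ≤ C * ‖p‖
  hess_phA_le : ∀ p, ‖fderiv ℝ (fderiv ℝ S.phA) p‖ * ‖p‖ ≤ C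
  hess_phB_le : ∀ p, ‖fderiv ℝ (fderiv ℝ S.phB) p‖ * ‖p‖ ≤ C
  hess_cor_le : ∀ p, ‖fderiv ℝ (fderiv ℝ S.cor) p‖ ≤ C

/-- The symbols of the profile, cut off near the origin. -/
def regSymb (lam ρ ε : ℝ) : Symb where
  phA := fun p => cut ε p • (mainSymb lam ρ).phA p
  phB := fun p => cut ε p • (mainSymb lam ρ).phB p
  cor := fun p => cut ε p • (mainSymb lam ρ).cor p

lemma exists_regSymb_good (lam ρ : ℝ) :
    ∃ C : ℝ, 0 < C ∧ ∀ ε : ℝ, 0 < ε → (regSymb lam ρ ε).Good C := by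
  have hA : ∀ p : ℂ × ℂ, p ≠ 0 → ContDiffAt ℝ 2 (mainSymb lam ρ).phA p := fun p hp =>
    contDiffAt_resPhase lam ρ hp
  have hB : ∀ p : ℂ × ℂ, p ≠ 0 → ContDiffAt ℝ 2 (mainSymb lam ρ).phB p := fun p hp => by
    have hp' : (p.2, p.1) ≠ (0 : ℂ × ℂ) := fun h => hp (by
      rw [Prod.mk_eq_zero] at h; exact Prod.ext h.2 h.1)
    exact ((contDiffAt_resPhase lam ρ hp').comp p
      (contDiff_snd.prodMk contDiff_fst).contDiffAt).neg
  have hV : ∀ p : ℂ × ℂ, p ≠ 0 → ContDiffAt ℝ 2 (mainSymb lam ρ).cor p := fun p hp =>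
    contDiffAt_kernelAvg (continuous_corrKernel lam) hp
  obtain ⟨C₁, h₁, b₁⟩ := exists_bound_cut_smul hA 1 (fun c hc p => resPhase_smul lam ρ c hc p)
  obtain ⟨C₂, h₂, b₂⟩ := exists_bound_cut_smul hB 1 (fun c hc p => by
    have := resPhase_smul lam ρ c hc (p.2, p.1)
    simp only [Prod.smul_mk] at this
    simp only [mainSymb, Prod.smul_fst, Prod.smul_snd, this, smul_neg])
  obtain ⟨C₃, h₃, b₃⟩ := exists_bound_cut_smul hV 2 (fun c hc p => kernelAvg_smul _ hc.le p)
  refine ⟨max C₁ (max C₂ C₃), lt_max_of_lt_left h₁, fun ε hε => ?_⟩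
  set C := max C₁ (max C₂ C₃)
  have e₁ : C₁ ≤ C := le_max_left _ _
  have e₂ : C₂ ≤ C := (le_max_left _ _).trans (le_max_right _ _)
  have e₃ : C₃ ≤ C := (le_max_right _ _).trans (le_max_right _ _)
  have hC0 : 0 < C := h₁.trans_le e₁
  have hz : ∀ {F : Type} [NormedAddCommGroup F] [NormedSpace ℝ F] (f : ℂ × ℂ → F),
      (fun p => cut ε p • f p) =ᶠ[𝓝 0] fun _ => 0 := fun f => by
    filter_upwards [eventually_cut_eq_zero hε] with p hp
    rw [hp, zero_smul]
  have hz1 : ∀ {F : Type} [NormedAddCommGroup F] [NormedSpace ℝ F] (f : ℂ × ℂ → F),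
      fderiv ℝ (fun p => cut ε p • f p) =ᶠ[𝓝 0] fun _ => 0 := fun f => by
    filter_upwards [(hz f).eventuallyEq_nhds] with w hw
    rw [hw.fderiv_eq]; simp
  have hpow : ∀ {X K : ℝ} {p : ℂ × ℂ}, p ≠ 0 → X * ‖p‖ ≤ K * ‖p‖ → X ≤ K := fun hp h =>
    le_of_mul_le_mul_right h (norm_pos_iff.2 hp)
  refine ⟨contDiff_cut_smul hA hε, contDiff_cut_smul hB hε, contDiff_cut_smul hV hε,
    fun p => ?_, fun p => ?_, fun p => ?_, fun p => ?_, fun p => ?_, fun p => ?_, fun p => ?_,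
    fun p => ?_, fun p => ?_⟩
  · have := (b₁ ε hε p).1
    rw [pow_one, norm_eq_abs] at this
    exact this.trans (by gcongr)
  · have := (b₂ ε hε p).1
    rw [pow_one, norm_eq_abs] at this
    exact this.trans (by gcongr)
  · exact (b₃ ε hε p).1.trans (by gcongr)
  · rcases eq_or_ne p 0 with rfl | hp
    · simp only [regSymb]; rw [(hz1 _).self_of_nhds]; simpa using hC0.le
    · refine (hpow hp ?_).trans e₁
      have := (b₁ ε hε p).2.1
      rw [pow_one] at this
      exact this
  · rcases eq_or_ne p 0 with rfl | hp
    · simp only [regSymb]; rw [(hz1 _).self_of_nhds]; simpa using hC0.le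
    · refine (hpow hp ?_).trans e₂
      have := (b₂ ε hε p).2.1
      rw [pow_one] at this
      exact this
  · rcases eq_or_ne p 0 with rfl | hp
    · simp only [regSymb]; rw [(hz1 _).self_of_nhds]; simp
    · refine (hpow hp ?_).trans (mul_le_mul_of_nonneg_right e₃ (norm_nonneg p))
      have := (b₃ ε hε p).2.1
      rw [pow_two, ← mul_assoc] at this
      exact this
  · rcases eq_or_ne p 0 with rfl | hp
    · simpa using hC0.le
    · refine (hpow hp ?_).trans e₁
      have := (b₁ ε hε p).2.2
      rw [pow_one, pow_two, ← mul_assoc] at this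
      exact this
  · rcases eq_or_ne p 0 with rfl | hp
    · simpa using hC0.le
    · refine (hpow hp ?_).trans e₂
      have := (b₂ ε hε p).2.2
      rw [pow_one, pow_two, ← mul_assoc] at this
      exact this
  · rcases eq_or_ne p 0 with rfl | hp
    · simp only [regSymb]; rw [(hz1 _).fderiv_eq, fderiv_fun_const]
      exact (le_of_eq (norm_zero (E := ℂ × ℂ →L[ℝ] ℂ × ℂ →L[ℝ] ℂ))).trans hC0.le
    · have := (b₃ ε hε p).2.2
      exact (le_of_mul_le_mul_right this (by positivity)).trans e₃

/-! ### Second order chain rules -/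

section ChainRules

variable {E G F : Type*} [NormedAddCommGroup E] [NormedSpace ℝ E] [NormedAddCommGroup G]
  [NormedSpace ℝ G] [NormedAddCommGroup F] [NormedSpace ℝ F]

/-- The second derivative `D² f(e)(w, v)`. -/
def hess (f : E → F) (e w v : E) : F := fderiv ℝ (fderiv ℝ f) e w v

lemma hasFDerivAt_fderiv_apply {f : E → F} {e : E} (hf : ContDiffAt ℝ 2 f e) (v : E) :
    HasFDerivAt (fun e' => fderiv ℝ f e' v)
      ((ContinuousLinearMap.apply ℝ F v).comp (fderiv ℝ (fderiv ℝ f) e)) e := by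
  have h1 : DifferentiableAt ℝ (fderiv ℝ f) e :=
    (hf.fderiv_right (m := 1) (by norm_num)).differentiableAt one_ne_zero
  exact (ContinuousLinearMap.apply ℝ F v).hasFDerivAt.comp e h1.hasFDerivAt

lemma hess_eq {f : E → F} {e : E} (hf : ContDiffAt ℝ 2 f e) (w v : E) :
    hess f e w v = fderiv ℝ (fun e' => fderiv ℝ f e' v) e w := by
  rw [(hasFDerivAt_fderiv_apply hf v).fderiv]; rfl

lemma hess_of_hasFDerivAt {f : E → F} {e : E} (hf : ContDiffAt ℝ 2 f e) {w v : E} {g : E → F}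
    (hg : ∀ᶠ e' in 𝓝 e, fderiv ℝ f e' v = g e') {g' : E →L[ℝ] F} (hg' : HasFDerivAt g g' e) :
    hess f e w v = g' w := by
  rw [hess_eq hf, Filter.EventuallyEq.fderiv_eq hg, hg'.fderiv]

lemma hess_comm {f : E → F} {e : E} (hf : ContDiffAt ℝ 2 f e) (w v : E) :
    hess f e w v = hess f e v w :=
  (hf.isSymmSndFDerivAt (by simp)).eq w v

lemma hess_add_left (f : E → F) (e w w' v : E) :
    hess f e (w + w') v = hess f e w v + hess f e w' v := by
  simp [hess]

lemma hess_add_right (f : E → F) (e w v v' : E) :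
    hess f e w (v + v') = hess f e w v + hess f e w v' := by
  simp [hess]

lemma hess_smul_left (f : E → F) (e : E) (c : ℝ) (w v : E) :
    hess f e (c • w) v = c • hess f e w v := by
  simp [hess]

lemma hess_smul_right (f : E → F) (e : E) (c : ℝ) (w v : E) :
    hess f e w (c • v) = c • hess f e w v := by
  simp [hess]

lemma hess_add {f g : E → F} (hf : ContDiff ℝ 2 f) (hg : ContDiff ℝ 2 g) (e w v : E) :
    hess (fun x => f x + g x) e w v = hess f e w v + hess g e w v := by
  refine hess_of_hasFDerivAt (hf.add hg).contDiffAt (g := fun e' => fderiv ℝ f e' v + fderiv ℝ g e' v)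
    (.of_forall fun e' => ?_)
    ((hasFDerivAt_fderiv_apply hf.contDiffAt v).add (hasFDerivAt_fderiv_apply hg.contDiffAt v))
  rw [fderiv_fun_add (hf.differentiable two_ne_zero e') (hg.differentiable two_ne_zero e')]
  rfl

lemma hess_comp_at {f : E → G} {V : G → F} {e : E} (hf : ContDiffAt ℝ 2 f e) (hV : ContDiff ℝ 2 V)
    (w v : E) :
    hess (fun x => V (f x)) e w v = hess V (f e) (fderiv ℝ f e w) (fderiv ℝ f e v)
      + fderiv ℝ V (f e) (hess f e w v) := by
  have h1 : HasFDerivAt (fun e' => fderiv ℝ V (f e'))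
      ((fderiv ℝ (fderiv ℝ V) (f e)).comp (fderiv ℝ f e)) e := by
    have : DifferentiableAt ℝ (fderiv ℝ V) (f e) :=
      ((hV.fderiv_right (m := 1) (by norm_num)).differentiable one_ne_zero) _
    exact this.hasFDerivAt.comp e (hf.differentiableAt two_ne_zero).hasFDerivAt
  have h2 := h1.clm_apply (hasFDerivAt_fderiv_apply hf v)
  have hev : ∀ᶠ e' in 𝓝 e, fderiv ℝ (fun x => V (f x)) e' v = fderiv ℝ V (f e') (fderiv ℝ f e' v) := by
    filter_upwards [hf.eventually (by simp)] with e' he'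
    have := fderiv_comp e' (hV.differentiable two_ne_zero (f e')) (he'.differentiableAt two_ne_zero)
    rw [show fderiv ℝ (fun x => V (f x)) e' = _ from this]; rfl
  have hc : ContDiffAt ℝ 2 (fun x => V (f x)) e := hV.contDiffAt.comp e hf
  rw [hess_of_hasFDerivAt hc hev h2]
  simp [hess, add_comm]

lemma hess_comp {f : E → G} {V : G → F} (hf : ContDiff ℝ 2 f) (hV : ContDiff ℝ 2 V) (e w v : E) :
    hess (fun x => V (f x)) e w v = hess V (f e) (fderiv ℝ f e w) (fderiv ℝ f e v)
      + fderiv ℝ V (f e) (hess f e w v) := hess_comp_at hf.contDiffAt hV w v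

lemma fderiv_mul_apply {f g : E → ℂ} (hf : ContDiff ℝ 2 f) (hg : ContDiff ℝ 2 g) (e v : E) :
    fderiv ℝ (fun x => f x * g x) e v = fderiv ℝ f e v * g e + f e * fderiv ℝ g e v := by
  rw [fderiv_fun_mul (hf.differentiable two_ne_zero e) (hg.differentiable two_ne_zero e)]
  simp; ring

lemma hess_mul {f g : E → ℂ} (hf : ContDiff ℝ 2 f) (hg : ContDiff ℝ 2 g) (e w v : E) :
    hess (fun x => f x * g x) e w v = hess f e w v * g e + fderiv ℝ f e v * fderiv ℝ g e w
      + fderiv ℝ f e w * fderiv ℝ g e v + f e * hess g e w v := by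
  have h1 := ((hasFDerivAt_fderiv_apply hf.contDiffAt v).mul
      (hg.differentiable two_ne_zero e).hasFDerivAt).add
    ((hf.differentiable two_ne_zero e).hasFDerivAt.mul (hasFDerivAt_fderiv_apply hg.contDiffAt v))
  rw [hess_of_hasFDerivAt (hf.mul hg).contDiffAt
    (.of_forall fun e' => fderiv_mul_apply hf hg e' v) h1]
  simp [hess]; ring

lemma contDiff_cexp_mul {κ : E → ℝ} (hκ : ContDiff ℝ 2 κ) (c : ℂ) :
    ContDiff ℝ 2 fun x => exp (c * κ x) :=
  (contDiff_const.mul (Complex.ofRealCLM.contDiff.comp hκ)).cexp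

lemma hasFDerivAt_cexp_mul {κ : E → ℝ} {κ' : E →L[ℝ] ℝ} {e : E} (hκ : HasFDerivAt κ κ' e) (c : ℂ) :
    HasFDerivAt (fun x => exp (c * κ x))
      (exp (c * κ e) • c • (Complex.ofRealCLM.comp κ')) e :=
  ((Complex.ofRealCLM.hasFDerivAt.comp e hκ).const_mul c).cexp

lemma fderiv_cexp_mul_apply {κ : E → ℝ} (hκ : ContDiff ℝ 2 κ) (c : ℂ) (e v : E) :
    fderiv ℝ (fun x => exp (c * κ x)) e v
      = c * (fderiv ℝ κ e v : ℝ) * exp (c * κ e) := by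
  rw [(hasFDerivAt_cexp_mul (hκ.differentiable two_ne_zero e).hasFDerivAt c).fderiv]
  simp; ring

lemma hess_cexp_mul {κ : E → ℝ} (hκ : ContDiff ℝ 2 κ) (c : ℂ) (e w v : E) :
    hess (fun x => exp (c * κ x)) e w v
      = (c * (hess κ e w v : ℝ) + c ^ 2 * (fderiv ℝ κ e w : ℝ) * (fderiv ℝ κ e v : ℝ))
        * exp (c * κ e) := by
  have h1 := ((Complex.ofRealCLM.hasFDerivAt.comp e
    (hasFDerivAt_fderiv_apply hκ.contDiffAt v)).const_mul c).mul
      (hasFDerivAt_cexp_mul (hκ.differentiable two_ne_zero e).hasFDerivAt c)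
  rw [hess_of_hasFDerivAt (contDiff_cexp_mul hκ c).contDiffAt
    (.of_forall fun e' => fderiv_cexp_mul_apply hκ c e' v) h1]
  simp [hess]; ring

lemma hess_clm (L : E →L[ℝ] F) (e w v : E) : hess (fun x => L x) e w v = 0 := by
  have : fderiv ℝ (fun x => L x) = fun _ => L := by ext1 x; exact L.fderiv
  rw [hess, this, fderiv_fun_const]; rfl

lemma fderiv_clm_apply_self (L : E →L[ℝ] F) (e v : E) : fderiv ℝ (fun x => L x) e v = L v := by
  rw [show fderiv ℝ (fun x => L x) e = L from L.fderiv]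

end ChainRules

/-! ### Derivatives of the waves -/

/-- Coordinate projections of the slow variables. -/
def prS : Slow →L[ℝ] ℝ := fst ℝ _ _

/-- The projection to `log t`. -/
def prL : Slow →L[ℝ] ℝ := (fst ℝ _ _).comp (snd ℝ _ _)

/-- The projection to `⟨μ⟩⁻¹`. -/
def prR : Slow →L[ℝ] ℝ := (fst ℝ _ _).comp
  ((snd ℝ _ _).comp (snd ℝ _ _))

/-- The projection to the amplitudes. -/
def prP : Slow →L[ℝ] ℂ × ℂ := (snd ℝ _ _).comp
  ((snd ℝ _ _).comp (snd ℝ _ _))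

/-- The phase `δ s + r ℓ φ(p)`. -/
def phase (δ : ℝ) (φ : ℂ × ℂ → ℝ) (e : Slow) : ℝ := δ * prS e + prR e * prL e * φ (prP e)

lemma contDiff_phase (δ : ℝ) {φ : ℂ × ℂ → ℝ} (hφ : ContDiff ℝ 2 φ) : ContDiff ℝ 2 (phase δ φ) :=
  (contDiff_const.mul prS.contDiff).add
    ((prR.contDiff.mul prL.contDiff).mul (hφ.comp prP.contDiff))

lemma fderiv_phase_apply (δ : ℝ) {φ : ℂ × ℂ → ℝ} (hφ : ContDiff ℝ 2 φ) (e v : Slow) :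
    fderiv ℝ (phase δ φ) e v = δ * prS v + (prR v * prL e + prR e * prL v) * φ (prP e)
      + prR e * prL e * fderiv ℝ φ (prP e) (prP v) := by
  have h := (prS.hasFDerivAt (x := e)).const_mul δ |>.add
    (((prR.hasFDerivAt (x := e)).mul (prL.hasFDerivAt (x := e))).mul
      ((hφ.differentiable two_ne_zero (prP e)).hasFDerivAt.comp e (prP.hasFDerivAt (x := e))))
  have h' : HasFDerivAt (phase δ φ) _ e := h
  rw [h'.fderiv]
  simp; ring

lemma hess_phase (δ : ℝ) {φ : ℂ × ℂ → ℝ} (hφ : ContDiff ℝ 2 φ) (e w v : Slow) :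
    hess (phase δ φ) e w v = (prR v * prL w + prR w * prL v) * φ (prP e)
      + (prR v * prL e + prR e * prL v) * fderiv ℝ φ (prP e) (prP w)
      + (prR w * prL e + prR e * prL w) * fderiv ℝ φ (prP e) (prP v)
      + prR e * prL e * hess φ (prP e) (prP w) (prP v) := by
  have hφ' := (hφ.differentiable two_ne_zero (prP e)).hasFDerivAt.comp e (prP.hasFDerivAt (x := e))
  have hL := prL.hasFDerivAt (x := e)
  have hR := prR.hasFDerivAt (x := e)
  have h2 := (hasFDerivAt_fderiv_apply hφ.contDiffAt (prP v)).comp e (prP.hasFDerivAt (x := e))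
  have h := (((hL.const_mul (prR v)).add (hR.mul_const (prL v))).mul hφ').const_add (δ * prS v)
    |>.add ((hR.mul hL).mul h2)
  rw [hess_of_hasFDerivAt (contDiff_phase δ hφ).contDiffAt
    (.of_forall fun e' => fderiv_phase_apply δ hφ e' v) h]
  simp [hess]; ring

/-- The wave `e^{i (δ s + r ℓ φ(p))} π(p)`. -/
def gwave (δ : ℝ) (φ : ℂ × ℂ → ℝ) (π : ℂ × ℂ →L[ℝ] ℂ) (e : Slow) : ℂ :=
  exp (I * phase δ φ e) * π.comp prP e

lemma contDiff_gwave (δ : ℝ) {φ : ℂ × ℂ → ℝ} (hφ : ContDiff ℝ 2 φ) (π : ℂ × ℂ →L[ℝ] ℂ) :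
    ContDiff ℝ 2 (gwave δ φ π) :=
  (contDiff_cexp_mul (contDiff_phase δ hφ) _).mul (π.comp prP).contDiff

lemma fderiv_gwave_apply (δ : ℝ) {φ : ℂ × ℂ → ℝ} (hφ : ContDiff ℝ 2 φ) (π : ℂ × ℂ →L[ℝ] ℂ)
    (e v : Slow) : fderiv ℝ (gwave δ φ π) e v =
    exp (I * phase δ φ e) *
      (I * (fderiv ℝ (phase δ φ) e v : ℝ) * π (prP e) + π (prP v)) := by
  have h := fderiv_mul_apply (contDiff_cexp_mul (contDiff_phase δ hφ) I)
    (π.comp prP).contDiff e v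
  rw [show fderiv ℝ (gwave δ φ π) e v = _ from h,
    fderiv_cexp_mul_apply (contDiff_phase δ hφ), fderiv_clm_apply_self]
  simp; ring

lemma hess_gwave (δ : ℝ) {φ : ℂ × ℂ → ℝ} (hφ : ContDiff ℝ 2 φ) (π : ℂ × ℂ →L[ℝ] ℂ)
    (e w v : Slow) : hess (gwave δ φ π) e w v =
    exp (I * phase δ φ e) *
      ((I * (hess (phase δ φ) e w v : ℝ)
          - (fderiv ℝ (phase δ φ) e w : ℝ) * (fderiv ℝ (phase δ φ) e v : ℝ)) * π (prP e)
        + I * (fderiv ℝ (phase δ φ) e v : ℝ) * π (prP w)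
        + I * (fderiv ℝ (phase δ φ) e w : ℝ) * π (prP v)) := by
  have h := hess_mul (contDiff_cexp_mul (contDiff_phase δ hφ) I)
    (π.comp prP).contDiff e w v
  rw [show hess (gwave δ φ π) e w v = _ from h,
    fderiv_cexp_mul_apply (contDiff_phase δ hφ), fderiv_cexp_mul_apply (contDiff_phase δ hφ),
    hess_cexp_mul (contDiff_phase δ hφ), fderiv_clm_apply_self, fderiv_clm_apply_self, hess_clm,
    Complex.I_sq]
  simp; ring

lemma Symb.wave_fst_eq (S : Symb) (e : Slow) :
    (S.wave e).1 = gwave (-1) S.phA (fst ℝ ℂ ℂ) e := by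
  simp [Symb.wave, gwave, phase, prS, prL, prR, prP]

lemma Symb.wave_snd_eq (S : Symb) (e : Slow) :
    (S.wave e).2 = gwave 1 S.phB (snd ℝ ℂ ℂ) e := by
  simp [Symb.wave, gwave, phase, prS, prL, prR, prP]

lemma Symb.wave_eq (S : Symb) : S.wave = fun e =>
    (gwave (-1) S.phA (fst ℝ ℂ ℂ) e,
      gwave 1 S.phB (snd ℝ ℂ ℂ) e) := by
  ext1 e
  exact Prod.ext (S.wave_fst_eq e) (S.wave_snd_eq e)

section PairRules

variable {E : Type*} [NormedAddCommGroup E] [NormedSpace ℝ E]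

lemma fderiv_pair_apply {f g : E → ℂ} (hf : ContDiff ℝ 2 f) (hg : ContDiff ℝ 2 g) (e v : E) :
    fderiv ℝ (fun x => (f x, g x)) e v = (fderiv ℝ f e v, fderiv ℝ g e v) := by
  have h := ((hf.differentiable two_ne_zero e).hasFDerivAt.prodMk
    (hg.differentiable two_ne_zero e).hasFDerivAt).fderiv
  rw [h]; rfl

lemma hess_pair {f g : E → ℂ} (hf : ContDiff ℝ 2 f) (hg : ContDiff ℝ 2 g) (e w v : E) :
    hess (fun x => (f x, g x)) e w v = (hess f e w v, hess g e w v) := by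
  have h := (hasFDerivAt_fderiv_apply hf.contDiffAt (e := e) v).prodMk
    (hasFDerivAt_fderiv_apply hg.contDiffAt v)
  rw [hess_of_hasFDerivAt (hf.prodMk hg).contDiffAt
    (.of_forall fun e' => fderiv_pair_apply hf hg e' v) h]
  rfl

end PairRules

lemma Symb.Good.contDiff_wave {C : ℝ} {S : Symb} (hS : S.Good C) : ContDiff ℝ 2 S.wave := by
  rw [S.wave_eq]
  exact (contDiff_gwave _ hS.contDiff_phA _).prodMk (contDiff_gwave _ hS.contDiff_phB _)

lemma Symb.prof_eq (S : Symb) : S.prof = fun e =>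
    exp ((-1 : ℂ) * prL e) *
      (gwave (-1) S.phA (fst ℝ ℂ ℂ) e
        + gwave 1 S.phB (snd ℝ ℂ ℂ) e)
    + exp ((-2 : ℂ) * prL e) * S.cor (S.wave e) := by
  ext1 e
  rw [Symb.prof, S.wave_fst_eq, S.wave_snd_eq]
  congr 2
  · rw [Complex.ofReal_exp]; congr 1; simp [prL]
  · rw [Complex.ofReal_exp]; congr 1; simp [prL]

lemma Symb.Good.contDiff_prof {C : ℝ} {S : Symb} (hS : S.Good C) : ContDiff ℝ 2 S.prof := by
  rw [S.prof_eq]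
  exact ((contDiff_cexp_mul prL.contDiff _).mul ((contDiff_gwave _ hS.contDiff_phA _).add
    (contDiff_gwave _ hS.contDiff_phB _))).add
    ((contDiff_cexp_mul prL.contDiff _).mul (hS.contDiff_cor.comp hS.contDiff_wave))

/-- Derivative of `e^{-kℓ} f`. -/
lemma fderiv_exp_mul_apply (k : ℂ) {f : Slow → ℂ} (hf : ContDiff ℝ 2 f) (e v : Slow) :
    fderiv ℝ (fun x => exp (k * prL x) * f x) e v
      = exp (k * prL e) * (fderiv ℝ f e v + k * prL v * f e) := by
  rw [fderiv_mul_apply (contDiff_cexp_mul prL.contDiff _) hf,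
    fderiv_cexp_mul_apply prL.contDiff, fderiv_clm_apply_self]
  ring

/-- Second derivative of `e^{-kℓ} f`. -/
lemma hess_exp_mul (k : ℂ) {f : Slow → ℂ} (hf : ContDiff ℝ 2 f) (e w v : Slow) :
    hess (fun x => exp (k * prL x) * f x) e w v
      = exp (k * prL e) * (hess f e w v + k * prL v * fderiv ℝ f e w
        + k * prL w * fderiv ℝ f e v + k ^ 2 * prL w * prL v * f e) := by
  rw [hess_mul (contDiff_cexp_mul prL.contDiff _) hf,
    fderiv_cexp_mul_apply prL.contDiff, fderiv_cexp_mul_apply prL.contDiff,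
    hess_cexp_mul prL.contDiff, fderiv_clm_apply_self, fderiv_clm_apply_self, hess_clm]
  push_cast; ring

/-! ### Bounds for the derivatives of the profile -/

lemma norm_exp_I_mul_phase (δ : ℝ) (φ : ℂ × ℂ → ℝ) (e : Slow) :
    ‖exp (I * phase δ φ e)‖ = 1 := norm_exp_I_mul _

lemma norm_hess_le {E F : Type*} [NormedAddCommGroup E] [NormedSpace ℝ E] [NormedAddCommGroup F]
    [NormedSpace ℝ F] (f : E → F) (e w v : E) :
    ‖hess f e w v‖ ≤ ‖fderiv ℝ (fderiv ℝ f) e‖ * ‖w‖ * ‖v‖ :=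
  (fderiv ℝ (fderiv ℝ f) e).le_opNorm₂ w v

/-- A direction tangent to the slow variables `(ℓ, r, p)` with bounded first components. -/
structure SlowDir (v : Slow) : Prop where
  prS_eq : prS v = 0
  prL_le : |prL v| ≤ 2
  prR_le : |prR v| ≤ 2

/-- The range of the slow variables. -/
structure SlowPt (e : Slow) : Prop where
  prL_nonneg : 0 ≤ prL e
  prR_nonneg : 0 ≤ prR e
  prR_le : prR e ≤ 1

section PhaseBounds

variable {C : ℝ} {φ : ℂ × ℂ → ℝ} {e v : Slow}

lemma SlowPt.abs_coeff_le (he : SlowPt e) (hv : SlowDir v) :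
    |prR v * prL e + prR e * prL v| ≤ 2 * (1 + prL e) ∧ |prR e * prL e| ≤ prL e := by
  have hL := he.prL_nonneg
  have hR := he.prR_nonneg
  have hR1 := he.prR_le
  constructor
  · refine (abs_add_le _ _).trans ?_
    rw [abs_mul, abs_mul, abs_of_nonneg hL, abs_of_nonneg hR]
    nlinarith [hv.prL_le, hv.prR_le, abs_nonneg (prL v), abs_nonneg (prR v)]
  · rw [abs_mul, abs_of_nonneg hL, abs_of_nonneg hR]; nlinarith

lemma abs_fderiv_phase_le (hC : 1 ≤ C) (δ : ℝ) (hφ : ContDiff ℝ 2 φ) (h0 : ∀ p, |φ p| ≤ C * ‖p‖)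
    (h1 : ∀ p, ‖fderiv ℝ φ p‖ ≤ C) (he : SlowPt e) (hv : SlowDir v) :
    |fderiv ℝ (phase δ φ) e v| ≤ 2 * C * (1 + prL e) * (‖prP e‖ + ‖prP v‖) := by
  rw [fderiv_phase_apply δ hφ, hv.prS_eq, mul_zero, zero_add]
  have hL := he.prL_nonneg
  obtain ⟨a1, a3⟩ := he.abs_coeff_le hv
  have a2 : |fderiv ℝ φ (prP e) (prP v)| ≤ C * ‖prP v‖ :=
    ((fderiv ℝ φ (prP e)).le_opNorm (prP v)).trans (by gcongr; exact h1 _)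
  refine (abs_add_le _ _).trans ?_
  rw [abs_mul, abs_mul]
  calc _ ≤ 2 * (1 + prL e) * (C * ‖prP e‖) + prL e * (C * ‖prP v‖) := by
        gcongr; exact h0 _
    _ ≤ _ := by
        have : 0 ≤ C * ‖prP v‖ := by positivity
        nlinarith

lemma abs_hess_phase_mul_le (hC : 1 ≤ C) (δ : ℝ) (hφ : ContDiff ℝ 2 φ)
    (h0 : ∀ p, |φ p| ≤ C * ‖p‖)
    (h1 : ∀ p, ‖fderiv ℝ φ p‖ ≤ C) (h2 : ∀ p, ‖fderiv ℝ (fderiv ℝ φ) p‖ * ‖p‖ ≤ C)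
    (he : SlowPt e) (hv : SlowDir v) :
    |hess (phase δ φ) e v v| * ‖prP e‖ ≤ 8 * C * (1 + prL e) * (‖prP e‖ + ‖prP v‖) ^ 2 := by
  rw [hess_phase δ hφ]
  have hL := he.prL_nonneg
  obtain ⟨a1, a3⟩ := he.abs_coeff_le hv
  have a0 : |prR v * prL v + prR v * prL v| ≤ 8 := by
    refine (abs_add_le _ _).trans ?_
    rw [abs_mul]
    nlinarith [hv.prL_le, hv.prR_le, abs_nonneg (prL v), abs_nonneg (prR v)]
  have a2 : |fderiv ℝ φ (prP e) (prP v)| ≤ C * ‖prP v‖ :=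
    ((fderiv ℝ φ (prP e)).le_opNorm (prP v)).trans (by gcongr; exact h1 _)
  have a4 : |hess φ (prP e) (prP v) (prP v)| * ‖prP e‖ ≤ C * ‖prP v‖ ^ 2 := by
    have := norm_hess_le φ (prP e) (prP v) (prP v)
    rw [norm_eq_abs] at this
    calc _ ≤ ‖fderiv ℝ (fderiv ℝ φ) (prP e)‖ * ‖prP v‖ * ‖prP v‖ * ‖prP e‖ := by gcongr
      _ = (‖fderiv ℝ (fderiv ℝ φ) (prP e)‖ * ‖prP e‖) * ‖prP v‖ ^ 2 := by ring
      _ ≤ _ := by gcongr; exact h2 _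
  set x := ‖prP e‖
  set y := ‖prP v‖
  have hx0 : 0 ≤ x := norm_nonneg _
  have hy0 : 0 ≤ y := norm_nonneg _
  calc _ ≤ (8 * (C * x) + 2 * (1 + prL e) * (C * y) + 2 * (1 + prL e) * (C * y)
        + prL e * |hess φ (prP e) (prP v) (prP v)|) * x := by
        refine mul_le_mul_of_nonneg_right ((norm_add₄_le (E := ℝ)).trans ?_) hx0
        simp only [norm_eq_abs, abs_mul (prR v * prL v + prR v * prL v), abs_mul (prR v * prL e + prR e * prL v),
          abs_mul (prR e * prL e)]
        gcongr; exact h0 _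
    _ = 8 * C * x ^ 2 + 4 * (1 + prL e) * C * (x * y)
        + prL e * (|hess φ (prP e) (prP v) (prP v)| * x) := by ring
    _ ≤ 8 * C * x ^ 2 + 4 * (1 + prL e) * C * (x * y) + prL e * (C * y ^ 2) := by gcongr
    _ ≤ _ := by
        have e1 : 0 ≤ C * x ^ 2 * prL e := by positivity
        have e2 : 0 ≤ C * (x * y) * prL e := by positivity
        have e3 : 0 ≤ C * (x * y) := by positivity
        have e4 : 0 ≤ C * y ^ 2 := by positivity
        have e5 : 0 ≤ C * y ^ 2 * prL e := by positivity
        nlinarith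

lemma norm_fderiv_gwave_le (hC : 1 ≤ C) (δ : ℝ) (hφ : ContDiff ℝ 2 φ)
    (h0 : ∀ p, |φ p| ≤ C * ‖p‖)
    (h1 : ∀ p, ‖fderiv ℝ φ p‖ ≤ C) {π : ℂ × ℂ →L[ℝ] ℂ} (hπ : ∀ q, ‖π q‖ ≤ ‖q‖)
    (he : SlowPt e) (hv : SlowDir v) :
    ‖fderiv ℝ (gwave δ φ π) e v‖ ≤
      2 * C * (1 + prL e) * (‖prP e‖ + ‖prP v‖) * (1 + ‖prP e‖) := by
  rw [fderiv_gwave_apply δ hφ, norm_mul, norm_exp_I_mul_phase, one_mul]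
  refine (norm_add_le _ _).trans ?_
  rw [norm_mul, norm_mul, norm_I, one_mul, norm_real, norm_eq_abs]
  have a := abs_fderiv_phase_le hC δ hφ h0 h1 he hv
  have hL := he.prL_nonneg
  set x := ‖prP e‖
  set y := ‖prP v‖
  have hx0 : 0 ≤ x := norm_nonneg _
  have hy0 : 0 ≤ y := norm_nonneg _
  calc _ ≤ 2 * C * (1 + prL e) * (x + y) * x + y := by gcongr <;> exact hπ _
    _ ≤ _ := by
      have e1 : 0 ≤ C * prL e * (x + y) := by positivity
      have e2 : 0 ≤ (C - 1) * (x + y) := mul_nonneg (by linarith) (by positivity)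
      nlinarith

lemma norm_hess_gwave_le (hC : 1 ≤ C) (δ : ℝ) (hφ : ContDiff ℝ 2 φ)
    (h0 : ∀ p, |φ p| ≤ C * ‖p‖)
    (h1 : ∀ p, ‖fderiv ℝ φ p‖ ≤ C) (h2 : ∀ p, ‖fderiv ℝ (fderiv ℝ φ) p‖ * ‖p‖ ≤ C)
    {π : ℂ × ℂ →L[ℝ] ℂ} (hπ : ∀ q, ‖π q‖ ≤ ‖q‖) (he : SlowPt e) (hv : SlowDir v) :
    ‖hess (gwave δ φ π) e v v‖ ≤
      12 * C ^ 2 * (1 + prL e) ^ 2 * (‖prP e‖ + ‖prP v‖) ^ 2 * (1 + ‖prP e‖) := by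
  rw [hess_gwave δ hφ, norm_mul, norm_exp_I_mul_phase, one_mul]
  have a := abs_fderiv_phase_le hC δ hφ h0 h1 he hv
  have b := abs_hess_phase_mul_le hC δ hφ h0 h1 h2 he hv
  have hL := he.prL_nonneg
  set x := ‖prP e‖
  set y := ‖prP v‖
  have hx0 : 0 ≤ x := norm_nonneg _
  have hy0 : 0 ≤ y := norm_nonneg _
  set D := |fderiv ℝ (phase δ φ) e v|
  set H := |hess (phase δ φ) e v v|
  set Λ := 1 + prL e with hΛ
  have hΛ1 : 1 ≤ Λ := by linarith
  have hD0 : 0 ≤ D := abs_nonneg _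
  have hH0 : 0 ≤ H := abs_nonneg _
  have n1 : ‖(I * (hess (phase δ φ) e v v : ℝ)
          - (fderiv ℝ (phase δ φ) e v : ℝ) * (fderiv ℝ (phase δ φ) e v : ℝ)) * π (prP e)‖
      ≤ (H + D * D) * x := by
    rw [norm_mul]
    gcongr
    · refine (norm_sub_le _ _).trans ?_
      rw [norm_mul, norm_mul, norm_I, one_mul, norm_real, norm_real,
        norm_eq_abs, norm_eq_abs]
    · exact hπ _
  have n2 : ‖I * (fderiv ℝ (phase δ φ) e v : ℝ) * π (prP v)‖ ≤ D * y := by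
    rw [norm_mul, norm_mul, norm_I, one_mul, norm_real, norm_eq_abs]
    gcongr; exact hπ _
  refine (norm_add_le _ _).trans ((add_le_add ((norm_add_le _ _).trans (add_le_add n1 n2)) n2).trans ?_)
  have hDD : D * D ≤ (2 * C * Λ * (x + y)) ^ 2 := by nlinarith
  calc (H + D * D) * x + D * y + D * y = H * x + D * D * x + 2 * (D * y) := by ring
    _ ≤ 8 * C * Λ * (x + y) ^ 2 + (2 * C * Λ * (x + y)) ^ 2 * x
        + 2 * ((2 * C * Λ * (x + y)) * (x + y)) := by
        gcongr; linarith
    _ = 12 * (C * Λ) * (x + y) ^ 2 + 4 * (C * Λ) ^ 2 * (x + y) ^ 2 * x := by ring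
    _ ≤ 12 * (C * Λ) ^ 2 * (x + y) ^ 2 + 12 * (C * Λ) ^ 2 * (x + y) ^ 2 * x := by
        have : 1 ≤ C * Λ := one_le_mul_of_one_le_of_one_le hC hΛ1
        have : C * Λ ≤ (C * Λ) ^ 2 := by nlinarith
        gcongr; norm_num
    _ = _ := by ring

end PhaseBounds

lemma norm_fst_clm_le (q : ℂ × ℂ) : ‖fst ℝ ℂ ℂ q‖ ≤ ‖q‖ := norm_fst_le q

lemma norm_snd_clm_le (q : ℂ × ℂ) : ‖snd ℝ ℂ ℂ q‖ ≤ ‖q‖ := norm_snd_le q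

section ProfBounds

variable {C : ℝ} {S : Symb} {e v : Slow}

lemma Symb.Good.fderiv_wave (hS : S.Good C) (e v : Slow) : fderiv ℝ S.wave e v =
    (fderiv ℝ (gwave (-1) S.phA (fst ℝ ℂ ℂ)) e v,
      fderiv ℝ (gwave 1 S.phB (snd ℝ ℂ ℂ)) e v) := by
  rw [S.wave_eq]
  exact fderiv_pair_apply (contDiff_gwave _ hS.contDiff_phA _) (contDiff_gwave _ hS.contDiff_phB _) e v

lemma Symb.Good.hess_wave (hS : S.Good C) (e w v : Slow) : hess S.wave e w v =
    (hess (gwave (-1) S.phA (fst ℝ ℂ ℂ)) e w v,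
      hess (gwave 1 S.phB (snd ℝ ℂ ℂ)) e w v) := by
  rw [S.wave_eq]
  exact hess_pair (contDiff_gwave _ hS.contDiff_phA _) (contDiff_gwave _ hS.contDiff_phB _) e w v

lemma Symb.Good.norm_fderiv_wave_le (hS : S.Good C) (hC : 1 ≤ C) (he : SlowPt e) (hv : SlowDir v) :
    ‖fderiv ℝ S.wave e v‖ ≤ 2 * C * (1 + prL e) * (‖prP e‖ + ‖prP v‖) * (1 + ‖prP e‖) := by
  rw [hS.fderiv_wave]
  exact max_le (norm_fderiv_gwave_le hC _ hS.contDiff_phA hS.phA_le hS.fderiv_phA_le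
      norm_fst_clm_le he hv)
    (norm_fderiv_gwave_le hC _ hS.contDiff_phB hS.phB_le hS.fderiv_phB_le norm_snd_clm_le he hv)

lemma Symb.Good.norm_hess_wave_le (hS : S.Good C) (hC : 1 ≤ C) (he : SlowPt e) (hv : SlowDir v) :
    ‖hess S.wave e v v‖ ≤
      12 * C ^ 2 * (1 + prL e) ^ 2 * (‖prP e‖ + ‖prP v‖) ^ 2 * (1 + ‖prP e‖) := by
  rw [hS.hess_wave]
  exact max_le (norm_hess_gwave_le hC _ hS.contDiff_phA hS.phA_le hS.fderiv_phA_le hS.hess_phA_le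
      norm_fst_clm_le he hv)
    (norm_hess_gwave_le hC _ hS.contDiff_phB hS.phB_le hS.fderiv_phB_le hS.hess_phB_le
      norm_snd_clm_le he hv)

/-- The quadratic correction evaluated at the waves. -/
def Symb.corw (S : Symb) (e : Slow) : ℂ := S.cor (S.wave e)

lemma Symb.Good.contDiff_corw (hS : S.Good C) : ContDiff ℝ 2 S.corw :=
  hS.contDiff_cor.comp hS.contDiff_wave

lemma Symb.Good.fderiv_corw (hS : S.Good C) (e v : Slow) :
    fderiv ℝ S.corw e v = fderiv ℝ S.cor (S.wave e) (fderiv ℝ S.wave e v) := by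
  have := fderiv_comp e (hS.contDiff_cor.differentiable two_ne_zero (S.wave e))
    (hS.contDiff_wave.differentiable two_ne_zero e)
  rw [show fderiv ℝ S.corw e = _ from this]; rfl

lemma Symb.Good.hess_corw (hS : S.Good C) (e w v : Slow) :
    hess S.corw e w v = hess S.cor (S.wave e) (fderiv ℝ S.wave e w) (fderiv ℝ S.wave e v)
      + fderiv ℝ S.cor (S.wave e) (hess S.wave e w v) :=
  hess_comp hS.contDiff_wave hS.contDiff_cor e w v

lemma norm_wave_eq (S : Symb) (e : Slow) : ‖S.wave e‖ = ‖prP e‖ := norm_wave S e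

lemma Symb.Good.norm_corw_le (hS : S.Good C) : ‖S.corw e‖ ≤ C * ‖prP e‖ ^ 2 := by
  have := hS.cor_le (S.wave e)
  rwa [norm_wave_eq] at this

lemma Symb.Good.norm_fderiv_corw_le (hS : S.Good C) (v : Slow) :
    ‖fderiv ℝ S.corw e v‖ ≤ C * ‖prP e‖ * ‖fderiv ℝ S.wave e v‖ := by
  rw [hS.fderiv_corw]
  refine (le_opNorm _ _).trans ?_
  have := hS.fderiv_cor_le (S.wave e)
  rw [norm_wave_eq] at this
  gcongr

lemma Symb.Good.norm_hess_corw_le (hS : S.Good C) (w v : Slow) :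
    ‖hess S.corw e w v‖ ≤ C * ‖fderiv ℝ S.wave e w‖ * ‖fderiv ℝ S.wave e v‖
      + C * ‖prP e‖ * ‖hess S.wave e w v‖ := by
  rw [hS.hess_corw]
  refine (norm_add_le _ _).trans (add_le_add ?_ ?_)
  · refine (norm_hess_le _ _ _ _).trans ?_
    gcongr; exact hS.hess_cor_le _
  · refine (le_opNorm _ _).trans ?_
    have := hS.fderiv_cor_le (S.wave e)
    rw [norm_wave_eq] at this
    gcongr

/-- The sum of the two waves. -/
def Symb.sumw (S : Symb) (e : Slow) : ℂ :=
  gwave (-1) S.phA (fst ℝ ℂ ℂ) e + gwave 1 S.phB (snd ℝ ℂ ℂ) e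

lemma Symb.Good.contDiff_sumw (hS : S.Good C) : ContDiff ℝ 2 S.sumw :=
  (contDiff_gwave _ hS.contDiff_phA _).add (contDiff_gwave _ hS.contDiff_phB _)

lemma Symb.prof_eq' (S : Symb) : S.prof = fun e =>
    exp ((-1 : ℂ) * prL e) * S.sumw e + exp ((-2 : ℂ) * prL e) * S.corw e := S.prof_eq

lemma Symb.Good.fderiv_prof (hS : S.Good C) (e v : Slow) : fderiv ℝ S.prof e v =
    exp ((-1 : ℂ) * prL e) * (fderiv ℝ S.sumw e v + (-1) * prL v * S.sumw e)
    + exp ((-2 : ℂ) * prL e) * (fderiv ℝ S.corw e v + (-2) * prL v * S.corw e) := by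
  rw [S.prof_eq', fderiv_fun_add, add_apply, fderiv_exp_mul_apply _ hS.contDiff_sumw,
    fderiv_exp_mul_apply _ hS.contDiff_corw]
  · exact ((contDiff_cexp_mul prL.contDiff _).mul hS.contDiff_sumw).differentiable two_ne_zero e
  · exact ((contDiff_cexp_mul prL.contDiff _).mul hS.contDiff_corw).differentiable two_ne_zero e

lemma Symb.Good.hess_prof (hS : S.Good C) (e w v : Slow) : hess S.prof e w v =
    exp ((-1 : ℂ) * prL e) * (hess S.sumw e w v + (-1) * prL v * fderiv ℝ S.sumw e w
        + (-1) * prL w * fderiv ℝ S.sumw e v + (-1) ^ 2 * prL w * prL v * S.sumw e)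
    + exp ((-2 : ℂ) * prL e) * (hess S.corw e w v + (-2) * prL v * fderiv ℝ S.corw e w
        + (-2) * prL w * fderiv ℝ S.corw e v + (-2) ^ 2 * prL w * prL v * S.corw e) := by
  rw [S.prof_eq', hess_add, hess_exp_mul _ hS.contDiff_sumw, hess_exp_mul _ hS.contDiff_corw]
  · exact (contDiff_cexp_mul prL.contDiff _).mul hS.contDiff_sumw
  · exact (contDiff_cexp_mul prL.contDiff _).mul hS.contDiff_corw

lemma norm_cexp_neg_one_mul (l : ℝ) : ‖exp ((-1 : ℂ) * l)‖ = Real.exp (-l) := by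
  rw [Complex.norm_exp]; simp

lemma norm_cexp_neg_two_mul (l : ℝ) : ‖exp ((-2 : ℂ) * l)‖ = Real.exp (-(2 * l)) := by
  rw [Complex.norm_exp]; simp

lemma Symb.norm_sumw_le (S : Symb) (e : Slow) : ‖S.sumw e‖ ≤ 2 * ‖prP e‖ := by
  rw [Symb.sumw, ← S.wave_fst_eq, ← S.wave_snd_eq]
  refine (norm_add_le _ _).trans ?_
  have h1 := norm_fst_le (S.wave e)
  have h2 := norm_snd_le (S.wave e)
  rw [norm_wave_eq] at h1 h2
  linarith

lemma Symb.Good.fderiv_sumw (hS : S.Good C) (e v : Slow) : fderiv ℝ S.sumw e v =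
    fderiv ℝ (gwave (-1) S.phA (fst ℝ ℂ ℂ)) e v
      + fderiv ℝ (gwave 1 S.phB (snd ℝ ℂ ℂ)) e v := by
  have := fderiv_fun_add ((contDiff_gwave (-1) hS.contDiff_phA
    (fst ℝ ℂ ℂ)).differentiable two_ne_zero e)
    ((contDiff_gwave 1 hS.contDiff_phB
    (snd ℝ ℂ ℂ)).differentiable two_ne_zero e)
  rw [show fderiv ℝ S.sumw e = _ from this]; rfl

lemma Symb.Good.hess_sumw (hS : S.Good C) (e w v : Slow) : hess S.sumw e w v =
    hess (gwave (-1) S.phA (fst ℝ ℂ ℂ)) e w v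
      + hess (gwave 1 S.phB (snd ℝ ℂ ℂ)) e w v :=
  hess_add (contDiff_gwave (-1) hS.contDiff_phA _) (contDiff_gwave 1 hS.contDiff_phB _) e w v

lemma Symb.Good.norm_fderiv_sumw_le (hS : S.Good C) (v : Slow) :
    ‖fderiv ℝ S.sumw e v‖ ≤ 2 * ‖fderiv ℝ S.wave e v‖ := by
  have h : fderiv ℝ S.sumw e v = (fderiv ℝ S.wave e v).1 + (fderiv ℝ S.wave e v).2 := by
    rw [hS.fderiv_wave, hS.fderiv_sumw]
  rw [h]
  refine (norm_add_le _ _).trans ?_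
  have h1 := norm_fst_le (fderiv ℝ S.wave e v)
  have h2 := norm_snd_le (fderiv ℝ S.wave e v)
  linarith

lemma Symb.Good.norm_hess_sumw_le (hS : S.Good C) (w v : Slow) :
    ‖hess S.sumw e w v‖ ≤ 2 * ‖hess S.wave e w v‖ := by
  have h : hess S.sumw e w v = (hess S.wave e w v).1 + (hess S.wave e w v).2 := by
    rw [hS.hess_wave, hS.hess_sumw]
  rw [h]
  refine (norm_add_le _ _).trans ?_
  have h1 := norm_fst_le (hess S.wave e w v)
  have h2 := norm_snd_le (hess S.wave e w v)
  linarith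

lemma Symb.Good.norm_fderiv_prof_le (hS : S.Good C) (hC : 1 ≤ C) (he : SlowPt e) (hv : SlowDir v) :
    ‖fderiv ℝ S.prof e v‖ ≤ 60 * C ^ 3 * (Real.exp (-prL e) * (1 + prL e) ^ 2 * (1 + ‖prP e‖) ^ 2
      * (‖prP e‖ + ‖prP v‖)) := by
  rw [hS.fderiv_prof]
  have hL := he.prL_nonneg
  have a := hS.norm_fderiv_wave_le hC he hv
  have b1 := hS.norm_fderiv_sumw_le (e := e) v
  have b2 := S.norm_sumw_le e
  have b3 := hS.norm_fderiv_corw_le (e := e) v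
  have b4 := hS.norm_corw_le (e := e)
  have hl := hv.prL_le
  set x := ‖prP e‖
  set y := ‖prP v‖
  have hx0 : 0 ≤ x := norm_nonneg _
  have hy0 : 0 ≤ y := norm_nonneg _
  set Λ := 1 + prL e with hΛ
  have hΛ1 : 1 ≤ Λ := by linarith
  set W := ‖fderiv ℝ S.wave e v‖ with hW
  have hW0 : 0 ≤ W := norm_nonneg _
  have n1 : ‖fderiv ℝ S.sumw e v + (-1) * prL v * S.sumw e‖ ≤ 2 * W + 2 * (2 * x) := by
    refine (norm_add_le _ _).trans ?_
    rw [norm_mul, norm_mul, norm_neg, norm_one, one_mul, norm_real, norm_eq_abs]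
    gcongr
  have n2 : ‖fderiv ℝ S.corw e v + (-2) * prL v * S.corw e‖ ≤ C * x * W + 4 * (C * x ^ 2) := by
    refine (norm_add_le _ _).trans ?_
    rw [norm_mul, norm_mul, norm_neg, norm_real, norm_eq_abs, Complex.norm_ofNat]
    gcongr
    linarith
  have he2 : Real.exp (-(2 * prL e)) ≤ Real.exp (-prL e) := Real.exp_le_exp.2 (by linarith)
  have hE := Real.exp_pos (-prL e)
  refine (norm_add_le _ _).trans ?_
  rw [norm_mul, norm_mul, norm_cexp_neg_one_mul, norm_cexp_neg_two_mul]
  calc _ ≤ Real.exp (-prL e) * (2 * W + 2 * (2 * x)) + Real.exp (-prL e) * (C * x * W + 4 * (C * x ^ 2)) := by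
        gcongr
    _ = Real.exp (-prL e) * ((2 + C * x) * W + 4 * x + 4 * C * x ^ 2) := by ring
    _ ≤ Real.exp (-prL e) * (60 * C ^ 3 * (Λ ^ 2 * (1 + x) ^ 2 * (x + y))) := by
        gcongr
        have hN : 0 ≤ x + y := by positivity
        have c1 : 2 + C * x ≤ 2 * C * (1 + x) := by nlinarith
        have c2 : (2 + C * x) * W ≤ 2 * C * (1 + x) * (2 * C * Λ * (x + y) * (1 + x)) := by gcongr
        have c3 : 4 * x + 4 * C * x ^ 2 ≤ 4 * C * (1 + x) ^ 2 * (x + y) := by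
          have : 0 ≤ C * y := by positivity
          have : 0 ≤ C * x * y := by positivity
          have : 0 ≤ C * x ^ 2 * y := by positivity
          have : 0 ≤ C * x ^ 3 := by positivity
          have : 0 ≤ (C - 1) * x := mul_nonneg (by linarith) hx0
          have : 0 ≤ C * x ^ 2 := by positivity
          nlinarith
        have d1 : C ^ 2 ≤ C ^ 3 := pow_le_pow_right₀ hC (by norm_num)
        have d2 : C ≤ C ^ 3 := by nlinarith
        have d3 : Λ ≤ Λ ^ 2 := by nlinarith
        have d4 : 1 ≤ Λ ^ 2 := by nlinarith
        set Q := (1 + x) ^ 2 * (x + y) with hQ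
        have hQ0 : 0 ≤ Q := by positivity
        calc _ ≤ 2 * C * (1 + x) * (2 * C * Λ * (x + y) * (1 + x)) + 4 * C * (1 + x) ^ 2 * (x + y) := by linarith
          _ = 4 * (C ^ 2 * Λ * Q) + 4 * (C * 1 * Q) := by rw [hQ]; ring
          _ ≤ 4 * (C ^ 3 * Λ ^ 2 * Q) + 4 * (C ^ 3 * Λ ^ 2 * Q) := by gcongr
          _ ≤ 60 * (C ^ 3 * Λ ^ 2 * Q) := by
            have : 0 ≤ C ^ 3 * Λ ^ 2 * Q := by positivity
            linarith
          _ = _ := by rw [hQ]; ring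
    _ = _ := by ring

lemma hess_prof_arith {C Λ x y W X : ℝ} (hC : 1 ≤ C) (hΛ1 : 1 ≤ Λ) (hx0 : 0 ≤ x) (hy0 : 0 ≤ y)
    (hW0 : 0 ≤ W) (hX0 : 0 ≤ X) (a : W ≤ 2 * C * Λ * (x + y) * (1 + x))
    (a' : X ≤ 12 * C ^ 2 * Λ ^ 2 * (x + y) ^ 2 * (1 + x)) :
    (2 + C * x) * X + C * W ^ 2 + (8 + 8 * (C * x)) * W + 8 * x + 16 * (C * x ^ 2)
      ≤ 60 * C ^ 3 * (Λ ^ 2 * (1 + x) ^ 2 * ((x + y) + (x + y) ^ 2)) := by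
  set N := x + y
  have hN0 : 0 ≤ N := by positivity
  have hxN : x ≤ N := by linarith
  set Q := C ^ 3 * Λ ^ 2 * (1 + x) ^ 2 with hQ
  have hC0 : 0 ≤ C := by linarith
  have d1 : C ^ 2 ≤ C ^ 3 := pow_le_pow_right₀ hC (by norm_num)
  have d2 : C ≤ C ^ 3 := le_self_pow₀ hC (by norm_num)
  have d3 : Λ ≤ Λ ^ 2 := le_self_pow₀ hΛ1 (by norm_num)
  have d4 : 1 ≤ Λ ^ 2 := one_le_pow₀ hΛ1
  have d5 : 1 ≤ C ^ 3 := one_le_pow₀ hC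
  have d6 : 1 ≤ (1 + x) ^ 2 := one_le_pow₀ (by linarith)
  have c1 : (2 + C * x) * X ≤ 24 * (Q * N ^ 2) := by
    have c0 : 2 + C * x ≤ 2 * C * (1 + x) := by nlinarith
    calc _ ≤ 2 * C * (1 + x) * (12 * C ^ 2 * Λ ^ 2 * N ^ 2 * (1 + x)) := by gcongr
      _ = _ := by rw [hQ]; ring
  have c2 : C * W ^ 2 ≤ 4 * (Q * N ^ 2) := by
    calc _ ≤ C * (2 * C * Λ * N * (1 + x)) ^ 2 := by gcongr
      _ = _ := by rw [hQ]; ring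
  have c3 : (8 + 8 * (C * x)) * W ≤ 16 * (Q * N) := by
    have c0 : 8 + 8 * (C * x) ≤ 8 * C * (1 + x) := by nlinarith
    calc _ ≤ 8 * C * (1 + x) * (2 * C * Λ * N * (1 + x)) := by gcongr
      _ = 16 * (C ^ 2 * Λ * (1 + x) ^ 2 * N) := by ring
      _ ≤ 16 * (C ^ 3 * Λ ^ 2 * (1 + x) ^ 2 * N) := by gcongr
  have c4 : 8 * x ≤ 8 * (Q * N) := by
    have : 1 ≤ Q := by
      rw [hQ]
      exact one_le_mul_of_one_le_of_one_le (one_le_mul_of_one_le_of_one_le d5 d4) d6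
    nlinarith
  have c5 : 16 * (C * x ^ 2) ≤ 16 * (Q * N) := by
    have : x ^ 2 ≤ 1 * (1 + x) ^ 2 * N := by nlinarith
    calc _ ≤ 16 * (C ^ 3 * (1 * (1 + x) ^ 2 * N)) := by gcongr
      _ ≤ 16 * (C ^ 3 * (Λ ^ 2 * (1 + x) ^ 2 * N)) := by gcongr
      _ = _ := by rw [hQ]; ring
  have hQ0 : 0 ≤ Q := by positivity
  have q1 : 0 ≤ Q * N := by positivity
  have q2 : 0 ≤ Q * N ^ 2 := by positivity
  calc _ ≤ 60 * (Q * N + Q * N ^ 2) := by linarith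
    _ = _ := by rw [hQ]; ring

lemma Symb.Good.norm_hess_prof_le (hS : S.Good C) (hC : 1 ≤ C) (he : SlowPt e) (hv : SlowDir v) :
    ‖hess S.prof e v v‖ ≤ 60 * C ^ 3 * (Real.exp (-prL e) * (1 + prL e) ^ 2 * (1 + ‖prP e‖) ^ 2
      * ((‖prP e‖ + ‖prP v‖) + (‖prP e‖ + ‖prP v‖) ^ 2)) := by
  rw [hS.hess_prof]
  have hL := he.prL_nonneg
  have a := hS.norm_fderiv_wave_le hC he hv
  have a' := hS.norm_hess_wave_le hC he hv
  have b1 := hS.norm_fderiv_sumw_le (e := e) v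
  have b2 := S.norm_sumw_le e
  have b3 := hS.norm_fderiv_corw_le (e := e) v
  have b4 := hS.norm_corw_le (e := e)
  have b5 := hS.norm_hess_sumw_le (e := e) v v
  have b6 := hS.norm_hess_corw_le (e := e) v v
  have hl := hv.prL_le
  set x := ‖prP e‖
  set y := ‖prP v‖
  have hx0 : 0 ≤ x := norm_nonneg _
  have hy0 : 0 ≤ y := norm_nonneg _
  set Λ := 1 + prL e with hΛ
  have hΛ1 : 1 ≤ Λ := by linarith
  set W := ‖fderiv ℝ S.wave e v‖ with hW
  have hW0 : 0 ≤ W := norm_nonneg _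
  set X := ‖hess S.wave e v v‖ with hX
  have hX0 : 0 ≤ X := norm_nonneg _
  have n1 : ‖hess S.sumw e v v + (-1) * prL v * fderiv ℝ S.sumw e v
        + (-1) * prL v * fderiv ℝ S.sumw e v + (-1) ^ 2 * prL v * prL v * S.sumw e‖
      ≤ 2 * X + 2 * (2 * W) + 2 * (2 * W) + 2 * 2 * (2 * x) := by
    refine norm_add₄_le.trans ?_
    simp only [norm_mul, norm_pow, norm_neg, norm_one, one_mul, one_pow, norm_real,
      norm_eq_abs]
    gcongr
  have n2 : ‖hess S.corw e v v + (-2) * prL v * fderiv ℝ S.corw e v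
        + (-2) * prL v * fderiv ℝ S.corw e v + (-2) ^ 2 * prL v * prL v * S.corw e‖
      ≤ (C * W * W + C * x * X) + 2 * 2 * (C * x * W) + 2 * 2 * (C * x * W)
        + 2 ^ 2 * 2 * 2 * (C * x ^ 2) := by
    refine norm_add₄_le.trans ?_
    simp only [norm_mul, norm_pow, norm_neg, norm_real, norm_eq_abs,
      Complex.norm_ofNat]
    gcongr
  have he2 : Real.exp (-(2 * prL e)) ≤ Real.exp (-prL e) := Real.exp_le_exp.2 (by linarith)
  have hE := Real.exp_pos (-prL e)
  refine (norm_add_le _ _).trans ?_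
  rw [norm_mul, norm_mul, norm_cexp_neg_one_mul, norm_cexp_neg_two_mul]
  calc _ ≤ Real.exp (-prL e) * (2 * X + 2 * (2 * W) + 2 * (2 * W) + 2 * 2 * (2 * x))
        + Real.exp (-prL e) * ((C * W * W + C * x * X) + 2 * 2 * (C * x * W)
          + 2 * 2 * (C * x * W) + 2 ^ 2 * 2 * 2 * (C * x ^ 2)) := by
        gcongr
    _ = Real.exp (-prL e) * ((2 + C * x) * X + C * W ^ 2 + (8 + 8 * (C * x)) * W
        + 8 * x + 16 * (C * x ^ 2)) := by ring
    _ ≤ Real.exp (-prL e) * (60 * C ^ 3 * (Λ ^ 2 * (1 + x) ^ 2 * ((x + y) + (x + y) ^ 2))) := by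
        gcongr
        exact hess_prof_arith hC hΛ1 hx0 hy0 hW0 hX0 a a'
    _ = _ := by ring

end ProfBounds

/-! ### The Klein-Gordon operator on the profile: leading terms -/

/-- The direction of `s`. -/
def eS : Slow := (1, 0, 0, 0)

/-- The direction of `log t`. -/
def eL : Slow := (0, 1, 0, 0)

@[simp] lemma prS_eS : prS eS = 1 := rfl
@[simp] lemma prL_eS : prL eS = 0 := rfl
@[simp] lemma prR_eS : prR eS = 0 := rfl
@[simp] lemma prP_eS : prP eS = 0 := rfl
@[simp] lemma prS_eL : prS eL = 0 := rfl
@[simp] lemma prL_eL : prL eL = 1 := rfl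
@[simp] lemma prR_eL : prR eL = 0 := rfl
@[simp] lemma prP_eL : prP eL = 0 := rfl

section Leading

variable {C : ℝ} {S : Symb} {e : Slow}

lemma fderiv_gwave_eS (δ : ℝ) {φ : ℂ × ℂ → ℝ} (hφ : ContDiff ℝ 2 φ) (π : ℂ × ℂ →L[ℝ] ℂ) (e : Slow) :
    fderiv ℝ (gwave δ φ π) e eS = I * δ * gwave δ φ π e := by
  rw [fderiv_gwave_apply δ hφ, fderiv_phase_apply δ hφ]
  simp [gwave]; ring

lemma hess_gwave_eS_eS (δ : ℝ) {φ : ℂ × ℂ → ℝ} (hφ : ContDiff ℝ 2 φ) (π : ℂ × ℂ →L[ℝ] ℂ)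
    (e : Slow) : hess (gwave δ φ π) e eS eS = -(δ ^ 2 * gwave δ φ π e) := by
  rw [hess_gwave δ hφ, fderiv_phase_apply δ hφ, hess_phase δ hφ]
  simp [gwave, hess]; ring

lemma hess_gwave_eS_eL (δ : ℝ) {φ : ℂ × ℂ → ℝ} (hφ : ContDiff ℝ 2 φ) (π : ℂ × ℂ →L[ℝ] ℂ)
    (e : Slow) :
    hess (gwave δ φ π) e eS eL = -(δ * (prR e * φ (prP e)) * gwave δ φ π e) := by
  rw [hess_gwave δ hφ, fderiv_phase_apply δ hφ, fderiv_phase_apply δ hφ, hess_phase δ hφ]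
  simp [gwave, hess]; ring

/-- The terms of size `t⁻²` in the Klein-Gordon operator applied to the profile. -/
def Symb.lead (S : Symb) (e : Slow) : ℂ :=
  2 * S.phA (prP e) * (S.wave e).1 - 2 * S.phB (prP e) * (S.wave e).2
    + hess S.corw e eS eS + S.corw e

lemma Symb.Good.leading_identity (hS : S.Good C) (hs : prS e ≠ 0)
    (hr : prR e = prS e * Real.exp (-prL e)) :
    hess S.prof e eS eS + S.prof e
        + (2 / prS e : ℂ) * (fderiv ℝ S.prof e eS + hess S.prof e eS eL) =
      exp ((-2 : ℂ) * prL e) * S.lead e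
        + (2 / prS e : ℂ) * (exp ((-2 : ℂ) * prL e)
            * (hess S.corw e eS eL - fderiv ℝ S.corw e eS)) := by
  rw [hS.hess_prof, hS.hess_prof, hS.fderiv_prof, hS.hess_sumw, hS.hess_sumw, hS.fderiv_sumw,
    hess_gwave_eS_eS _ hS.contDiff_phA, hess_gwave_eS_eS _ hS.contDiff_phB,
    hess_gwave_eS_eL _ hS.contDiff_phA, hess_gwave_eS_eL _ hS.contDiff_phB,
    fderiv_gwave_eS _ hS.contDiff_phA, fderiv_gwave_eS _ hS.contDiff_phB, Symb.lead,
    S.wave_fst_eq, S.wave_snd_eq, S.prof_eq', hr]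
  have hE : exp ((-2 : ℂ) * prL e) = exp ((-1 : ℂ) * prL e) * exp ((-1 : ℂ) * prL e) := by
    rw [← exp_add]; ring_nf
  have hE' : ((Real.exp (-prL e) : ℝ) : ℂ) = exp ((-1 : ℂ) * prL e) := by
    push_cast; ring_nf
  have hs' : (prS e : ℂ) ≠ 0 := by exact_mod_cast hs
  simp only [prL_eS, prL_eL, Symb.sumw, hE]
  push_cast at hE' ⊢
  rw [hE']
  field_simp
  ring

lemma Symb.Good.norm_fderiv_wave_eS (hS : S.Good C) (e : Slow) :
    ‖fderiv ℝ S.wave e eS‖ ≤ ‖prP e‖ := by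
  rw [hS.fderiv_wave, fderiv_gwave_eS _ hS.contDiff_phA, fderiv_gwave_eS _ hS.contDiff_phB,
    ← S.wave_fst_eq, ← S.wave_snd_eq, ← norm_wave_eq S]
  refine max_le ?_ ?_
  · simpa using norm_fst_le (S.wave e)
  · simpa using norm_snd_le (S.wave e)

lemma Symb.Good.norm_hess_wave_eS_eS (hS : S.Good C) (e : Slow) :
    ‖hess S.wave e eS eS‖ ≤ ‖prP e‖ := by
  rw [hS.hess_wave, hess_gwave_eS_eS _ hS.contDiff_phA, hess_gwave_eS_eS _ hS.contDiff_phB,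
    ← S.wave_fst_eq, ← S.wave_snd_eq, ← norm_wave_eq S]
  refine max_le ?_ ?_
  · simpa using norm_fst_le (S.wave e)
  · simpa using norm_snd_le (S.wave e)

lemma Symb.Good.norm_hess_wave_eS_eL (hS : S.Good C) (hC : 1 ≤ C) (he : SlowPt e) :
    ‖hess S.wave e eS eL‖ ≤ C * ‖prP e‖ ^ 2 := by
  rw [hS.hess_wave, hess_gwave_eS_eL _ hS.contDiff_phA, hess_gwave_eS_eL _ hS.contDiff_phB,
    ← S.wave_fst_eq, ← S.wave_snd_eq]
  have h1 := norm_fst_le (S.wave e)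
  have h2 := norm_snd_le (S.wave e)
  rw [norm_wave_eq] at h1 h2
  have a := hS.phA_le (prP e)
  have b := hS.phB_le (prP e)
  have hr0 := he.prR_nonneg
  have hr1 := he.prR_le
  have key : ∀ x w n : ℝ, 0 ≤ x → 0 ≤ w → x ≤ C * n → w ≤ n → prR e * x * w ≤ C * n ^ 2 :=
    fun x w n hx hw hxn hwn => by
      calc prR e * x * w ≤ 1 * (C * n) * n := by gcongr; linarith
        _ = _ := by ring
  refine max_le ?_ ?_
  · simp only [norm_neg, norm_mul, norm_real, norm_eq_abs, abs_one, one_mul,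
      abs_of_nonneg hr0]
    exact key _ _ _ (abs_nonneg _) (norm_nonneg _) a h1
  · simp only [norm_neg, norm_mul, norm_real, norm_eq_abs, abs_one, one_mul,
      abs_of_nonneg hr0]
    exact key _ _ _ (abs_nonneg _) (norm_nonneg _) b h2

lemma Symb.Good.norm_fderiv_wave_eL (hS : S.Good C) (hC : 1 ≤ C) (he : SlowPt e) :
    ‖fderiv ℝ S.wave e eL‖ ≤ C * ‖prP e‖ ^ 2 := by
  have key : ∀ (δ : ℝ) (φ : ℂ × ℂ → ℝ) (π : ℂ × ℂ →L[ℝ] ℂ), ContDiff ℝ 2 φ →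
      (∀ p, |φ p| ≤ C * ‖p‖) → (∀ q, ‖π q‖ ≤ ‖q‖) →
      ‖fderiv ℝ (gwave δ φ π) e eL‖ ≤ C * ‖prP e‖ ^ 2 := fun δ φ π hφ h0 hπ => by
    rw [fderiv_gwave_apply δ hφ, fderiv_phase_apply δ hφ, norm_mul, norm_exp_I_mul_phase]
    simp only [prS_eL, mul_zero, zero_add, prR_eL, prL_eL, zero_mul, mul_one, prP_eL, map_zero,
      add_zero, one_mul, norm_mul, norm_I, norm_real, norm_eq_abs,
      abs_of_nonneg he.prR_nonneg]
    calc prR e * |φ (prP e)| * ‖π (prP e)‖ ≤ 1 * (C * ‖prP e‖) * ‖prP e‖ := by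
          gcongr
          · exact he.prR_le
          · exact h0 _
          · exact hπ _
      _ = _ := by ring
  rw [hS.fderiv_wave]
  exact max_le (key _ _ _ hS.contDiff_phA hS.phA_le norm_fst_clm_le)
    (key _ _ _ hS.contDiff_phB hS.phB_le norm_snd_clm_le)

lemma Symb.Good.norm_lower_order_le (hS : S.Good C) (hC : 1 ≤ C) (he : SlowPt e) :
    ‖hess S.corw e eS eL - fderiv ℝ S.corw e eS‖ ≤ 3 * C ^ 2 * (1 + ‖prP e‖) ^ 2 * ‖prP e‖ := by
  have a := hS.norm_hess_corw_le (e := e) eS eL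
  have b := hS.norm_fderiv_corw_le (e := e) eS
  have c := hS.norm_fderiv_wave_eS e
  have d := hS.norm_fderiv_wave_eL hC he
  have f := hS.norm_hess_wave_eS_eL hC he
  refine (norm_sub_le _ _).trans ((add_le_add a b).trans ?_)
  set x := ‖prP e‖
  have hx : 0 ≤ x := norm_nonneg _
  have hC2 : C ≤ C ^ 2 := le_self_pow₀ hC (by norm_num)
  have e1 : 0 ≤ C ^ 2 * x := by positivity
  have e2 : 0 ≤ C ^ 2 * x ^ 2 := by positivity
  have e3 : 0 ≤ C ^ 2 * x ^ 3 := by positivity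
  calc _ ≤ C * x * (C * x ^ 2) + C * x * (C * x ^ 2) + C * x * x := by gcongr
    _ = 2 * (C ^ 2 * x ^ 3) + C * x ^ 2 := by ring
    _ ≤ 2 * (C ^ 2 * x ^ 3) + C ^ 2 * x ^ 2 := by gcongr
    _ ≤ 3 * (C ^ 2 * x ^ 3) + 6 * (C ^ 2 * x ^ 2) + 3 * (C ^ 2 * x) := by linarith
    _ = _ := by ring

lemma Symb.Good.norm_lead_le (hS : S.Good C) : ‖S.lead e‖ ≤ 7 * C * ‖prP e‖ ^ 2 := by
  have a := hS.norm_hess_corw_le (e := e) eS eS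
  have b := hS.norm_corw_le (e := e)
  have c := hS.norm_fderiv_wave_eS e
  have d := hS.norm_hess_wave_eS_eS e
  have h1 := norm_fst_le (S.wave e)
  have h2 := norm_snd_le (S.wave e)
  rw [norm_wave_eq] at h1 h2
  have p1 := hS.phA_le (prP e)
  have p2 := hS.phB_le (prP e)
  have hC : 0 ≤ C * ‖prP e‖ := (abs_nonneg _).trans p1
  have hC0 : 0 ≤ C := (norm_nonneg _).trans (hS.fderiv_phA_le 0)
  rw [Symb.lead]
  set x := ‖prP e‖
  have hx : 0 ≤ x := norm_nonneg _
  have q1 : ‖2 * (S.phA (prP e) : ℂ) * (S.wave e).1‖ ≤ 2 * (C * x) * x := by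
    simp only [norm_mul, norm_real, Complex.norm_ofNat, norm_eq_abs]
    gcongr
  have q2 : ‖2 * (S.phB (prP e) : ℂ) * (S.wave e).2‖ ≤ 2 * (C * x) * x := by
    simp only [norm_mul, norm_real, Complex.norm_ofNat, norm_eq_abs]
    gcongr
  have q3 : ‖hess S.corw e eS eS‖ ≤ C * x * x + C * x * x := a.trans (by gcongr)
  refine (norm_add_le _ _).trans ((add_le_add ((norm_add_le _ _).trans
    (add_le_add ((norm_sub_le _ _).trans (add_le_add q1 q2)) q3)) b).trans (le_of_eq ?_))
  ring

end Leading

/-- Second derivative along a line. -/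
lemma hess_eq_of_line {E F : Type*} [NormedAddCommGroup E] [NormedSpace ℝ E] [NormedAddCommGroup F]
    [NormedSpace ℝ F] {f : E → F} (hf : ContDiff ℝ 2 f) (e v : E) {y : ℝ → F} {z : F}
    (h1 : ∀ τ : ℝ, HasDerivAt (fun τ : ℝ => f (e + τ • v)) (y τ) τ) (h2 : HasDerivAt y z 0) :
    hess f e v v = z := by
  have hline : ∀ τ : ℝ, HasDerivAt (fun τ : ℝ => e + τ • v) v τ := fun τ => by
    simpa using ((hasDerivAt_id τ).smul_const v).const_add e
  have hy : y = fun τ => fderiv ℝ f (e + τ • v) v := by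
    ext1 τ
    exact (h1 τ).unique
      ((hf.differentiable two_ne_zero _).hasFDerivAt.comp_hasDerivAt τ (hline τ))
  have h3 : HasDerivAt y (hess f e v v) 0 := by
    rw [hy]
    have := hasFDerivAt_fderiv_apply (hf.contDiffAt (x := e + (0 : ℝ) • v)) v
    have h4 := this.comp_hasDerivAt (0 : ℝ) (hline 0)
    rw [zero_smul, add_zero] at h4
    exact h4
  exact h3.unique h2

lemma resPhase_mul_eq (lam : ℝ) {ρ : ℝ} {p q : ℂ × ℂ} (hp : InCone ρ p) (h1 : ‖q.1‖ = ‖p.1‖)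
    (h2 : ‖q.2‖ = ‖p.2‖) : 2 * (resPhase lam ρ p : ℂ) * q.1 = lam * harmCoeff 0 q := by
  have e1 := resPhase_eq lam (a := p.1) (b := p.2) hp
  rw [Prod.mk.eta] at e1
  rw [e1]
  rcases eq_or_ne p.1 0 with h0 | h0
  · have h0' := hp.fst_eq_zero_iff.1 h0
    rw [h0, norm_zero, norm_eq_zero] at h1
    rw [h0', norm_zero, norm_eq_zero] at h2
    have hq : q = (0, 0) := Prod.ext h1 h2
    rw [hq, harmCoeff_zero_right]; simp
  · have h0' : p.2 ≠ 0 := fun h => h0 (hp.fst_eq_zero_iff.2 h)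
    have g1 : q.1 ≠ 0 := by rwa [← norm_ne_zero_iff, h1, norm_ne_zero_iff]
    have g2 : q.2 ≠ 0 := by rwa [← norm_ne_zero_iff, h2, norm_ne_zero_iff]
    have := harmCoeff_eq_fourierL 0 g1 g2
    rw [Prod.mk.eta] at this
    rw [this, h1, h2]
    simp; ring

lemma lead_regSymb {lam ρ ε C : ℝ} (hS : (regSymb lam ρ ε).Good C) {e : Slow}
    (he : InCone ρ (prP e)) :
    (regSymb lam ρ ε).lead e = lam * cut ε (prP e) *
      absMul (((regSymb lam ρ ε).wave e).1 + ((regSymb lam ρ ε).wave e).2) := by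
  set S := regSymb lam ρ ε with hSdef
  obtain ⟨y, hy1, hy2⟩ := exists_hasDerivAt_corr_rotate lam (S.wave e).1 (S.wave e).2
  have hw : ∀ τ : ℝ, S.wave (e + τ • eS) =
      (exp (I * (-τ : ℝ)) * (S.wave e).1, exp (I * τ) * (S.wave e).2) := by
    intro τ
    simp only [Symb.wave, eS, Prod.smul_mk, smul_eq_mul, mul_one, mul_zero, smul_zero, Prod.fst_add,
      Prod.snd_add, add_zero]
    refine Prod.ext ?_ ?_
    · simp only []
      rw [← mul_assoc, ← exp_add]; push_cast; ring_nf
    · simp only []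
      rw [← mul_assoc, ← exp_add]; push_cast; ring_nf
  have hn1 : ‖(S.wave e).1‖ = ‖(prP e).1‖ := norm_wave_fst S e
  have hn2 : ‖(S.wave e).2‖ = ‖(prP e).2‖ := norm_wave_snd S e
  have hcut : ∀ τ : ℝ, cut ε (S.wave (e + τ • eS)) = cut ε (prP e) := fun τ => by
    refine cut_congr ε ?_ ?_
    · rw [hw, norm_mul, norm_exp_I_mul, one_mul, hn1]
    · rw [hw, norm_mul, norm_exp_I_mul, one_mul, hn2]
  have hcor : ∀ τ : ℝ, S.corw (e + τ • eS) = (cut ε (prP e) : ℂ) * corr lam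
      (exp (I * (-τ : ℝ)) * (S.wave e).1, exp (I * τ) * (S.wave e).2) := by
    intro τ
    rw [← hw, ← hcut τ]
    exact real_smul
  have hh : hess S.corw e eS eS = (cut ε (prP e) : ℂ) * (lam * (absMul ((S.wave e).1 + (S.wave e).2)
      - harmCoeff 0 (S.wave e) - harmCoeff (-1) (S.wave e)) - corr lam (S.wave e)) := by
    refine hess_eq_of_line hS.contDiff_corw e eS (y := fun τ => (cut ε (prP e) : ℂ) * y τ)
      (fun τ => ?_) (hy2.const_mul _)
    simp only [hcor]
    exact (hy1 τ).const_mul _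
  have h0 : S.corw e = (cut ε (prP e) : ℂ) * corr lam (S.wave e) := by
    have := hcor 0
    have h' := hw 0
    rw [zero_smul, add_zero] at this h'
    rw [this, ← h']
  have hA : 2 * (S.phA (prP e) : ℂ) * (S.wave e).1 = cut ε (prP e) * (lam * harmCoeff 0 (S.wave e)) := by
    rw [← resPhase_mul_eq lam he hn1 hn2]
    simp only [hSdef, regSymb, mainSymb, smul_eq_mul]; push_cast; ring
  have hB : 2 * (S.phB (prP e) : ℂ) * (S.wave e).2
      = -(cut ε (prP e) * (lam * harmCoeff (-1) (S.wave e))) := by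
    have h1 := harmCoeff_neg 1 (S.wave e).1 (S.wave e).2
    rw [sub_self, Prod.mk.eta] at h1
    rw [h1, ← resPhase_mul_eq lam (q := ((S.wave e).2, (S.wave e).1)) he.swap hn2 hn1]
    simp only [hSdef, regSymb, mainSymb, smul_eq_mul]; push_cast; ring
  rw [Symb.lead, hA, hB, hh, h0]
  ring

/-! ### The Klein-Gordon operator in hyperbolic coordinates -/

/-- Values, first and second derivatives of a pair of amplitudes at a point. -/
abbrev Jet : Type := (ℂ × ℂ) × (Fin 2 → ℂ × ℂ) × (Fin 2 → Fin 2 → ℂ × ℂ)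

/-- `⟨μ⟩⁻¹`. -/
def rinv (μ : Plane) : ℝ := (jap ‖μ‖)⁻¹

lemma jap_pos (x : ℝ) : 0 < jap x := Real.sqrt_pos.2 (by positivity)

lemma jap_sq (x : ℝ) : jap x ^ 2 = 1 + x ^ 2 := Real.sq_sqrt (by positivity)

lemma one_le_jap (x : ℝ) : 1 ≤ jap x := by
  rw [jap, Real.one_le_sqrt]; nlinarith [sq_nonneg x]

lemma abs_le_jap (x : ℝ) : |x| ≤ jap x := Real.abs_le_sqrt (by linarith)

lemma rinv_pos (μ : Plane) : 0 < rinv μ := inv_pos.2 (jap_pos _)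

lemma rinv_le_one (μ : Plane) : rinv μ ≤ 1 := inv_le_one_of_one_le₀ (one_le_jap _)

lemma rinv_sq_mul (μ : Plane) : rinv μ ^ 2 * (1 + ‖μ‖ ^ 2) = 1 := by
  rw [← jap_sq, rinv, ← mul_pow, inv_mul_cancel₀ (jap_pos _).ne', one_pow]

lemma norm_mul_rinv_le (μ : Plane) : ‖μ‖ * rinv μ ≤ 1 := by
  rw [rinv, mul_inv_le_iff₀ (jap_pos _), one_mul]
  exact (le_abs_self _).trans (abs_le_jap _)

/-- The slow variables at time `t` and hyperbolic position `μ`. -/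
def slowPt (t : ℝ) (μ : Plane) (p : ℂ × ℂ) : Slow := (t * rinv μ, log t, rinv μ, p)

/-- The direction of the `i`-th derivative of the slow variables. -/
def dirJet (μ : Plane) (J : Jet) (i : Fin 2) : Slow := (0, 0, -(μ i * rinv μ ^ 3), J.2.1 i)

/-- The radial direction, shifted by the direction of `log t`. -/
def radJet (μ : Plane) (J : Jet) : Slow :=
  (0, 1, -(‖μ‖ ^ 2 * rinv μ ^ 3), ∑ i, μ i • J.2.1 i)

/-- The direction of the hyperbolic Laplacian of the slow variables. -/
def lapJet (μ : Plane) (J : Jet) : Slow :=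
  (0, -rinv μ ^ 2, 2 * rinv μ ^ 3,
    -((2 : ℝ) • ∑ i, μ i • J.2.1 i + ∑ i, J.2.2 i i + ∑ i, ∑ j, (μ i * μ j) • J.2.2 i j))

/-- The terms of the Klein-Gordon operator that contain derivatives tangent to the hyperboloids. -/
def tangAt (S : Symb) (t : ℝ) (μ : Plane) (J : Jet) : ℂ :=
  (1 + rinv μ ^ 2 : ℝ) * hess S.prof (slowPt t μ J.1) eL eL
    - hess S.prof (slowPt t μ J.1) (radJet μ J) (radJet μ J)
    - ∑ i, hess S.prof (slowPt t μ J.1) (dirJet μ J i) (dirJet μ J i)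
    + fderiv ℝ S.prof (slowPt t μ J.1) (lapJet μ J)

/-- The Klein-Gordon operator applied to the profile, in terms of the jet of the amplitudes. -/
def kgAt (S : Symb) (t : ℝ) (μ : Plane) (J : Jet) : ℂ :=
  hess S.prof (slowPt t μ J.1) eS eS + S.prof (slowPt t μ J.1)
    + (2 / (t * rinv μ : ℝ) : ℂ) * (fderiv ℝ S.prof (slowPt t μ J.1) eS
      + hess S.prof (slowPt t μ J.1) eS eL)
    + (((t * rinv μ) ^ 2)⁻¹ : ℝ) * tangAt S t μ J

/-- The size of the jet, first order. -/
def jetOne (μ : Plane) (J : Jet) : ℝ := ‖J.1‖ + jap ‖μ‖ * ∑ i, ‖J.2.1 i‖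

/-- The size of the jet, second order. -/
def jetTwo (J : Jet) : ℝ := ∑ i, ∑ j, ‖J.2.2 i j‖

/-- The quantity that controls the error terms. -/
def jetSize (μ : Plane) (J : Jet) : ℝ :=
  (1 + ‖J.1‖) ^ 2 * (jetOne μ J + jetOne μ J ^ 2 + jap ‖μ‖ ^ 2 * jetTwo J)

lemma jetOne_nonneg (μ : Plane) (J : Jet) : 0 ≤ jetOne μ J :=
  add_nonneg (norm_nonneg _) (mul_nonneg (jap_pos _).le (Finset.sum_nonneg fun _ _ => norm_nonneg _))

lemma jetTwo_nonneg (J : Jet) : 0 ≤ jetTwo J :=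
  Finset.sum_nonneg fun _ _ => Finset.sum_nonneg fun _ _ => norm_nonneg _

lemma norm_le_jetOne (μ : Plane) (J : Jet) : ‖J.1‖ ≤ jetOne μ J :=
  le_add_of_nonneg_right (mul_nonneg (jap_pos _).le (Finset.sum_nonneg fun _ _ => norm_nonneg _))

lemma abs_coord_le (μ : Plane) (i : Fin 2) : |μ i| ≤ ‖μ‖ := by
  simpa using PiLp.norm_apply_le μ i

lemma abs_coord_le_jap (μ : Plane) (i : Fin 2) : |μ i| ≤ jap ‖μ‖ :=
  (abs_coord_le μ i).trans ((le_abs_self _).trans (abs_le_jap _))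

lemma norm_rad_le (μ : Plane) (J : Jet) : ‖∑ i, μ i • J.2.1 i‖ ≤ jap ‖μ‖ * ∑ i, ‖J.2.1 i‖ := by
  rw [Finset.mul_sum]
  refine norm_sum_le_of_le _ fun i _ => ?_
  rw [norm_smul, norm_eq_abs]
  gcongr
  exact abs_coord_le_jap μ i

lemma norm_lap_le (μ : Plane) (J : Jet) :
    ‖(2 : ℝ) • ∑ i, μ i • J.2.1 i + ∑ i, J.2.2 i i + ∑ i, ∑ j, (μ i * μ j) • J.2.2 i j‖
      ≤ 2 * (jap ‖μ‖ * ∑ i, ‖J.2.1 i‖) + 2 * (jap ‖μ‖ ^ 2 * jetTwo J) := by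
  have h1 : ‖(2 : ℝ) • ∑ i, μ i • J.2.1 i‖ ≤ 2 * (jap ‖μ‖ * ∑ i, ‖J.2.1 i‖) := by
    rw [norm_smul, Real.norm_ofNat]
    exact mul_le_mul_of_nonneg_left (norm_rad_le μ J) zero_le_two
  have hj : 1 ≤ jap ‖μ‖ ^ 2 := one_le_pow₀ (one_le_jap _)
  have h2 : ‖∑ i, J.2.2 i i‖ ≤ jap ‖μ‖ ^ 2 * jetTwo J := by
    refine (norm_sum_le_of_le _ fun i _ => ?_).trans
      (le_mul_of_one_le_left (jetTwo_nonneg J) hj)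
    exact Finset.single_le_sum (f := fun j => ‖J.2.2 i j‖) (fun _ _ => norm_nonneg _)
      (Finset.mem_univ i)
  have h3 : ‖∑ i, ∑ j, (μ i * μ j) • J.2.2 i j‖ ≤ jap ‖μ‖ ^ 2 * jetTwo J := by
    rw [jetTwo, Finset.mul_sum]
    refine norm_sum_le_of_le _ fun i _ => ?_
    rw [Finset.mul_sum]
    refine norm_sum_le_of_le _ fun j _ => ?_
    rw [norm_smul, norm_mul, norm_eq_abs, norm_eq_abs, pow_two]
    gcongr
    · exact (jap_pos _).le
    · exact abs_coord_le_jap μ i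
    · exact abs_coord_le_jap μ j
  have := norm_add_le ((2 : ℝ) • ∑ i, μ i • J.2.1 i + ∑ i, J.2.2 i i)
    (∑ i, ∑ j, (μ i * μ j) • J.2.2 i j)
  have := norm_add_le ((2 : ℝ) • ∑ i, μ i • J.2.1 i) (∑ i, J.2.2 i i)
  linarith

lemma slowPt_mem {t : ℝ} (ht : 1 ≤ t) (μ : Plane) (p : ℂ × ℂ) : SlowPt (slowPt t μ p) :=
  ⟨Real.log_nonneg ht, (rinv_pos μ).le, rinv_le_one μ⟩

lemma slowDir_eL : SlowDir eL := ⟨rfl, by simp, by simp⟩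

lemma slowDir_dirJet (μ : Plane) (J : Jet) (i : Fin 2) : SlowDir (dirJet μ J i) := by
  refine ⟨rfl, by simp [dirJet, prL], ?_⟩
  change |-(μ i * rinv μ ^ 3)| ≤ 2
  have h1 : |μ i| * rinv μ ≤ 1 :=
    (mul_le_mul_of_nonneg_right (abs_coord_le μ i) (rinv_pos μ).le).trans (norm_mul_rinv_le μ)
  have h2 : rinv μ ^ 2 ≤ 1 := pow_le_one₀ (rinv_pos μ).le (rinv_le_one μ)
  rw [abs_neg, abs_mul, abs_of_pos (pow_pos (rinv_pos μ) 3)]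
  calc |μ i| * rinv μ ^ 3 = |μ i| * rinv μ * rinv μ ^ 2 := by ring
    _ ≤ 1 * 1 := by gcongr
    _ ≤ 2 := by norm_num

lemma slowDir_radJet (μ : Plane) (J : Jet) : SlowDir (radJet μ J) := by
  refine ⟨rfl, by simp [radJet, prL], ?_⟩
  change |-(‖μ‖ ^ 2 * rinv μ ^ 3)| ≤ 2
  have h1 := norm_mul_rinv_le μ
  have h0 := rinv_pos μ
  have h2 := rinv_le_one μ
  rw [abs_neg, abs_of_nonneg (by positivity)]
  calc ‖μ‖ ^ 2 * rinv μ ^ 3 = (‖μ‖ * rinv μ) ^ 2 * rinv μ := by ring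
    _ ≤ 1 ^ 2 * 1 := by gcongr
    _ ≤ 2 := by norm_num

lemma slowDir_lapJet (μ : Plane) (J : Jet) : SlowDir (lapJet μ J) := by
  have h0 := rinv_pos μ
  have h2 : rinv μ ^ 2 ≤ 1 := pow_le_one₀ h0.le (rinv_le_one μ)
  have h3 : rinv μ ^ 3 ≤ 1 := pow_le_one₀ h0.le (rinv_le_one μ)
  refine ⟨rfl, ?_, ?_⟩
  · change |-rinv μ ^ 2| ≤ 2
    rw [abs_neg, abs_of_pos (by positivity)]; linarith
  · change |2 * rinv μ ^ 3| ≤ 2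
    rw [abs_of_pos (by positivity)]; linarith

lemma Symb.Good.norm_tangAt_le {C : ℝ} {S : Symb} (hS : S.Good C) (hC : 1 ≤ C) {t : ℝ} (ht : 1 ≤ t)
    (μ : Plane) (J : Jet) :
    ‖tangAt S t μ J‖ ≤ 420 * C ^ 3 * (t⁻¹ * (1 + log t) ^ 2 * jetSize μ J) := by
  have hL := Real.log_nonneg ht
  have he := slowPt_mem ht μ J.1
  set e := slowPt t μ J.1
  have hEx : Real.exp (-prL e) = t⁻¹ := by
    rw [Real.exp_neg]; congr 1; exact Real.exp_log (by linarith)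
  have hN0 := jetOne_nonneg μ J
  have hJ0 := norm_le_jetOne μ J
  have hT0 := jetTwo_nonneg J
  have hj : 0 ≤ jap ‖μ‖ ^ 2 * jetTwo J := mul_nonneg (by positivity) hT0
  set Y := jetOne μ J + jetOne μ J ^ 2 + jap ‖μ‖ ^ 2 * jetTwo J with hY
  set Q := t⁻¹ * (1 + log t) ^ 2 * (1 + ‖J.1‖) ^ 2 with hQ
  have ht0 : 0 < t := by linarith
  have hQ0 : 0 ≤ Q := by positivity
  have hess_le : ∀ v : Slow, SlowDir v → ‖J.1‖ + ‖prP v‖ ≤ jetOne μ J →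
      ‖hess S.prof e v v‖ ≤ 60 * C ^ 3 * (Q * Y) := fun v hv hvn => by
    refine (hS.norm_hess_prof_le hC he hv).trans ?_
    rw [hEx]
    change 60 * C ^ 3 * (t⁻¹ * (1 + log t) ^ 2 * (1 + ‖J.1‖) ^ 2
      * ((‖J.1‖ + ‖prP v‖) + (‖J.1‖ + ‖prP v‖) ^ 2)) ≤ _
    have hx : 0 ≤ ‖J.1‖ + ‖prP v‖ := by positivity
    have : (‖J.1‖ + ‖prP v‖) + (‖J.1‖ + ‖prP v‖) ^ 2 ≤ Y := by
      have := pow_le_pow_left₀ hx hvn 2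
      linarith
    gcongr
  have h1 := hess_le eL slowDir_eL (by simpa using hJ0)
  have h2 := hess_le (radJet μ J) (slowDir_radJet μ J) (by
    change _ + ‖∑ i, μ i • J.2.1 i‖ ≤ _
    have := norm_rad_le μ J
    rw [jetOne]; linarith)
  have h3 : ∀ i, ‖hess S.prof e (dirJet μ J i) (dirJet μ J i)‖ ≤ 60 * C ^ 3 * (Q * Y) := fun i =>
    hess_le (dirJet μ J i) (slowDir_dirJet μ J i) (by
      change _ + ‖J.2.1 i‖ ≤ _
      have h : ‖J.2.1 i‖ ≤ ∑ i, ‖J.2.1 i‖ := Finset.single_le_sum (f := fun i => ‖J.2.1 i‖)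
        (fun _ _ => norm_nonneg _) (Finset.mem_univ i)
      have h' : ∑ i, ‖J.2.1 i‖ ≤ jap ‖μ‖ * ∑ i, ‖J.2.1 i‖ :=
        le_mul_of_one_le_left (Finset.sum_nonneg fun _ _ => norm_nonneg _) (one_le_jap _)
      rw [jetOne]; linarith)
  have h4 : ‖fderiv ℝ S.prof e (lapJet μ J)‖ ≤ 120 * C ^ 3 * (Q * Y) := by
    refine (hS.norm_fderiv_prof_le hC he (slowDir_lapJet μ J)).trans ?_
    rw [hEx]
    change 60 * C ^ 3 * (t⁻¹ * (1 + log t) ^ 2 * (1 + ‖J.1‖) ^ 2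
      * (‖J.1‖ + ‖prP (lapJet μ J)‖)) ≤ _
    have : ‖J.1‖ + ‖prP (lapJet μ J)‖ ≤ 2 * Y := by
      change _ + ‖-(_ : ℂ × ℂ)‖ ≤ _
      rw [norm_neg]
      have := norm_lap_le μ J
      have h5 : jetOne μ J = ‖J.1‖ + jap ‖μ‖ * ∑ i, ‖J.2.1 i‖ := rfl
      have := norm_nonneg J.1
      have := sq_nonneg (jetOne μ J)
      rw [hY]; linarith
    calc _ ≤ 60 * C ^ 3 * (Q * (2 * Y)) := by gcongr
      _ = _ := by ring
  have hr2 : rinv μ ^ 2 ≤ 1 := pow_le_one₀ (rinv_pos μ).le (rinv_le_one μ)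
  have h5 : ‖((1 + rinv μ ^ 2 : ℝ) : ℂ) * hess S.prof e eL eL‖ ≤ 2 * (60 * C ^ 3 * (Q * Y)) := by
    rw [norm_mul, norm_real, norm_eq_abs, abs_of_pos (by positivity)]
    gcongr
    linarith
  have h6 : ‖∑ i, hess S.prof e (dirJet μ J i) (dirJet μ J i)‖ ≤ 2 * (60 * C ^ 3 * (Q * Y)) := by
    refine (norm_sum_le_of_le _ fun i _ => h3 i).trans ?_
    simp
  have : ‖tangAt S t μ J‖ ≤ 2 * (60 * C ^ 3 * (Q * Y)) + 60 * C ^ 3 * (Q * Y)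
      + 2 * (60 * C ^ 3 * (Q * Y)) + 120 * C ^ 3 * (Q * Y) := by
    refine (norm_add_le _ _).trans (add_le_add ((norm_sub_le _ _).trans (add_le_add
      ((norm_sub_le _ _).trans (add_le_add h5 h2)) h6)) h4)
  refine this.trans (le_of_eq ?_)
  rw [jetSize, hQ, ← hY]; ring

lemma exp_neg_two_log {t : ℝ} (ht : 0 < t) : exp ((-2 : ℂ) * (log t : ℝ)) = ((t ^ 2)⁻¹ : ℝ) := by
  rw [show (-2 : ℂ) * (log t : ℝ) = ((-(log t + log t) : ℝ) : ℂ) by push_cast; ring,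
    ← Complex.ofReal_exp, Real.exp_neg, Real.exp_add, Real.exp_log ht, pow_two]

lemma le_jetSize (μ : Plane) (J : Jet) : (1 + ‖J.1‖) ^ 2 * ‖J.1‖ ≤ jetSize μ J := by
  have := norm_le_jetOne μ J
  have := jetTwo_nonneg J
  have h : 0 ≤ jap ‖μ‖ ^ 2 * jetTwo J := mul_nonneg (by positivity) this
  rw [jetSize]
  gcongr
  nlinarith [sq_nonneg (jetOne μ J)]

/-- Away from the leading terms, the Klein-Gordon operator produces only small errors. -/
lemma Symb.Good.norm_kgAt_sub_lead_le {C : ℝ} {S : Symb} (hS : S.Good C) (hC : 1 ≤ C) {t : ℝ}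
    (ht : 1 ≤ t) (μ : Plane) (J : Jet) :
    ‖kgAt S t μ J - ((t ^ 2)⁻¹ : ℝ) * S.lead (slowPt t μ J.1)‖ ≤
      430 * C ^ 3 * (((t * rinv μ) ^ 2)⁻¹ * t⁻¹ * (1 + log t) ^ 2 * jetSize μ J) := by
  have ht0 : 0 < t := by linarith
  have hr := rinv_pos μ
  have hL := Real.log_nonneg ht
  have he := slowPt_mem ht μ J.1
  have hsr : prS (slowPt t μ J.1) = t * rinv μ := rfl
  have hlt : prL (slowPt t μ J.1) = log t := rfl
  have hrr : prR (slowPt t μ J.1) = rinv μ := rfl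
  have hid := hS.leading_identity (e := slowPt t μ J.1) (by rw [hsr]; positivity) (by
    rw [hrr, hsr, hlt, Real.exp_neg, Real.exp_log ht0]; field_simp)
  rw [hlt, exp_neg_two_log ht0, hsr] at hid
  rw [kgAt, hid]
  have hlow := hS.norm_lower_order_le hC he
  have htang := hS.norm_tangAt_le hC ht μ J
  have hJ := le_jetSize μ J
  have hJ0 : 0 ≤ jetSize μ J := le_trans (by positivity) hJ
  change ‖_‖ ≤ 3 * C ^ 2 * (1 + ‖J.1‖) ^ 2 * ‖J.1‖ at hlow
  set X := hess S.corw (slowPt t μ J.1) eS eL - fderiv ℝ S.corw (slowPt t μ J.1) eS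
  have e1 : ‖(2 / (t * rinv μ : ℝ) : ℂ) * ((((t ^ 2)⁻¹ : ℝ) : ℂ) * X)‖
      ≤ 6 * C ^ 3 * (((t * rinv μ) ^ 2)⁻¹ * t⁻¹ * (1 + log t) ^ 2 * jetSize μ J) := by
    rw [norm_mul, norm_mul, norm_div, Complex.norm_ofNat, norm_real, norm_real,
      norm_eq_abs, norm_eq_abs, abs_of_pos (by positivity), abs_of_pos (by positivity)]
    have a1 : 2 / (t * rinv μ) * (t ^ 2)⁻¹ = 2 * rinv μ * (((t * rinv μ) ^ 2)⁻¹ * t⁻¹) := by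
      field_simp
    have a2 : C ^ 2 ≤ C ^ 3 := pow_le_pow_right₀ hC (by norm_num)
    have a3 : 1 ≤ (1 + log t) ^ 2 := one_le_pow₀ (by linarith)
    calc 2 / (t * rinv μ) * ((t ^ 2)⁻¹ * ‖X‖) = 2 * rinv μ * (((t * rinv μ) ^ 2)⁻¹ * t⁻¹) * ‖X‖ := by
          rw [← mul_assoc, a1]
      _ ≤ 2 * 1 * (((t * rinv μ) ^ 2)⁻¹ * t⁻¹) * (3 * C ^ 2 * jetSize μ J) := by
          gcongr
          · exact rinv_le_one μ
          · refine hlow.trans (le_trans (le_of_eq (by ring)) (mul_le_mul_of_nonneg_left hJ (by positivity)))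
      _ = 6 * C ^ 2 * (((t * rinv μ) ^ 2)⁻¹ * t⁻¹ * 1 * jetSize μ J) := by ring
      _ ≤ _ := by gcongr
  have e2 : ‖((((t * rinv μ) ^ 2)⁻¹ : ℝ) : ℂ) * tangAt S t μ J‖
      ≤ 420 * C ^ 3 * (((t * rinv μ) ^ 2)⁻¹ * t⁻¹ * (1 + log t) ^ 2 * jetSize μ J) := by
    rw [norm_mul, norm_real, norm_eq_abs, abs_of_pos (by positivity)]
    calc _ ≤ ((t * rinv μ) ^ 2)⁻¹ * (420 * C ^ 3 * (t⁻¹ * (1 + log t) ^ 2 * jetSize μ J)) := by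
          gcongr
      _ = _ := by ring
  have : ∀ a b c : ℂ, ‖a + b + c - a‖ ≤ ‖b‖ + ‖c‖ := fun a b c => by
    rw [show a + b + c - a = b + c by ring]; exact norm_add_le _ _
  refine (this _ _ _).trans ((add_le_add e1 e2).trans ?_)
  have : 0 ≤ C ^ 3 * (((t * rinv μ) ^ 2)⁻¹ * t⁻¹ * (1 + log t) ^ 2 * jetSize μ J) := by positivity
  linarith

/-- A crude bound, used only for the passage to the limit. -/
lemma Symb.Good.norm_kgAt_le {C : ℝ} {S : Symb} (hS : S.Good C) (hC : 1 ≤ C) {t : ℝ} (ht : 1 ≤ t)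
    (μ : Plane) (J : Jet) :
    ‖kgAt S t μ J‖ ≤ 440 * C ^ 3 * ((rinv μ ^ 2)⁻¹ * (1 + log t) ^ 2 * jetSize μ J) := by
  have ht0 : 0 < t := by linarith
  have hr := rinv_pos μ
  have hL := Real.log_nonneg ht
  have h1 := hS.norm_kgAt_sub_lead_le hC ht μ J
  have h2 := hS.norm_lead_le (e := slowPt t μ J.1)
  change _ ≤ 7 * C * ‖J.1‖ ^ 2 at h2
  have hJ := le_jetSize μ J
  have hJ0 : 0 ≤ jetSize μ J := le_trans (by positivity) hJ
  have hJ' : ‖J.1‖ ^ 2 ≤ jetSize μ J := by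
    refine le_trans ?_ hJ
    nlinarith [norm_nonneg J.1, pow_nonneg (norm_nonneg J.1) 3]
  have a2 : C ≤ C ^ 3 := le_self_pow₀ hC (by norm_num)
  have a3 : 1 ≤ (1 + log t) ^ 2 := one_le_pow₀ (by linarith)
  have a4 : (t ^ 2)⁻¹ ≤ 1 := inv_le_one_of_one_le₀ (one_le_pow₀ ht)
  have a5 : t⁻¹ ≤ 1 := inv_le_one_of_one_le₀ ht
  have a6 : 1 ≤ (rinv μ ^ 2)⁻¹ := (one_le_inv₀ (by positivity)).2
    (pow_le_one₀ hr.le (rinv_le_one μ))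
  have e1 : ‖(((t ^ 2)⁻¹ : ℝ) : ℂ) * S.lead (slowPt t μ J.1)‖ ≤
      7 * C ^ 3 * ((rinv μ ^ 2)⁻¹ * (1 + log t) ^ 2 * jetSize μ J) := by
    rw [norm_mul, norm_real, norm_eq_abs, abs_of_pos (by positivity)]
    calc _ ≤ 1 * (7 * C * ‖J.1‖ ^ 2) := by gcongr
      _ = 7 * C * (1 * 1 * ‖J.1‖ ^ 2) := by ring
      _ ≤ _ := by gcongr
  have e2 : 430 * C ^ 3 * (((t * rinv μ) ^ 2)⁻¹ * t⁻¹ * (1 + log t) ^ 2 * jetSize μ J)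
      ≤ 430 * C ^ 3 * ((rinv μ ^ 2)⁻¹ * (1 + log t) ^ 2 * jetSize μ J) := by
    have : ((t * rinv μ) ^ 2)⁻¹ * t⁻¹ ≤ (rinv μ ^ 2)⁻¹ := by
      rw [mul_pow, mul_inv]
      calc (t ^ 2)⁻¹ * (rinv μ ^ 2)⁻¹ * t⁻¹ ≤ 1 * (rinv μ ^ 2)⁻¹ * 1 := by gcongr
        _ = _ := by ring
    gcongr
  have := norm_le_norm_sub_add (kgAt S t μ J) ((((t ^ 2)⁻¹ : ℝ) : ℂ) * S.lead (slowPt t μ J.1))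
  have h0 : 0 ≤ C ^ 3 * ((rinv μ ^ 2)⁻¹ * (1 + log t) ^ 2 * jetSize μ J) := by positivity
  linarith

/-! ### The d'Alembertian in hyperbolic coordinates -/

section LocalRules

variable {E F G : Type*} [NormedAddCommGroup E] [NormedSpace ℝ E] [NormedAddCommGroup F]
  [NormedSpace ℝ F] [NormedAddCommGroup G] [NormedSpace ℝ G]

/-- First and second derivative along a line, local version. -/
lemma fderiv_hess_of_line {f : E → F} {e v : E} (hf : ContDiffAt ℝ 2 f e) {y : ℝ → F} {z : F}
    (h1 : ∀ᶠ τ in 𝓝 (0 : ℝ), HasDerivAt (fun τ : ℝ => f (e + τ • v)) (y τ) τ)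
    (h2 : HasDerivAt y z 0) : fderiv ℝ f e v = y 0 ∧ hess f e v v = z := by
  have hline : ∀ τ : ℝ, HasDerivAt (fun τ : ℝ => e + τ • v) v τ := fun τ => by
    simpa using ((hasDerivAt_id τ).smul_const v).const_add e
  have hc : Tendsto (fun τ : ℝ => e + τ • v) (𝓝 0) (𝓝 e) := by
    have := (hline 0).continuousAt
    simpa [ContinuousAt] using this
  have hy : y =ᶠ[𝓝 0] fun τ => fderiv ℝ f (e + τ • v) v := by
    filter_upwards [h1, hc.eventually (hf.eventually (by simp))] with τ hτ hτ'
    exact hτ.unique ((hτ'.differentiableAt two_ne_zero).hasFDerivAt.comp_hasDerivAt τ (hline τ))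
  have h3 : HasDerivAt y (hess f e v v) 0 := by
    refine HasDerivAt.congr_of_eventuallyEq ?_ hy
    have h0 : ContDiffAt ℝ 2 f (e + (0 : ℝ) • v) := by rwa [zero_smul, add_zero]
    have h4 := (hasFDerivAt_fderiv_apply h0 v).comp_hasDerivAt (0 : ℝ) (hline 0)
    rw [zero_smul, add_zero] at h4
    exact h4
  refine ⟨?_, h3.unique h2⟩
  have := hy.self_of_nhds
  simp only [zero_smul, add_zero] at this
  exact this.symm

end LocalRules

/-- The coordinates `(s, log t, μ)` in the forward light cone. -/
def hypCoord (q : ℝ × Plane) : ℝ × ℝ × Plane :=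
  (sqrt (q.1 ^ 2 - ‖q.2‖ ^ 2), log q.1, mu q.1 q.2)

/-- The open forward light cone. -/
def lightCone : Set (ℝ × Plane) := {q | ‖q.2‖ < q.1}

lemma isOpen_lightCone : IsOpen lightCone := isOpen_lt (by fun_prop) (by fun_prop)

lemma lightCone_pos {q : ℝ × Plane} (hq : q ∈ lightCone) : 0 < q.1 := (norm_nonneg _).trans_lt hq

lemma lightCone_sq_pos {q : ℝ × Plane} (hq : q ∈ lightCone) : 0 < q.1 ^ 2 - ‖q.2‖ ^ 2 := by
  have h : ‖q.2‖ < q.1 := hq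
  have := norm_nonneg q.2
  nlinarith

lemma contDiffAt_hypCoord {q : ℝ × Plane} (hq : q ∈ lightCone) {n : ℕ∞} :
    ContDiffAt ℝ n hypCoord q := by
  have h0 : ContDiffAt ℝ n (fun q : ℝ × Plane => q.1 ^ 2 - ‖q.2‖ ^ 2) q :=
    ((contDiff_fst.pow 2).sub (contDiff_snd.norm_sq ℝ)).contDiffAt
  have h1 : ContDiffAt ℝ n (fun q : ℝ × Plane => sqrt (q.1 ^ 2 - ‖q.2‖ ^ 2)) q :=
    h0.sqrt (lightCone_sq_pos hq).ne'
  refine h1.prodMk ((contDiffAt_fst.log (lightCone_pos hq).ne').prodMk ?_)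
  exact (h1.inv (Real.sqrt_pos.2 (lightCone_sq_pos hq)).ne').smul contDiffAt_snd

lemma hypCoord_derivs {t : ℝ} {x : Plane} (hq : (t, x) ∈ lightCone) (a : ℝ) (b : Plane) {σ : ℝ}
    (hσ : σ = sqrt (t ^ 2 - ‖x‖ ^ 2)) {κ : ℝ} (hκ : κ = t * a - inner ℝ x b) :
    fderiv ℝ hypCoord (t, x) (a, b) = (κ / σ, a / t, σ⁻¹ • b - (κ / σ ^ 3) • x) ∧
    hess hypCoord (t, x) (a, b) (a, b) =
      ((a ^ 2 - ‖b‖ ^ 2) / σ - κ ^ 2 / σ ^ 3, -(a ^ 2 / t ^ 2),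
        -((2 * κ / σ ^ 3) • b) - ((a ^ 2 - ‖b‖ ^ 2) / σ ^ 3 - 3 * κ ^ 2 / σ ^ 5) • x) := by
  have hline : Continuous fun τ : ℝ => ((t + τ * a, x + τ • b) : ℝ × Plane) := by fun_prop
  have hev : ∀ᶠ τ in 𝓝 (0 : ℝ), ((t + τ * a, x + τ • b) : ℝ × Plane) ∈ lightCone :=
    hline.continuousAt.eventually (isOpen_lightCone.mem_nhds (by simpa using hq))
  set N : ℝ → ℝ := fun τ => (t + τ * a) ^ 2 - ‖x + τ • b‖ ^ 2 with hN
  set k : ℝ → ℝ := fun τ => (t + τ * a) * a - inner ℝ (x + τ • b) b with hk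
  have hX : ∀ τ : ℝ, HasDerivAt (fun τ : ℝ => x + τ • b) b τ := fun τ => by
    simpa using ((hasDerivAt_id τ).smul_const b).const_add x
  have hT : ∀ τ : ℝ, HasDerivAt (fun τ : ℝ => t + τ * a) a τ := fun τ => by
    simpa using ((hasDerivAt_id τ).mul_const a).const_add t
  have hN' : ∀ τ, HasDerivAt N (2 * k τ) τ := fun τ => by
    refine (((hT τ).pow 2).sub ((hX τ).norm_sq)).congr_deriv ?_
    simp [hk]; ring
  have hk' : ∀ τ, HasDerivAt k (a ^ 2 - ‖b‖ ^ 2) τ := fun τ => by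
    refine (((hT τ).mul_const a).sub ((hX τ).inner ℝ (hasDerivAt_const τ b))).congr_deriv ?_
    simp [pow_two]
  set s : ℝ → ℝ := fun τ => sqrt (N τ) with hs
  have hs' : ∀ τ, 0 < N τ → HasDerivAt s (k τ / s τ) τ := fun τ hτ => by
    refine ((hN' τ).sqrt hτ.ne').congr_deriv ?_
    have : s τ ≠ 0 := (Real.sqrt_pos.2 hτ).ne'
    simp only [hs] at this ⊢
    field_simp
  have hpos : ∀ τ, ((t + τ * a, x + τ • b) : ℝ × Plane) ∈ lightCone → 0 < N τ := fun τ hτ =>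
    lightCone_sq_pos hτ
  have hN0 : 0 < N 0 := hpos 0 (by simpa using hq)
  have hs0 : s 0 = σ := by simp [hs, hN, hσ]
  have hk0 : k 0 = κ := by simp [hk, hκ]
  have hσ0 : 0 < σ := by rw [← hs0]; exact Real.sqrt_pos.2 hN0
  have ht : 0 < t := lightCone_pos hq
  have h := fderiv_hess_of_line (v := (a, b)) (contDiffAt_hypCoord hq)
    (y := fun τ => (k τ / s τ, a / (t + τ * a), (s τ)⁻¹ • b - (k τ / s τ ^ 3) • (x + τ • b)))
    (z := ((a ^ 2 - ‖b‖ ^ 2) / σ - κ ^ 2 / σ ^ 3, -(a ^ 2 / t ^ 2),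
        -((2 * κ / σ ^ 3) • b) - ((a ^ 2 - ‖b‖ ^ 2) / σ ^ 3 - 3 * κ ^ 2 / σ ^ 5) • x)) ?_ ?_
  · refine ⟨h.1.trans ?_, h.2⟩
    simp [hs0, hk0]
  · filter_upwards [hev] with τ hτ
    have hNτ := hpos τ hτ
    have hsτ : s τ ≠ 0 := (Real.sqrt_pos.2 hNτ).ne'
    have htτ : t + τ * a ≠ 0 := (lightCone_pos hτ).ne'
    have d3 := ((hs' τ hNτ).inv hsτ).smul (hX τ)
    have := (hs' τ hNτ).prodMk (((hT τ).log htτ).prodMk d3)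
    refine HasDerivAt.congr_deriv (f := fun τ : ℝ => hypCoord ((t, x) + τ • (a, b))) this ?_
    refine Prod.ext rfl (Prod.ext rfl ?_)
    simp only []
    rw [sub_eq_add_neg, ← neg_smul]
    congr 2
    field_simp
  · have e1 := (hk' 0).div (hs' 0 hN0) (by rw [hs0]; exact hσ0.ne')
    have e2 := (hasDerivAt_const (0 : ℝ) a).div (hT 0) (by simpa using ht.ne')
    have e3 := (((hs' 0 hN0).inv (by rw [hs0]; exact hσ0.ne')).smul_const b).sub
      (((hk' 0).div ((hs' 0 hN0).pow 3) (by rw [Pi.pow_apply, hs0]; positivity)).smul (hX 0))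
    refine (e1.prodMk (e2.prodMk e3)).congr_deriv ?_
    refine Prod.ext ?_ (Prod.ext ?_ ?_)
    · simp only [hs0, hk0]; field_simp
    · simp; ring
    · simp only [Pi.pow_apply, Pi.div_apply, hs0, hk0, zero_smul, add_zero]
      ext i
      simp
      field_simp
      ring

lemma contDiff_rinv {n : ℕ∞} : ContDiff ℝ n rinv := by
  have h0 : ContDiff ℝ n (fun μ : Plane => 1 + ‖μ‖ ^ 2) := contDiff_const.add (contDiff_norm_sq ℝ)
  exact (h0.sqrt fun μ => by positivity).inv fun μ => (jap_pos _).ne'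

lemma hasFDerivAt_rinv (μ : Plane) :
    HasFDerivAt rinv (-(rinv μ ^ 3) • innerSL ℝ μ) μ := by
  have h0 : HasFDerivAt (fun μ : Plane => 1 + ‖μ‖ ^ 2) ((2 : ℝ) • innerSL ℝ μ) μ := by
    simpa [two_smul] using ((hasStrictFDerivAt_norm_sq μ).hasFDerivAt).const_add 1
  have h1 := (hasDerivAt_inv (jap_pos ‖μ‖).ne').comp_hasFDerivAt μ (h0.sqrt (by positivity))
  refine HasFDerivAt.congr_fderiv (f := rinv) h1 ?_
  have hj := (jap_pos ‖μ‖).ne'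
  ext v
  simp only [rinv]
  change -(jap ‖μ‖ ^ 2)⁻¹ * ((1 / (2 * jap ‖μ‖)) * (2 * inner ℝ μ v)) = -((jap ‖μ‖)⁻¹ ^ 3) * inner ℝ μ v
  field_simp

lemma fderiv_rinv_apply (μ v : Plane) : fderiv ℝ rinv μ v = -(rinv μ ^ 3 * inner ℝ μ v) := by
  rw [(hasFDerivAt_rinv μ).fderiv]; simp

lemma hess_rinv (μ w v : Plane) : hess rinv μ w v =
    -(rinv μ ^ 3 * inner ℝ w v) + 3 * rinv μ ^ 5 * inner ℝ μ w * inner ℝ μ v := by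
  have h1 := (((hasFDerivAt_rinv μ).pow 3).mul
    ((hasFDerivAt_id μ).inner ℝ (hasFDerivAt_const v μ))).neg
  rw [hess_of_hasFDerivAt (contDiff_rinv (n := 2)).contDiffAt
    (.of_forall fun μ' => fderiv_rinv_apply μ' v) h1]
  simp
  ring

/-- The slow variables in terms of `(s, log t, μ)`. -/
def slowMap (P : Plane → ℂ × ℂ) (q : ℝ × ℝ × Plane) : Slow := (q.1, q.2.1, rinv q.2.2, P q.2.2)

lemma contDiff_slowMap {P : Plane → ℂ × ℂ} {n : ℕ∞} (hP : ContDiff ℝ n P) :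
    ContDiff ℝ n (slowMap P) :=
  contDiff_fst.prodMk ((contDiff_fst.comp contDiff_snd).prodMk
    ((contDiff_rinv.comp (contDiff_snd.comp contDiff_snd)).prodMk
      (hP.comp (contDiff_snd.comp contDiff_snd))))

lemma fderiv_slowMap {P : Plane → ℂ × ℂ} (hP : ContDiff ℝ 2 P) (q v : ℝ × ℝ × Plane) :
    fderiv ℝ (slowMap P) q v
      = (v.1, v.2.1, fderiv ℝ rinv q.2.2 v.2.2, fderiv ℝ P q.2.2 v.2.2) := by
  have hs : HasFDerivAt (fun q : ℝ × ℝ × Plane => q.2.2)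
      ((snd ℝ ℝ Plane).comp (snd ℝ ℝ (ℝ × Plane))) q :=
    ((snd ℝ ℝ Plane).comp (snd ℝ ℝ (ℝ × Plane))).hasFDerivAt
  have hl : HasFDerivAt (fun q : ℝ × ℝ × Plane => q.2.1)
      ((fst ℝ ℝ Plane).comp (snd ℝ ℝ (ℝ × Plane))) q :=
    ((fst ℝ ℝ Plane).comp (snd ℝ ℝ (ℝ × Plane))).hasFDerivAt
  have h1 : HasFDerivAt (fun q : ℝ × ℝ × Plane => rinv q.2.2) _ q :=
    HasFDerivAt.comp (g := rinv) q
      ((contDiff_rinv (n := 2)).differentiable two_ne_zero q.2.2).hasFDerivAt hs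
  have h2 : HasFDerivAt (fun q : ℝ × ℝ × Plane => P q.2.2) _ q :=
    ((hP.differentiable two_ne_zero q.2.2).hasFDerivAt).comp q hs
  have h : HasFDerivAt (slowMap P) _ q := (hasFDerivAt_fst (p := q)).prodMk (hl.prodMk (h1.prodMk h2))
  rw [h.fderiv]; rfl

lemma hess_slowMap {P : Plane → ℂ × ℂ} (hP : ContDiff ℝ 2 P) (q w v : ℝ × ℝ × Plane) :
    hess (slowMap P) q w v = (0, 0, hess rinv q.2.2 w.2.2 v.2.2, hess P q.2.2 w.2.2 v.2.2) := by
  have hs : HasFDerivAt (fun q : ℝ × ℝ × Plane => q.2.2)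
      ((snd ℝ ℝ Plane).comp (snd ℝ ℝ (ℝ × Plane))) q :=
    ((snd ℝ ℝ Plane).comp (snd ℝ ℝ (ℝ × Plane))).hasFDerivAt
  have h1 : HasFDerivAt (fun q : ℝ × ℝ × Plane => fderiv ℝ rinv q.2.2 v.2.2) _ q :=
    (hasFDerivAt_fderiv_apply (contDiff_rinv (n := 2)).contDiffAt v.2.2).comp q hs
  have h2 : HasFDerivAt (fun q : ℝ × ℝ × Plane => fderiv ℝ P q.2.2 v.2.2) _ q :=
    (hasFDerivAt_fderiv_apply hP.contDiffAt v.2.2).comp q hs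
  have h := (hasFDerivAt_const v.1 q).prodMk ((hasFDerivAt_const v.2.1 q).prodMk (h1.prodMk h2))
  rw [hess_of_hasFDerivAt (contDiff_slowMap (n := 2) hP).contDiffAt
    (.of_forall fun q' => fderiv_slowMap hP q' v) h]
  rfl

/-- The jet of a pair of smooth amplitudes. -/
def jetOf (P : Plane → ℂ × ℂ) (μ : Plane) : Jet :=
  (P μ, fun i => fderiv ℝ P μ (basisVec i), fun i j => hess P μ (basisVec i) (basisVec j))

/-- The directions of the coordinates `s`, `log t`, `μ₁`, `μ₂`. -/
def vecS : ℝ × ℝ × Plane := (1, 0, 0)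
/-- See `vecS`. -/
def vecL : ℝ × ℝ × Plane := (0, 1, 0)
/-- See `vecS`. -/
def vecM (i : Fin 2) : ℝ × ℝ × Plane := (0, 0, basisVec i)

lemma inner_basisVec (x : Plane) (i : Fin 2) : inner ℝ x (basisVec i) = x i := by
  simp [basisVec, EuclideanSpace.inner_single_right]

lemma norm_basisVec (i : Fin 2) : ‖basisVec i‖ = 1 := by simp [basisVec]

lemma norm_sq_plane (x : Plane) : ‖x‖ ^ 2 = x 0 ^ 2 + x 1 ^ 2 := by
  simp [EuclideanSpace.norm_sq_eq, Fin.sum_univ_two]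

/-- `∂_t² - ∂_{x₁}² - ∂_{x₂}²` for functions of class `C²`. -/
def boxHess (u : ℝ × Plane → ℂ) (q : ℝ × Plane) : ℂ :=
  hess u q (1, 0) (1, 0) - ∑ i : Fin 2, hess u q (0, basisVec i) (0, basisVec i)

lemma box_hypCoord {Y : ℝ × ℝ × Plane → ℂ} (hY : ContDiff ℝ 2 Y) {t : ℝ} {x : Plane}
    (hq : (t, x) ∈ lightCone) {σ : ℝ} (hσ : σ = sqrt (t ^ 2 - ‖x‖ ^ 2)) {m : ℝ × ℝ × Plane}
    (hm : m = hypCoord (t, x)) {μ : Plane} (hμ : μ = mu t x) :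
    boxHess (fun q => Y (hypCoord q)) (t, x) =
      hess Y m vecS vecS + (2 / σ : ℝ) * (hess Y m vecS vecL + fderiv ℝ Y m vecS)
      + ((σ ^ 2)⁻¹ : ℝ) * ((σ / t : ℝ) ^ 2 * hess Y m vecL vecL
        - 2 * ∑ i, (μ i : ℂ) * hess Y m vecL (vecM i)
        - ∑ i, hess Y m (vecM i) (vecM i)
        - ∑ i, ∑ j, (μ i * μ j : ℂ) * hess Y m (vecM i) (vecM j)
        - (σ / t : ℝ) ^ 2 * fderiv ℝ Y m vecL - 2 * ∑ i, (μ i : ℂ) * fderiv ℝ Y m (vecM i)) := by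
  have ht : 0 < t := lightCone_pos hq
  have hN := lightCone_sq_pos hq
  have hσ0 : 0 < σ := by rw [hσ]; exact Real.sqrt_pos.2 hN
  have hσ2 : σ ^ 2 = t ^ 2 - ‖x‖ ^ 2 := by rw [hσ, Real.sq_sqrt hN.le]
  have hx : x = σ • μ := by
    rw [hμ, mu, ← hσ, smul_smul, mul_inv_cancel₀ hσ0.ne', one_smul]
  set T := t / σ with hT
  have htT : t = σ * T := by rw [hT]; field_simp
  have hT0 : 0 < T := by positivity
  have hT2 : T ^ 2 = 1 + (μ 0 ^ 2 + μ 1 ^ 2) := by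
    have : ‖x‖ ^ 2 = σ ^ 2 * (μ 0 ^ 2 + μ 1 ^ 2) := by
      rw [hx, norm_smul, mul_pow, norm_sq_plane, norm_eq_abs, sq_abs]
    rw [this, htT] at hσ2
    have h2 : σ ^ 2 ≠ 0 := by positivity
    apply mul_left_cancel₀ h2
    linarith
  have hcd := contDiffAt_hypCoord (n := 2) hq
  have hc : ∀ d : ℝ × Plane, hess (fun q => Y (hypCoord q)) (t, x) d d =
      hess Y m (fderiv ℝ hypCoord (t, x) d) (fderiv ℝ hypCoord (t, x) d)
      + fderiv ℝ Y m (hess hypCoord (t, x) d d) := fun d => by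
    rw [hm]; exact hess_comp_at hcd hY d d
  have hμx : ∀ i, x i = σ * μ i := fun i => by rw [hx]; simp
  have hxv : x = (σ * μ 0) • basisVec 0 + (σ * μ 1) • basisVec 1 := by
    ext i; rw [hμx]; fin_cases i <;> simp [basisVec]
  obtain ⟨a1, a2⟩ := hypCoord_derivs hq 1 0 hσ rfl
  have b := fun i => hypCoord_derivs hq 0 (basisVec i) hσ rfl
  have y0 : fderiv ℝ hypCoord (t, x) (1, 0) = T • vecS + (σ * T)⁻¹ • vecL
      + (-(T / σ) * μ 0) • vecM 0 + (-(T / σ) * μ 1) • vecM 1 := by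
    rw [a1, hxv]
    simp only [vecS, vecL, vecM, Prod.smul_mk, Prod.mk_add_mk, smul_zero, smul_eq_mul, mul_one,
      mul_zero, add_zero, zero_add, inner_zero_right, sub_zero]
    refine Prod.ext rfl (Prod.ext ?_ ?_)
    · simp [htT]
    · simp only [smul_add, smul_smul, zero_sub, neg_add]
      rw [← neg_smul, ← neg_smul]
      congr 2 <;> rw [htT] <;> field_simp
  have z0 : hess hypCoord (t, x) (1, 0) (1, 0) = (σ⁻¹ * (1 - T ^ 2)) • vecS + (-((σ * T) ^ 2)⁻¹) • vecL
      + (-((σ ^ 2)⁻¹ * (1 - 3 * T ^ 2)) * μ 0) • vecM 0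
      + (-((σ ^ 2)⁻¹ * (1 - 3 * T ^ 2)) * μ 1) • vecM 1 := by
    rw [a2, hxv]
    simp only [vecS, vecL, vecM, Prod.smul_mk, Prod.mk_add_mk, smul_zero, smul_eq_mul, mul_one,
      mul_zero, add_zero, zero_add, inner_zero_right, sub_zero, norm_zero]
    refine Prod.ext ?_ (Prod.ext ?_ ?_)
    · simp only []; rw [htT]; field_simp; ring
    · simp only []; rw [htT]; field_simp
    · simp only [smul_add, smul_smul, neg_zero, zero_sub, neg_add]
      rw [← neg_smul, ← neg_smul]
      congr 2 <;> rw [htT] <;> field_simp <;> ring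
  have yi : ∀ i, fderiv ℝ hypCoord (t, x) (0, basisVec i) = (-μ i) • vecS + σ⁻¹ • vecM i
      + (σ⁻¹ * μ i * μ 0) • vecM 0 + (σ⁻¹ * μ i * μ 1) • vecM 1 := fun i => by
    rw [(b i).1, inner_basisVec, hμx]
    conv_lhs => rw [hxv]
    simp only [vecS, vecM, Prod.smul_mk, Prod.mk_add_mk, smul_zero, smul_eq_mul, mul_one,
      mul_zero, add_zero, zero_add, zero_sub, zero_div]
    refine Prod.ext ?_ (Prod.ext rfl ?_)
    · simp only []; field_simp
    · simp only [smul_add, smul_smul, sub_eq_add_neg, neg_add]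
      rw [← neg_smul, ← neg_smul, ← add_assoc]
      congr 2
      · congr 2; field_simp
      · field_simp
  have zi : ∀ i, hess hypCoord (t, x) (0, basisVec i) (0, basisVec i) =
      (-(σ⁻¹ * (1 + μ i ^ 2))) • vecS + (2 * (σ ^ 2)⁻¹ * μ i) • vecM i
      + ((σ ^ 2)⁻¹ * (1 + 3 * μ i ^ 2) * μ 0) • vecM 0
      + ((σ ^ 2)⁻¹ * (1 + 3 * μ i ^ 2) * μ 1) • vecM 1 := fun i => by
    rw [(b i).2, inner_basisVec, hμx, norm_basisVec]
    conv_lhs => rw [hxv]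
    simp only [vecS, vecM, Prod.smul_mk, Prod.mk_add_mk, smul_zero, smul_eq_mul, mul_one,
      mul_zero, add_zero, zero_add, zero_sub]
    refine Prod.ext ?_ (Prod.ext (by simp) ?_)
    · simp only []; field_simp; ring
    · simp only []
      match_scalars <;> field_simp <;> ring
  have hsym := fun w v => hess_comm (hY.contDiffAt (x := m)) w v
  rw [boxHess, Fin.sum_univ_two, hc, hc, hc, y0, z0, yi, yi, zi, zi]
  simp only [hess_add_left, hess_add_right, hess_smul_left, hess_smul_right, map_add, map_smul,
    real_smul, Fin.sum_univ_two]
  rw [hsym vecL vecS, hsym (vecM 0) vecS, hsym (vecM 1) vecS, hsym (vecM 0) vecL,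
    hsym (vecM 1) vecL, hsym (vecM 1) (vecM 0)]
  rw [show σ / t = T⁻¹ by rw [htT]; field_simp]
  have hT2' : (T : ℂ) ^ 2 = 1 + ((μ 0 : ℂ) ^ 2 + (μ 1 : ℂ) ^ 2) := by exact_mod_cast hT2
  have hs' : (σ : ℂ) ≠ 0 := by exact_mod_cast hσ0.ne'
  have hT' : (T : ℂ) ≠ 0 := by exact_mod_cast hT0.ne'
  push_cast
  generalize hess Y m vecS vecS = bSS
  generalize hess Y m vecS vecL = bSL
  generalize hess Y m vecS (vecM 0) = bS0
  generalize hess Y m vecS (vecM 1) = bS1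
  generalize hess Y m vecL vecL = bLL
  generalize hess Y m vecL (vecM 0) = bL0
  generalize hess Y m vecL (vecM 1) = bL1
  generalize hess Y m (vecM 0) (vecM 0) = b00
  generalize hess Y m (vecM 0) (vecM 1) = b01
  generalize hess Y m (vecM 1) (vecM 1) = b11
  generalize (fderiv ℝ Y m) vecS = dS
  generalize (fderiv ℝ Y m) vecL = dL
  generalize (fderiv ℝ Y m) (vecM 0) = d0
  generalize (fderiv ℝ Y m) (vecM 1) = d1
  generalize (μ.ofLp 0 : ℂ) = u at *
  generalize (μ.ofLp 1 : ℂ) = v at *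
  generalize (σ : ℂ) = s at *
  generalize (T : ℂ) = τ at *
  have i1 : s * s⁻¹ = 1 := mul_inv_cancel₀ hs'
  have i2 : τ * τ⁻¹ = 1 := mul_inv_cancel₀ hT'
  simp only [div_eq_mul_inv, mul_inv, inv_pow, mul_pow]
  linear_combination (bSS - 2 * s⁻¹ * (u * bS0 + v * bS1)
      + s⁻¹ ^ 2 * (u ^ 2 * b00 + 2 * u * v * b01 + v ^ 2 * b11)
      - s⁻¹ * dS + 3 * s⁻¹ ^ 2 * (u * d0 + v * d1)) * hT2'
    + (2 * s⁻¹ * bSL - 2 * s⁻¹ ^ 2 * (u * bL0 + v * bL1)) * i2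

lemma jap_mu {t : ℝ} {x : Plane} (hq : (t, x) ∈ lightCone) :
    rinv (mu t x) = sqrt (t ^ 2 - ‖x‖ ^ 2) / t := by
  have ht : 0 < t := lightCone_pos hq
  have hN := lightCone_sq_pos hq
  have hσ0 := Real.sqrt_pos.2 hN
  simp only [] at hN hσ0
  rw [rinv, jap, mu, norm_smul, norm_inv, norm_eq_abs, abs_of_pos hσ0, mul_pow, inv_pow,
    Real.sq_sqrt hN.le, ← inv_div, inv_inj]
  rw [show 1 + (t ^ 2 - ‖x‖ ^ 2)⁻¹ * ‖x‖ ^ 2 = t ^ 2 / (t ^ 2 - ‖x‖ ^ 2) by field_simp; ring,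
    Real.sqrt_div (by positivity), Real.sqrt_sq ht.le]

lemma slowAt_eq_slowPt (P : Plane → ℂ × ℂ) {t : ℝ} {x : Plane} (hq : (t, x) ∈ lightCone) :
    slowAt P t x = slowPt t (mu t x) (P (mu t x)) := by
  have ht : 0 < t := lightCone_pos hq
  refine Prod.ext ?_ rfl
  change sqrt (t ^ 2 - ‖x‖ ^ 2) = t * rinv (mu t x)
  rw [jap_mu hq]; field_simp

/-- The Klein-Gordon operator applied to a profile with amplitudes of class `C²`. -/
lemma Symb.Good.box_prof {C : ℝ} {S : Symb} (hS : S.Good C) {P : Plane → ℂ × ℂ}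
    (hP : ContDiff ℝ 2 P) {t : ℝ} {x : Plane} (hq : (t, x) ∈ lightCone) :
    boxHess (fun q => S.prof (slowAt P q.1 q.2)) (t, x) + S.prof (slowAt P t x)
      = kgAt S t (mu t x) (jetOf P (mu t x)) := by
  have ht : 0 < t := lightCone_pos hq
  have hN := lightCone_sq_pos hq
  have hσ0 := Real.sqrt_pos.2 hN
  simp only [] at hN hσ0
  have hsl := contDiff_slowMap (n := 2) hP
  have hY : ContDiff ℝ 2 (fun m => S.prof (slowMap P m)) := hS.contDiff_prof.comp hsl
  have hbox := box_hypCoord hY hq rfl rfl rfl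
  set μ := mu t x
  set m := hypCoord (t, x)
  have hmμ : m.2.2 = μ := rfl
  have hpt : slowMap P m = slowPt t μ (P μ) := slowAt_eq_slowPt P hq
  have hr : sqrt (t ^ 2 - ‖x‖ ^ 2) / t = rinv μ := (jap_mu hq).symm
  have hs : sqrt (t ^ 2 - ‖x‖ ^ 2) = t * rinv μ := by rw [← hr]; field_simp
  rw [hr, hs] at hbox
  have hfd : ∀ v, fderiv ℝ (fun m => S.prof (slowMap P m)) m v
      = fderiv ℝ S.prof (slowPt t μ (P μ)) (fderiv ℝ (slowMap P) m v) := fun v => by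
    have := fderiv_comp m (hS.contDiff_prof.differentiable two_ne_zero (slowMap P m))
      (hsl.differentiable two_ne_zero m)
    rw [show fderiv ℝ (fun m => S.prof (slowMap P m)) m = _ from this, hpt]; rfl
  have hhe : ∀ w v, hess (fun m => S.prof (slowMap P m)) m w v
      = hess S.prof (slowPt t μ (P μ)) (fderiv ℝ (slowMap P) m w) (fderiv ℝ (slowMap P) m v)
        + fderiv ℝ S.prof (slowPt t μ (P μ)) (hess (slowMap P) m w v) := fun w v => by
    rw [hess_comp hsl hS.contDiff_prof, hpt]
  have fS : fderiv ℝ (slowMap P) m vecS = eS := by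
    rw [fderiv_slowMap hP]; simp [vecS, eS]
  have fL : fderiv ℝ (slowMap P) m vecL = eL := by
    rw [fderiv_slowMap hP]; simp [vecL, eL]
  set J := jetOf P μ with hJ
  have fM : ∀ i, fderiv ℝ (slowMap P) m (vecM i) = dirJet μ J i := fun i => by
    rw [fderiv_slowMap hP, hmμ, fderiv_rinv_apply]
    simp [vecM, dirJet, inner_basisVec, hJ, jetOf, mul_comm]
  have hS0 : ∀ v, hess (slowMap P) m vecS v = 0 := fun v => by
    rw [hess_slowMap hP]; simp [vecS, hess]
  have hL0 : ∀ v, hess (slowMap P) m vecL v = 0 := fun v => by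
    rw [hess_slowMap hP]; simp [vecL, hess]
  have hMM : ∀ i j, hess (slowMap P) m (vecM i) (vecM j)
      = (0, 0, hess rinv μ (basisVec i) (basisVec j), J.2.2 i j) := fun i j => by
    rw [hess_slowMap hP]; rfl
  have hcomp : (fun q : ℝ × Plane => S.prof (slowMap P (hypCoord q)))
      = fun q => S.prof (slowAt P q.1 q.2) := rfl
  rw [hcomp] at hbox
  rw [hbox]
  simp only [hhe, hfd, fS, fL, fM, hS0, hL0, hMM, map_zero, add_zero]
  rw [show S.prof (slowAt P t x) = S.prof (slowPt t μ (P μ)) from congrArg _ hpt, kgAt, tangAt]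
  have hJ1 : J.1 = P μ := rfl
  rw [hJ1]
  set e := slowPt t μ (P μ) with he
  have hrad : radJet μ J = eL + μ 0 • dirJet μ J 0 + μ 1 • dirJet μ J 1 := by
    simp only [radJet, eL, dirJet, Prod.smul_mk, Prod.mk_add_mk, smul_eq_mul, mul_zero,
      add_zero, zero_add, Fin.sum_univ_two, norm_sq_plane]
    congr 3
    ring
  have hμ2 : rinv μ ^ 2 * (1 + (μ 0 ^ 2 + μ 1 ^ 2)) = 1 := by
    rw [← norm_sq_plane]; exact rinv_sq_mul μ
  have hin : ∀ i j, inner ℝ (basisVec i) (basisVec j) = if i = j then (1 : ℝ) else 0 := fun i j => by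
    rw [inner_basisVec]
    fin_cases i <;> fin_cases j <;> simp [basisVec]
  have hlap : lapJet μ J = (-rinv μ ^ 2) • eL + (-(2 * μ 0)) • dirJet μ J 0 + (-(2 * μ 1)) • dirJet μ J 1
      + (-(1 + μ 0 * μ 0)) • ((0, 0, hess rinv μ (basisVec 0) (basisVec 0), J.2.2 0 0) : Slow)
      + (-(μ 0 * μ 1)) • ((0, 0, hess rinv μ (basisVec 0) (basisVec 1), J.2.2 0 1) : Slow)
      + (-(μ 1 * μ 0)) • ((0, 0, hess rinv μ (basisVec 1) (basisVec 0), J.2.2 1 0) : Slow)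
      + (-(1 + μ 1 * μ 1)) • ((0, 0, hess rinv μ (basisVec 1) (basisVec 1), J.2.2 1 1) : Slow) := by
    simp only [lapJet, eL, dirJet, Prod.smul_mk, Prod.mk_add_mk, smul_zero, smul_eq_mul, mul_zero,
      mul_one, add_zero, zero_add, Fin.sum_univ_two, hess_rinv, hin, inner_basisVec]
    refine Prod.ext rfl (Prod.ext rfl (Prod.ext ?_ ?_))
    · simp
      linear_combination (3 * rinv μ ^ 3 * (μ 0 ^ 2 + μ 1 ^ 2)) * hμ2
    · simp only []
      module
  rw [hrad, hlap]
  have hsym := fun w v => hess_comm (hS.contDiff_prof.contDiffAt (x := e)) w v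
  simp only [hess_add_left, hess_add_right, hess_smul_left, hess_smul_right, map_add, map_smul,
    real_smul, Fin.sum_univ_two]
  rw [hsym (dirJet μ J 0) eL, hsym (dirJet μ J 1) eL, hsym (dirJet μ J 1) (dirJet μ J 0)]
  push_cast
  ring

/-! ### Change of variables in the light cone -/

/-- The point with hyperbolic position `μ` at time `t`. -/
def hypPt (t : ℝ) (μ : Plane) : Plane := (t * rinv μ) • μ

lemma sq_sub_norm_hypPt (t : ℝ) (μ : Plane) : t ^ 2 - ‖hypPt t μ‖ ^ 2 = (t * rinv μ) ^ 2 := by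
  have := rinv_sq_mul μ
  rw [hypPt, norm_smul, mul_pow, norm_eq_abs, sq_abs, mul_pow]
  linear_combination (-t ^ 2) * this

lemma norm_hypPt_lt {t : ℝ} (ht : 0 < t) (μ : Plane) : ‖hypPt t μ‖ < t := by
  have h := sq_sub_norm_hypPt t μ
  have : 0 < (t * rinv μ) ^ 2 := by have := rinv_pos μ; positivity
  nlinarith [norm_nonneg (hypPt t μ)]

lemma mu_hypPt {t : ℝ} (ht : 0 < t) (μ : Plane) : mu t (hypPt t μ) = μ := by
  have := rinv_pos μ
  rw [mu, sq_sub_norm_hypPt, Real.sqrt_sq (by positivity), hypPt, smul_smul,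
    inv_mul_cancel₀ (by positivity), one_smul]

lemma hypPt_mu {t : ℝ} {x : Plane} (hx : ‖x‖ < t) : hypPt t (mu t x) = x := by
  have hq : (t, x) ∈ lightCone := hx
  have ht := lightCone_pos hq
  have hs := Real.sqrt_pos.2 (lightCone_sq_pos hq)
  simp only [] at ht hs
  rw [hypPt, jap_mu hq, mu, smul_smul]
  rw [show t * (sqrt (t ^ 2 - ‖x‖ ^ 2) / t) * (sqrt (t ^ 2 - ‖x‖ ^ 2))⁻¹ = 1 by field_simp,
    one_smul]

lemma hasFDerivAt_hypPt (t : ℝ) (μ : Plane) : HasFDerivAt (hypPt t)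
    ((t * rinv μ) • ContinuousLinearMap.id ℝ Plane
      + ((-(t * rinv μ ^ 3)) • innerSL ℝ μ).smulRight μ) μ := by
  have h1 : HasFDerivAt (fun μ => t * rinv μ) ((-(t * rinv μ ^ 3)) • innerSL ℝ μ) μ := by
    refine ((hasFDerivAt_rinv μ).const_mul t).congr_fderiv ?_
    rw [smul_smul]; congr 1; ring
  exact h1.smul (hasFDerivAt_id μ)

lemma det_fderiv_hypPt (t : ℝ) (μ : Plane) :
    ((t * rinv μ) • ContinuousLinearMap.id ℝ Plane
      + ((-(t * rinv μ ^ 3)) • innerSL ℝ μ).smulRight μ).det = t ^ 2 * rinv μ ^ 4 := by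
  set A := (t * rinv μ) • ContinuousLinearMap.id ℝ Plane
      + ((-(t * rinv μ ^ 3)) • innerSL ℝ μ).smulRight μ with hA
  have hr := rinv_sq_mul μ
  rw [norm_sq_plane] at hr
  have hent : ∀ i j, LinearMap.toMatrix (EuclideanSpace.basisFun (Fin 2) ℝ).toBasis
      (EuclideanSpace.basisFun (Fin 2) ℝ).toBasis (A : Plane →ₗ[ℝ] Plane) i j
      = t * rinv μ * (if i = j then 1 else 0) - t * rinv μ ^ 3 * μ j * μ i := fun i j => by
    rw [LinearMap.toMatrix_apply]
    simp [hA, EuclideanSpace.inner_single_right, PiLp.single_apply]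
    ring
  rw [ContinuousLinearMap.det, ← LinearMap.det_toMatrix (EuclideanSpace.basisFun (Fin 2) ℝ).toBasis,
    Matrix.det_fin_two, hent, hent, hent, hent]
  simp
  linear_combination (-(t ^ 2 * rinv μ ^ 2)) * hr

lemma lintegral_cone {t : ℝ} (ht : 0 < t) (g : Plane → ℝ≥0∞) :
    ∫⁻ x in {x : Plane | ‖x‖ < t}, g (mu t x) = ∫⁻ μ, ofReal (t ^ 2 * rinv μ ^ 4) * g μ := by
  have himg : hypPt t '' Set.univ = {x : Plane | ‖x‖ < t} := by
    ext x
    constructor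
    · rintro ⟨μ, -, rfl⟩; exact norm_hypPt_lt ht μ
    · exact fun hx => ⟨mu t x, trivial, hypPt_mu hx⟩
  have hinj : Set.InjOn (hypPt t) Set.univ := fun a _ b _ hab => by
    rw [← mu_hypPt ht a, hab, mu_hypPt ht b]
  have h := lintegral_image_eq_lintegral_abs_det_fderiv_mul volume MeasurableSet.univ
    (fun μ _ => (hasFDerivAt_hypPt t μ).hasFDerivWithinAt) hinj (fun x => g (mu t x))
  rw [himg, Measure.restrict_univ] at h
  rw [h]
  refine lintegral_congr fun μ => ?_
  have := rinv_pos μ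
  rw [det_fderiv_hypPt, mu_hypPt ht, abs_of_nonneg (by positivity)]

lemma measurable_mu : Measurable fun q : ℝ × Plane => mu q.1 q.2 := by
  unfold mu
  fun_prop

/-- Extension by zero of a function of time and hyperbolic position. -/
def coneExt (Φ : ℝ × Plane → ℂ) (t : ℝ) (x : Plane) : ℂ :=
  open Classical in if ‖x‖ < t then Φ (t, mu t x) else 0

lemma coneExt_of_mem (Φ : ℝ × Plane → ℂ) {t : ℝ} {x : Plane} (hx : ‖x‖ < t) :
    coneExt Φ t x = Φ (t, mu t x) := if_pos hx

lemma coneExt_of_notMem (Φ : ℝ × Plane → ℂ) {t : ℝ} {x : Plane} (hx : ¬ ‖x‖ < t) :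
    coneExt Φ t x = 0 := if_neg hx

lemma measurable_coneExt {Φ : ℝ × Plane → ℂ} (hΦ : Measurable Φ) :
    Measurable fun q : ℝ × Plane => coneExt Φ q.1 q.2 := by
  classical
  unfold coneExt
  exact Measurable.ite isOpen_lightCone.measurableSet
    (hΦ.comp (measurable_fst.prodMk measurable_mu)) measurable_const

lemma coneExt_sub (Φ Ψ : ℝ × Plane → ℂ) (t : ℝ) (x : Plane) :
    coneExt Φ t x - coneExt Ψ t x = coneExt (fun q => Φ q - Ψ q) t x := by
  unfold coneExt; split_ifs <;> simp

lemma lintegral_comp_coneExt (Φ : ℝ × Plane → ℂ) {t : ℝ} (ht : 0 < t) {g : ℂ → ℝ≥0∞} (hg : g 0 = 0) :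
    ∫⁻ x, g (coneExt Φ t x) = ∫⁻ μ, ofReal (t ^ 2 * rinv μ ^ 4) * g (Φ (t, μ)) := by
  rw [← lintegral_cone ht (fun μ => g (Φ (t, μ))),
    ← lintegral_indicator (isOpen_lt continuous_norm continuous_const).measurableSet]
  refine lintegral_congr fun x => ?_
  by_cases hx : ‖x‖ < t
  · rw [coneExt_of_mem _ hx, Set.indicator_of_mem (show x ∈ {b : Plane | ‖b‖ < t} from hx)]
  · rw [coneExt_of_notMem _ hx, Set.indicator_of_notMem (show x ∉ {b : Plane | ‖b‖ < t} from hx), hg]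

lemma lintegral_enorm_coneExt (Φ : ℝ × Plane → ℂ) {t : ℝ} (ht : 0 < t) :
    ∫⁻ x, ‖coneExt Φ t x‖ₑ = ∫⁻ μ, ofReal (t ^ 2 * rinv μ ^ 4) * ‖Φ (t, μ)‖ₑ :=
  lintegral_comp_coneExt Φ ht (g := fun z => ‖z‖ₑ) enorm_zero

/-- The slab `1 < t < T`. -/
def slab (T : ℝ) : Set (ℝ × Plane) := Set.Ioo 1 T ×ˢ Set.univ

lemma lintegral_slab_coneExt {Φ : ℝ × Plane → ℂ} (hΦ : Measurable Φ) (T : ℝ) :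
    ∫⁻ q in slab T, ‖coneExt Φ q.1 q.2‖ₑ =
      ∫⁻ t in Set.Ioo 1 T, ∫⁻ μ, ofReal (t ^ 2 * rinv μ ^ 4) * ‖Φ (t, μ)‖ₑ := by
  rw [slab, Measure.volume_eq_prod, ← Measure.prod_restrict, Measure.restrict_univ,
    lintegral_prod _ (measurable_coneExt hΦ).enorm.aemeasurable]
  exact setLIntegral_congr_fun measurableSet_Ioo fun t ht =>
    lintegral_enorm_coneExt Φ (zero_lt_one.trans ht.1)

/-! ### Convergence lemmas -/

/-- Convergence under a convergent family of bounds. -/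
lemma tendsto_lintegral_zero_of_le {α : Type*} [MeasurableSpace α] {ν : Measure α}
    {f g : ℕ → α → ℝ≥0∞} {h : α → ℝ≥0∞} (hf : ∀ k, Measurable (f k)) (hg : ∀ k, Measurable (g k))
    (hh : Measurable h) (hle : ∀ k, ∀ᵐ x ∂ν, f k x ≤ g k x)
    (hf0 : ∀ᵐ x ∂ν, Tendsto (fun k => f k x) atTop (𝓝 0))
    (hgh : ∀ᵐ x ∂ν, Tendsto (fun k => g k x) atTop (𝓝 (h x)))
    (hItg : ∀ k, ∫⁻ x, g k x ∂ν ≤ ∫⁻ x, h x ∂ν) (hfin : ∫⁻ x, h x ∂ν ≠ ⊤) :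
    Tendsto (fun k => ∫⁻ x, f k x ∂ν) atTop (𝓝 0) := by
  have h1 : Tendsto (fun k => ∫⁻ x, min (f k x) (h x) ∂ν) atTop (𝓝 0) := by
    have := tendsto_lintegral_of_dominated_convergence (μ := ν) (F := fun k x => min (f k x) (h x))
      (f := fun _ => 0) h (fun k => (hf k).min hh) (fun k => Eventually.of_forall fun x => min_le_right _ _)
      hfin (by
        filter_upwards [hf0] with x hx
        have := hx.min (tendsto_const_nhds (x := h x))
        rwa [min_eq_left (zero_le)] at this)
    simpa using this
  have h2 : Tendsto (fun k => ∫⁻ x, min (g k x) (h x) ∂ν) atTop (𝓝 (∫⁻ x, h x ∂ν)) := by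
    refine tendsto_lintegral_of_dominated_convergence (μ := ν) h (fun k => (hg k).min hh)
      (fun k => Eventually.of_forall fun x => min_le_right _ _) hfin ?_
    filter_upwards [hgh] with x hx
    have := hx.min (tendsto_const_nhds (x := h x))
    rwa [min_self] at this
  have h3 : Tendsto (fun k => ∫⁻ x, (g k x - h x) ∂ν) atTop (𝓝 0) := by
    have h4 : Tendsto (fun k => ∫⁻ x, h x ∂ν - ∫⁻ x, min (g k x) (h x) ∂ν) atTop (𝓝 0) := by
      have := ENNReal.Tendsto.sub (tendsto_const_nhds (x := ∫⁻ x, h x ∂ν)) h2 (Or.inl hfin)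
      rwa [tsub_self] at this
    refine tendsto_of_tendsto_of_tendsto_of_le_of_le tendsto_const_nhds h4 (fun _ => zero_le)
      fun k => ?_
    have hsplit : ∫⁻ x, (g k x - h x) ∂ν + ∫⁻ x, min (g k x) (h x) ∂ν = ∫⁻ x, g k x ∂ν := by
      rw [← lintegral_add_left (f := fun x => g k x - h x) ((hg k).sub hh)]
      refine lintegral_congr fun x => ?_
      rcases le_total (g k x) (h x) with hx | hx
      · rw [min_eq_left hx, tsub_eq_zero_of_le hx, zero_add]
      · rw [min_eq_right hx, tsub_add_cancel_of_le hx]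
    have hmfin : ∫⁻ x, min (g k x) (h x) ∂ν ≠ ⊤ :=
      ((lintegral_mono fun x => min_le_right _ _).trans_lt hfin.lt_top).ne
    refine ENNReal.le_sub_of_add_le_right hmfin ?_
    rw [hsplit]; exact hItg k
  have h5 := h1.add h3
  rw [add_zero] at h5
  refine tendsto_of_tendsto_of_tendsto_of_le_of_le tendsto_const_nhds h5 (fun _ => zero_le)
    fun k => ?_
  simp only []
  rw [← lintegral_add_left ((hf k).min hh)]
  refine lintegral_mono_ae ?_
  filter_upwards [hle k] with x hx
  rcases le_total (f k x) (h x) with hx' | hx'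
  · rw [min_eq_left hx']; exact le_self_add
  · rw [min_eq_right hx', add_tsub_cancel_of_le (hx'.trans hx)]; exact hx

lemma measurable_rinv : Measurable rinv := (contDiff_rinv (n := 0)).continuous.measurable

lemma measurable_coneWeight (t : ℝ) : Measurable fun μ => ofReal (t ^ 2 * rinv μ ^ 4) :=
  ((measurable_rinv.pow_const 4).const_mul _).ennreal_ofReal

/-- Convergence in the slab, for functions bounded in hyperbolic coordinates. -/
lemma tendsto_slab_of_le {Φ : ℕ → ℝ × Plane → ℂ} {Φ₀ : ℝ × Plane → ℂ} {T : ℝ}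
    (hΦ : ∀ k, Measurable (Φ k)) (hΦ₀ : Measurable Φ₀) {g : ℕ → Plane → ℝ≥0∞} {h : Plane → ℝ≥0∞}
    (hg : ∀ k, Measurable (g k)) (hh : Measurable h)
    (hle : ∀ k, ∀ t ∈ Set.Ioo 1 T, ∀ᵐ μ, ofReal (t ^ 2 * rinv μ ^ 4) * ‖Φ k (t, μ) - Φ₀ (t, μ)‖ₑ ≤ g k μ)
    (hlim : ∀ t ∈ Set.Ioo 1 T, ∀ᵐ μ, Tendsto (fun k => Φ k (t, μ)) atTop (𝓝 (Φ₀ (t, μ))))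
    (hgh : ∀ᵐ μ, Tendsto (fun k => g k μ) atTop (𝓝 (h μ)))
    (hItg : ∀ k, ∫⁻ μ, g k μ ≤ ∫⁻ μ, h μ) (hfin : ∫⁻ μ, h μ ≠ ⊤) :
    Tendsto (fun k => ∫⁻ q in slab T, ‖coneExt (Φ k) q.1 q.2 - coneExt Φ₀ q.1 q.2‖ₑ) atTop (𝓝 0) := by
  have hm : ∀ k, Measurable fun q => Φ k q - Φ₀ q := fun k => (hΦ k).sub hΦ₀
  simp only [coneExt_sub]
  simp only [fun k => lintegral_slab_coneExt (hm k) T]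
  have hmeas : ∀ k, Measurable fun t : ℝ => ∫⁻ μ, ofReal (t ^ 2 * rinv μ ^ 4)
      * ‖Φ k (t, μ) - Φ₀ (t, μ)‖ₑ := fun k => by
    refine Measurable.lintegral_prod_right'
      (f := fun q : ℝ × Plane => ofReal (q.1 ^ 2 * rinv q.2 ^ 4) * ‖Φ k q - Φ₀ q‖ₑ) ?_
    exact (((measurable_fst.pow_const 2).mul
      ((measurable_rinv.comp measurable_snd).pow_const 4)).ennreal_ofReal).mul (hm k).enorm
  have := tendsto_lintegral_of_dominated_convergence (μ := volume.restrict (Set.Ioo 1 T))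
    (F := fun k t => ∫⁻ μ, ofReal (t ^ 2 * rinv μ ^ 4) * ‖Φ k (t, μ) - Φ₀ (t, μ)‖ₑ)
    (f := fun _ => 0) (fun _ => ∫⁻ μ, h μ) hmeas ?_ ?_ ?_
  · simpa using this
  · intro k
    filter_upwards [ae_restrict_mem measurableSet_Ioo] with t ht
    exact (lintegral_mono_ae (hle k t ht)).trans (hItg k)
  · rw [lintegral_const, Measure.restrict_apply_univ, Real.volume_Ioo]
    exact mul_ne_top hfin ofReal_ne_top
  · filter_upwards [ae_restrict_mem measurableSet_Ioo] with t ht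
    refine tendsto_lintegral_zero_of_le (fun k => (measurable_coneWeight t).mul
      ((hm k).comp (measurable_const.prodMk measurable_id)).enorm) hg hh (fun k => hle k t ht) ?_
      hgh hItg hfin
    filter_upwards [hlim t ht] with μ hμ
    have h0 : Tendsto (fun k => ‖Φ k (t, μ) - Φ₀ (t, μ)‖ₑ) atTop (𝓝 0) := by
      have := (hμ.sub_const (Φ₀ (t, μ))).enorm
      rwa [sub_self, enorm_zero] at this
    have := ENNReal.Tendsto.const_mul (a := ofReal (t ^ 2 * rinv μ ^ 4)) h0
      (Or.inr ofReal_ne_top)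
    rwa [mul_zero] at this

lemma integrableOn_slab_of_le {Φ : ℝ × Plane → ℂ} (hΦ : Measurable Φ) {T : ℝ} {h : Plane → ℝ≥0∞}
    (hle : ∀ t ∈ Set.Ioo 1 T, ∀ᵐ μ, ofReal (t ^ 2 * rinv μ ^ 4) * ‖Φ (t, μ)‖ₑ ≤ h μ)
    (hfin : ∫⁻ μ, h μ ≠ ⊤) :
    IntegrableOn (fun q : ℝ × Plane => coneExt Φ q.1 q.2) (slab T) := by
  refine ⟨(measurable_coneExt hΦ).aestronglyMeasurable, ?_⟩
  rw [HasFiniteIntegral, lintegral_slab_coneExt hΦ]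
  calc _ ≤ ∫⁻ t in Set.Ioo 1 T, ∫⁻ μ, h μ :=
        setLIntegral_mono' measurableSet_Ioo fun t ht => lintegral_mono_ae (hle t ht)
    _ < ⊤ := by
        rw [lintegral_const, Measure.restrict_apply_univ, Real.volume_Ioo]
        exact ENNReal.mul_lt_top hfin.lt_top ENNReal.ofReal_lt_top

lemma locallyIntegrableOn_of_slab {f : ℝ × Plane → ℂ} (hf : ∀ T, IntegrableOn f (slab T)) :
    LocallyIntegrableOn f {p | 1 < p.1} volume := fun q hq => by
  refine ⟨slab (q.1 + 1), mem_nhdsWithin_of_mem_nhds ?_, hf _⟩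
  have : IsOpen (slab (q.1 + 1)) := isOpen_Ioo.prod isOpen_univ
  exact this.mem_nhds ⟨⟨hq, lt_add_one _⟩, trivial⟩

lemma continuous_boxTest {φ : ℝ × Plane → ℝ} (hφ : ContDiff ℝ ∞ φ) : Continuous (boxTest φ) := by
  have h : ∀ v w : ℝ × Plane, Continuous (dirDeriv v (dirDeriv w φ)) := fun v w => by
    have h1 : ContDiff ℝ ∞ (dirDeriv w φ) := (hφ.fderiv_right (m := ∞) (by simp)).clm_apply contDiff_const
    have h2 : ContDiff ℝ ∞ (dirDeriv v (dirDeriv w φ)) :=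
      (h1.fderiv_right (m := ∞) (by simp)).clm_apply contDiff_const
    exact h2.continuous
  unfold boxTest
  exact (h _ _).sub (continuous_finsetSum _ fun i _ => h _ _)

lemma tsupport_dirDeriv_subset {E : Type*} [NormedAddCommGroup E] [NormedSpace ℝ E] (v : E) (φ : E → ℝ) :
    tsupport (dirDeriv v φ) ⊆ tsupport φ := by
  refine (closure_mono ?_).trans (tsupport_fderiv_subset ℝ (f := φ))
  intro x hx; contrapose! hx
  simp only [Function.notMem_support] at hx ⊢
  simp [dirDeriv, hx]

lemma boxTest_eq_zero {φ : ℝ × Plane → ℝ} {q : ℝ × Plane} (hq : q ∉ tsupport φ) :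
    boxTest φ q = 0 := by
  have h : ∀ v w : ℝ × Plane, dirDeriv v (dirDeriv w φ) q = 0 := fun v w => by
    have h2 : q ∉ tsupport (fderiv ℝ (dirDeriv w φ)) := fun h => hq (tsupport_dirDeriv_subset w φ (tsupport_fderiv_subset ℝ h))
    have := image_eq_zero_of_notMem_tsupport h2
    simp [dirDeriv] at this ⊢
    rw [this]; simp
  simp [boxTest, h]

lemma exists_slab {φ : ℝ × Plane → ℝ} (hc : HasCompactSupport φ) (hs : tsupport φ ⊆ {p | 1 < p.1}) :
    ∃ T, tsupport φ ⊆ slab T := by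
  obtain ⟨T, hT⟩ := (hc.image continuous_fst).bddAbove
  refine ⟨T + 1, fun q hq => ⟨⟨hs hq, ?_⟩, trivial⟩⟩
  have := hT ⟨q, hq, rfl⟩
  linarith

lemma tendsto_integral_smul_of_slab {u : ℕ → ℝ × Plane → ℂ} {u₀ : ℝ × Plane → ℂ} {T : ℝ}
    (hu : ∀ k, IntegrableOn (u k) (slab T)) (hu₀ : IntegrableOn u₀ (slab T))
    (hlim : Tendsto (fun k => ∫⁻ q in slab T, ‖u k q - u₀ q‖ₑ) atTop (𝓝 0))
    {ψ : ℝ × Plane → ℝ} (hψ : Continuous ψ) (hc : HasCompactSupport ψ) (hs : ∀ q ∉ slab T, ψ q = 0) :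
    Tendsto (fun k => ∫ q, ψ q • u k q) atTop (𝓝 (∫ q, ψ q • u₀ q)) := by
  obtain ⟨M, hM⟩ := hψ.bounded_above_of_compact_support hc
  have hset : ∀ f : ℝ × Plane → ℂ, ∫ q, ψ q • f q = ∫ q in slab T, ψ q • f q := fun f => by
    rw [setIntegral_eq_integral_of_forall_compl_eq_zero]
    intro q hq; rw [hs q hq, zero_smul]
  simp only [hset]
  have hItg : ∀ f : ℝ × Plane → ℂ, IntegrableOn f (slab T) →
      Integrable (fun q => ψ q • f q) (volume.restrict (slab T)) := fun f hf =>
    hf.bdd_smul M hψ.aestronglyMeasurable (.of_forall hM)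
  refine tendsto_integral_of_L1 _ (hItg u₀ hu₀).aestronglyMeasurable
    (.of_forall fun k => hItg _ (hu k)) ?_
  have h1 : Tendsto (fun k => ofReal M * ∫⁻ q in slab T, ‖u k q - u₀ q‖ₑ) atTop (𝓝 0) := by
    have := ENNReal.Tendsto.const_mul hlim (Or.inr (ofReal_ne_top (r := M)))
    rwa [mul_zero] at this
  refine tendsto_of_tendsto_of_tendsto_of_le_of_le tendsto_const_nhds h1 (fun _ => zero_le) fun k => ?_
  simp only []
  rw [← lintegral_const_mul' _ _ ofReal_ne_top]
  refine lintegral_mono fun q => ?_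
  rw [← smul_sub, enorm_smul]
  gcongr
  rw [← ofReal_norm]
  exact ofReal_le_ofReal (hM q)

lemma isKleinGordonOf_of_tendsto {u F : ℕ → ℝ → Plane → ℂ} {u₀ F₀ : ℝ → Plane → ℂ}
    (hk : ∀ k, IsKleinGordonOf (u k) (F k))
    (hu : ∀ k T, IntegrableOn (fun q : ℝ × Plane => u k q.1 q.2) (slab T))
    (hF : ∀ k T, IntegrableOn (fun q : ℝ × Plane => F k q.1 q.2) (slab T))
    (hu₀ : ∀ T, IntegrableOn (fun q : ℝ × Plane => u₀ q.1 q.2) (slab T))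
    (hF₀ : ∀ T, IntegrableOn (fun q : ℝ × Plane => F₀ q.1 q.2) (slab T))
    (hlu : ∀ T, Tendsto (fun k => ∫⁻ q in slab T, ‖u k q.1 q.2 - u₀ q.1 q.2‖ₑ) atTop (𝓝 0))
    (hlF : ∀ T, Tendsto (fun k => ∫⁻ q in slab T, ‖F k q.1 q.2 - F₀ q.1 q.2‖ₑ) atTop (𝓝 0)) :
    IsKleinGordonOf u₀ F₀ := by
  refine ⟨locallyIntegrableOn_of_slab hu₀, locallyIntegrableOn_of_slab hF₀, fun φ hφ hc hs => ?_⟩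
  obtain ⟨T, hT⟩ := exists_slab hc hs
  have h1 := tendsto_integral_smul_of_slab (fun k => hu k T) (hu₀ T) (hlu T)
    (ψ := fun q => boxTest φ q + φ q) ((continuous_boxTest hφ).add hφ.continuous)
    (hc.mono' fun q hq => by
      by_contra h
      exact hq (by simp [boxTest_eq_zero h, image_eq_zero_of_notMem_tsupport h]))
    (fun q hq => by
      have h : q ∉ tsupport φ := fun h => hq (hT h)
      simp [boxTest_eq_zero h, image_eq_zero_of_notMem_tsupport h])
  have h2 := tendsto_integral_smul_of_slab (fun k => hF k T) (hF₀ T) (hlF T)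
    (ψ := φ) hφ.continuous hc
    (fun q hq => image_eq_zero_of_notMem_tsupport fun h => hq (hT h))
  refine tendsto_nhds_unique h1 (h2.congr fun k => ?_)
  exact ((hk k).2.2 φ hφ hc hs).symm

/-! ### Smooth amplitudes with compact support -/

lemma continuous_smul_of_tsupport {E : Type*} [TopologicalSpace E] {ψ : E → ℝ} {h : E → ℂ} (hψ : Continuous ψ)
    (hh : ∀ x ∈ tsupport ψ, ContinuousAt h x) : Continuous fun x => ψ x • h x := by
  rw [continuous_iff_continuousAt]
  intro x
  by_cases hx : x ∈ tsupport ψ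
  · exact hψ.continuousAt.smul (hh x hx)
  · refine ContinuousAt.congr (f := fun _ => (0 : ℂ)) continuousAt_const ?_
    filter_upwards [(isClosed_tsupport ψ).isOpen_compl.mem_nhds hx] with y hy
    rw [image_eq_zero_of_notMem_tsupport hy, zero_smul]

section IntegrationByParts

variable {E : Type*} [NormedAddCommGroup E] [NormedSpace ℝ E] [MeasurableSpace E] [BorelSpace E]
  [FiniteDimensional ℝ E] {ν : Measure E} [ν.IsAddHaarMeasure]

lemma contDiff_dirDeriv {V : Type*} [NormedAddCommGroup V] [NormedSpace ℝ V] (v : V) {φ : V → ℝ}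
    (hφ : ContDiff ℝ ∞ φ) : ContDiff ℝ ∞ (dirDeriv v φ) :=
  (hφ.fderiv_right (m := ∞) (by simp)).clm_apply contDiff_const

lemma integral_dirDeriv_dirDeriv_smul {φ : E → ℝ} (hφ : ContDiff ℝ ∞ φ) (hc : HasCompactSupport φ)
    {w : E → ℂ} (hw : ∀ x ∈ tsupport φ, ContDiffAt ℝ 2 w x) (d : E) :
    ∫ x, dirDeriv d (dirDeriv d φ) x • w x ∂ν = ∫ x, φ x • hess w x d d ∂ν := by
  set ψ := dirDeriv d φ
  have hψ : ContDiff ℝ ∞ ψ := contDiff_dirDeriv d hφ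
  have hψs : tsupport ψ ⊆ tsupport φ := tsupport_dirDeriv_subset d φ
  have hψψ : ContDiff ℝ ∞ (dirDeriv d ψ) := contDiff_dirDeriv d hψ
  have hψψs : tsupport (dirDeriv d ψ) ⊆ tsupport φ := (tsupport_dirDeriv_subset d ψ).trans hψs
  have c0 : ∀ x ∈ tsupport φ, ContinuousAt w x := fun x hx => (hw x hx).continuousAt
  have c1 : ∀ x ∈ tsupport φ, ContinuousAt (fun x => fderiv ℝ w x d) x := fun x hx =>
    ((hasFDerivAt_fderiv_apply (hw x hx) d).continuousAt)
  have c2 : ∀ x ∈ tsupport φ, ContinuousAt (fun x => fderiv ℝ (fun x => fderiv ℝ w x d) x d) x :=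
    fun x hx => by
      have h1 : ContDiffAt ℝ 1 (fun x => fderiv ℝ w x d) x :=
        ((hw x hx).fderiv_right (m := 1) (by norm_num)).clm_apply contDiffAt_const
      exact ((h1.fderiv_right (m := 0) (by simp)).clm_apply contDiffAt_const).continuousAt
  have int : ∀ (κ : E → ℝ) (h : E → ℂ), Continuous κ → tsupport κ ⊆ tsupport φ →
      (∀ x ∈ tsupport φ, ContinuousAt h x) → Integrable (fun x => κ x • h x) ν :=
    fun κ h hκ hκs hh => by
      refine (continuous_smul_of_tsupport hκ fun x hx => hh x (hκs hx)).integrable_of_hasCompactSupport ?_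
      exact (HasCompactSupport.of_support_subset_isCompact hc
        ((subset_closure).trans hκs)).smul_right
  have i1 := integral_bilinear_fderiv_right_eq_neg_left_of_integrable (μ := ν) (f := ψ) (g := w)
    (v := d) (B := lsmul ℝ ℝ)
    (int (dirDeriv d ψ) w hψψ.continuous hψψs c0)
    (int ψ (fun x => fderiv ℝ w x d) hψ.continuous hψs c1) (int ψ w hψ.continuous hψs c0)
    (fun x _ => hψ.differentiable (by simp) x)
    (fun x hx => (hw x (hψs hx)).differentiableAt two_ne_zero)
  have i2 := integral_bilinear_fderiv_right_eq_neg_left_of_integrable (μ := ν) (f := φ)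
    (g := fun x => fderiv ℝ w x d) (v := d) (B := lsmul ℝ ℝ)
    (int ψ (fun x => fderiv ℝ w x d) hψ.continuous hψs c1)
    (int φ _ hφ.continuous subset_rfl c2) (int φ _ hφ.continuous subset_rfl c1)
    (fun x _ => hφ.differentiable (by simp) x)
    (fun x hx => (hasFDerivAt_fderiv_apply (hw x hx) d).differentiableAt)
  simp only [lsmul_apply] at i1 i2
  have e1 : ∫ x, φ x • hess w x d d ∂ν = ∫ x, φ x • fderiv ℝ (fun x => fderiv ℝ w x d) x d ∂ν := by
    refine integral_congr_ae (.of_forall fun x => ?_)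
    by_cases hx : x ∈ tsupport φ
    · simp only []; rw [hess_eq (hw x hx)]
    · simp only []; rw [image_eq_zero_of_notMem_tsupport hx, zero_smul, zero_smul]
  rw [e1, i2]
  change _ = -∫ x, ψ x • fderiv ℝ w x d ∂ν
  rw [i1, neg_neg]
  rfl

end IntegrationByParts

lemma Symb.Good.prof_eq_zero {C : ℝ} {S : Symb} (hS : S.Good C) {e : Slow} (he : prP e = 0) :
    S.prof e = 0 := by
  have hw : S.wave e = 0 := by rw [← norm_eq_zero, norm_wave_eq, he, norm_zero]
  have hc : S.cor 0 = 0 := by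
    have := hS.cor_le 0
    simpa using this
  rw [Symb.prof, hw, hc]; simp

/-- The profile and its image under the Klein-Gordon operator, in hyperbolic coordinates. -/
def profH (S : Symb) (P : Plane → ℂ × ℂ) (q : ℝ × Plane) : ℂ := S.prof (slowPt q.1 q.2 (P q.2))

/-- See `profH`. -/
def kgH (S : Symb) (J : Plane → Jet) (q : ℝ × Plane) : ℂ := kgAt S q.1 q.2 (J q.2)

lemma isKleinGordonOf_smooth {C : ℝ} {S : Symb} (hS : S.Good C) {P : Plane → ℂ × ℂ}
    (hP : ContDiff ℝ 2 P) (hPc : HasCompactSupport P) {φ : ℝ × Plane → ℝ} (hφ : ContDiff ℝ ∞ φ)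
    (hc : HasCompactSupport φ) (hs : tsupport φ ⊆ {p | 1 < p.1}) :
    ∫ p : ℝ × Plane, (boxTest φ p + φ p) • coneExt (profH S P) p.1 p.2
      = ∫ p : ℝ × Plane, φ p • coneExt (kgH S (jetOf P)) p.1 p.2 := by
  set w : ℝ × Plane → ℂ := fun q => coneExt (profH S P) q.1 q.2 with hw
  set u : ℝ × Plane → ℂ := fun q => S.prof (slowAt P q.1 q.2) with hu
  have hwu : ∀ q ∈ lightCone, w q = u q := fun q hq => by
    rw [hw]; simp only []
    rw [coneExt_of_mem _ hq, hu]; simp only [profH]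
    rw [slowAt_eq_slowPt P (show (q.1, q.2) ∈ lightCone from hq)]
  have hev : ∀ q ∈ lightCone, w =ᶠ[𝓝 q] u := fun q hq => by
    filter_upwards [isOpen_lightCone.mem_nhds hq] with q' hq' using hwu q' hq'
  have hud : ∀ q ∈ lightCone, ContDiffAt ℝ 2 u q := fun q hq =>
    (hS.contDiff_prof.comp (contDiff_slowMap (n := 2) hP)).contDiffAt.comp q
      (contDiffAt_hypCoord (n := 2) hq)
  obtain ⟨R, hR⟩ := hPc.isBounded.subset_closedBall 0
  have hzero : ∀ q : ℝ × Plane, 0 < q.1 → q ∉ lightCone → w =ᶠ[𝓝 q] fun _ => 0 := fun q hq1 hq => by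
    have hopen : IsOpen {q : ℝ × Plane | R ^ 2 * (q.1 ^ 2 - ‖q.2‖ ^ 2) < ‖q.2‖ ^ 2} :=
      isOpen_lt (by fun_prop) (by fun_prop)
    have hmem : R ^ 2 * (q.1 ^ 2 - ‖q.2‖ ^ 2) < ‖q.2‖ ^ 2 := by
      have h1 : q.1 ≤ ‖q.2‖ := not_lt.1 hq
      have h2 : q.1 ^ 2 ≤ ‖q.2‖ ^ 2 := by gcongr
      have h3 : R ^ 2 * (q.1 ^ 2 - ‖q.2‖ ^ 2) ≤ 0 :=
        mul_nonpos_of_nonneg_of_nonpos (sq_nonneg R) (by linarith)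
      have : 0 < q.1 ^ 2 := by positivity
      linarith
    filter_upwards [hopen.mem_nhds hmem] with q' hq'
    by_cases hc' : q' ∈ lightCone
    · rw [hwu q' hc', hu]
      refine hS.prof_eq_zero ?_
      change P (mu q'.1 q'.2) = 0
      by_contra hne
      have h1 := hR (subset_tsupport P hne)
      rw [mem_closedBall_zero_iff] at h1
      have hN := lightCone_sq_pos hc'
      have h2 : ‖mu q'.1 q'.2‖ ^ 2 * (q'.1 ^ 2 - ‖q'.2‖ ^ 2) = ‖q'.2‖ ^ 2 := by
        rw [mu, norm_smul, norm_inv, norm_eq_abs, abs_of_nonneg (Real.sqrt_nonneg _), mul_pow,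
          inv_pow, Real.sq_sqrt hN.le]
        field_simp
      have h3 : ‖mu q'.1 q'.2‖ ^ 2 ≤ R ^ 2 := by gcongr
      have h4 := mul_le_mul_of_nonneg_right h3 hN.le
      have h5 : R ^ 2 * (q'.1 ^ 2 - ‖q'.2‖ ^ 2) < ‖q'.2‖ ^ 2 := hq'
      linarith
    · rw [hw]; exact coneExt_of_notMem _ hc'
  have hwd : ∀ q ∈ tsupport φ, ContDiffAt ℝ 2 w q := fun q hq => by
    have h1 : 1 < q.1 := hs hq
    by_cases hq' : q ∈ lightCone
    · exact (hud q hq').congr_of_eventuallyEq (hev q hq')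
    · exact (contDiffAt_const).congr_of_eventuallyEq (hzero q (by linarith) hq')
  have hcongr : ∀ {f g : ℝ × Plane → ℂ} {q : ℝ × Plane}, f =ᶠ[𝓝 q] g → ∀ d, hess f q d d = hess g q d d :=
    fun h d => by rw [hess, hess, h.fderiv.fderiv_eq]
  have hkg : ∀ q ∈ tsupport φ, boxHess w q + w q = coneExt (kgH S (jetOf P)) q.1 q.2 := fun q hq => by
    have h1 : 1 < q.1 := hs hq
    by_cases hq' : q ∈ lightCone
    · have := hS.box_prof hP (show (q.1, q.2) ∈ lightCone from hq')
      rw [coneExt_of_mem _ hq']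
      change _ = kgAt S q.1 (mu q.1 q.2) (jetOf P (mu q.1 q.2))
      rw [← this, hwu q hq', boxHess, boxHess]
      simp only [hcongr (hev q hq')]
      rfl
    · rw [coneExt_of_notMem _ hq', boxHess]
      have h0 : ∀ d, hess w q d d = 0 := fun d => by
        rw [hcongr (hzero q (by linarith) hq') d]; simp [hess]
      simp only [h0]
      rw [(hzero q (by linarith) hq').self_of_nhds]; simp
  have hbt : ∀ p, (boxTest φ p + φ p) • w p = dirDeriv (1, 0) (dirDeriv (1, 0) φ) p • w p
      - ∑ i : Fin 2, dirDeriv (0, basisVec i) (dirDeriv (0, basisVec i) φ) p • w p + φ p • w p :=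
    fun p => by
      rw [boxTest, add_smul, sub_smul, Finset.sum_smul]
  have hItg : ∀ (κ : ℝ × Plane → ℝ) (h : ℝ × Plane → ℂ), Continuous κ → tsupport κ ⊆ tsupport φ →
      (∀ x ∈ tsupport φ, ContinuousAt h x) → Integrable (fun x => κ x • h x) :=
    fun κ h hκ hκs hh => by
      refine (continuous_smul_of_tsupport hκ fun x hx => hh x (hκs hx)).integrable_of_hasCompactSupport ?_
      exact (HasCompactSupport.of_support_subset_isCompact hc ((subset_closure).trans hκs)).smul_right
  have hi2 : ∀ d : ℝ × Plane, Integrable fun p => dirDeriv d (dirDeriv d φ) p • w p := fun d =>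
    hItg _ _ (contDiff_dirDeriv d (contDiff_dirDeriv d hφ)).continuous
      ((tsupport_dirDeriv_subset d _).trans (tsupport_dirDeriv_subset d φ))
      fun x hx => (hwd x hx).continuousAt
  have hi0 : Integrable fun p => φ p • w p :=
    hItg _ _ hφ.continuous subset_rfl fun x hx => (hwd x hx).continuousAt
  have hih : ∀ d : ℝ × Plane, Integrable fun p => φ p • hess w p d d := fun d =>
    hItg _ _ hφ.continuous subset_rfl fun x hx => by
      have h1 : ContDiffAt ℝ 1 (fderiv ℝ w) x := (hwd x hx).fderiv_right (m := 1) (by norm_num)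
      exact (((h1.fderiv_right (m := 0) (by simp)).clm_apply contDiffAt_const).clm_apply
        contDiffAt_const).continuousAt
  have : (volume : Measure (ℝ × Plane)).IsAddHaarMeasure :=
    inferInstanceAs ((volume : Measure ℝ).prod (volume : Measure Plane)).IsAddHaarMeasure
  have hibp := fun d : ℝ × Plane => integral_dirDeriv_dirDeriv_smul (ν := volume) hφ hc hwd d
  have hsplit : ∀ (f h : ℝ × Plane → ℂ) (g : Fin 2 → ℝ × Plane → ℂ), Integrable f → Integrable h →
      (∀ i, Integrable (g i)) →
      ∫ p, (f p - ∑ i, g i p + h p) = (∫ p, f p) - (∑ i, ∫ p, g i p) + ∫ p, h p :=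
    fun f h g hf hh hg => by
      have hsum : Integrable fun p => ∑ i, g i p := integrable_finsetSum _ fun i _ => hg i
      rw [integral_add (f := fun p => f p - ∑ i, g i p) (hf.sub hsum) hh, integral_sub hf hsum,
        integral_finsetSum _ fun i _ => hg i]
  calc ∫ p, (boxTest φ p + φ p) • w p
      = (∫ p, dirDeriv (1, 0) (dirDeriv (1, 0) φ) p • w p)
        - (∑ i : Fin 2, ∫ p, dirDeriv (0, basisVec i) (dirDeriv (0, basisVec i) φ) p • w p)
        + ∫ p, φ p • w p := by
        simp only [hbt]
        exact hsplit _ _ _ (hi2 _) hi0 fun i => hi2 _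
    _ = (∫ p, φ p • hess w p (1, 0) (1, 0))
        - (∑ i : Fin 2, ∫ p, φ p • hess w p (0, basisVec i) (0, basisVec i))
        + ∫ p, φ p • w p := by simp only [hibp]
    _ = ∫ p, (φ p • hess w p (1, 0) (1, 0) - ∑ i : Fin 2, φ p • hess w p (0, basisVec i) (0, basisVec i)
        + φ p • w p) := (hsplit _ _ _ (hih _) hi0 fun i => hih _).symm
    _ = ∫ p, φ p • coneExt (kgH S (jetOf P)) p.1 p.2 := by
        refine integral_congr_ae (.of_forall fun p => ?_)
        by_cases hp : p ∈ tsupport φ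
        · simp only []
          rw [← hkg p hp, boxHess, smul_add, smul_sub, Finset.smul_sum]
        · simp [image_eq_zero_of_notMem_tsupport hp]

open scoped Convolution

/-! ### Weak derivatives and mollification -/

/-- The multi-index of the `i`-th derivative. -/
def idx (i : Fin 2) : ℕ × ℕ := if i = 0 then (1, 0) else (0, 1)

lemma HasWeakDeriv.ae_eq {α : ℕ × ℕ} {f g g' : Plane → ℂ} (h : HasWeakDeriv α f g)
    (h' : HasWeakDeriv α f g') : g =ᵐ[volume] g' := by
  refine ae_eq_of_integral_contDiff_smul_eq h.2.1 h'.2.1 fun φ hφ hc => ?_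
  have h1 := h.2.2 φ hφ hc
  have h2 := h'.2.2 φ hφ hc
  rw [h1] at h2
  have hne : (-1 : ℝ) ^ (α.1 + α.2) ≠ 0 := by positivity
  exact smul_right_injective ℂ hne h2

lemma HasWeakDeriv.congr_ae {α : ℕ × ℕ} {f g g' : Plane → ℂ} (h : HasWeakDeriv α f g)
    (hg : g =ᵐ[volume] g') : HasWeakDeriv α f g' := by
  refine ⟨h.1, h.2.1.congr hg, fun φ hφ hc => ?_⟩
  rw [h.2.2 φ hφ hc]
  congr 1
  refine integral_congr_ae ?_
  filter_upwards [hg] with x hx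
  rw [hx]

lemma hasWeakDeriv_zero {f : Plane → ℂ} (hf : LocallyIntegrable f) : HasWeakDeriv (0, 0) f f :=
  ⟨hf, hf, fun φ _ _ => by simp [multiDeriv]⟩

lemma HasWeakDeriv.eLpNorm_le {α : ℕ × ℕ} {k : ℕ} {s : ℝ} {f g : Plane → ℂ}
    (h : HasWeakDeriv α f g) (hα : α.1 + α.2 ≤ k) :
    eLpNorm (fun x => (jap ‖x‖ ^ s) • g x) 2 volume ≤ sobolevNorm k s f := by
  have h1 : eLpNorm (fun x => (jap ‖x‖ ^ s) • g x) 2 volume ≤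
      ⨅ (g' : Plane → ℂ) (_ : HasWeakDeriv α f g'), eLpNorm (fun x => (jap ‖x‖ ^ s) • g' x) 2 volume := by
    refine le_iInf₂ fun g' h' => le_of_eq (eLpNorm_congr_ae ?_)
    filter_upwards [h.ae_eq h'] with x hx
    rw [hx]
  refine h1.trans ?_
  rw [sobolevNorm]
  refine le_trans ?_ (Finset.single_le_sum (f := fun j => ∑ α ∈ Finset.HasAntidiagonal.antidiagonal j,
    ⨅ (g : Plane → ℂ) (_ : HasWeakDeriv α f g), eLpNorm (fun x => (jap ‖x‖ ^ s) • g x) 2 volume)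
    (fun _ _ => zero_le) (Finset.mem_range.2 (Nat.lt_succ_of_le hα)))
  exact Finset.single_le_sum (f := fun α => ⨅ (g : Plane → ℂ) (_ : HasWeakDeriv α f g),
    eLpNorm (fun x => (jap ‖x‖ ^ s) • g x) 2 volume) (fun _ _ => zero_le)
    (Finset.HasAntidiagonal.mem_antidiagonal.2 rfl)

lemma MemSobolev.exists_hasWeakDeriv {k : ℕ} {s : ℝ} {f : Plane → ℂ} (h : MemSobolev k s f)
    {α : ℕ × ℕ} (hα : α.1 + α.2 ≤ k) : ∃ g, Measurable g ∧ HasWeakDeriv α f g := by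
  have : ∃ g, HasWeakDeriv α f g := by
    by_contra hne
    push Not at hne
    have htop : (⨅ (g' : Plane → ℂ) (_ : HasWeakDeriv α f g'),
        eLpNorm (fun x => (jap ‖x‖ ^ s) • g' x) 2 volume) = ⊤ := by
      simp only [hne, iInf_false, iInf_top]
    have h2 := h.2
    rw [sobolevNorm, ENNReal.sum_lt_top] at h2
    have h3 := h2 _ (Finset.mem_range.2 (Nat.lt_succ_of_le hα))
    rw [ENNReal.sum_lt_top] at h3
    have h4 := h3 α (Finset.HasAntidiagonal.mem_antidiagonal.2 rfl)
    rw [htop] at h4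
    exact lt_irrefl _ h4
  obtain ⟨g, hg⟩ := this
  have hm := hg.2.1.aestronglyMeasurable
  exact ⟨hm.mk g, hm.stronglyMeasurable_mk.measurable, hg.congr_ae hm.ae_eq_mk⟩

/-- Weak derivatives of first and second order. -/
structure WeakJet (f : Plane → ℂ) (g₁ : Fin 2 → Plane → ℂ) (g₂ : Fin 2 → Fin 2 → Plane → ℂ) :
    Prop where
  continuous : Continuous f
  measurable₁ : ∀ i, Measurable (g₁ i)
  measurable₂ : ∀ i j, Measurable (g₂ i j)
  weak₁ : ∀ i, HasWeakDeriv (idx i) f (g₁ i)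
  weak₂ : ∀ i j, HasWeakDeriv (idx i + idx j) f (g₂ i j)

lemma idx_sum (i : Fin 2) : (idx i).1 + (idx i).2 = 1 := by fin_cases i <;> rfl

lemma idx_add_sum (i j : Fin 2) : (idx i + idx j).1 + (idx i + idx j).2 = 2 := by
  fin_cases i <;> fin_cases j <;> rfl

lemma MemSobolev.exists_weakJet {s : ℝ} {f : Plane → ℂ} (h : MemSobolev 2 s f) (hc : Continuous f) :
    ∃ g₁ g₂, WeakJet f g₁ g₂ := by
  have e1 := fun i => h.exists_hasWeakDeriv (α := idx i) (by rw [idx_sum]; norm_num)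
  have e2 := fun i j => h.exists_hasWeakDeriv (α := idx i + idx j) (by rw [idx_add_sum])
  choose g₁ h₁ w₁ using e1
  choose g₂ h₂ w₂ using e2
  exact ⟨g₁, g₂, hc, h₁, h₂, w₁, w₂⟩

section Moll

variable {η : Plane → ℝ} {f g : Plane → ℂ}

lemma fderiv_convolution_apply (hη : ContDiff ℝ ∞ η) (hc : HasCompactSupport η)
    (hf : LocallyIntegrable f) (x v : Plane) :
    fderiv ℝ (η ⋆[lsmul ℝ ℝ] f) x v
      = (dirDeriv v η ⋆[lsmul ℝ ℝ] f) x := by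
  have h1 := (hc.hasFDerivAt_convolution_right (lsmul ℝ ℝ : ℝ →L[ℝ] ℂ →L[ℝ] ℂ).flip
    hf (hη.of_le (by simp)) x).fderiv
  rw [convolution_flip] at h1
  rw [h1, convolution_precompR_apply (lsmul ℝ ℝ : ℝ →L[ℝ] ℂ →L[ℝ] ℂ).flip hf
    (hc.fderiv (𝕜 := ℝ)) (hη.continuous_fderiv (by simp))]
  rw [← convolution_flip]
  rfl

lemma contDiff_convolution (hη : ContDiff ℝ ∞ η) (hc : HasCompactSupport η)
    (hf : LocallyIntegrable f) : ContDiff ℝ ∞ (η ⋆[lsmul ℝ ℝ] f) :=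
  hc.contDiff_convolution_left _ hη hf

lemma hasCompactSupport_dirDeriv (hc : HasCompactSupport η) (v : Plane) :
    HasCompactSupport (dirDeriv v η) :=
  HasCompactSupport.of_support_subset_isCompact hc
    (subset_closure.trans (tsupport_dirDeriv_subset v η))

lemma hess_convolution (hη : ContDiff ℝ ∞ η) (hc : HasCompactSupport η)
    (hf : LocallyIntegrable f) (x w v : Plane) :
    hess (η ⋆[lsmul ℝ ℝ] f) x w v
      = (dirDeriv w (dirDeriv v η) ⋆[lsmul ℝ ℝ] f) x := by
  have h2 : ContDiff ℝ 2 (η ⋆[lsmul ℝ ℝ] f) :=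
    by exact_mod_cast contDiff_infty.1 (contDiff_convolution hη hc hf) 2
  rw [hess_eq h2.contDiffAt]
  simp only [fderiv_convolution_apply hη hc hf]
  exact fderiv_convolution_apply (contDiff_dirDeriv v hη) (hasCompactSupport_dirDeriv hc v) hf x w

lemma dirDeriv_comp_sub (hη : ContDiff ℝ ∞ η) (c : ℝ) (x v : Plane) :
    dirDeriv v (fun y => c * η (x - y)) = fun y => -c * dirDeriv v η (x - y) := by
  ext y
  have h1 : HasFDerivAt (fun y : Plane => x - y) (-ContinuousLinearMap.id ℝ Plane) y :=
    (hasFDerivAt_id y).const_sub x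
  have h2 := (((hη.differentiable (by simp) (x - y)).hasFDerivAt).comp y h1).const_mul c
  rw [dirDeriv, show fderiv ℝ (fun y => c * η (x - y)) y = _ from h2.fderiv]
  simp [dirDeriv]

lemma iterate_dirDeriv_comp_sub (n : ℕ) (hη : ContDiff ℝ ∞ η) (c : ℝ) (x v : Plane) :
    ContDiff ℝ ∞ ((dirDeriv v)^[n] η) ∧ (dirDeriv v)^[n] (fun y => c * η (x - y))
      = fun y => ((-1) ^ n * c) * (dirDeriv v)^[n] η (x - y) := by
  induction n with
  | zero => exact ⟨hη, by simp⟩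
  | succ n ih =>
    rw [Function.iterate_succ_apply', Function.iterate_succ_apply', ih.2,
      dirDeriv_comp_sub ih.1]
    refine ⟨contDiff_dirDeriv v ih.1, ?_⟩
    ext y; ring

lemma multiDeriv_comp_sub (α : ℕ × ℕ) (hη : ContDiff ℝ ∞ η) (x y : Plane) :
    multiDeriv α (fun y => η (x - y)) y = (-1) ^ (α.1 + α.2) * multiDeriv α η (x - y) := by
  have h1 := iterate_dirDeriv_comp_sub α.2 hη 1 x (basisVec 1)
  simp only [one_mul, mul_one] at h1
  have h2 := iterate_dirDeriv_comp_sub α.1 h1.1 ((-1) ^ α.2) x (basisVec 0)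
  rw [multiDeriv, h1.2, h2.2, multiDeriv]
  simp only []
  ring

lemma HasWeakDeriv.convolution_eq {α : ℕ × ℕ} (h : HasWeakDeriv α f g) (hη : ContDiff ℝ ∞ η)
    (hc : HasCompactSupport η) (x : Plane) :
    (multiDeriv α η ⋆[lsmul ℝ ℝ] f) x
      = (η ⋆[lsmul ℝ ℝ] g) x := by
  have hφ : ContDiff ℝ ∞ fun y => η (x - y) := hη.comp (contDiff_const.sub contDiff_id)
  have hφc : HasCompactSupport fun y => η (x - y) :=
    hc.comp_homeomorph (Homeomorph.subLeft x)
  have h1 := h.2.2 _ hφ hφc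
  rw [convolution_eq_swap, convolution_eq_swap]
  simp only [lsmul_apply]
  have h2 : ∀ y, multiDeriv α (fun y => η (x - y)) y • f y
      = (-1 : ℝ) ^ (α.1 + α.2) • (multiDeriv α η (x - y) • f y) := fun y => by
    rw [multiDeriv_comp_sub α hη, mul_smul]
  simp only [h2] at h1
  rw [integral_smul] at h1
  have hne : (-1 : ℝ) ^ (α.1 + α.2) ≠ 0 := by positivity
  exact smul_right_injective ℂ hne h1

lemma WeakJet.fderiv_convolution {g₁ : Fin 2 → Plane → ℂ} {g₂ : Fin 2 → Fin 2 → Plane → ℂ}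
    (h : WeakJet f g₁ g₂) (hη : ContDiff ℝ ∞ η) (hc : HasCompactSupport η) (x : Plane) (i : Fin 2) :
    fderiv ℝ (η ⋆[lsmul ℝ ℝ] f) x (basisVec i)
      = (η ⋆[lsmul ℝ ℝ] g₁ i) x := by
  rw [fderiv_convolution_apply hη hc h.continuous.locallyIntegrable, ← (h.weak₁ i).convolution_eq hη hc]
  fin_cases i <;> rfl

lemma WeakJet.hess_convolution {g₁ : Fin 2 → Plane → ℂ} {g₂ : Fin 2 → Fin 2 → Plane → ℂ}
    (h : WeakJet f g₁ g₂) (hη : ContDiff ℝ ∞ η) (hc : HasCompactSupport η) (x : Plane) (i j : Fin 2) :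
    hess (η ⋆[lsmul ℝ ℝ] f) x (basisVec i) (basisVec j)
      = (η ⋆[lsmul ℝ ℝ] g₂ i j) x := by
  have h2 : ContDiff ℝ 2 (η ⋆[lsmul ℝ ℝ] f) :=
    by exact_mod_cast contDiff_infty.1 (contDiff_convolution hη hc h.continuous.locallyIntegrable) 2
  rw [← (h.weak₂ i j).convolution_eq hη hc]
  fin_cases i <;> fin_cases j
  · exact KG.hess_convolution hη hc h.continuous.locallyIntegrable _ _ _
  · exact KG.hess_convolution hη hc h.continuous.locallyIntegrable _ _ _
  · exact (hess_comm h2.contDiffAt _ _).trans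
      (KG.hess_convolution hη hc h.continuous.locallyIntegrable _ _ _)
  · exact KG.hess_convolution hη hc h.continuous.locallyIntegrable _ _ _

end Moll

/-- A sequence of bump functions shrinking to the origin. -/
def bump (k : ℕ) : ContDiffBump (0 : Plane) where
  rIn := 1 / (2 * ((k : ℝ) + 1))
  rOut := 1 / ((k : ℝ) + 1)
  rIn_pos := by positivity
  rIn_lt_rOut := by
    rw [div_lt_div_iff_of_pos_left one_pos (by positivity) (by positivity)]
    have : (0 : ℝ) < (k : ℝ) + 1 := by positivity
    linarith

/-- The mollifiers. -/
def bumpN (k : ℕ) : Plane → ℝ := (bump k).normed volume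

/-- Mollification. -/
def moll (k : ℕ) (f : Plane → ℂ) : Plane → ℂ := bumpN k ⋆[lsmul ℝ ℝ] f

lemma contDiff_bumpN (k : ℕ) : ContDiff ℝ ∞ (bumpN k) := (bump k).contDiff_normed

lemma hasCompactSupport_bumpN (k : ℕ) : HasCompactSupport (bumpN k) := (bump k).hasCompactSupport_normed

lemma bumpN_nonneg (k : ℕ) (x : Plane) : 0 ≤ bumpN k x := (bump k).nonneg_normed x

lemma tendsto_bump_rOut : Tendsto (fun k => (bump k).rOut) atTop (𝓝 0) :=
  tendsto_one_div_add_atTop_nhds_zero_nat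

lemma ae_tendsto_convolution {E : Type*} [NormedAddCommGroup E] [NormedSpace ℝ E] [CompleteSpace E]
    {f : Plane → E} (hf : LocallyIntegrable f) : ∀ᵐ x, Tendsto
      (fun k => (bumpN k ⋆[lsmul ℝ ℝ] f) x) atTop (𝓝 (f x)) := by
  refine ContDiffBump.ae_convolution_tendsto_right_of_locallyIntegrable (K := 2) tendsto_bump_rOut
    (.of_forall fun k => ?_) hf
  change 1 / ((k : ℝ) + 1) ≤ 2 * (1 / (2 * ((k : ℝ) + 1)))
  have : (0 : ℝ) < (k : ℝ) + 1 := by positivity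
  rw [← mul_div_assoc, mul_one, div_le_div_iff₀ (by positivity) (by positivity)]
  linarith

lemma tendsto_moll_of_continuous {f : Plane → ℂ} (hf : Continuous f) (x : Plane) :
    Tendsto (fun k => moll k f x) atTop (𝓝 (f x)) :=
  ContDiffBump.convolution_tendsto_right_of_continuous tendsto_bump_rOut hf x

/-- Mollification of non-negative functions. -/
def mollE (k : ℕ) (h : Plane → ℝ≥0∞) (x : Plane) : ℝ≥0∞ :=
  ∫⁻ y, ofReal (bumpN k (x - y)) * h y

lemma measurable_bumpN_sub (k : ℕ) :
    Measurable fun q : Plane × Plane => ofReal (bumpN k (q.1 - q.2)) :=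
  ((contDiff_bumpN k).continuous.measurable.comp (measurable_fst.sub measurable_snd)).ennreal_ofReal

lemma measurable_bumpN_sub_right (k : ℕ) (x : Plane) :
    Measurable fun y : Plane => ofReal (bumpN k (x - y)) :=
  ((contDiff_bumpN k).continuous.comp (continuous_const.sub continuous_id)).measurable.ennreal_ofReal

lemma measurable_bumpN_sub_left (k : ℕ) (y : Plane) :
    Measurable fun x : Plane => ofReal (bumpN k (x - y)) :=
  ((contDiff_bumpN k).continuous.comp (continuous_id.sub continuous_const)).measurable.ennreal_ofReal

lemma measurable_mollE (k : ℕ) {h : Plane → ℝ≥0∞} (hh : Measurable h) : Measurable (mollE k h) :=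
  Measurable.lintegral_prod_right'
    (f := fun q : Plane × Plane => ofReal (bumpN k (q.1 - q.2)) * h q.2)
    ((measurable_bumpN_sub k).mul (hh.comp measurable_snd))

lemma lintegral_bumpN_sub_left (k : ℕ) (y : Plane) :
    ∫⁻ x, ofReal (bumpN k (x - y)) = 1 := by
  rw [lintegral_sub_right_eq_self (fun x => ofReal (bumpN k x)) y,
    ← ofReal_integral_eq_lintegral_ofReal ((contDiff_bumpN k).continuous.integrable_of_hasCompactSupport
      (hasCompactSupport_bumpN k)) (.of_forall fun x => bumpN_nonneg k x)]
  rw [show ∫ x, bumpN k x = 1 from (bump k).integral_normed, ENNReal.ofReal_one]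

lemma lintegral_bumpN_sub_right (k : ℕ) (x : Plane) :
    ∫⁻ y, ofReal (bumpN k (x - y)) = 1 := by
  rw [lintegral_sub_left_eq_self (fun x => ofReal (bumpN k x)) x]
  have := lintegral_bumpN_sub_left k 0
  simpa using this

lemma lintegral_mollE (k : ℕ) {h : Plane → ℝ≥0∞} (hh : Measurable h) :
    ∫⁻ x, mollE k h x = ∫⁻ x, h x := by
  simp only [mollE]
  rw [lintegral_lintegral_swap ((measurable_bumpN_sub k).mul (hh.comp measurable_snd)).aemeasurable]
  refine lintegral_congr fun y => ?_
  rw [lintegral_mul_const _ (measurable_bumpN_sub_left k y),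
    lintegral_bumpN_sub_left, one_mul]

lemma mollE_sq_le (k : ℕ) {h : Plane → ℝ≥0∞} (hh : Measurable h) (x : Plane) :
    mollE k h x ^ 2 ≤ mollE k (fun y => h y ^ 2) x := by
  have hb := measurable_bumpN_sub_right k x
  set b : Plane → ℝ≥0∞ := fun y => ofReal (bumpN k (x - y))
  have h1 := ENNReal.lintegral_mul_le_Lp_mul_Lq (μ := (volume : Measure Plane).withDensity b)
    Real.HolderConjugate.two_two (f := h) (g := fun _ => 1) hh.aemeasurable aemeasurable_const
  have hw : ∀ φ : Plane → ℝ≥0∞, Measurable φ →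
      ∫⁻ y, φ y ∂(volume : Measure Plane).withDensity b = ∫⁻ y, b y * φ y := fun φ hφ =>
    lintegral_withDensity_eq_lintegral_mul _ hb hφ
  simp only [Pi.mul_apply, mul_one, ENNReal.rpow_two, one_pow] at h1
  rw [hw _ hh, hw _ (hh.pow_const 2), hw _ measurable_const] at h1
  simp only [mul_one] at h1
  rw [show ∫⁻ y, b y = 1 from lintegral_bumpN_sub_right k x, ENNReal.one_rpow, mul_one] at h1
  calc mollE k h x ^ 2 ≤ ((∫⁻ y, b y * h y ^ 2) ^ (1 / 2 : ℝ)) ^ 2 := by gcongr; exact h1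
    _ = mollE k (fun y => h y ^ 2) x := by
      rw [← ENNReal.rpow_two, ← ENNReal.rpow_mul]; norm_num; rfl

lemma enorm_moll_le (k : ℕ) (f : Plane → ℂ) (x : Plane) :
    ‖moll k f x‖ₑ ≤ mollE k (fun y => ‖f y‖ₑ) x := by
  rw [moll, convolution_eq_swap]
  refine (enorm_integral_le_lintegral_enorm _).trans (le_of_eq ?_)
  refine lintegral_congr fun y => ?_
  rw [lsmul_apply, enorm_smul, Real.enorm_eq_ofReal (bumpN_nonneg k _)]

lemma jap_le_two_mul {x y : Plane} (h : ‖x - y‖ ≤ 1) : jap ‖x‖ ≤ 2 * jap ‖y‖ := by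
  have h1 : ‖x‖ ≤ ‖y‖ + 1 := by
    have := norm_le_norm_add_norm_sub' x y
    linarith
  rw [jap, Real.sqrt_le_left (by have := jap_pos ‖y‖; positivity), mul_pow, jap_sq]
  nlinarith [norm_nonneg x, norm_nonneg y, sq_nonneg (‖y‖ - 1)]

lemma bumpN_eq_zero {k : ℕ} {x y : Plane} (h : 1 < ‖x - y‖) : bumpN k (x - y) = 0 := by
  have h1 : x - y ∉ Function.support (bumpN k) := by
    rw [bumpN, (bump k).support_normed_eq, mem_ball_zero_iff, not_lt]
    refine le_trans ?_ h.le
    change 1 / ((k : ℝ) + 1) ≤ 1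
    rw [div_le_one (by positivity)]
    have : (0 : ℝ) ≤ k := Nat.cast_nonneg k
    linarith
  exact Function.notMem_support.1 h1

/-- Mollification commutes with polynomial weights up to constants. -/
lemma weight_mollE_le (k n : ℕ) {h : Plane → ℝ≥0∞} (x : Plane) :
    ofReal (jap ‖x‖ ^ n) * mollE k h x
      ≤ ofReal (2 ^ n) * mollE k (fun y => ofReal (jap ‖y‖ ^ n) * h y) x := by
  rw [mollE, mollE, ← lintegral_const_mul' _ _ ofReal_ne_top,
    ← lintegral_const_mul' _ _ ofReal_ne_top]
  refine lintegral_mono fun y => ?_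
  simp only []
  by_cases hxy : ‖x - y‖ ≤ 1
  · have h1 : jap ‖x‖ ^ n ≤ 2 ^ n * jap ‖y‖ ^ n := by
      rw [← mul_pow]
      exact pow_le_pow_left₀ (jap_pos _).le (jap_le_two_mul hxy) n
    calc _ ≤ ofReal (2 ^ n * jap ‖y‖ ^ n) * (ofReal (bumpN k (x - y)) * h y) := by
          gcongr
      _ = _ := by rw [ofReal_mul (by positivity)]; ring
  · rw [bumpN_eq_zero (not_le.1 hxy)]; simp

/-- Convergence of the mollifications of an integrable function. -/
lemma ae_tendsto_mollE {h : Plane → ℝ≥0∞} (hh : Measurable h) (hfin : ∫⁻ x, h x ≠ ⊤) :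
    ∀ᵐ x, Tendsto (fun k => mollE k h x) atTop (𝓝 (h x)) := by
  have hItg : Integrable fun x => (h x).toReal := integrable_toReal_of_lintegral_ne_top hh.aemeasurable hfin
  have hae := ae_lt_top hh hfin
  filter_upwards [ae_tendsto_convolution hItg.locallyIntegrable, hae] with x hx hxt
  have h1 := ENNReal.tendsto_ofReal hx
  rw [ofReal_toReal hxt.ne] at h1
  refine h1.congr fun k => ?_
  rw [convolution_eq_swap]
  simp only [lsmul_apply, smul_eq_mul]
  rw [ofReal_integral_eq_lintegral_ofReal]
  · refine lintegral_congr_ae ?_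
    filter_upwards [hae] with y hy
    rw [ofReal_mul (bumpN_nonneg k _), ofReal_toReal hy.ne]
  · obtain ⟨M, hM⟩ := (contDiff_bumpN k).continuous.bounded_above_of_compact_support
      (hasCompactSupport_bumpN k)
    exact hItg.bdd_mul (c := M) ((contDiff_bumpN k).continuous.comp
      (continuous_const.sub continuous_id)).aestronglyMeasurable (.of_forall fun y => hM _)
  · exact Eventually.of_forall fun y => mul_nonneg (bumpN_nonneg k _) ENNReal.toReal_nonneg

open scoped Convolution

/-! ### Approximation by smooth functions with compact support -/

/-- A smooth cutoff at scale one. -/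
def bumpOne : ContDiffBump (0 : Plane) where
  rIn := 1
  rOut := 2
  rIn_pos := one_pos
  rIn_lt_rOut := one_lt_two

/-- The scales of the cutoffs. -/
def cScale (k : ℕ) : ℝ := ((k : ℝ) + 1)⁻¹

lemma cScale_pos (k : ℕ) : 0 < cScale k := by unfold cScale; positivity

/-- Cutoffs at scale `k + 1`. -/
def chi (k : ℕ) (x : Plane) : ℂ := (bumpOne (cScale k • x) : ℝ)

lemma fderiv_comp_smul_scale {E F : Type*} [NormedAddCommGroup E] [NormedSpace ℝ E]
    [NormedAddCommGroup F] [NormedSpace ℝ F] {f : E → F} (hf : Differentiable ℝ f) (c : ℝ) (x : E) :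
    fderiv ℝ (fun x => f (c • x)) x = c • fderiv ℝ f (c • x) := by
  have h : HasFDerivAt (fun x : E => c • x) (c • ContinuousLinearMap.id ℝ E) x :=
    (hasFDerivAt_id x).const_smul c
  have h2 := (hf (c • x)).hasFDerivAt.comp x h
  rw [show fderiv ℝ (fun x => f (c • x)) x = _ from h2.fderiv]
  ext v; simp

lemma contDiff_bumpOne : ContDiff ℝ 2 fun x : Plane => ((bumpOne x : ℝ) : ℂ) :=
  Complex.ofRealCLM.contDiff.comp bumpOne.contDiff

lemma contDiff_chi (k : ℕ) : ContDiff ℝ 2 (chi k) :=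
  contDiff_bumpOne.comp (contDiff_const_smul (cScale k))

lemma norm_chi_le (k : ℕ) (x : Plane) : ‖chi k x‖ ≤ 1 := by
  rw [chi, norm_real, norm_eq_abs, abs_of_nonneg bumpOne.nonneg]
  exact bumpOne.le_one

lemma hasCompactSupport_chi (k : ℕ) : HasCompactSupport (chi k) := by
  have h : HasCompactSupport fun x : Plane => ((bumpOne x : ℝ) : ℂ) :=
    bumpOne.hasCompactSupport.comp_left (g := fun r : ℝ => (r : ℂ)) Complex.ofReal_zero
  exact h.comp_homeomorph (Homeomorph.smulOfNeZero (cScale k) (cScale_pos k).ne')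

lemma eventually_chi_eq_one (x : Plane) : ∀ᶠ k in atTop, chi k =ᶠ[𝓝 x] fun _ => 1 := by
  have h : Tendsto (fun k => cScale k * (‖x‖ + 1)) atTop (𝓝 (0 * (‖x‖ + 1))) :=
    (tendsto_one_div_add_atTop_nhds_zero_nat.congr fun k => by simp [cScale]).mul_const _
  rw [zero_mul] at h
  filter_upwards [h.eventually (gt_mem_nhds one_pos)] with k hk
  filter_upwards [Metric.ball_mem_nhds x one_pos] with y hy
  have h1 : ‖y‖ ≤ ‖x‖ + 1 := by
    rw [mem_ball_iff_norm] at hy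
    have := norm_le_norm_add_norm_sub' y x
    linarith
  have h2 : cScale k • y ∈ Metric.closedBall (0 : Plane) bumpOne.rIn := by
    rw [mem_closedBall_zero_iff, norm_smul, norm_eq_abs, abs_of_pos (cScale_pos k)]
    exact (mul_le_mul_of_nonneg_left h1 (cScale_pos k).le).trans hk.le
  rw [chi, bumpOne.one_of_mem_closedBall h2, Complex.ofReal_one]

lemma cScale_le {k : ℕ} {x : Plane} (h : ‖cScale k • x‖ ≤ 2) : cScale k ≤ 3 * rinv x := by
  have hc := cScale_pos k
  have hk : cScale k ≤ 1 := by
    rw [cScale]; exact inv_le_one_of_one_le₀ (by linarith [Nat.cast_nonneg (α := ℝ) k])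
  rw [norm_smul, norm_eq_abs, abs_of_pos hc] at h
  rw [rinv, ← div_eq_mul_inv, le_div_iff₀ (jap_pos _)]
  have h1 : jap ‖x‖ ≤ 1 + ‖x‖ := by
    rw [jap, Real.sqrt_le_left (by positivity)]; nlinarith [norm_nonneg x]
  nlinarith

lemma exists_chi_bound : ∃ C : ℝ, 1 ≤ C ∧ ∀ k x, ‖fderiv ℝ (chi k) x‖ ≤ C * rinv x ∧
    ‖fderiv ℝ (fderiv ℝ (chi k)) x‖ ≤ C * rinv x ^ 2 := by
  set f : Plane → ℂ := fun x => ((bumpOne x : ℝ) : ℂ) with hf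
  have hfc : HasCompactSupport f :=
    bumpOne.hasCompactSupport.comp_left (g := fun r : ℝ => (r : ℂ)) Complex.ofReal_zero
  have hd := contDiff_bumpOne
  have hd1 : ContDiff ℝ 1 (fderiv ℝ f) := hd.fderiv_right (m := 1) (by norm_num)
  obtain ⟨C₁, h₁⟩ := hd1.continuous.bounded_above_of_compact_support (hfc.fderiv (𝕜 := ℝ))
  obtain ⟨C₂, h₂⟩ := (hd1.continuous_fderiv one_ne_zero).bounded_above_of_compact_support
    ((hfc.fderiv (𝕜 := ℝ)).fderiv (𝕜 := ℝ))
  have hC₁ : 0 ≤ C₁ := (norm_nonneg _).trans (h₁ 0)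
  have hC₂ : 0 ≤ C₂ := (norm_nonneg _).trans (h₂ 0)
  have hsupp : ∀ x : Plane, 2 < ‖x‖ → x ∉ tsupport f := fun x hx h => by
    have h1 : tsupport f ⊆ tsupport bumpOne := closure_mono fun y hy => by
      contrapose! hy
      simp only [Function.notMem_support] at hy ⊢
      simp [hf, hy]
    have h2 := h1 h
    rw [bumpOne.tsupport_eq, mem_closedBall_zero_iff] at h2
    exact absurd h2 (not_le.2 hx)
  have e1 : ∀ k, fderiv ℝ (chi k) = fun x => cScale k • fderiv ℝ f (cScale k • x) := fun k => by
    ext1 x; exact fderiv_comp_smul_scale (hd.differentiable two_ne_zero) _ x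
  have e2 : ∀ k x, fderiv ℝ (fderiv ℝ (chi k)) x
      = cScale k • cScale k • fderiv ℝ (fderiv ℝ f) (cScale k • x) := fun k x => by
    rw [e1]
    have hdd : Differentiable ℝ (fderiv ℝ f) := hd1.differentiable one_ne_zero
    have h3 : DifferentiableAt ℝ (fun x => fderiv ℝ f (cScale k • x)) x :=
      (hdd _).comp x ((differentiable_id.const_smul (cScale k)) x)
    rw [fderiv_fun_const_smul h3, fderiv_comp_smul_scale hdd]
  refine ⟨1 + 3 * C₁ + 9 * C₂, by linarith, fun k x => ?_⟩
  have hr := rinv_pos x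
  by_cases hx : ‖cScale k • x‖ ≤ 2
  · have hc := cScale_le hx
    have hc0 := (cScale_pos k).le
    constructor
    · rw [e1]; simp only []
      rw [norm_smul, norm_eq_abs, abs_of_nonneg hc0]
      calc cScale k * ‖fderiv ℝ f (cScale k • x)‖ ≤ (3 * rinv x) * C₁ := by gcongr; exact h₁ _
        _ ≤ _ := by nlinarith [mul_nonneg hC₂ hr.le]
    · rw [e2, norm_smul, norm_smul, norm_eq_abs, abs_of_nonneg hc0]
      calc cScale k * (cScale k * ‖fderiv ℝ (fderiv ℝ f) (cScale k • x)‖)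
          ≤ (3 * rinv x) * ((3 * rinv x) * C₂) := by gcongr; exact h₂ _
        _ ≤ _ := by nlinarith [mul_nonneg hC₁ (sq_nonneg (rinv x)), sq_nonneg (rinv x)]
  · have h0 := hsupp _ (not_le.1 hx)
    have h1 : fderiv ℝ f (cScale k • x) = 0 :=
      image_eq_zero_of_notMem_tsupport fun h => h0 (tsupport_fderiv_subset ℝ h)
    have h2 : fderiv ℝ (fderiv ℝ f) (cScale k • x) = 0 :=
      image_eq_zero_of_notMem_tsupport fun h =>
        h0 (tsupport_fderiv_subset ℝ (tsupport_fderiv_subset ℝ h))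
    constructor
    · rw [e1]; simp only []; rw [h1, smul_zero, norm_zero]; positivity
    · rw [e2, h2, smul_zero, smul_zero]
      exact (le_of_eq (norm_zero (E := Plane →L[ℝ] Plane →L[ℝ] ℂ))).trans (by positivity)

/-- Smooth approximations with compact support. -/
def approx (k : ℕ) (f : Plane → ℂ) (x : Plane) : ℂ := chi k x * moll k f x

/-- The weighted square density of a function and its derivatives. -/
def dens (f : Plane → ℂ) (g₁ : Fin 2 → Plane → ℂ) (g₂ : Fin 2 → Fin 2 → Plane → ℂ) (x : Plane) :
    ℝ≥0∞ :=
  ofReal (jap ‖x‖ ^ 4) *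
    (‖f x‖ₑ ^ 2 + ∑ i, ‖g₁ i x‖ₑ ^ 2 + ∑ i, ∑ j, ‖g₂ i j x‖ₑ ^ 2)

lemma continuous_jap_norm : Continuous fun x : Plane => jap ‖x‖ := by unfold jap; fun_prop

lemma measurable_japPow (n : ℕ) : Measurable fun x : Plane => ofReal (jap ‖x‖ ^ n) :=
  (continuous_jap_norm.pow n).measurable.ennreal_ofReal

lemma enorm_weight_le_iff {z : ℂ} {x : Plane} {Y : ℝ} (hY : 0 ≤ Y) :
    ofReal (jap ‖x‖ ^ 4) * ‖z‖ₑ ^ 2 ≤ ofReal (Y ^ 2) ↔ ‖z‖ ≤ rinv x ^ 2 * Y := by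
  have hj := jap_pos ‖x‖
  rw [← ofReal_norm, ← ofReal_pow (norm_nonneg _), ← ofReal_mul (by positivity),
    ENNReal.ofReal_le_ofReal_iff (by positivity), show jap ‖x‖ ^ 4 * ‖z‖ ^ 2 = (jap ‖x‖ ^ 2 * ‖z‖) ^ 2 by ring,
    pow_le_pow_iff_left₀ (by positivity) hY two_ne_zero, rinv, inv_pow, mul_comm (_)⁻¹,
    ← div_eq_mul_inv, le_div_iff₀ (by positivity), mul_comm]

section Approx

variable {f : Plane → ℂ} {g₁ : Fin 2 → Plane → ℂ} {g₂ : Fin 2 → Fin 2 → Plane → ℂ}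

lemma WeakJet.measurable_dens (h : WeakJet f g₁ g₂) : Measurable (dens f g₁ g₂) := by
  refine (measurable_japPow 4).mul (((h.continuous.measurable.enorm.pow_const 2).add
    (Finset.measurable_fun_sum _ fun i _ => (h.measurable₁ i).enorm.pow_const 2)).add
    (Finset.measurable_fun_sum _ fun i _ => Finset.measurable_fun_sum _ fun j _ =>
      (h.measurable₂ i j).enorm.pow_const 2))

lemma dens_ge_zero (x : Plane) : ofReal (jap ‖x‖ ^ 4) * ‖f x‖ₑ ^ 2 ≤ dens f g₁ g₂ x := by
  unfold dens; gcongr; rw [add_assoc]; exact le_self_add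

lemma dens_ge_one (i : Fin 2) (x : Plane) :
    ofReal (jap ‖x‖ ^ 4) * ‖g₁ i x‖ₑ ^ 2 ≤ dens f g₁ g₂ x := by
  unfold dens; gcongr
  refine le_trans (Finset.single_le_sum (f := fun i => ‖g₁ i x‖ₑ ^ 2) (fun _ _ => zero_le)
    (Finset.mem_univ i)) ?_
  exact le_add_right le_add_self

lemma dens_ge_two (i j : Fin 2) (x : Plane) :
    ofReal (jap ‖x‖ ^ 4) * ‖g₂ i j x‖ₑ ^ 2 ≤ dens f g₁ g₂ x := by
  unfold dens; gcongr
  refine le_trans (Finset.single_le_sum (f := fun j => ‖g₂ i j x‖ₑ ^ 2) (fun _ _ => zero_le)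
    (Finset.mem_univ j)) ?_
  refine le_trans (Finset.single_le_sum (f := fun i => ∑ j, ‖g₂ i j x‖ₑ ^ 2) (fun _ _ => zero_le)
    (Finset.mem_univ i)) le_add_self

lemma weight_enorm_sq_moll_le (k : ℕ) {g : Plane → ℂ} (hg : Measurable g) {w : Plane → ℝ≥0∞}
    (hw : ∀ x, ofReal (jap ‖x‖ ^ 4) * ‖g x‖ₑ ^ 2 ≤ w x) (x : Plane) :
    ofReal (jap ‖x‖ ^ 4) * ‖moll k g x‖ₑ ^ 2 ≤ 16 * mollE k w x := by
  calc ofReal (jap ‖x‖ ^ 4) * ‖moll k g x‖ₑ ^ 2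
      ≤ ofReal (jap ‖x‖ ^ 4) * mollE k (fun y => ‖g y‖ₑ ^ 2) x := by
        gcongr
        exact (pow_le_pow_left₀ zero_le (enorm_moll_le k g x) 2).trans (mollE_sq_le k hg.enorm x)
    _ ≤ ofReal (2 ^ 4) * mollE k (fun y => ofReal (jap ‖y‖ ^ 4) * ‖g y‖ₑ ^ 2) x :=
        weight_mollE_le k 4 x
    _ ≤ 16 * mollE k w x := by
        have : ofReal (2 ^ 4) = 16 := by norm_num
        rw [this]
        gcongr
        exact lintegral_mono fun y => by gcongr; exact hw y

lemma norm_moll_le_of_mollE {k : ℕ} {g : Plane → ℂ} (hg : Measurable g) {w : Plane → ℝ≥0∞}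
    (hw : ∀ x, ofReal (jap ‖x‖ ^ 4) * ‖g x‖ₑ ^ 2 ≤ w x) {x : Plane} {Y : ℝ} (hY : 0 ≤ Y)
    (h : mollE k w x ≤ ofReal (Y ^ 2)) : ‖moll k g x‖ ≤ 4 * (rinv x ^ 2 * Y) := by
  have h1 := weight_enorm_sq_moll_le k hg hw x
  have h2 : ofReal (jap ‖x‖ ^ 4) * ‖moll k g x‖ₑ ^ 2 ≤ ofReal ((4 * Y) ^ 2) := by
    refine h1.trans ?_
    rw [mul_pow, ofReal_mul (by positivity)]
    have : ofReal (4 ^ 2) = 16 := by norm_num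
    rw [this]; gcongr
  have := (enorm_weight_le_iff (by positivity)).1 h2
  linarith

lemma WeakJet.contDiff_moll (h : WeakJet f g₁ g₂) (k : ℕ) : ContDiff ℝ 2 (moll k f) := by
  exact_mod_cast contDiff_infty.1 (contDiff_convolution (contDiff_bumpN k) (hasCompactSupport_bumpN k)
    h.continuous.locallyIntegrable) 2

lemma WeakJet.contDiff_approx (h : WeakJet f g₁ g₂) (k : ℕ) : ContDiff ℝ 2 (approx k f) :=
  (contDiff_chi k).mul (h.contDiff_moll k)

lemma hasCompactSupport_approx (k : ℕ) (f : Plane → ℂ) : HasCompactSupport (approx k f) :=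
  (hasCompactSupport_chi k).mul_right

lemma WeakJet.fderiv_approx (h : WeakJet f g₁ g₂) (k : ℕ) (x : Plane) (i : Fin 2) :
    fderiv ℝ (approx k f) x (basisVec i)
      = fderiv ℝ (chi k) x (basisVec i) * moll k f x + chi k x * moll k (g₁ i) x := by
  rw [show approx k f = fun x => chi k x * moll k f x from rfl,
    fderiv_mul_apply (contDiff_chi k) (h.contDiff_moll k)]
  congr 2
  exact h.fderiv_convolution (contDiff_bumpN k) (hasCompactSupport_bumpN k) x i

lemma WeakJet.hess_approx (h : WeakJet f g₁ g₂) (k : ℕ) (x : Plane) (i j : Fin 2) :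
    hess (approx k f) x (basisVec i) (basisVec j)
      = hess (chi k) x (basisVec i) (basisVec j) * moll k f x
        + fderiv ℝ (chi k) x (basisVec j) * moll k (g₁ i) x
        + fderiv ℝ (chi k) x (basisVec i) * moll k (g₁ j) x + chi k x * moll k (g₂ i j) x := by
  have e := fun i => h.fderiv_convolution (contDiff_bumpN k) (hasCompactSupport_bumpN k) x i
  have e2 := h.hess_convolution (contDiff_bumpN k) (hasCompactSupport_bumpN k) x i j
  rw [show approx k f = fun x => chi k x * moll k f x from rfl,
    hess_mul (contDiff_chi k) (h.contDiff_moll k)]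
  change _ * moll k f x + _ * fderiv ℝ (moll k f) x (basisVec i) + _ * fderiv ℝ (moll k f) x (basisVec j)
    + _ * hess (moll k f) x (basisVec i) (basisVec j) = _
  rw [show fderiv ℝ (moll k f) x (basisVec i) = moll k (g₁ i) x from e i,
    show fderiv ℝ (moll k f) x (basisVec j) = moll k (g₁ j) x from e j,
    show hess (moll k f) x (basisVec i) (basisVec j) = moll k (g₂ i j) x from e2]

/-- Pointwise bounds for the approximations. -/
lemma exists_approx_bound : ∃ C : ℝ, 1 ≤ C ∧ ∀ {f : Plane → ℂ} {g₁ : Fin 2 → Plane → ℂ}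
    {g₂ : Fin 2 → Fin 2 → Plane → ℂ}, WeakJet f g₁ g₂ → ∀ (k : ℕ) (x : Plane) (Y : ℝ), 0 ≤ Y →
    mollE k (dens f g₁ g₂) x ≤ ofReal (Y ^ 2) →
    ‖approx k f x‖ ≤ C * (rinv x ^ 2 * Y) ∧
    (∀ i, ‖fderiv ℝ (approx k f) x (basisVec i)‖ ≤ C * (rinv x ^ 2 * Y)) ∧
    (∀ i j, ‖hess (approx k f) x (basisVec i) (basisVec j)‖ ≤ C * (rinv x ^ 2 * Y)) := by
  obtain ⟨C, hC, hchi⟩ := exists_chi_bound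
  refine ⟨16 * C, by linarith, fun {f g₁ g₂} h k x Y hY hle => ?_⟩
  have m0 := norm_moll_le_of_mollE h.continuous.measurable dens_ge_zero hY hle
  have m1 := fun i => norm_moll_le_of_mollE (h.measurable₁ i) (dens_ge_one i) hY hle
  have m2 := fun i j => norm_moll_le_of_mollE (h.measurable₂ i j) (dens_ge_two i j) hY hle
  set Z := rinv x ^ 2 * Y
  have hr := rinv_pos x
  have hr1 := rinv_le_one x
  have hZ0 : 0 ≤ Z := by positivity
  have c0 := norm_chi_le k x
  have c1 : ∀ i, ‖fderiv ℝ (chi k) x (basisVec i)‖ ≤ C := fun i => by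
    refine (le_opNorm _ _).trans ?_
    rw [norm_basisVec, mul_one]
    exact (hchi k x).1.trans (mul_le_of_le_one_right (by linarith) hr1)
  have c2 : ∀ i j, ‖hess (chi k) x (basisVec i) (basisVec j)‖ ≤ C := fun i j => by
    refine (norm_hess_le _ _ _ _).trans ?_
    rw [norm_basisVec, norm_basisVec, mul_one, mul_one]
    exact (hchi k x).2.trans (mul_le_of_le_one_right (by linarith) (pow_le_one₀ hr.le hr1))
  have hCZ : Z ≤ C * Z := le_mul_of_one_le_left hZ0 hC
  refine ⟨?_, fun i => ?_, fun i j => ?_⟩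
  · rw [approx, norm_mul]
    calc _ ≤ 1 * (4 * Z) := by gcongr
      _ ≤ _ := by linarith
  · rw [h.fderiv_approx]
    refine (norm_add_le _ _).trans ?_
    rw [norm_mul, norm_mul]
    calc _ ≤ C * (4 * Z) + 1 * (4 * Z) := by gcongr <;> first | exact c1 i | exact m1 i
      _ ≤ _ := by linarith
  · rw [h.hess_approx]
    refine norm_add₄_le.trans ?_
    simp only [norm_mul]
    calc _ ≤ C * (4 * Z) + C * (4 * Z) + C * (4 * Z) + 1 * (4 * Z) := by
          gcongr <;> first | exact c1 _ | exact m1 _ | exact c2 i j | exact m2 i j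
      _ ≤ _ := by linarith

lemma norm_moll_le {f : Plane → ℂ} {m : ℝ} (hm : ∀ x, ‖f x‖ ≤ m) (k : ℕ) (x : Plane) :
    ‖moll k f x‖ ≤ m := by
  have hm0 : 0 ≤ m := (norm_nonneg _).trans (hm 0)
  have h := enorm_moll_le k f x
  have h2 : mollE k (fun y => ‖f y‖ₑ) x ≤ ofReal m := by
    calc _ ≤ ∫⁻ y, ofReal (bumpN k (x - y)) * ofReal m := by
          refine lintegral_mono fun y => ?_
          simp only []
          rw [← ofReal_norm]; gcongr; exact hm y
      _ = ofReal m := by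
          rw [lintegral_mul_const _ (measurable_bumpN_sub_right k x), lintegral_bumpN_sub_right, one_mul]
  have h3 := h.trans h2
  rwa [← ofReal_norm, ENNReal.ofReal_le_ofReal_iff hm0] at h3

lemma norm_approx_le {f : Plane → ℂ} {m : ℝ} (hm : ∀ x, ‖f x‖ ≤ m) (k : ℕ) (x : Plane) :
    ‖approx k f x‖ ≤ m := by
  rw [approx, norm_mul]
  calc _ ≤ 1 * m := by
        gcongr
        · exact norm_chi_le k x
        · exact norm_moll_le hm k x
    _ = m := one_mul m

/-- Almost everywhere convergence of the approximations and their derivatives. -/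
lemma WeakJet.tendsto_approx (h : WeakJet f g₁ g₂) : (∀ x, Tendsto (fun k => approx k f x) atTop (𝓝 (f x))) ∧
    ∀ᵐ x, (∀ i, Tendsto (fun k => fderiv ℝ (approx k f) x (basisVec i)) atTop (𝓝 (g₁ i x))) ∧
      ∀ i j, Tendsto (fun k => hess (approx k f) x (basisVec i) (basisVec j)) atTop (𝓝 (g₂ i j x)) := by
  have key : ∀ x, ∀ᶠ k in atTop, chi k x = 1 ∧ fderiv ℝ (chi k) x = 0 ∧
      fderiv ℝ (fderiv ℝ (chi k)) x = 0 := fun x => by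
    filter_upwards [eventually_chi_eq_one x] with k hk
    refine ⟨hk.self_of_nhds, by rw [hk.fderiv_eq]; simp, ?_⟩
    rw [hk.fderiv.fderiv_eq]; simp
  constructor
  · intro x
    refine (tendsto_moll_of_continuous h.continuous x).congr' ?_
    filter_upwards [key x] with k hk
    rw [approx, hk.1, one_mul]
  · have a1 : ∀ i, ∀ᵐ x, Tendsto (fun k => moll k (g₁ i) x) atTop (𝓝 (g₁ i x)) := fun i =>
      ae_tendsto_convolution (h.weak₁ i).2.1
    have a2 : ∀ i j, ∀ᵐ x, Tendsto (fun k => moll k (g₂ i j) x) atTop (𝓝 (g₂ i j x)) := fun i j =>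
      ae_tendsto_convolution (h.weak₂ i j).2.1
    filter_upwards [ae_all_iff.2 a1, ae_all_iff.2 fun i => ae_all_iff.2 (a2 i)] with x h1 h2
    refine ⟨fun i => (h1 i).congr' ?_, fun i j => (h2 i j).congr' ?_⟩
    · filter_upwards [key x] with k hk
      rw [h.fderiv_approx, hk.1, hk.2.1]; simp
    · filter_upwards [key x] with k hk
      rw [h.hess_approx, hess, hk.1, hk.2.1, hk.2.2]; simp

end Approx

/-! ### Bounds by the Sobolev norm -/

section Bounds

variable {f : Plane → ℂ} {g₁ : Fin 2 → Plane → ℂ} {g₂ : Fin 2 → Fin 2 → Plane → ℂ}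

lemma lintegral_weight_le {α : ℕ × ℕ} {f g : Plane → ℂ} (h : HasWeakDeriv α f g) (hα : α.1 + α.2 ≤ 2) :
    ∫⁻ x, ofReal (jap ‖x‖ ^ 4) * ‖g x‖ₑ ^ 2 ≤ sobolevNorm 2 2 f ^ 2 := by
  have e := eLpNorm_nnreal_pow_eq_lintegral (f := fun x : Plane => (jap ‖x‖ ^ (2 : ℝ)) • g x)
    (μ := volume) (p := 2) two_ne_zero
  have h1 := h.eLpNorm_le (s := 2) hα
  calc _ = ∫⁻ x, ‖(jap ‖x‖ ^ (2 : ℝ)) • g x‖ₑ ^ (((2 : NNReal)) : ℝ) := by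
        refine lintegral_congr fun x => ?_
        have hj := (jap_pos ‖x‖).le
        rw [enorm_smul, NNReal.coe_ofNat, ENNReal.rpow_two, mul_pow, Real.rpow_two,
          Real.enorm_of_nonneg (by positivity), ← ofReal_pow (by positivity), ← pow_mul]
    _ = eLpNorm (fun x : Plane => (jap ‖x‖ ^ (2 : ℝ)) • g x) 2 volume ^ 2 := by
        rw [← e, NNReal.coe_ofNat, ENNReal.rpow_two]; rfl
    _ ≤ _ := by gcongr

lemma WeakJet.lintegral_dens_le (h : WeakJet f g₁ g₂) :
    ∫⁻ x, dens f g₁ g₂ x ≤ 7 * sobolevNorm 2 2 f ^ 2 := by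
  have h0 := lintegral_weight_le (hasWeakDeriv_zero h.continuous.locallyIntegrable) (by norm_num)
  have h1 := fun i => lintegral_weight_le (h.weak₁ i) (by rw [idx_sum]; norm_num)
  have h2 := fun i j => lintegral_weight_le (h.weak₂ i j) (by rw [idx_add_sum])
  have m1 : ∀ i, Measurable fun x => ofReal (jap ‖x‖ ^ 4) * ‖g₁ i x‖ₑ ^ 2 := fun i =>
    (measurable_japPow 4).mul ((h.measurable₁ i).enorm.pow_const 2)
  have m2 : ∀ i j, Measurable fun x => ofReal (jap ‖x‖ ^ 4) * ‖g₂ i j x‖ₑ ^ 2 := fun i j =>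
    (measurable_japPow 4).mul ((h.measurable₂ i j).enorm.pow_const 2)
  calc _ = (∫⁻ x, ofReal (jap ‖x‖ ^ 4) * ‖f x‖ₑ ^ 2) +
        (∑ i, ∫⁻ x, ofReal (jap ‖x‖ ^ 4) * ‖g₁ i x‖ₑ ^ 2) +
        ∑ i, ∑ j, ∫⁻ x, ofReal (jap ‖x‖ ^ 4) * ‖g₂ i j x‖ₑ ^ 2 := by
        simp only [dens, mul_add, Finset.mul_sum]
        rw [lintegral_add_right, lintegral_add_right, lintegral_finsetSum _ (fun i _ => m1 i),
          lintegral_finsetSum _ (fun i _ => Finset.measurable_fun_sum _ fun j _ => m2 i j)]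
        · congr 1
          exact Finset.sum_congr rfl fun i _ => lintegral_finsetSum _ fun j _ => m2 i j
        · exact Finset.measurable_fun_sum _ fun i _ => m1 i
        · exact Finset.measurable_fun_sum _ fun i _ => Finset.measurable_fun_sum _ fun j _ => m2 i j
    _ ≤ sobolevNorm 2 2 f ^ 2 + (∑ _i : Fin 2, sobolevNorm 2 2 f ^ 2) +
        ∑ _i : Fin 2, ∑ _j : Fin 2, sobolevNorm 2 2 f ^ 2 := by
        gcongr with i _ i _ j _
        · exact h1 i
        · exact h2 i j
    _ = _ := by simp only [Fin.sum_univ_two]; ring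

lemma lintegral_rinv_lt_top : ∫⁻ x : Plane, ofReal (rinv x ^ 4) < ⊤ := by
  have h := integrable_rpow_neg_one_add_norm_sq (E := Plane) (μ := volume) (r := 4) (by simp; norm_num)
  have e : (fun x : Plane => ((1 : ℝ) + ‖x‖ ^ 2) ^ (-(4 : ℝ) / 2)) = fun x => rinv x ^ 4 := by
    funext x
    rw [show (-(4 : ℝ) / 2) = -(2 : ℝ) by norm_num, Real.rpow_neg (by positivity), Real.rpow_two,
      ← jap_sq, rinv, inv_pow]
    ring
  rw [e] at h
  exact h.lintegral_lt_top

lemma exists_enorm_approx_bound : ∃ c : ℝ≥0∞, c ≠ ⊤ ∧ ∀ {f : Plane → ℂ} {g₁ : Fin 2 → Plane → ℂ}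
    {g₂ : Fin 2 → Fin 2 → Plane → ℂ}, WeakJet f g₁ g₂ → ∀ (k : ℕ) (x : Plane),
    (∀ i, ofReal (jap ‖x‖ ^ 4) * ‖fderiv ℝ (approx k f) x (basisVec i)‖ₑ ^ 2 ≤
      c * mollE k (dens f g₁ g₂) x) ∧
    ∀ i j, ofReal (jap ‖x‖ ^ 4) * ‖hess (approx k f) x (basisVec i) (basisVec j)‖ₑ ^ 2 ≤
      c * mollE k (dens f g₁ g₂) x := by
  obtain ⟨C, hC, hb⟩ := exists_approx_bound
  have hc : ofReal (C ^ 2) ≠ 0 := by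
    rw [Ne, ENNReal.ofReal_eq_zero, not_le]; positivity
  refine ⟨ofReal (C ^ 2), ofReal_ne_top, fun {f g₁ g₂} h k x => ?_⟩
  by_cases ht : mollE k (dens f g₁ g₂) x = ⊤
  · rw [ht, ENNReal.mul_top hc]
    exact ⟨fun _ => le_top, fun _ _ => le_top⟩
  · have hY : mollE k (dens f g₁ g₂) x =
        ofReal (√(mollE k (dens f g₁ g₂) x).toReal ^ 2) := by
      rw [Real.sq_sqrt ENNReal.toReal_nonneg, ofReal_toReal ht]
    obtain ⟨-, b1, b2⟩ := hb h k x _ (Real.sqrt_nonneg _) hY.le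
    have e : ofReal (C ^ 2) * mollE k (dens f g₁ g₂) x =
        ofReal ((C * √(mollE k (dens f g₁ g₂) x).toReal) ^ 2) := by
      rw [mul_pow, ofReal_mul (by positivity), ← hY]
    rw [e]
    constructor
    · intro i
      rw [enorm_weight_le_iff (by positivity)]
      exact (b1 i).trans_eq (by ring)
    · intro i j
      rw [enorm_weight_le_iff (by positivity)]
      exact (b2 i j).trans_eq (by ring)

/-- The plane as a product. -/
def planeMap (q : ℝ × ℝ) : Plane := q.1 • basisVec 0 + q.2 • basisVec 1

lemma planeMap_coord (x : Plane) : planeMap (x 0, x 1) = x := by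
  ext i; fin_cases i <;> simp [planeMap, basisVec]

lemma measurePreserving_planeMap : MeasurePreserving planeMap := by
  have h1 := (volume_preserving_finTwoArrow ℝ).symm
  have h2 := PiLp.volume_preserving_toLp (Fin 2)
  have h3 := h2.comp h1
  have e : planeMap = WithLp.toLp 2 ∘ (MeasurableEquiv.finTwoArrow (α := ℝ)).symm := by
    funext q
    ext i; fin_cases i <;> simp [planeMap, basisVec]
  rw [e]; exact h3

lemma enorm_le_lintegral_line {F : Type*} [NormedAddCommGroup F] [NormedSpace ℝ F] {v : Plane → F}
    (hv : ContDiff ℝ 1 v) (hc : HasCompactSupport v) (y w : Plane) (hw : ‖w‖ = 1) (s : ℝ) :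
    ‖v (s • w + y)‖ₑ ≤ ∫⁻ τ : ℝ, ‖fderiv ℝ v (τ • w + y) w‖ₑ := by
  have hcl : Topology.IsClosedEmbedding fun τ : ℝ => τ • w + y := by
    refine Isometry.isClosedEmbedding ?_
    refine Isometry.of_dist_eq fun a b => ?_
    rw [dist_eq_norm, dist_eq_norm, add_sub_add_right_eq_sub, ← sub_smul, norm_smul, hw, mul_one]
  have h1 : ContDiff ℝ 1 fun τ : ℝ => v (τ • w + y) := hv.comp (by fun_prop)
  have h2 : HasCompactSupport fun τ : ℝ => v (τ • w + y) := hc.comp_isClosedEmbedding hcl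
  refine (h2.enorm_le_lintegral_Ici_deriv h1 s).trans ?_
  refine (setLIntegral_le_lintegral _ _).trans (lintegral_mono fun τ => le_of_eq ?_)
  have hl : HasDerivAt (fun τ : ℝ => τ • w + y) w τ := by
    simpa using ((hasDerivAt_id τ).smul_const w).add_const y
  have := ((hv.differentiable one_ne_zero (τ • w + y)).hasFDerivAt.comp_hasDerivAt τ hl).deriv
  change ‖deriv (v ∘ fun τ : ℝ => τ • w + y) τ‖ₑ = _
  rw [this]

lemma enorm_le_lintegral_hess {v : Plane → ℂ} (hv : ContDiff ℝ 2 v) (hc : HasCompactSupport v)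
    (x : Plane) : ‖v x‖ₑ ≤ ∫⁻ y, ‖hess v y (basisVec 1) (basisVec 0)‖ₑ := by
  have hv' : ContDiff ℝ 1 fun y => fderiv ℝ v y (basisVec 0) :=
    (hv.fderiv_right (m := 1) (by norm_num)).clm_apply contDiff_const
  have hc' : HasCompactSupport fun y => fderiv ℝ v y (basisVec 0) := hc.fderiv_apply (𝕜 := ℝ) _
  have hm : Measurable fun y => ‖hess v y (basisVec 1) (basisVec 0)‖ₑ := by
    have : Continuous fun y => hess v y (basisVec 1) (basisVec 0) := by
      have := (hv.fderiv_right (m := 1) (by norm_num)).continuous_fderiv one_ne_zero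
      unfold hess; fun_prop
    exact this.measurable.enorm
  have e : x = x 0 • basisVec 0 + x 1 • basisVec 1 := (planeMap_coord x).symm
  calc ‖v x‖ₑ = ‖v (x 0 • basisVec 0 + x 1 • basisVec 1)‖ₑ := by rw [← e]
    _ ≤ ∫⁻ s : ℝ, ‖fderiv ℝ v (s • basisVec 0 + x 1 • basisVec 1) (basisVec 0)‖ₑ :=
        enorm_le_lintegral_line (hv.of_le (by norm_num)) hc _ _ (norm_basisVec 0) _
    _ ≤ ∫⁻ s : ℝ, ∫⁻ τ : ℝ, ‖hess v (planeMap (s, τ)) (basisVec 1) (basisVec 0)‖ₑ := by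
        refine lintegral_mono fun s => ?_
        rw [add_comm]
        refine (enorm_le_lintegral_line hv' hc' _ _ (norm_basisVec 1) _).trans
          (lintegral_mono fun τ => le_of_eq ?_)
        rw [(hasFDerivAt_fderiv_apply hv.contDiffAt _).fderiv, add_comm]
        rfl
    _ = ∫⁻ q : ℝ × ℝ, ‖hess v (planeMap q) (basisVec 1) (basisVec 0)‖ₑ :=
        (lintegral_prod _ (hm.comp measurePreserving_planeMap.measurable).aemeasurable).symm
    _ = _ := measurePreserving_planeMap.lintegral_comp hm

/-- The supremum bound. -/
lemma exists_sup_bound : ∃ c : ℝ≥0∞, c ≠ ⊤ ∧ ∀ {f : Plane → ℂ} {g₁ : Fin 2 → Plane → ℂ}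
    {g₂ : Fin 2 → Fin 2 → Plane → ℂ}, WeakJet f g₁ g₂ → ∀ x, ‖f x‖ₑ ^ 2 ≤ c * ∫⁻ y, dens f g₁ g₂ y := by
  obtain ⟨c, hc, hb⟩ := exists_enorm_approx_bound
  refine ⟨(∫⁻ x : Plane, ofReal (rinv x ^ 4)) * c,
    mul_ne_top lintegral_rinv_lt_top.ne hc, fun {f g₁ g₂} h x => ?_⟩
  have hl : Tendsto (fun k => ‖approx k f x‖ₑ ^ 2) atTop (𝓝 (‖f x‖ₑ ^ 2)) :=
    ((ENNReal.continuous_pow 2).tendsto _).comp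
      ((continuous_enorm.tendsto _).comp (h.tendsto_approx.1 x))
  refine le_of_tendsto' hl fun k => ?_
  have hv := h.contDiff_approx k
  have m1 : Measurable fun y => ofReal (rinv y ^ 2) := (measurable_rinv.pow_const 2).ennreal_ofReal
  have m2 : Measurable fun y => ofReal (jap ‖y‖ ^ 2) *
      ‖hess (approx k f) y (basisVec 1) (basisVec 0)‖ₑ := by
    have : Continuous fun y => hess (approx k f) y (basisVec 1) (basisVec 0) := by
      have := (hv.fderiv_right (m := 1) (by norm_num)).continuous_fderiv one_ne_zero
      unfold hess; fun_prop
    exact (measurable_japPow 2).mul this.measurable.enorm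
  have h2 : (2 : ℝ).HolderConjugate 2 := Real.HolderConjugate.two_two
  have hCS := ENNReal.lintegral_mul_le_Lp_mul_Lq volume h2 m1.aemeasurable m2.aemeasurable
  have e1 : ‖approx k f x‖ₑ ≤ ∫⁻ y, ((fun y => ofReal (rinv y ^ 2)) *
      fun y => ofReal (jap ‖y‖ ^ 2) * ‖hess (approx k f) y (basisVec 1) (basisVec 0)‖ₑ) y := by
    refine (enorm_le_lintegral_hess hv (hasCompactSupport_approx k f) x).trans_eq
      (lintegral_congr fun y => ?_)
    have hj := jap_pos ‖y‖
    rw [Pi.mul_apply, ← mul_assoc, ← ofReal_mul (by positivity), rinv, ← mul_pow,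
      inv_mul_cancel₀ hj.ne', one_pow, ENNReal.ofReal_one, one_mul]
  calc ‖approx k f x‖ₑ ^ 2 ≤ ((∫⁻ y, ofReal (rinv y ^ 2) ^ (2 : ℝ)) ^ (1 / (2 : ℝ)) *
        (∫⁻ y, (ofReal (jap ‖y‖ ^ 2) *
          ‖hess (approx k f) y (basisVec 1) (basisVec 0)‖ₑ) ^ (2 : ℝ)) ^ (1 / (2 : ℝ))) ^ 2 := by
        gcongr; exact e1.trans hCS
    _ = (∫⁻ y, ofReal (rinv y ^ 4)) * ∫⁻ y, ofReal (jap ‖y‖ ^ 4) *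
          ‖hess (approx k f) y (basisVec 1) (basisVec 0)‖ₑ ^ 2 := by
        rw [mul_pow, ← ENNReal.rpow_natCast, ← ENNReal.rpow_mul, ← ENNReal.rpow_natCast,
          ← ENNReal.rpow_mul]
        norm_num
        congr 1
        · refine lintegral_congr fun y => ?_
          rw [← ofReal_pow (sq_nonneg _), ← pow_mul]
        · refine lintegral_congr fun y => ?_
          rw [mul_pow, ← ofReal_pow (sq_nonneg _), ← pow_mul]
    _ ≤ (∫⁻ y, ofReal (rinv y ^ 4)) * ∫⁻ y, c * mollE k (dens f g₁ g₂) y := by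
        refine mul_le_mul_right (lintegral_mono fun y => (hb h k y).2 1 0) _
    _ = _ := by
        rw [lintegral_const_mul' _ _ hc, lintegral_mollE k h.measurable_dens, mul_assoc]

lemma opNorm_le_sum {F : Type*} [NormedAddCommGroup F] [NormedSpace ℝ F] (L : Plane →L[ℝ] F) :
    ‖L‖ ≤ ‖L (basisVec 0)‖ + ‖L (basisVec 1)‖ := by
  refine L.opNorm_le_bound (by positivity) fun x => ?_
  have e : x = x 0 • basisVec 0 + x 1 • basisVec 1 := (planeMap_coord x).symm
  calc ‖L x‖ = ‖x 0 • L (basisVec 0) + x 1 • L (basisVec 1)‖ := by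
        conv_lhs => rw [e]
        rw [map_add, map_smul, map_smul]
    _ ≤ ‖x‖ * ‖L (basisVec 0)‖ + ‖x‖ * ‖L (basisVec 1)‖ := by
        refine (norm_add_le _ _).trans ?_
        rw [norm_smul, norm_smul]
        gcongr
        · exact abs_coord_le x 0
        · exact abs_coord_le x 1
    _ = _ := by ring

lemma norm_fderiv_weight_sq_le {a : Plane → ℂ} (ha : ContDiff ℝ 1 a) (x : Plane) :
    ‖fderiv ℝ (fun x => (1 + ‖x‖ ^ 2) • a x ^ 2) x‖ ≤ jap ‖x‖ ^ 4 *
      (4 * ‖a x‖ ^ 2 + ‖fderiv ℝ a x (basisVec 0)‖ ^ 2 + ‖fderiv ℝ a x (basisVec 1)‖ ^ 2) := by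
  have h1 : HasFDerivAt (fun x : Plane => 1 + ‖x‖ ^ 2) (2 • innerSL ℝ x) x :=
    (hasStrictFDerivAt_norm_sq x).hasFDerivAt.const_add 1
  have h2 := (ha.differentiable one_ne_zero x).hasFDerivAt.pow 2
  have hd : fderiv ℝ (fun x => (1 + ‖x‖ ^ 2) • a x ^ 2) x = _ := (h1.smul h2).fderiv
  rw [hd]
  have hL := opNorm_le_sum (fderiv ℝ a x)
  set a0 := ‖a x‖ with ha0
  set b0 := ‖fderiv ℝ a x (basisVec 0)‖
  set b1 := ‖fderiv ℝ a x (basisVec 1)‖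
  have hj := one_le_jap ‖x‖
  have hx : ‖x‖ ≤ jap ‖x‖ := by simpa using abs_le_jap ‖x‖
  have hja := jap_sq ‖x‖
  have n0 : 0 ≤ a0 := norm_nonneg _
  have e1 : ‖(2 • innerSL ℝ x).smulRight (a x ^ 2)‖ ≤ 2 * ‖x‖ * a0 ^ 2 := by
    rw [ContinuousLinearMap.norm_smulRight_apply, norm_pow, ← Nat.cast_smul_eq_nsmul ℝ, norm_smul,
      innerSL_apply_norm]
    simp [ha0]
  have e2 : ‖(1 + ‖x‖ ^ 2) • (2 • a x ^ (2 - 1)) • fderiv ℝ a x‖ ≤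
      jap ‖x‖ ^ 2 * (2 * a0 * (b0 + b1)) := by
    rw [norm_smul, norm_smul, ← hja, norm_of_nonneg (by positivity)]
    have : ‖(2 • a x ^ (2 - 1) : ℂ)‖ = 2 * a0 := by simp [ha0]
    rw [this]; gcongr
  have hj2 : jap ‖x‖ ^ 2 ≤ jap ‖x‖ ^ 4 := by gcongr; norm_num
  have hxj : ‖x‖ ≤ jap ‖x‖ ^ 2 := hx.trans (by nlinarith)
  calc _ ≤ jap ‖x‖ ^ 2 * (2 * a0 * (b0 + b1)) + 2 * ‖x‖ * a0 ^ 2 :=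
        (norm_add_le _ _).trans (add_le_add e2 e1)
    _ ≤ jap ‖x‖ ^ 2 * (2 * a0 * (b0 + b1)) + 2 * jap ‖x‖ ^ 2 * a0 ^ 2 := by gcongr
    _ = jap ‖x‖ ^ 2 * (2 * a0 * (b0 + b1) + 2 * a0 ^ 2) := by ring
    _ ≤ jap ‖x‖ ^ 2 * (4 * a0 ^ 2 + b0 ^ 2 + b1 ^ 2) := by
        refine mul_le_mul_of_nonneg_left ?_ (by positivity)
        nlinarith [sq_nonneg (a0 - b0), sq_nonneg (a0 - b1)]
    _ ≤ _ := by gcongr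

lemma holderConjugate_plane : Real.HolderConjugate (Module.finrank ℝ Plane) 2 := by
  rw [finrank_euclideanSpace_fin]; exact_mod_cast Real.HolderConjugate.two_two

lemma exists_gagliardo_nirenberg : ∃ K : NNReal, ∀ ψ : Plane → ℂ, ContDiff ℝ 1 ψ →
    HasCompactSupport ψ → ∫⁻ x, ‖ψ x‖ₑ ^ (2 : ℝ) ≤ K * (∫⁻ x, ‖fderiv ℝ ψ x‖ₑ) ^ (2 : ℝ) :=
  ⟨lintegralPowLePowLIntegralFDerivConst volume 2, fun _ h1 h2 =>
    lintegral_pow_le_pow_lintegral_fderiv volume h1 h2 holderConjugate_plane⟩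

/-- A weighted Gagliardo-Nirenberg inequality. -/
lemma exists_weighted_L4 : ∃ K : NNReal, ∀ a : Plane → ℂ, ContDiff ℝ 1 a → HasCompactSupport a →
    ∫⁻ x, ofReal (jap ‖x‖ ^ 4) * ‖a x‖ₑ ^ 4 ≤ K * (∫⁻ x, ofReal (jap ‖x‖ ^ 4) *
      (4 * ‖a x‖ₑ ^ 2 + ‖fderiv ℝ a x (basisVec 0)‖ₑ ^ 2 + ‖fderiv ℝ a x (basisVec 1)‖ₑ ^ 2)) ^ 2 := by
  obtain ⟨K, hGN⟩ := exists_gagliardo_nirenberg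
  refine ⟨K, fun a ha hc => ?_⟩
  have hψ : ContDiff ℝ 1 fun x => (1 + ‖x‖ ^ 2) • a x ^ 2 :=
    (contDiff_const.add (contDiff_norm_sq ℝ)).smul (ha.pow 2)
  have h2 : HasCompactSupport fun x => a x ^ 2 :=
    hc.comp_left (g := fun z : ℂ => z ^ 2) (zero_pow two_ne_zero)
  have hψc : HasCompactSupport fun x => (1 + ‖x‖ ^ 2) • a x ^ 2 :=
    h2.mono' fun x hx => subset_closure fun h0 => hx (by simp [show a x ^ 2 = 0 from h0])
  have e1 : ∫⁻ x, ofReal (jap ‖x‖ ^ 4) * ‖a x‖ₑ ^ 4 =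
      ∫⁻ x, ‖(1 + ‖x‖ ^ 2) • a x ^ 2‖ₑ ^ (2 : ℝ) := by
    refine lintegral_congr fun x => ?_
    rw [enorm_smul, ENNReal.rpow_two, mul_pow, enorm_pow, ← pow_mul, ← jap_sq,
      Real.enorm_of_nonneg (by positivity), ← ofReal_pow (by positivity), ← pow_mul]
  have e2 : ∫⁻ x, ‖fderiv ℝ (fun x => (1 + ‖x‖ ^ 2) • a x ^ 2) x‖ₑ ≤
      ∫⁻ x, ofReal (jap ‖x‖ ^ 4) * (4 * ‖a x‖ₑ ^ 2 + ‖fderiv ℝ a x (basisVec 0)‖ₑ ^ 2 +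
        ‖fderiv ℝ a x (basisVec 1)‖ₑ ^ 2) := by
    refine lintegral_mono fun x => ?_
    rw [← ofReal_norm]
    refine (ofReal_le_ofReal (norm_fderiv_weight_sq_le ha x)).trans_eq ?_
    rw [ofReal_mul (by positivity), ofReal_add (by positivity) (by positivity),
      ofReal_add (by positivity) (by positivity), ofReal_mul (by norm_num),
      ofReal_pow (norm_nonneg _), ofReal_pow (norm_nonneg _),
      ofReal_pow (norm_nonneg _), ofReal_norm, ofReal_norm, ofReal_norm,
      ENNReal.ofReal_ofNat]
  rw [e1]
  refine (hGN _ hψ hψc).trans ?_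
  rw [ENNReal.rpow_two]
  gcongr

/-- The weighted `L⁴` bound for the first derivatives. -/
lemma exists_L4_bound : ∃ c : ℝ≥0∞, c ≠ ⊤ ∧ ∀ {f : Plane → ℂ} {g₁ : Fin 2 → Plane → ℂ}
    {g₂ : Fin 2 → Fin 2 → Plane → ℂ}, WeakJet f g₁ g₂ → ∀ i,
    ∫⁻ x, ofReal (jap ‖x‖ ^ 4) * ‖g₁ i x‖ₑ ^ 4 ≤ c * (∫⁻ y, dens f g₁ g₂ y) ^ 2 := by
  obtain ⟨c, hc, hb⟩ := exists_enorm_approx_bound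
  obtain ⟨K, hGN⟩ := exists_weighted_L4
  refine ⟨K * (6 * c) ^ 2, mul_ne_top ENNReal.coe_ne_top
    (ENNReal.pow_ne_top (mul_ne_top (by norm_num) hc)), fun {f g₁ g₂} h i => ?_⟩
  have hm : ∀ k, ContDiff ℝ 1 fun x => fderiv ℝ (approx k f) x (basisVec i) := fun k =>
    ((h.contDiff_approx k).fderiv_right (m := 1) (by norm_num)).clm_apply contDiff_const
  have hcs : ∀ k, HasCompactSupport fun x => fderiv ℝ (approx k f) x (basisVec i) := fun k =>
    (hasCompactSupport_approx k f).fderiv_apply (𝕜 := ℝ) _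
  have hk : ∀ k, ∫⁻ x, ofReal (jap ‖x‖ ^ 4) * ‖fderiv ℝ (approx k f) x (basisVec i)‖ₑ ^ 4 ≤
      K * (6 * c) ^ 2 * (∫⁻ y, dens f g₁ g₂ y) ^ 2 := fun k => by
    refine (hGN _ (hm k) (hcs k)).trans ?_
    rw [mul_assoc, ← mul_pow]
    refine mul_le_mul_right (pow_le_pow_left' ?_ 2) _
    rw [← lintegral_mollE k h.measurable_dens,
      ← lintegral_const_mul' _ _ (mul_ne_top (by norm_num) hc)]
    refine lintegral_mono fun x => ?_
    have b0 := (hb h k x).1 i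
    have b1 := (hb h k x).2 0 i
    have b2 := (hb h k x).2 1 i
    have e0 : ∀ w, fderiv ℝ (fun x => fderiv ℝ (approx k f) x (basisVec i)) x w =
        hess (approx k f) x w (basisVec i) := fun w => by
      rw [(hasFDerivAt_fderiv_apply (h.contDiff_approx k).contDiffAt _).fderiv]; rfl
    rw [e0, e0]
    calc _ = 4 * (ofReal (jap ‖x‖ ^ 4) * ‖fderiv ℝ (approx k f) x (basisVec i)‖ₑ ^ 2) +
        ofReal (jap ‖x‖ ^ 4) * ‖hess (approx k f) x (basisVec 0) (basisVec i)‖ₑ ^ 2 +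
        ofReal (jap ‖x‖ ^ 4) * ‖hess (approx k f) x (basisVec 1) (basisVec i)‖ₑ ^ 2 := by
          ring
      _ ≤ 4 * (c * mollE k (dens f g₁ g₂) x) + c * mollE k (dens f g₁ g₂) x +
        c * mollE k (dens f g₁ g₂) x := by gcongr
      _ = _ := by ring
  have hlim : ∀ᵐ x, ofReal (jap ‖x‖ ^ 4) * ‖g₁ i x‖ₑ ^ 4 = liminf (fun k =>
      ofReal (jap ‖x‖ ^ 4) * ‖fderiv ℝ (approx k f) x (basisVec i)‖ₑ ^ 4) atTop := by
    filter_upwards [h.tendsto_approx.2] with x hx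
    refine (Tendsto.liminf_eq ?_).symm
    refine ENNReal.Tendsto.const_mul ?_ (Or.inr ofReal_ne_top)
    exact ((ENNReal.continuous_pow 4).tendsto _).comp ((continuous_enorm.tendsto _).comp (hx.1 i))
  rw [lintegral_congr_ae hlim]
  refine (lintegral_liminf_le fun k => (measurable_japPow 4).mul
    ((hm k).continuous.measurable.enorm.pow_const 4)).trans ?_
  refine liminf_le_of_frequently_le' (Frequently.of_forall hk)

end Bounds

/-! ### Passage to the limit in the Klein-Gordon equation -/

lemma Symb.Good.mono {C C' : ℝ} {S : Symb} (hS : S.Good C) (h : C ≤ C') : S.Good C' where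
  contDiff_phA := hS.contDiff_phA
  contDiff_phB := hS.contDiff_phB
  contDiff_cor := hS.contDiff_cor
  phA_le p := (hS.phA_le p).trans (by gcongr)
  phB_le p := (hS.phB_le p).trans (by gcongr)
  cor_le p := (hS.cor_le p).trans (by gcongr)
  fderiv_phA_le p := (hS.fderiv_phA_le p).trans h
  fderiv_phB_le p := (hS.fderiv_phB_le p).trans h
  fderiv_cor_le p := (hS.fderiv_cor_le p).trans (by gcongr)
  hess_phA_le p := (hS.hess_phA_le p).trans h
  hess_phB_le p := (hS.hess_phB_le p).trans h
  hess_cor_le p := (hS.hess_cor_le p).trans h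

lemma Symb.Good.norm_prof_le {C : ℝ} {S : Symb} (hS : S.Good C) {t : ℝ} (ht : 0 < t) (μ : Plane)
    (p : ℂ × ℂ) : ‖S.prof (slowPt t μ p) - (t⁻¹ : ℝ) * S.sumw (slowPt t μ p)‖ ≤ C * (t ^ 2)⁻¹ * ‖p‖ ^ 2 := by
  have h1 : exp ((-1 : ℂ) * prL (slowPt t μ p)) = (t⁻¹ : ℝ) := by
    change exp ((-1 : ℂ) * (log t : ℝ)) = _
    rw [show (-1 : ℂ) * (log t : ℝ) = ((-log t : ℝ) : ℂ) by push_cast; ring,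
      ← Complex.ofReal_exp, Real.exp_neg, Real.exp_log ht]
  have h2 : exp ((-2 : ℂ) * prL (slowPt t μ p)) = ((t ^ 2)⁻¹ : ℝ) := exp_neg_two_log ht
  rw [S.prof_eq']
  simp only []
  rw [h1, h2, add_sub_cancel_left, norm_mul, norm_real, norm_of_nonneg (by positivity)]
  have := hS.norm_corw_le (e := slowPt t μ p)
  calc _ ≤ (t ^ 2)⁻¹ * (C * ‖p‖ ^ 2) := by gcongr; exact this
    _ = _ := by ring

lemma Symb.Good.norm_profH_le {C : ℝ} {S : Symb} (hS : S.Good C) (hC : 1 ≤ C) {t : ℝ} (ht : 1 ≤ t)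
    (μ : Plane) (J : Jet) : ‖S.prof (slowPt t μ J.1)‖ ≤ 2 * C * jetSize μ J := by
  have h1 := hS.norm_prof_le (by linarith) μ J.1
  have h2 : ‖(t⁻¹ : ℝ) * S.sumw (slowPt t μ J.1)‖ ≤ 2 * ‖J.1‖ := by
    rw [norm_mul, norm_real, norm_of_nonneg (by positivity)]
    calc _ ≤ 1 * (2 * ‖J.1‖) := by
          gcongr
          · exact inv_le_one_of_one_le₀ ht
          · exact S.norm_sumw_le _
      _ = _ := one_mul _
  have h3 : C * (t ^ 2)⁻¹ * ‖J.1‖ ^ 2 ≤ C * ‖J.1‖ ^ 2 := by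
    have : (t ^ 2)⁻¹ ≤ 1 := inv_le_one_of_one_le₀ (one_le_pow₀ ht)
    calc _ ≤ C * 1 * ‖J.1‖ ^ 2 := by gcongr
      _ = _ := by ring
  have h4 := norm_le_norm_sub_add (S.prof (slowPt t μ J.1)) ((t⁻¹ : ℝ) * S.sumw (slowPt t μ J.1))
  have h5 := le_jetSize μ J
  have hn := norm_nonneg J.1
  have h6 : 2 * ‖J.1‖ + C * ‖J.1‖ ^ 2 ≤ 2 * C * ((1 + ‖J.1‖) ^ 2 * ‖J.1‖) := by
    have a1 : 2 * ‖J.1‖ ≤ 2 * C * ‖J.1‖ := by nlinarith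
    have a2 : 0 ≤ C * ‖J.1‖ ^ 3 := by positivity
    have a3 : 0 ≤ C * ‖J.1‖ ^ 2 := by positivity
    nlinarith
  have h7 : 2 * C * ((1 + ‖J.1‖) ^ 2 * ‖J.1‖) ≤ 2 * C * jetSize μ J := by gcongr
  linarith

lemma jetSize_nonneg (μ : Plane) (J : Jet) : 0 ≤ jetSize μ J :=
  le_trans (by positivity) (le_jetSize μ J)

lemma jetSize_le_of_le {μ : Plane} {J : Jet} {C m Y : ℝ} (hC : 1 ≤ C) (hY : 0 ≤ Y) (hm : ‖J.1‖ ≤ m)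
    (h0 : ‖J.1‖ ≤ C * (rinv μ ^ 2 * Y)) (h1 : ∀ i, ‖J.2.1 i‖ ≤ C * (rinv μ ^ 2 * Y))
    (h2 : ∀ i j, ‖J.2.2 i j‖ ≤ C * (rinv μ ^ 2 * Y)) :
    rinv μ ^ 2 * jetSize μ J ≤ 16 * C ^ 2 * (1 + m) ^ 2 * (rinv μ ^ 4 + Y ^ 2) := by
  have hr := rinv_pos μ
  have hr1 := rinv_le_one μ
  have hj := jap_pos ‖μ‖
  have hjr : jap ‖μ‖ * rinv μ = 1 := mul_inv_cancel₀ hj.ne'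
  set r := rinv μ
  set j := jap ‖μ‖
  have e1 : jetOne μ J ≤ 3 * C * (r * Y) := by
    have : ∑ i, ‖J.2.1 i‖ ≤ 2 * (C * (r ^ 2 * Y)) := by
      rw [Fin.sum_univ_two]; linarith [h1 0, h1 1]
    calc jetOne μ J ≤ C * (r ^ 2 * Y) + j * (2 * (C * (r ^ 2 * Y))) := by
          unfold jetOne; gcongr
      _ = C * (r ^ 2 * Y) + (j * r) * (2 * (C * (r * Y))) := by ring
      _ ≤ C * (r * Y) + 1 * (2 * (C * (r * Y))) := by
          rw [hjr]
          have : r ^ 2 ≤ r := by nlinarith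
          gcongr
      _ = _ := by ring
  have e2 : j ^ 2 * jetTwo J ≤ 4 * C * Y := by
    have : jetTwo J ≤ 4 * (C * (r ^ 2 * Y)) := by
      unfold jetTwo; simp only [Fin.sum_univ_two]
      linarith [h2 0 0, h2 0 1, h2 1 0, h2 1 1]
    calc _ ≤ j ^ 2 * (4 * (C * (r ^ 2 * Y))) := by gcongr
      _ = (j * r) ^ 2 * (4 * C * Y) := by ring
      _ = _ := by rw [hjr]; ring
  have hJ1 := jetOne_nonneg μ J
  have e3 : jetOne μ J ^ 2 ≤ 9 * C ^ 2 * (r ^ 2 * Y ^ 2) := by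
    calc _ ≤ (3 * C * (r * Y)) ^ 2 := by gcongr
      _ = _ := by ring
  have hm0 : 0 ≤ m := (norm_nonneg _).trans hm
  have e4 : r ^ 2 * (jetOne μ J + jetOne μ J ^ 2 + j ^ 2 * jetTwo J) ≤ 16 * C ^ 2 * (r ^ 4 + Y ^ 2) := by
    have f1 : r ^ 2 * jetOne μ J ≤ 3 * C ^ 2 * (r ^ 2 * Y) := by
      calc _ ≤ r ^ 2 * (3 * C * (1 * Y)) := by gcongr; exact e1.trans (by gcongr)
        _ = 3 * C * (r ^ 2 * Y) := by ring
        _ ≤ _ := by gcongr; nlinarith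
    have f2 : r ^ 2 * jetOne μ J ^ 2 ≤ 9 * C ^ 2 * Y ^ 2 := by
      calc _ ≤ 1 * (9 * C ^ 2 * (1 * Y ^ 2)) := by
            gcongr
            · exact pow_le_one₀ hr.le hr1
            · exact e3.trans (by gcongr; exact pow_le_one₀ hr.le hr1)
        _ = _ := by ring
    have f3 : r ^ 2 * (j ^ 2 * jetTwo J) ≤ 4 * C ^ 2 * (r ^ 2 * Y) := by
      calc _ ≤ r ^ 2 * (4 * C * Y) := by gcongr
        _ = 4 * C * (r ^ 2 * Y) := by ring
        _ ≤ _ := by gcongr; nlinarith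
    have f4 : 2 * (r ^ 2 * Y) ≤ r ^ 4 + Y ^ 2 := by nlinarith [sq_nonneg (r ^ 2 - Y)]
    have f5 : C ^ 2 * (2 * (r ^ 2 * Y)) ≤ C ^ 2 * (r ^ 4 + Y ^ 2) := by gcongr
    have f6 : 0 ≤ C ^ 2 * r ^ 4 := by positivity
    have f7 : 0 ≤ C ^ 2 * Y ^ 2 := by positivity
    linarith
  calc r ^ 2 * jetSize μ J
      = (1 + ‖J.1‖) ^ 2 * (r ^ 2 * (jetOne μ J + jetOne μ J ^ 2 + j ^ 2 * jetTwo J)) := by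
        rw [jetSize]; ring
    _ ≤ (1 + m) ^ 2 * (16 * C ^ 2 * (r ^ 4 + Y ^ 2)) := by
        have := jetTwo_nonneg J
        gcongr
    _ = _ := by ring

/-- Domination of the jet by a density. -/
lemma ofReal_jetSize_le {μ : Plane} {J : Jet} {C m : ℝ} {w : ℝ≥0∞} (hC : 1 ≤ C) (hm : ‖J.1‖ ≤ m)
    (h : ∀ Y, 0 ≤ Y → w ≤ ofReal (Y ^ 2) → ‖J.1‖ ≤ C * (rinv μ ^ 2 * Y) ∧
      (∀ i, ‖J.2.1 i‖ ≤ C * (rinv μ ^ 2 * Y)) ∧ ∀ i j, ‖J.2.2 i j‖ ≤ C * (rinv μ ^ 2 * Y)) :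
    ofReal (rinv μ ^ 2 * jetSize μ J) ≤
      ofReal (16 * C ^ 2 * (1 + m) ^ 2) * (ofReal (rinv μ ^ 4) + w) := by
  have hm0 : 0 ≤ m := (norm_nonneg _).trans hm
  have hr := rinv_pos μ
  by_cases hw : w = ⊤
  · rw [hw, add_top, ENNReal.mul_top]
    · exact le_top
    · rw [Ne, ENNReal.ofReal_eq_zero, not_le]; positivity
  · have e : w = ofReal (√w.toReal ^ 2) := by
      rw [Real.sq_sqrt ENNReal.toReal_nonneg, ofReal_toReal hw]
    obtain ⟨h0, h1, h2⟩ := h _ (Real.sqrt_nonneg _) e.le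
    rw [e, ← ofReal_add (by positivity) (by positivity), ← ofReal_mul (by positivity)]
    exact ofReal_le_ofReal (jetSize_le_of_le hC (Real.sqrt_nonneg _) hm h0 h1 h2)

/-- The bound for the profile and its image in the slab. -/
lemma Symb.Good.slab_bound {C : ℝ} {S : Symb} (hS : S.Good C) (hC : 1 ≤ C) {t T : ℝ}
    (ht : t ∈ Set.Ioo 1 T) (μ : Plane) (J : Jet) :
    ofReal (t ^ 2 * rinv μ ^ 4) * ‖S.prof (slowPt t μ J.1)‖ₑ ≤
      ofReal (440 * C ^ 3 * (T ^ 2 * (1 + log T) ^ 2)) *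
        ofReal (rinv μ ^ 2 * jetSize μ J) ∧
    ofReal (t ^ 2 * rinv μ ^ 4) * ‖kgAt S t μ J‖ₑ ≤
      ofReal (440 * C ^ 3 * (T ^ 2 * (1 + log T) ^ 2)) *
        ofReal (rinv μ ^ 2 * jetSize μ J) := by
  have ht1 : 1 ≤ t := ht.1.le
  have ht0 : 0 < t := by linarith
  have htT : t ≤ T := ht.2.le
  have hT1 : 1 ≤ T := ht1.trans htT
  have hr := rinv_pos μ
  have hr1 := rinv_le_one μ
  have hJ := jetSize_nonneg μ J
  have hlog : log t ≤ log T := Real.log_le_log ht0 htT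
  have hlog0 := Real.log_nonneg ht1
  have key : ∀ z : ℂ, ‖z‖ ≤ 440 * C ^ 3 * ((rinv μ ^ 2)⁻¹ * (1 + log t) ^ 2 * jetSize μ J) →
      ofReal (t ^ 2 * rinv μ ^ 4) * ‖z‖ₑ ≤
      ofReal (440 * C ^ 3 * (T ^ 2 * (1 + log T) ^ 2)) *
        ofReal (rinv μ ^ 2 * jetSize μ J) := fun z hz => by
    rw [← ofReal_norm, ← ofReal_mul (by positivity), ← ofReal_mul (by positivity)]
    refine ofReal_le_ofReal ?_
    calc t ^ 2 * rinv μ ^ 4 * ‖z‖ ≤ t ^ 2 * rinv μ ^ 4 *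
          (440 * C ^ 3 * ((rinv μ ^ 2)⁻¹ * (1 + log t) ^ 2 * jetSize μ J)) := by gcongr
      _ = 440 * C ^ 3 * (t ^ 2 * (1 + log t) ^ 2) * (rinv μ ^ 2 * jetSize μ J) := by
          field_simp
      _ ≤ _ := by gcongr
  refine ⟨key _ ?_, key _ (hS.norm_kgAt_le hC ht1 μ J)⟩
  have h1 := hS.norm_profH_le hC ht1 μ J
  have a2 : C ≤ C ^ 3 := le_self_pow₀ hC (by norm_num)
  have a3 : 1 ≤ (1 + log t) ^ 2 := one_le_pow₀ (by linarith)
  have a6 : 1 ≤ (rinv μ ^ 2)⁻¹ := (one_le_inv₀ (by positivity)).2 (pow_le_one₀ hr.le hr1)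
  calc _ ≤ _ := h1
    _ = 2 * C * (1 * 1 * jetSize μ J) := by ring
    _ ≤ 440 * C ^ 3 * ((rinv μ ^ 2)⁻¹ * (1 + log t) ^ 2 * jetSize μ J) := by
        gcongr; norm_num

/-- A limit theorem for the Klein-Gordon equation in hyperbolic coordinates. -/
lemma isKleinGordonOf_coneExt_of_tendsto {Φ Ψ : ℕ → ℝ × Plane → ℂ} {Φ₀ Ψ₀ : ℝ × Plane → ℂ}
    (hΦ : ∀ k, Measurable (Φ k)) (hΨ : ∀ k, Measurable (Ψ k)) (hΦ₀ : Measurable Φ₀) (hΨ₀ : Measurable Ψ₀)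
    {w : ℕ → Plane → ℝ≥0∞} {w₀ : Plane → ℝ≥0∞} (hw : ∀ k, Measurable (w k)) (hw₀ : Measurable w₀)
    {K : ℝ → ℝ≥0∞} (hK : ∀ T, K T ≠ ⊤)
    (bΦ : ∀ k T, ∀ t ∈ Set.Ioo 1 T, ∀ μ, ofReal (t ^ 2 * rinv μ ^ 4) * ‖Φ k (t, μ)‖ₑ ≤ K T * w k μ)
    (bΨ : ∀ k T, ∀ t ∈ Set.Ioo 1 T, ∀ μ, ofReal (t ^ 2 * rinv μ ^ 4) * ‖Ψ k (t, μ)‖ₑ ≤ K T * w k μ)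
    (lΦ : ∀ t, 1 < t → ∀ᵐ μ, Tendsto (fun k => Φ k (t, μ)) atTop (𝓝 (Φ₀ (t, μ))))
    (lΨ : ∀ t, 1 < t → ∀ᵐ μ, Tendsto (fun k => Ψ k (t, μ)) atTop (𝓝 (Ψ₀ (t, μ))))
    (hlim : ∀ᵐ μ, Tendsto (fun k => w k μ) atTop (𝓝 (w₀ μ))) (hItg : ∀ k, ∫⁻ μ, w k μ = ∫⁻ μ, w₀ μ)
    (hfin : ∫⁻ μ, w₀ μ ≠ ⊤)
    (hKG : ∀ k, ∀ φ : ℝ × Plane → ℝ, ContDiff ℝ ∞ φ → HasCompactSupport φ →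
      tsupport φ ⊆ {p | 1 < p.1} → ∫ p : ℝ × Plane, (boxTest φ p + φ p) • coneExt (Φ k) p.1 p.2
        = ∫ p : ℝ × Plane, φ p • coneExt (Ψ k) p.1 p.2) :
    IsKleinGordonOf (coneExt Φ₀) (coneExt Ψ₀) := by
  have bound : ∀ {Θ : ℕ → ℝ × Plane → ℂ} {Θ₀ : ℝ × Plane → ℂ},
      (∀ k T, ∀ t ∈ Set.Ioo 1 T, ∀ μ, ofReal (t ^ 2 * rinv μ ^ 4) * ‖Θ k (t, μ)‖ₑ ≤ K T * w k μ) →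
      (∀ t, 1 < t → ∀ᵐ μ, Tendsto (fun k => Θ k (t, μ)) atTop (𝓝 (Θ₀ (t, μ)))) →
      ∀ T, ∀ t ∈ Set.Ioo 1 T, ∀ᵐ μ, ofReal (t ^ 2 * rinv μ ^ 4) * ‖Θ₀ (t, μ)‖ₑ ≤ K T * w₀ μ := by
    intro Θ Θ₀ b l T t ht
    filter_upwards [l t ht.1, hlim] with μ h1 h2
    refine le_of_tendsto_of_tendsto' (ENNReal.Tendsto.const_mul h1.enorm (Or.inr ofReal_ne_top))
      (ENNReal.Tendsto.const_mul h2 (Or.inr (hK T))) fun k => b k T t ht μ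
  have fin : ∀ T, ∫⁻ μ, K T * w₀ μ ≠ ⊤ := fun T => by
    rw [lintegral_const_mul _ hw₀]; exact mul_ne_top (hK T) hfin
  have fink : ∀ k T, ∫⁻ μ, K T * w k μ ≠ ⊤ := fun k T => by
    rw [lintegral_const_mul _ (hw k), hItg]; exact mul_ne_top (hK T) hfin
  have slabLim : ∀ {Θ : ℕ → ℝ × Plane → ℂ} {Θ₀ : ℝ × Plane → ℂ}, (∀ k, Measurable (Θ k)) →
      Measurable Θ₀ →
      (∀ k T, ∀ t ∈ Set.Ioo 1 T, ∀ μ, ofReal (t ^ 2 * rinv μ ^ 4) * ‖Θ k (t, μ)‖ₑ ≤ K T * w k μ) →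
      (∀ t, 1 < t → ∀ᵐ μ, Tendsto (fun k => Θ k (t, μ)) atTop (𝓝 (Θ₀ (t, μ)))) → ∀ T,
      Tendsto (fun k => ∫⁻ q in slab T, ‖coneExt (Θ k) q.1 q.2 - coneExt Θ₀ q.1 q.2‖ₑ) atTop (𝓝 0) := by
    intro Θ Θ₀ m m₀ b l T
    refine tendsto_slab_of_le m m₀ (g := fun k μ => K T * w k μ + K T * w₀ μ)
      (h := fun μ => K T * w₀ μ + K T * w₀ μ) (fun k => ((hw k).const_mul _).add (hw₀.const_mul _))
      ((hw₀.const_mul _).add (hw₀.const_mul _)) (fun k t ht => ?_) (fun t ht => l t ht.1) ?_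
      (fun k => ?_) ?_
    · filter_upwards [bound b l T t ht] with μ hμ
      calc _ ≤ ofReal (t ^ 2 * rinv μ ^ 4) * (‖Θ k (t, μ)‖ₑ + ‖Θ₀ (t, μ)‖ₑ) := by
            gcongr; exact enorm_sub_le
        _ ≤ _ := by rw [mul_add]; exact add_le_add (b k T t ht μ) hμ
    · filter_upwards [hlim] with μ hμ
      exact (ENNReal.Tendsto.const_mul hμ (Or.inr (hK T))).add tendsto_const_nhds
    · rw [lintegral_add_right _ (hw₀.const_mul _), lintegral_add_right _ (hw₀.const_mul _),
        lintegral_const_mul _ (hw k), lintegral_const_mul _ hw₀, hItg]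
    · rw [lintegral_add_right _ (hw₀.const_mul _)]
      exact add_ne_top.2 ⟨fin T, fin T⟩
  have iΦ : ∀ k T, IntegrableOn (fun q : ℝ × Plane => coneExt (Φ k) q.1 q.2) (slab T) := fun k T =>
    integrableOn_slab_of_le (hΦ k) (fun t ht => Eventually.of_forall (bΦ k T t ht)) (fink k T)
  have iΨ : ∀ k T, IntegrableOn (fun q : ℝ × Plane => coneExt (Ψ k) q.1 q.2) (slab T) := fun k T =>
    integrableOn_slab_of_le (hΨ k) (fun t ht => Eventually.of_forall (bΨ k T t ht)) (fink k T)
  refine isKleinGordonOf_of_tendsto (u := fun k => coneExt (Φ k)) (F := fun k => coneExt (Ψ k))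
    (fun k => ⟨locallyIntegrableOn_of_slab (iΦ k), locallyIntegrableOn_of_slab (iΨ k), hKG k⟩)
    iΦ iΨ (fun T => integrableOn_slab_of_le hΦ₀ (bound bΦ lΦ T) (fin T))
    (fun T => integrableOn_slab_of_le hΨ₀ (bound bΨ lΨ T) (fin T))
    (slabLim hΦ hΦ₀ bΦ lΦ) (slabLim hΨ hΨ₀ bΨ lΨ)

/-! ### The Klein-Gordon equation for amplitudes with weak derivatives -/

section Continuity

variable {C : ℝ} {S : Symb}

lemma Symb.Good.continuous_hess_prof (hS : S.Good C) :
    Continuous fun q : Slow × Slow × Slow => hess S.prof q.1 q.2.1 q.2.2 := by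
  have := (hS.contDiff_prof.fderiv_right (m := 1) (by norm_num)).continuous_fderiv one_ne_zero
  unfold hess; fun_prop

lemma Symb.Good.continuous_fderiv_prof (hS : S.Good C) :
    Continuous fun q : Slow × Slow => fderiv ℝ S.prof q.1 q.2 := by
  have := hS.contDiff_prof.continuous_fderiv two_ne_zero
  fun_prop

lemma continuous_slowPt (t : ℝ) (μ : Plane) : Continuous fun p => slowPt t μ p := by
  unfold slowPt; fun_prop

lemma Symb.Good.continuous_kgAt (hS : S.Good C) (t : ℝ) (μ : Plane) : Continuous (kgAt S t μ) := by
  have h1 := hS.continuous_hess_prof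
  have h2 := hS.continuous_fderiv_prof
  have h3 := hS.contDiff_prof.continuous
  have hp : Continuous fun J : Jet => slowPt t μ J.1 := (continuous_slowPt t μ).comp continuous_fst
  have hH : ∀ {v w : Jet → Slow}, Continuous v → Continuous w →
      Continuous fun J : Jet => hess S.prof (slowPt t μ J.1) (v J) (w J) := fun hv hw =>
    h1.comp (hp.prodMk (hv.prodMk hw))
  have hD : ∀ {v : Jet → Slow}, Continuous v →
      Continuous fun J : Jet => fderiv ℝ S.prof (slowPt t μ J.1) (v J) := fun hv =>
    h2.comp (hp.prodMk hv)
  have hdir : ∀ i, Continuous fun J : Jet => dirJet μ J i := fun i => by unfold dirJet; fun_prop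
  have hrad : Continuous fun J : Jet => radJet μ J := by unfold radJet; fun_prop
  have hlap : Continuous fun J : Jet => lapJet μ J := by unfold lapJet; fun_prop
  have htang : Continuous fun J : Jet => tangAt S t μ J := by
    unfold tangAt
    exact (((continuous_const.mul (hH continuous_const continuous_const)).sub (hH hrad hrad)).sub
      (continuous_finsetSum _ fun i _ => hH (hdir i) (hdir i))).add (hD hlap)
  unfold kgAt
  exact (((hH continuous_const continuous_const).add (h3.comp hp)).add (continuous_const.mul
    ((hD continuous_const).add (hH continuous_const continuous_const)))).add
    (continuous_const.mul htang)

lemma measurable_slowPt {P : Plane → ℂ × ℂ} (hP : Measurable P) :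
    Measurable fun q : ℝ × Plane => slowPt q.1 q.2 (P q.2) :=
  (measurable_fst.mul (measurable_rinv.comp measurable_snd)).prodMk
    ((Real.measurable_log.comp measurable_fst).prodMk
      ((measurable_rinv.comp measurable_snd).prodMk (hP.comp measurable_snd)))

lemma Symb.Good.measurable_profH (hS : S.Good C) {P : Plane → ℂ × ℂ} (hP : Measurable P) :
    Measurable (profH S P) :=
  hS.contDiff_prof.continuous.measurable.comp (measurable_slowPt hP)

lemma measurable_coord (i : Fin 2) : Measurable fun μ : Plane => μ i := by fun_prop

lemma Symb.Good.measurable_kgH (hS : S.Good C) {J : Plane → Jet} (hJ : Measurable J) :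
    Measurable (kgH S J) := by
  have : BorelSpace Slow := inferInstance
  have : SecondCountableTopology Slow := inferInstance
  have : BorelSpace (Slow × Slow) := inferInstance
  have h1 := hS.continuous_hess_prof.measurable
  have h2 := hS.continuous_fderiv_prof.measurable
  have h3 := hS.contDiff_prof.continuous.measurable
  have hp : Measurable fun q : ℝ × Plane => slowPt q.1 q.2 (J q.2).1 :=
    measurable_slowPt (measurable_fst.comp hJ)
  have hJ' : Measurable fun q : ℝ × Plane => J q.2 := hJ.comp measurable_snd
  have hr : Measurable fun q : ℝ × Plane => rinv q.2 := measurable_rinv.comp measurable_snd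
  have hc : ∀ i, Measurable fun q : ℝ × Plane => q.2 i := fun i =>
    (measurable_coord i).comp measurable_snd
  have hn : Measurable fun q : ℝ × Plane => ‖q.2‖ := measurable_snd.norm
  have hH : ∀ {v w : ℝ × Plane → Slow}, Measurable v → Measurable w →
      Measurable fun q : ℝ × Plane => hess S.prof (slowPt q.1 q.2 (J q.2).1) (v q) (w q) := fun hv hw =>
    h1.comp (hp.prodMk (hv.prodMk hw))
  have hD : ∀ {v : ℝ × Plane → Slow}, Measurable v →
      Measurable fun q : ℝ × Plane => fderiv ℝ S.prof (slowPt q.1 q.2 (J q.2).1) (v q) := fun hv =>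
    h2.comp (hp.prodMk hv)
  have j1 : ∀ i, Measurable fun q : ℝ × Plane => (J q.2).2.1 i := fun i =>
    (measurable_pi_apply i).comp (measurable_fst.comp (measurable_snd.comp hJ'))
  have j2 : ∀ i j, Measurable fun q : ℝ × Plane => (J q.2).2.2 i j := fun i j =>
    (measurable_pi_apply j).comp ((measurable_pi_apply i).comp
      (measurable_snd.comp (measurable_snd.comp hJ')))
  have hsum : Measurable fun q : ℝ × Plane => ∑ i, q.2 i • (J q.2).2.1 i :=
    Finset.measurable_fun_sum _ fun i _ => (hc i).smul (j1 i)
  have hdir : ∀ i, Measurable fun q : ℝ × Plane => dirJet q.2 (J q.2) i := fun i =>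
    measurable_const.prodMk (measurable_const.prodMk
      (((hc i).mul (hr.pow_const 3)).neg.prodMk (j1 i)))
  have hrad : Measurable fun q : ℝ × Plane => radJet q.2 (J q.2) :=
    measurable_const.prodMk (measurable_const.prodMk
      (((hn.pow_const 2).mul (hr.pow_const 3)).neg.prodMk hsum))
  have hlap : Measurable fun q : ℝ × Plane => lapJet q.2 (J q.2) :=
    measurable_const.prodMk ((hr.pow_const 2).neg.prodMk (((hr.pow_const 3).const_mul 2).prodMk
      (((hsum.const_smul (2 : ℝ)).add (Finset.measurable_fun_sum _ fun i _ => j2 i i)).add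
        (Finset.measurable_fun_sum _ fun i _ => Finset.measurable_fun_sum _ fun j _ =>
          ((hc i).mul (hc j)).smul (j2 i j))).neg))
  have htang : Measurable fun q : ℝ × Plane => tangAt S q.1 q.2 (J q.2) :=
    (((Complex.measurable_ofReal.comp ((hr.pow_const 2).const_add 1)).mul
      (hH measurable_const measurable_const)).sub (hH hrad hrad)).sub
      (Finset.measurable_fun_sum _ fun i _ => hH (hdir i) (hdir i)) |>.add (hD hlap)
  have hs : Measurable fun q : ℝ × Plane => q.1 * rinv q.2 := measurable_fst.mul hr
  exact (((hH measurable_const measurable_const).add (h3.comp hp)).add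
    ((measurable_const.div (Complex.measurable_ofReal.comp hs)).mul
      ((hD measurable_const).add (hH measurable_const measurable_const)))).add
    ((Complex.measurable_ofReal.comp (hs.pow_const 2).inv).mul htang)

end Continuity

/-- The pair of jets. -/
def jetPair (A B : Plane → ℂ) (a₁ b₁ : Fin 2 → Plane → ℂ) (a₂ b₂ : Fin 2 → Fin 2 → Plane → ℂ)
    (μ : Plane) : Jet :=
  ((A μ, B μ), fun i => (a₁ i μ, b₁ i μ), fun i j => (a₂ i j μ, b₂ i j μ))

section Pair

variable {A B : Plane → ℂ} {a₁ b₁ : Fin 2 → Plane → ℂ} {a₂ b₂ : Fin 2 → Fin 2 → Plane → ℂ}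

lemma measurable_jetPair (hA : WeakJet A a₁ a₂) (hB : WeakJet B b₁ b₂) :
    Measurable (jetPair A B a₁ b₁ a₂ b₂) :=
  (hA.continuous.measurable.prodMk hB.continuous.measurable).prodMk
    ((measurable_pi_lambda _ fun i => (hA.measurable₁ i).prodMk (hB.measurable₁ i)).prodMk
      (measurable_pi_lambda _ fun i => measurable_pi_lambda _ fun j =>
        (hA.measurable₂ i j).prodMk (hB.measurable₂ i j)))

/-- The approximating amplitudes. -/
def approxPair (k : ℕ) (A B : Plane → ℂ) (μ : Plane) : ℂ × ℂ := (approx k A μ, approx k B μ)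

lemma jetOf_approxPair (hA : WeakJet A a₁ a₂) (hB : WeakJet B b₁ b₂) (k : ℕ) (μ : Plane) :
    jetOf (approxPair k A B) μ = ((approx k A μ, approx k B μ),
      fun i => (fderiv ℝ (approx k A) μ (basisVec i), fderiv ℝ (approx k B) μ (basisVec i)),
      fun i j => (hess (approx k A) μ (basisVec i) (basisVec j),
        hess (approx k B) μ (basisVec i) (basisVec j))) := by
  have h1 := hA.contDiff_approx k
  have h2 := hB.contDiff_approx k
  refine Prod.ext rfl (Prod.ext (funext fun i => ?_) (funext fun i => funext fun j => ?_))
  · exact fderiv_pair_apply h1 h2 μ _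
  · exact hess_pair h1 h2 μ _ _

lemma norm_jetPair_le {μ : Plane} {w : ℝ≥0∞} (hw : dens A a₁ a₂ μ + dens B b₁ b₂ μ ≤ w) {Y : ℝ}
    (hY : 0 ≤ Y) (hle : w ≤ ofReal (Y ^ 2)) :
    ‖(jetPair A B a₁ b₁ a₂ b₂ μ).1‖ ≤ 1 * (rinv μ ^ 2 * Y) ∧
      (∀ i, ‖(jetPair A B a₁ b₁ a₂ b₂ μ).2.1 i‖ ≤ 1 * (rinv μ ^ 2 * Y)) ∧
      ∀ i j, ‖(jetPair A B a₁ b₁ a₂ b₂ μ).2.2 i j‖ ≤ 1 * (rinv μ ^ 2 * Y) := by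
  have hA : dens A a₁ a₂ μ ≤ ofReal (Y ^ 2) := le_self_add.trans (hw.trans hle)
  have hB : dens B b₁ b₂ μ ≤ ofReal (Y ^ 2) := le_add_self.trans (hw.trans hle)
  rw [one_mul]
  exact ⟨max_le ((enorm_weight_le_iff hY).1 ((dens_ge_zero μ).trans hA))
      ((enorm_weight_le_iff hY).1 ((dens_ge_zero μ).trans hB)),
    fun i => max_le ((enorm_weight_le_iff hY).1 ((dens_ge_one i μ).trans hA))
      ((enorm_weight_le_iff hY).1 ((dens_ge_one i μ).trans hB)),
    fun i j => max_le ((enorm_weight_le_iff hY).1 ((dens_ge_two i j μ).trans hA))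
      ((enorm_weight_le_iff hY).1 ((dens_ge_two i j μ).trans hB))⟩

lemma ae_tendsto_jet (hA : WeakJet A a₁ a₂) (hB : WeakJet B b₁ b₂) : ∀ᵐ μ,
    Tendsto (fun k => jetOf (approxPair k A B) μ) atTop (𝓝 (jetPair A B a₁ b₁ a₂ b₂ μ)) := by
  filter_upwards [hA.tendsto_approx.2, hB.tendsto_approx.2] with μ h1 h2
  simp only [jetOf_approxPair hA hB]
  exact ((hA.tendsto_approx.1 μ).prodMk_nhds (hB.tendsto_approx.1 μ)).prodMk_nhds
    ((tendsto_pi_nhds.2 fun i => (h1.1 i).prodMk_nhds (h2.1 i)).prodMk_nhds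
      (tendsto_pi_nhds.2 fun i => tendsto_pi_nhds.2 fun j => (h1.2 i j).prodMk_nhds (h2.2 i j)))

/-- The weight that dominates the jets. -/
def domWeight (w₁ w₂ : Plane → ℝ≥0∞) (μ : Plane) : ℝ≥0∞ :=
  ofReal (rinv μ ^ 4) + (w₁ μ + w₂ μ)

lemma measurable_domWeight {w₁ w₂ : Plane → ℝ≥0∞} (h₁ : Measurable w₁) (h₂ : Measurable w₂) :
    Measurable (domWeight w₁ w₂) := ((measurable_rinv.pow_const 4).ennreal_ofReal).add (h₁.add h₂)

lemma lintegral_domWeight {w₁ w₂ : Plane → ℝ≥0∞} (h₁ : Measurable w₁) (h₂ : Measurable w₂) :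
    ∫⁻ μ, domWeight w₁ w₂ μ = (∫⁻ μ : Plane, ofReal (rinv μ ^ 4)) +
      ((∫⁻ μ, w₁ μ) + ∫⁻ μ, w₂ μ) := by
  unfold domWeight
  have h : Measurable fun μ => w₁ μ + w₂ μ := h₁.add h₂
  rw [lintegral_add_right _ h, lintegral_add_right _ h₂]

/-- The Klein-Gordon equation for a regular symbol. -/
lemma isKleinGordonOf_good {C : ℝ} {S : Symb} (hS : S.Good C) (hC : 1 ≤ C) (hA : WeakJet A a₁ a₂)
    (hB : WeakJet B b₁ b₂) {m : ℝ} (hmA : ∀ x, ‖A x‖ ≤ m) (hmB : ∀ x, ‖B x‖ ≤ m)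
    (fA : ∫⁻ x, dens A a₁ a₂ x ≠ ⊤) (fB : ∫⁻ x, dens B b₁ b₂ x ≠ ⊤) :
    IsKleinGordonOf (coneExt (profH S fun z => (A z, B z)))
      (coneExt (kgH S (jetPair A B a₁ b₁ a₂ b₂))) := by
  obtain ⟨C', hC', hb⟩ := exists_approx_bound
  have cP : ∀ k, ContDiff ℝ 2 (approxPair k A B) := fun k =>
    (hA.contDiff_approx k).prodMk (hB.contDiff_approx k)
  have sP : ∀ k, HasCompactSupport (approxPair k A B) := fun k =>
    ((hasCompactSupport_approx k A).isCompact.union (hasCompactSupport_approx k B).isCompact).of_isClosed_subset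
      (isClosed_tsupport _) (by
        rw [tsupport, tsupport, tsupport, ← closure_union]
        refine closure_mono fun μ hμ => ?_
        by_contra h
        simp only [Set.mem_union, Function.mem_support, not_or, not_not] at h
        exact hμ (Prod.ext h.1 h.2))
  have mJ : ∀ k, Measurable (jetOf (approxPair k A B)) := fun k => by
    have h1 := (cP k).continuous
    have h2 := (cP k).continuous_fderiv two_ne_zero
    have h3 := ((cP k).fderiv_right (m := 1) (by norm_num)).continuous_fderiv one_ne_zero
    have : Continuous (jetOf (approxPair k A B)) := by
      unfold jetOf hess; fun_prop
    exact this.measurable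
  have hmk : ∀ k μ, ‖(jetOf (approxPair k A B) μ).1‖ ≤ m := fun k μ =>
    max_le (norm_approx_le hmA k μ) (norm_approx_le hmB k μ)
  have dk : ∀ k μ, ofReal (rinv μ ^ 2 * jetSize μ (jetOf (approxPair k A B) μ)) ≤
      ofReal (16 * C' ^ 2 * (1 + m) ^ 2) *
        domWeight (mollE k (dens A a₁ a₂)) (mollE k (dens B b₁ b₂)) μ := fun k μ => by
    refine ofReal_jetSize_le hC' (hmk k μ) fun Y hY hle => ?_
    obtain ⟨p0, p1, p2⟩ := hb hA k μ Y hY (le_self_add.trans hle)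
    obtain ⟨q0, q1, q2⟩ := hb hB k μ Y hY (le_add_self.trans hle)
    rw [jetOf_approxPair hA hB]
    exact ⟨max_le p0 q0, fun i => max_le (p1 i) (q1 i), fun i j => max_le (p2 i j) (q2 i j)⟩
  have hlim := ae_tendsto_jet hA hB
  have lw : ∀ᵐ μ, Tendsto (fun k => domWeight (mollE k (dens A a₁ a₂)) (mollE k (dens B b₁ b₂)) μ)
      atTop (𝓝 (domWeight (dens A a₁ a₂) (dens B b₁ b₂) μ)) := by
    filter_upwards [ae_tendsto_mollE hA.measurable_dens fA, ae_tendsto_mollE hB.measurable_dens fB]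
      with μ h1 h2
    exact tendsto_const_nhds.add (h1.add h2)
  refine isKleinGordonOf_coneExt_of_tendsto (Φ := fun k => profH S (approxPair k A B))
    (Ψ := fun k => kgH S (jetOf (approxPair k A B)))
    (w := fun k => domWeight (mollE k (dens A a₁ a₂)) (mollE k (dens B b₁ b₂)))
    (w₀ := domWeight (dens A a₁ a₂) (dens B b₁ b₂))
    (K := fun T => ofReal (440 * C ^ 3 * (T ^ 2 * (1 + log T) ^ 2)) *
      ofReal (16 * C' ^ 2 * (1 + m) ^ 2))
    (fun k => hS.measurable_profH (cP k).continuous.measurable) (fun k => hS.measurable_kgH (mJ k))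
    (hS.measurable_profH (hA.continuous.prodMk hB.continuous).measurable)
    (hS.measurable_kgH (measurable_jetPair hA hB))
    (fun k => measurable_domWeight (measurable_mollE k hA.measurable_dens)
      (measurable_mollE k hB.measurable_dens))
    (measurable_domWeight hA.measurable_dens hB.measurable_dens)
    (fun T => mul_ne_top ofReal_ne_top ofReal_ne_top)
    (fun k T t ht μ => ?_) (fun k T t ht μ => ?_) (fun t _ => ?_) (fun t _ => ?_) lw (fun k => ?_) ?_
    (fun k φ hφ hc hs => isKleinGordonOf_smooth hS (cP k) (sP k) hφ hc hs)
  · rw [mul_assoc]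
    exact (hS.slab_bound hC ht μ (jetOf (approxPair k A B) μ)).1.trans (mul_le_mul_right (dk k μ) _)
  · rw [mul_assoc]
    exact (hS.slab_bound hC ht μ (jetOf (approxPair k A B) μ)).2.trans (mul_le_mul_right (dk k μ) _)
  · refine .of_forall fun μ => ?_
    exact ((hS.contDiff_prof.continuous.comp (continuous_slowPt t μ)).tendsto _).comp
      ((hA.tendsto_approx.1 μ).prodMk_nhds (hB.tendsto_approx.1 μ))
  · filter_upwards [hlim] with μ hμ
    exact ((hS.continuous_kgAt t μ).tendsto _).comp hμ
  · rw [lintegral_domWeight (measurable_mollE k hA.measurable_dens)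
      (measurable_mollE k hB.measurable_dens), lintegral_domWeight hA.measurable_dens
      hB.measurable_dens, lintegral_mollE k hA.measurable_dens, lintegral_mollE k hB.measurable_dens]
  · rw [lintegral_domWeight hA.measurable_dens hB.measurable_dens]
    exact add_ne_top.2 ⟨lintegral_rinv_lt_top.ne, add_ne_top.2 ⟨fA, fB⟩⟩

end Pair

/-! ### Removal of the cutoff near the origin -/

section Cutoff

variable {lam ρ : ℝ}

lemma regSymb_prof_congr {ε ε' : ℝ} {e : Slow} (h : cut ε (prP e) = cut ε' (prP e)) :
    (regSymb lam ρ ε).prof e = (regSymb lam ρ ε').prof e := by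
  have hA : (regSymb lam ρ ε).phA e.2.2.2 = (regSymb lam ρ ε').phA e.2.2.2 := by
    change cut ε (prP e) • _ = cut ε' (prP e) • _; rw [h]
  have hB : (regSymb lam ρ ε).phB e.2.2.2 = (regSymb lam ρ ε').phB e.2.2.2 := by
    change cut ε (prP e) • _ = cut ε' (prP e) • _; rw [h]
  have hw : (regSymb lam ρ ε).wave e = (regSymb lam ρ ε').wave e := by
    rw [Symb.wave, Symb.wave, hA, hB]
  have hc : ∀ ε'', cut ε'' ((regSymb lam ρ ε').wave e) = cut ε'' (prP e) := fun ε'' =>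
    cut_congr ε'' (norm_wave_fst _ e) (norm_wave_snd _ e)
  have hcor : (regSymb lam ρ ε).cor ((regSymb lam ρ ε').wave e) =
      (regSymb lam ρ ε').cor ((regSymb lam ρ ε').wave e) := by
    change cut ε _ • _ = cut ε' _ • _; rw [hc, hc, h]
  rw [Symb.prof, Symb.prof, hw, hcor]

lemma regSymb_prof_eq {ε : ℝ} {e : Slow} (h : cut ε (prP e) = 1) :
    (regSymb lam ρ ε).prof e = (mainSymb lam ρ).prof e := by
  have hA : (regSymb lam ρ ε).phA e.2.2.2 = (mainSymb lam ρ).phA e.2.2.2 := by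
    change cut ε (prP e) • _ = _; rw [h, one_smul]
  have hB : (regSymb lam ρ ε).phB e.2.2.2 = (mainSymb lam ρ).phB e.2.2.2 := by
    change cut ε (prP e) • _ = _; rw [h, one_smul]
  have hw : (regSymb lam ρ ε).wave e = (mainSymb lam ρ).wave e := by
    rw [Symb.wave, Symb.wave, hA, hB]
  have hc : cut ε ((mainSymb lam ρ).wave e) = cut ε (prP e) :=
    cut_congr ε (norm_wave_fst _ e) (norm_wave_snd _ e)
  have hcor : (regSymb lam ρ ε).cor ((mainSymb lam ρ).wave e) =
      (mainSymb lam ρ).cor ((mainSymb lam ρ).wave e) := by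
    change cut ε _ • _ = _; rw [hc, h, one_smul]
  rw [Symb.prof, Symb.prof, hw, hcor]

lemma mainSymb_prof_eq_zero {e : Slow} (he : prP e = 0) : (mainSymb lam ρ).prof e = 0 := by
  have hw : (mainSymb lam ρ).wave e = 0 := by rw [← norm_eq_zero, norm_wave_eq, he, norm_zero]
  have hc : (mainSymb lam ρ).cor 0 = 0 := by
    have := kernelAvg_smul (corrKernel lam) le_rfl (0 : ℂ × ℂ)
    simpa [mainSymb, corr] using this
  rw [Symb.prof, hw, hc]; simp

/-- The symbols cut off at scale `1 / (n + 1)`. -/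
def regSeq (lam ρ : ℝ) (n : ℕ) : Symb := regSymb lam ρ (cScale n)

lemma eventually_cut_cScale {p : ℂ × ℂ} (hp : p ≠ 0) :
    ∀ᶠ n in atTop, 2 * cScale n ^ 2 < sqNorm p := by
  have h : Tendsto (fun n => 2 * cScale n ^ 2) atTop (𝓝 (2 * 0 ^ 2)) :=
    ((tendsto_one_div_add_atTop_nhds_zero_nat.congr fun k => by simp [cScale]).pow 2).const_mul 2
  refine h.eventually (gt_mem_nhds ?_)
  simpa using sqNorm_pos hp

lemma exists_regSeq_eventuallyEq (lam ρ : ℝ) (e : Slow) :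
    ∃ N, ∀ n ≥ N, (regSeq lam ρ n).prof =ᶠ[𝓝 e] (regSeq lam ρ N).prof := by
  have hcont : Tendsto prP (𝓝 e) (𝓝 (prP e)) := prP.continuous.tendsto e
  rcases eq_or_ne (prP e) 0 with hp | hp
  · refine ⟨0, fun n _ => ?_⟩
    rw [hp] at hcont
    filter_upwards [hcont.eventually (eventually_cut_eq_zero (cScale_pos n)),
      hcont.eventually (eventually_cut_eq_zero (cScale_pos 0))] with e' h1 h2
    exact regSymb_prof_congr (h1.trans h2.symm)
  · obtain ⟨N, hN⟩ := eventually_atTop.1 (eventually_cut_cScale hp)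
    have key : ∀ n ≥ N, ∀ᶠ e' in 𝓝 e, cut (cScale n) (prP e') = 1 := fun n hn => by
      have h1 : ∀ᶠ p in 𝓝 (prP e), 2 * cScale n ^ 2 < sqNorm p :=
        continuousAt_const.eventually_lt
          (contDiff_sqNorm (n := 0)).continuous.continuousAt (hN n hn)
      filter_upwards [hcont.eventually h1] with e' he'
      exact cut_eq_one (cScale_pos n) he'.le
    refine ⟨N, fun n hn => ?_⟩
    filter_upwards [key n hn, key N le_rfl] with e' h1 h2
    exact regSymb_prof_congr (h1.trans h2.symm)

lemma kgAt_congr {S S' : Symb} {t : ℝ} {μ : Plane} {J : Jet}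
    (h : S.prof =ᶠ[𝓝 (slowPt t μ J.1)] S'.prof) : kgAt S t μ J = kgAt S' t μ J := by
  have h1 := h.fderiv_eq (𝕜 := ℝ)
  have h2 := (h.fderiv (𝕜 := ℝ)).fderiv_eq (𝕜 := ℝ)
  have h0 := h.self_of_nhds
  simp only [kgAt, tangAt, hess, h0, h1, h2]

/-- The Klein-Gordon operator applied to the profile, as a limit. -/
def kgLim (lam ρ t : ℝ) (μ : Plane) (J : Jet) : ℂ :=
  limUnder atTop fun n => kgAt (regSeq lam ρ n) t μ J

lemma tendsto_kgLim (lam ρ t : ℝ) (μ : Plane) (J : Jet) :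
    Tendsto (fun n => kgAt (regSeq lam ρ n) t μ J) atTop (𝓝 (kgLim lam ρ t μ J)) := by
  obtain ⟨N, hN⟩ := exists_regSeq_eventuallyEq lam ρ (slowPt t μ J.1)
  refine tendsto_nhds_limUnder ⟨kgAt (regSeq lam ρ N) t μ J, tendsto_const_nhds.congr' ?_⟩
  filter_upwards [eventually_ge_atTop N] with n hn
  exact (kgAt_congr (hN n hn)).symm

lemma eventually_regSeq_prof_eq (lam ρ : ℝ) {C : ℝ} (hS : ∀ n, (regSeq lam ρ n).Good C) (e : Slow) :
    ∀ᶠ n in atTop, (regSeq lam ρ n).prof e = (mainSymb lam ρ).prof e := by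
  rcases eq_or_ne (prP e) 0 with hp | hp
  · exact Eventually.of_forall fun n => by
      rw [(hS n).prof_eq_zero hp, mainSymb_prof_eq_zero hp]
  · filter_upwards [eventually_cut_cScale hp] with n hn
    exact regSymb_prof_eq (cut_eq_one (cScale_pos n) hn.le)

lemma exists_regSeq_good (lam ρ : ℝ) : ∃ C : ℝ, 1 ≤ C ∧ ∀ n, (regSeq lam ρ n).Good C := by
  obtain ⟨C, -, h⟩ := exists_regSymb_good lam ρ
  exact ⟨max 1 C, le_max_left _ _, fun n => (h _ (cScale_pos n)).mono (le_max_right _ _)⟩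

lemma measurable_profH_mainSymb (lam ρ : ℝ) {P : Plane → ℂ × ℂ} (hP : Measurable P) :
    Measurable (profH (mainSymb lam ρ) P) := by
  obtain ⟨C, -, hS⟩ := exists_regSeq_good lam ρ
  refine measurable_of_tendsto_metrizable (fun n => (hS n).measurable_profH hP)
    (tendsto_pi_nhds.2 fun q => tendsto_const_nhds.congr' ?_)
  filter_upwards [eventually_regSeq_prof_eq lam ρ hS (slowPt q.1 q.2 (P q.2))] with n hn
  exact hn.symm

lemma measurable_kgLim (lam ρ : ℝ) {J : Plane → Jet} (hJ : Measurable J) :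
    Measurable fun q : ℝ × Plane => kgLim lam ρ q.1 q.2 (J q.2) := by
  obtain ⟨C, -, hS⟩ := exists_regSeq_good lam ρ
  exact measurable_of_tendsto_metrizable (fun n => (hS n).measurable_kgH hJ)
    (tendsto_pi_nhds.2 fun q => tendsto_kgLim lam ρ q.1 q.2 (J q.2))

section Main

variable {A B : Plane → ℂ} {a₁ b₁ : Fin 2 → Plane → ℂ} {a₂ b₂ : Fin 2 → Fin 2 → Plane → ℂ}

/-- The Klein-Gordon equation for the profile. -/
lemma isKleinGordonOf_mainSymb (lam ρ : ℝ) (hA : WeakJet A a₁ a₂)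
    (hB : WeakJet B b₁ b₂) {m : ℝ} (hmA : ∀ x, ‖A x‖ ≤ m) (hmB : ∀ x, ‖B x‖ ≤ m)
    (fA : ∫⁻ x, dens A a₁ a₂ x ≠ ⊤) (fB : ∫⁻ x, dens B b₁ b₂ x ≠ ⊤) :
    IsKleinGordonOf (coneExt (profH (mainSymb lam ρ) fun z => (A z, B z)))
      (coneExt fun q => kgLim lam ρ q.1 q.2 (jetPair A B a₁ b₁ a₂ b₂ q.2)) := by
  obtain ⟨C, hC, hS⟩ := exists_regSeq_good lam ρ
  have mP : Measurable fun z => (A z, B z) := (hA.continuous.prodMk hB.continuous).measurable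
  have mJ := measurable_jetPair hA hB
  have mw := measurable_domWeight hA.measurable_dens hB.measurable_dens
  have dk : ∀ μ, ofReal (rinv μ ^ 2 * jetSize μ (jetPair A B a₁ b₁ a₂ b₂ μ)) ≤
      ofReal (16 * 1 ^ 2 * (1 + m) ^ 2) * domWeight (dens A a₁ a₂) (dens B b₁ b₂) μ := fun μ =>
    ofReal_jetSize_le le_rfl (max_le (hmA μ) (hmB μ)) fun Y hY hle => norm_jetPair_le le_rfl hY hle
  refine isKleinGordonOf_coneExt_of_tendsto (Φ := fun n => profH (regSeq lam ρ n) fun z => (A z, B z))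
    (Ψ := fun n => kgH (regSeq lam ρ n) (jetPair A B a₁ b₁ a₂ b₂))
    (w := fun _ => domWeight (dens A a₁ a₂) (dens B b₁ b₂))
    (w₀ := domWeight (dens A a₁ a₂) (dens B b₁ b₂))
    (K := fun T => ofReal (440 * C ^ 3 * (T ^ 2 * (1 + log T) ^ 2)) *
      ofReal (16 * 1 ^ 2 * (1 + m) ^ 2))
    (fun n => (hS n).measurable_profH mP) (fun n => (hS n).measurable_kgH mJ)
    (measurable_profH_mainSymb lam ρ mP) (measurable_kgLim lam ρ mJ) (fun _ => mw) mw
    (fun T => mul_ne_top ofReal_ne_top ofReal_ne_top)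
    (fun n T t ht μ => ?_) (fun n T t ht μ => ?_) (fun t _ => Eventually.of_forall fun μ => ?_)
    (fun t _ => Eventually.of_forall fun μ => tendsto_kgLim lam ρ t μ _)
    (.of_forall fun _ => tendsto_const_nhds) (fun _ => rfl) ?_
    (fun n => (isKleinGordonOf_good (hS n) hC hA hB hmA hmB fA fB).2.2)
  · rw [mul_assoc]
    exact ((hS n).slab_bound hC ht μ (jetPair A B a₁ b₁ a₂ b₂ μ)).1.trans (mul_le_mul_right (dk μ) _)
  · rw [mul_assoc]
    exact ((hS n).slab_bound hC ht μ (jetPair A B a₁ b₁ a₂ b₂ μ)).2.trans (mul_le_mul_right (dk μ) _)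
  · refine tendsto_const_nhds.congr' ?_
    filter_upwards [eventually_regSeq_prof_eq lam ρ hS (slowPt t μ (A μ, B μ))] with n hn
    exact hn.symm
  · rw [lintegral_domWeight hA.measurable_dens hB.measurable_dens]
    exact add_ne_top.2 ⟨lintegral_rinv_lt_top.ne, add_ne_top.2 ⟨fA, fB⟩⟩

end Main

lemma jetOne_sq_le_jetSize (μ : Plane) (J : Jet) : (1 + ‖J.1‖) ^ 2 * ‖J.1‖ ^ 2 ≤ jetSize μ J := by
  have h1 := norm_le_jetOne μ J
  have h2 := jetTwo_nonneg J
  have h3 := jetOne_nonneg μ J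
  have h : 0 ≤ jap ‖μ‖ ^ 2 * jetTwo J := mul_nonneg (by positivity) h2
  rw [jetSize]
  gcongr
  have : ‖J.1‖ ^ 2 ≤ jetOne μ J ^ 2 := by gcongr
  linarith

lemma Symb.sumw_eq (S : Symb) (e : Slow) : S.sumw e = (S.wave e).1 + (S.wave e).2 := by
  rw [S.wave_fst_eq, S.wave_snd_eq]; rfl

/-- The nonlinearity, up to errors of higher order. -/
lemma Symb.Good.norm_nonlin_sub_le {C : ℝ} {S : Symb} (hS : S.Good C) (hC : 1 ≤ C) {t : ℝ}
    (ht : 1 ≤ t) (μ : Plane) (J : Jet) :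
    ‖nonlin lam (S.prof (slowPt t μ J.1)) - ((t ^ 2)⁻¹ : ℝ) * (lam * absMul (S.sumw (slowPt t μ J.1)))‖ ≤
      4 * |lam| * C ^ 2 * (((t * rinv μ) ^ 2)⁻¹ * t⁻¹ * (1 + log t) ^ 2 * jetSize μ J) := by
  have ht0 : 0 < t := by linarith
  have hr := rinv_pos μ
  have hr1 := rinv_le_one μ
  have hL := Real.log_nonneg ht
  set e := slowPt t μ J.1
  set p := ‖J.1‖
  have hp0 : 0 ≤ p := norm_nonneg _
  have h1 : ‖S.prof e - (t⁻¹ : ℝ) * S.sumw e‖ ≤ C * (t ^ 2)⁻¹ * p ^ 2 := hS.norm_prof_le ht0 μ J.1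
  have h2 : ‖(t⁻¹ : ℝ) * S.sumw e‖ ≤ t⁻¹ * (2 * p) := by
    rw [norm_mul, norm_real, norm_of_nonneg (by positivity)]
    gcongr; exact S.norm_sumw_le _
  have h3 : ‖S.prof e‖ ≤ C * (t ^ 2)⁻¹ * p ^ 2 + t⁻¹ * (2 * p) :=
    (norm_le_norm_sub_add _ _).trans (add_le_add h1 h2)
  have hab : absMul ((t⁻¹ : ℝ) * S.sumw e) = ((t ^ 2)⁻¹ : ℝ) * absMul (S.sumw e) := by
    rw [absMul_mul, norm_real, norm_of_nonneg (by positivity)]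
    push_cast; ring
  have e1 : nonlin lam (S.prof e) - ((t ^ 2)⁻¹ : ℝ) * (lam * absMul (S.sumw e)) =
      lam * (absMul (S.prof e) - absMul ((t⁻¹ : ℝ) * S.sumw e)) := by
    rw [nonlin_eq, hab]; ring
  rw [e1, norm_mul, norm_real, norm_eq_abs]
  have h4 := norm_absMul_sub_le (S.prof e) ((t⁻¹ : ℝ) * S.sumw e)
  have hti : t⁻¹ ≤ 1 := inv_le_one_of_one_le₀ ht
  have hti0 : 0 < t⁻¹ := by positivity
  have h5 : (‖S.prof e‖ + ‖(t⁻¹ : ℝ) * S.sumw e‖) * ‖S.prof e - (t⁻¹ : ℝ) * S.sumw e‖ ≤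
      4 * C ^ 2 * (t⁻¹ ^ 3 * ((1 + p) ^ 2 * p ^ 2)) := by
    have a1 : ‖S.prof e‖ + ‖(t⁻¹ : ℝ) * S.sumw e‖ ≤ 4 * C * t⁻¹ * (p + p ^ 2) := by
      have b1 : C * (t ^ 2)⁻¹ * p ^ 2 ≤ C * t⁻¹ * p ^ 2 := by
        have : (t ^ 2)⁻¹ ≤ t⁻¹ := inv_anti₀ ht0 (by nlinarith)
        gcongr
      have b2 : t⁻¹ * (2 * p) ≤ C * t⁻¹ * (2 * p) := by
        have : 0 ≤ t⁻¹ * (2 * p) := by positivity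
        nlinarith
      have b3 : 0 ≤ C * t⁻¹ * p ^ 2 := by positivity
      nlinarith
    calc _ ≤ 4 * C * t⁻¹ * (p + p ^ 2) * (C * (t ^ 2)⁻¹ * p ^ 2) := by gcongr
      _ = 4 * C ^ 2 * (t⁻¹ ^ 3 * ((p + p ^ 2) * p ^ 2)) := by ring
      _ ≤ _ := by gcongr; nlinarith
  have h6 := jetOne_sq_le_jetSize μ J
  have h7 : t⁻¹ ^ 3 ≤ ((t * rinv μ) ^ 2)⁻¹ * t⁻¹ * (1 + log t) ^ 2 := by
    have c1 : t⁻¹ ^ 2 ≤ ((t * rinv μ) ^ 2)⁻¹ := by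
      rw [inv_pow]
      refine inv_anti₀ (by positivity) ?_
      rw [mul_pow]
      exact mul_le_of_le_one_right (by positivity) (pow_le_one₀ hr.le hr1)
    have c2 : 1 ≤ (1 + log t) ^ 2 := one_le_pow₀ (by linarith)
    calc t⁻¹ ^ 3 = t⁻¹ ^ 2 * t⁻¹ * 1 := by ring
      _ ≤ _ := by gcongr
  calc |lam| * ‖absMul (S.prof e) - absMul ((t⁻¹ : ℝ) * S.sumw e)‖
      ≤ |lam| * (4 * C ^ 2 * (t⁻¹ ^ 3 * ((1 + p) ^ 2 * p ^ 2))) := by gcongr; exact h4.trans h5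
    _ ≤ |lam| * (4 * C ^ 2 * (((t * rinv μ) ^ 2)⁻¹ * t⁻¹ * (1 + log t) ^ 2 * jetSize μ J)) := by
        gcongr
    _ = _ := by ring

/-- The pointwise bound for the error of the profile. -/
lemma exists_pointwise_bound (lam ρ : ℝ) : ∃ K : ℝ, 0 < K ∧ ∀ (t : ℝ) (μ : Plane) (J : Jet), 1 ≤ t →
    InCone ρ J.1 →
    ‖kgLim lam ρ t μ J - nonlin lam ((mainSymb lam ρ).prof (slowPt t μ J.1))‖ ≤
      K * (((t * rinv μ) ^ 2)⁻¹ * t⁻¹ * (1 + log t) ^ 2 * jetSize μ J) := by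
  obtain ⟨C, hC, hS⟩ := exists_regSeq_good lam ρ
  refine ⟨430 * C ^ 3 + 4 * |lam| * C ^ 2, by positivity, fun t μ J ht hJ => ?_⟩
  set X := ((t * rinv μ) ^ 2)⁻¹ * t⁻¹ * (1 + log t) ^ 2 * jetSize μ J
  refine le_of_tendsto ((tendsto_kgLim lam ρ t μ J).sub_const _).norm ?_
  have hcut : ∀ᶠ n in atTop, (regSeq lam ρ n).lead (slowPt t μ J.1) =
      lam * absMul ((regSeq lam ρ n).sumw (slowPt t μ J.1)) := by
    have hl : ∀ n, (regSeq lam ρ n).lead (slowPt t μ J.1) = lam * cut (cScale n) J.1 *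
        absMul ((regSeq lam ρ n).sumw (slowPt t μ J.1)) := fun n => by
      rw [Symb.sumw_eq]; exact lead_regSymb (hS n) hJ
    rcases eq_or_ne J.1 0 with hp | hp
    · refine .of_forall fun n => ?_
      have h0 : (regSeq lam ρ n).sumw (slowPt t μ J.1) = 0 := by
        have := (regSeq lam ρ n).norm_sumw_le (slowPt t μ J.1)
        change _ ≤ 2 * ‖J.1‖ at this
        rw [hp, norm_zero, mul_zero] at this
        rw [hp]; exact norm_le_zero_iff.1 this
      rw [hl, h0]; simp [absMul]
    · filter_upwards [eventually_cut_cScale hp] with n hn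
      rw [hl, cut_eq_one (cScale_pos n) hn.le]; simp
  filter_upwards [hcut, eventually_regSeq_prof_eq lam ρ hS (slowPt t μ J.1)] with n h1 h2
  have k1 := (hS n).norm_kgAt_sub_lead_le hC ht μ J
  have k2 := (hS n).norm_nonlin_sub_le (lam := lam) hC ht μ J
  rw [h1] at k1
  rw [h2, norm_sub_rev] at k2
  have := norm_sub_le_norm_sub_add_norm_sub (kgAt (regSeq lam ρ n) t μ J)
    (((t ^ 2)⁻¹ : ℝ) * (lam * absMul ((regSeq lam ρ n).sumw (slowPt t μ J.1))))
    (nonlin lam ((mainSymb lam ρ).prof (slowPt t μ J.1)))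
  calc _ ≤ _ := this
    _ ≤ 430 * C ^ 3 * X + 4 * |lam| * C ^ 2 * X := add_le_add k1 k2
    _ = _ := by ring

end Cutoff

/-! ### The norm of the jet -/

lemma jetSize_sq_le {μ : Plane} {J : Jet} {m : ℝ} (hm : ‖J.1‖ ≤ m) :
    jetSize μ J ^ 2 ≤ 81 * (1 + m) ^ 4 * ((1 + m ^ 2) * (jap ‖μ‖ ^ 4 * ‖J.1‖ ^ 2)
      + ∑ i, jap ‖μ‖ ^ 4 * ‖J.2.1 i‖ ^ 2 + ∑ i, ∑ j, jap ‖μ‖ ^ 4 * ‖J.2.2 i j‖ ^ 2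
      + ∑ i, jap ‖μ‖ ^ 4 * ‖J.2.1 i‖ ^ 4) := by
  have hj := one_le_jap ‖μ‖
  set j := jap ‖μ‖ with hjdef
  set p := ‖J.1‖ with hp
  have hp0 : 0 ≤ p := norm_nonneg _
  have hm0 : 0 ≤ m := hp0.trans hm
  simp only [Fin.sum_univ_two]
  have hJ : jetSize μ J = (1 + p) ^ 2 * ((p + j * (‖J.2.1 0‖ + ‖J.2.1 1‖))
      + (p + j * (‖J.2.1 0‖ + ‖J.2.1 1‖)) ^ 2
      + j ^ 2 * (‖J.2.2 0 0‖ + ‖J.2.2 0 1‖ + (‖J.2.2 1 0‖ + ‖J.2.2 1 1‖))) := by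
    simp only [jetSize, jetOne, jetTwo, Fin.sum_univ_two, hp, hjdef]
  rw [hJ]
  set x := ‖J.2.1 0‖
  set y := ‖J.2.1 1‖
  set a := ‖J.2.2 0 0‖
  set b := ‖J.2.2 0 1‖
  set c := ‖J.2.2 1 0‖
  set d := ‖J.2.2 1 1‖
  have three : ∀ u v w : ℝ, (u + v + w) ^ 2 ≤ 3 * (u ^ 2 + v ^ 2 + w ^ 2) := fun u v w => by
    nlinarith [sq_nonneg (u - v), sq_nonneg (u - w), sq_nonneg (v - w)]
  have j24 : j ^ 2 ≤ j ^ 4 := pow_le_pow_right₀ hj (by norm_num)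
  have j14 : 1 ≤ j ^ 4 := one_le_pow₀ hj
  have e1 : (p + j * (x + y)) ^ 2 ≤ 3 * (p ^ 2 + j ^ 2 * x ^ 2 + j ^ 2 * y ^ 2) := by
    have := three p (j * x) (j * y)
    rw [mul_pow, mul_pow] at this
    calc _ = (p + j * x + j * y) ^ 2 := by ring
      _ ≤ _ := this
  have e2 : ((p + j * (x + y)) ^ 2) ^ 2 ≤ 27 * (p ^ 4 + j ^ 4 * x ^ 4 + j ^ 4 * y ^ 4) := by
    calc _ ≤ (3 * (p ^ 2 + j ^ 2 * x ^ 2 + j ^ 2 * y ^ 2)) ^ 2 := by gcongr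
      _ = 9 * (p ^ 2 + j ^ 2 * x ^ 2 + j ^ 2 * y ^ 2) ^ 2 := by ring
      _ ≤ 9 * (3 * ((p ^ 2) ^ 2 + (j ^ 2 * x ^ 2) ^ 2 + (j ^ 2 * y ^ 2) ^ 2)) := by
          gcongr; exact three _ _ _
      _ = _ := by ring
  have e3 : (j ^ 2 * (a + b + (c + d))) ^ 2 ≤ 4 * (j ^ 4 * (a ^ 2 + b ^ 2 + (c ^ 2 + d ^ 2))) := by
    have : (a + b + (c + d)) ^ 2 ≤ 4 * (a ^ 2 + b ^ 2 + (c ^ 2 + d ^ 2)) := by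
      nlinarith [sq_nonneg (a - b), sq_nonneg (a - c), sq_nonneg (a - d), sq_nonneg (b - c),
        sq_nonneg (b - d), sq_nonneg (c - d)]
    calc _ = j ^ 4 * (a + b + (c + d)) ^ 2 := by ring
      _ ≤ j ^ 4 * (4 * (a ^ 2 + b ^ 2 + (c ^ 2 + d ^ 2))) := by gcongr
      _ = _ := by ring
  have f1 : p ^ 2 ≤ j ^ 4 * p ^ 2 := le_mul_of_one_le_left (by positivity) j14
  have f2 : p ^ 4 ≤ m ^ 2 * (j ^ 4 * p ^ 2) := by
    calc p ^ 4 = p ^ 2 * p ^ 2 := by ring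
      _ ≤ m ^ 2 * (j ^ 4 * p ^ 2) := by gcongr
  have f3 : j ^ 2 * x ^ 2 ≤ j ^ 4 * x ^ 2 := by gcongr
  have f4 : j ^ 2 * y ^ 2 ≤ j ^ 4 * y ^ 2 := by gcongr
  have g0 : 0 ≤ j ^ 4 * p ^ 2 := by positivity
  have g1 : 0 ≤ m ^ 2 * (j ^ 4 * p ^ 2) := by positivity
  have g2 : 0 ≤ j ^ 4 * x ^ 2 := by positivity
  have g3 : 0 ≤ j ^ 4 * y ^ 2 := by positivity
  have g4 : 0 ≤ j ^ 4 * (a ^ 2 + b ^ 2 + (c ^ 2 + d ^ 2)) := by positivity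
  have hsum := three (p + j * (x + y)) ((p + j * (x + y)) ^ 2) (j ^ 2 * (a + b + (c + d)))
  have hfin : (p + j * (x + y) + (p + j * (x + y)) ^ 2 + j ^ 2 * (a + b + (c + d))) ^ 2 ≤
      81 * ((1 + m ^ 2) * (j ^ 4 * p ^ 2) + (j ^ 4 * x ^ 2 + j ^ 4 * y ^ 2) +
        (j ^ 4 * a ^ 2 + j ^ 4 * b ^ 2 + (j ^ 4 * c ^ 2 + j ^ 4 * d ^ 2)) +
        (j ^ 4 * x ^ 4 + j ^ 4 * y ^ 4)) := by
    linarith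
  calc _ = (1 + p) ^ 4 * (p + j * (x + y) + (p + j * (x + y)) ^ 2 + j ^ 2 * (a + b + (c + d))) ^ 2 := by
        ring
    _ ≤ (1 + m) ^ 4 * (81 * ((1 + m ^ 2) * (j ^ 4 * p ^ 2) + (j ^ 4 * x ^ 2 + j ^ 4 * y ^ 2) +
        (j ^ 4 * a ^ 2 + j ^ 4 * b ^ 2 + (j ^ 4 * c ^ 2 + j ^ 4 * d ^ 2)) +
        (j ^ 4 * x ^ 4 + j ^ 4 * y ^ 4))) := by gcongr
    _ = _ := by ring

lemma norm_pair_pow_le (a b : ℂ) (n : ℕ) : ‖(a, b)‖ ^ n ≤ ‖a‖ ^ n + ‖b‖ ^ n := by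
  rw [Prod.norm_mk]
  rcases max_choice ‖a‖ ‖b‖ with h | h <;> rw [h]
  · exact le_add_of_nonneg_right (by positivity)
  · exact le_add_of_nonneg_left (by positivity)

section JetNorm

variable {A B : Plane → ℂ} {a₁ b₁ : Fin 2 → Plane → ℂ} {a₂ b₂ : Fin 2 → Fin 2 → Plane → ℂ}

/-- Fourth powers of the first derivatives. -/
def dens4 (g₁ : Fin 2 → Plane → ℂ) (μ : Plane) : ℝ≥0∞ :=
  ∑ i, ofReal (jap ‖μ‖ ^ 4) * ‖g₁ i μ‖ₑ ^ 4

lemma ofReal_jetSize_sq_le {m : ℝ} {μ : Plane} (hA : ‖A μ‖ ≤ m) (hB : ‖B μ‖ ≤ m) :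
    ofReal (jetSize μ (jetPair A B a₁ b₁ a₂ b₂ μ) ^ 2) ≤ ofReal (81 * (1 + m) ^ 4) *
      (ofReal (1 + m ^ 2) * (dens A a₁ a₂ μ + dens B b₁ b₂ μ) + (dens4 a₁ μ + dens4 b₁ μ)) := by
  have hm0 : 0 ≤ m := (norm_nonneg _).trans hA
  have h := jetSize_sq_le (μ := μ) (J := jetPair A B a₁ b₁ a₂ b₂ μ) (m := m) (max_le hA hB)
  set j := jap ‖μ‖
  have hj0 : 0 < j := jap_pos _
  have key : ∀ (n : ℕ) (z : ℂ), ofReal (j ^ 4 * ‖z‖ ^ n) = ofReal (j ^ 4) * ‖z‖ₑ ^ n :=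
    fun n z => by
      rw [ofReal_mul (by positivity), ofReal_pow (norm_nonneg _), ofReal_norm]
  have hd : ∀ {f : Plane → ℂ} {g₁ : Fin 2 → Plane → ℂ} {g₂ : Fin 2 → Fin 2 → Plane → ℂ},
      dens f g₁ g₂ μ = ofReal (j ^ 4 * ‖f μ‖ ^ 2 + ∑ i, j ^ 4 * ‖g₁ i μ‖ ^ 2 +
        ∑ i, ∑ k, j ^ 4 * ‖g₂ i k μ‖ ^ 2) := fun {f g₁ g₂} => by
    simp only [dens, Fin.sum_univ_two]
    rw [ofReal_add (by positivity) (by positivity), ofReal_add (by positivity) (by positivity),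
      ofReal_add (by positivity) (by positivity), ofReal_add (by positivity) (by positivity),
      ofReal_add (by positivity) (by positivity), ofReal_add (by positivity) (by positivity)]
    simp only [key]
    ring
  have hd4 : ∀ {g₁ : Fin 2 → Plane → ℂ}, dens4 g₁ μ = ofReal (∑ i, j ^ 4 * ‖g₁ i μ‖ ^ 4) :=
    fun {g₁} => by
      simp only [dens4, Fin.sum_univ_two]
      rw [ofReal_add (by positivity) (by positivity), key, key]
  rw [hd, hd, hd4, hd4, ← ofReal_add (by positivity) (by positivity),
    ← ofReal_add (by positivity) (by positivity), ← ofReal_mul (by positivity),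
    ← ofReal_add (by positivity) (by positivity), ← ofReal_mul (by positivity)]
  refine ofReal_le_ofReal (h.trans ?_)
  refine mul_le_mul_of_nonneg_left ?_ (by positivity)
  have n0 : j ^ 4 * ‖(jetPair A B a₁ b₁ a₂ b₂ μ).1‖ ^ 2 ≤ j ^ 4 * ‖A μ‖ ^ 2 + j ^ 4 * ‖B μ‖ ^ 2 := by
    rw [← mul_add]; gcongr; exact norm_pair_pow_le _ _ 2
  have n1 : ∀ (n : ℕ), ∑ i, j ^ 4 * ‖(jetPair A B a₁ b₁ a₂ b₂ μ).2.1 i‖ ^ n ≤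
      (∑ i, j ^ 4 * ‖a₁ i μ‖ ^ n) + ∑ i, j ^ 4 * ‖b₁ i μ‖ ^ n := fun n => by
    rw [← Finset.sum_add_distrib]
    gcongr with i
    rw [← mul_add]; gcongr; exact norm_pair_pow_le _ _ n
  have n2 : ∑ i, ∑ k, j ^ 4 * ‖(jetPair A B a₁ b₁ a₂ b₂ μ).2.2 i k‖ ^ 2 ≤
      (∑ i, ∑ k, j ^ 4 * ‖a₂ i k μ‖ ^ 2) + ∑ i, ∑ k, j ^ 4 * ‖b₂ i k μ‖ ^ 2 := by
    rw [← Finset.sum_add_distrib]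
    gcongr with i
    rw [← Finset.sum_add_distrib]
    gcongr with k
    rw [← mul_add]; gcongr; exact norm_pair_pow_le _ _ 2
  set D1 := (∑ i, j ^ 4 * ‖a₁ i μ‖ ^ 2) + ∑ i, j ^ 4 * ‖b₁ i μ‖ ^ 2 with hD1
  set D2 := (∑ i, ∑ k, j ^ 4 * ‖a₂ i k μ‖ ^ 2) + ∑ i, ∑ k, j ^ 4 * ‖b₂ i k μ‖ ^ 2 with hD2
  have hD1' : 0 ≤ D1 := by positivity
  have hD2' : 0 ≤ D2 := by positivity
  have hmul : (1 + m ^ 2) * (j ^ 4 * ‖(jetPair A B a₁ b₁ a₂ b₂ μ).1‖ ^ 2) ≤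
      (1 + m ^ 2) * (j ^ 4 * ‖A μ‖ ^ 2 + j ^ 4 * ‖B μ‖ ^ 2) := by gcongr
  have m1 : 0 ≤ m ^ 2 * D1 := by positivity
  have m2 : 0 ≤ m ^ 2 * D2 := by positivity
  have r1 := n1 2
  have r2 := n1 4
  calc _ ≤ (1 + m ^ 2) * (j ^ 4 * ‖A μ‖ ^ 2 + j ^ 4 * ‖B μ‖ ^ 2) + D1 + D2 + _ :=
        add_le_add (add_le_add (add_le_add hmul r1) n2) r2
    _ ≤ (1 + m ^ 2) * (j ^ 4 * ‖A μ‖ ^ 2 + j ^ 4 * ‖B μ‖ ^ 2 + D1 + D2) + _ := by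
        refine add_le_add_left ?_ _
        linarith
    _ = _ := by rw [hD1, hD2]; ring

/-- The `L²` norm of the jet is controlled by the Sobolev norms. -/
lemma exists_lintegral_jetSize_le : ∃ c : ℝ≥0∞, c ≠ ⊤ ∧ ∀ {A B : Plane → ℂ}
    {a₁ b₁ : Fin 2 → Plane → ℂ} {a₂ b₂ : Fin 2 → Fin 2 → Plane → ℂ}, WeakJet A a₁ a₂ → WeakJet B b₁ b₂ →
    sobolevNorm 2 2 A + sobolevNorm 2 2 B ≠ ⊤ →
    ∫⁻ μ, ofReal (jetSize μ (jetPair A B a₁ b₁ a₂ b₂ μ) ^ 2) ≤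
      c * ((sobolevNorm 2 2 A + sobolevNorm 2 2 B) ^ 2 *
        (1 + (sobolevNorm 2 2 A + sobolevNorm 2 2 B) ^ 2) ^ 3) := by
  obtain ⟨c₀, hc₀, hsup⟩ := exists_sup_bound
  obtain ⟨c₄, hc₄, h4⟩ := exists_L4_bound
  refine ⟨324 * (1 + 7 * c₀) ^ 3 * (7 + 4 * c₄ * 49), ?_, fun {A B a₁ b₁ a₂ b₂} hA hB hM => ?_⟩
  · refine mul_ne_top (mul_ne_top (by norm_num) (ENNReal.pow_ne_top ?_)) ?_
    · exact add_ne_top.2 ⟨ENNReal.one_ne_top, mul_ne_top (by norm_num) hc₀⟩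
    · exact add_ne_top.2 ⟨by norm_num, mul_ne_top
        (mul_ne_top (by norm_num) hc₄) (by norm_num)⟩
  set M := sobolevNorm 2 2 A + sobolevNorm 2 2 B with hMdef
  set DA := ∫⁻ x, dens A a₁ a₂ x
  set DB := ∫⁻ x, dens B b₁ b₂ x
  have hM2 : sobolevNorm 2 2 A ^ 2 + sobolevNorm 2 2 B ^ 2 ≤ M ^ 2 := by
    rw [hMdef, add_sq]
    exact add_le_add_left le_self_add _
  have hD : DA + DB ≤ 7 * M ^ 2 := by
    have h1 := hA.lintegral_dens_le
    have h2 := hB.lintegral_dens_le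
    calc DA + DB ≤ 7 * sobolevNorm 2 2 A ^ 2 + 7 * sobolevNorm 2 2 B ^ 2 := add_le_add h1 h2
      _ = 7 * (sobolevNorm 2 2 A ^ 2 + sobolevNorm 2 2 B ^ 2) := by ring
      _ ≤ 7 * M ^ 2 := by gcongr
  have hD' : DA + DB ≠ ⊤ := ne_top_of_le_ne_top (mul_ne_top (by norm_num) (ENNReal.pow_ne_top hM)) hD
  set m := sqrt (c₀ * (DA + DB)).toReal with hm
  have hm0 : 0 ≤ m := Real.sqrt_nonneg _
  have hm2 : ofReal (m ^ 2) = c₀ * (DA + DB) := by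
    rw [hm, Real.sq_sqrt ENNReal.toReal_nonneg, ofReal_toReal (mul_ne_top hc₀ hD')]
  have hsq : ∀ z : ℂ, ‖z‖ₑ ^ 2 ≤ c₀ * (DA + DB) → ‖z‖ ≤ m := fun z hz => by
    rw [← hm2, ← ofReal_norm, ← ofReal_pow (norm_nonneg _),
      ENNReal.ofReal_le_ofReal_iff (by positivity)] at hz
    exact le_of_sq_le_sq hz hm0
  have hmA : ∀ x, ‖A x‖ ≤ m := fun x => hsq _ ((hsup hA x).trans (by gcongr; exact le_self_add))
  have hmB : ∀ x, ‖B x‖ ≤ m := fun x => hsq _ ((hsup hB x).trans (by gcongr; exact le_add_self))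
  have mD4 : ∀ {g₁ : Fin 2 → Plane → ℂ}, (∀ i, Measurable (g₁ i)) → Measurable (dens4 g₁) := fun h =>
    Finset.measurable_fun_sum _ fun i _ => (measurable_japPow 4).mul ((h i).enorm.pow_const 4)
  have iD4 : ∀ {f : Plane → ℂ} {g₁ : Fin 2 → Plane → ℂ} {g₂ : Fin 2 → Fin 2 → Plane → ℂ},
      WeakJet f g₁ g₂ → ∫⁻ μ, dens4 g₁ μ ≤ 2 * c₄ * (∫⁻ x, dens f g₁ g₂ x) ^ 2 := fun {f g₁ g₂} h => by
    unfold dens4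
    have hi : ∀ i, Measurable fun x => ofReal (jap ‖x‖ ^ 4) * ‖g₁ i x‖ₑ ^ 4 := fun i =>
      (measurable_japPow 4).mul ((h.measurable₁ i).enorm.pow_const 4)
    rw [lintegral_finsetSum _ fun i _ => hi i, Fin.sum_univ_two]
    calc _ ≤ c₄ * (∫⁻ x, dens f g₁ g₂ x) ^ 2 + c₄ * (∫⁻ x, dens f g₁ g₂ x) ^ 2 :=
          add_le_add (h4 h 0) (h4 h 1)
      _ = _ := by ring
  have hone : ofReal (1 + m ^ 2) = 1 + c₀ * (DA + DB) := by
    rw [ofReal_add zero_le_one (by positivity), hm2, ENNReal.ofReal_one]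
  have hfour : ofReal (81 * (1 + m) ^ 4) ≤ 324 * (1 + c₀ * (DA + DB)) ^ 2 := by
    rw [← hone, ← ofReal_pow (by positivity), show (324 : ℝ≥0∞) = ofReal 324 by simp,
      ← ofReal_mul (by norm_num)]
    refine ofReal_le_ofReal ?_
    have : (1 + m) ^ 2 ≤ 2 * (1 + m ^ 2) := by nlinarith [sq_nonneg (1 - m)]
    calc 81 * (1 + m) ^ 4 = 81 * ((1 + m) ^ 2) ^ 2 := by ring
      _ ≤ 81 * (2 * (1 + m ^ 2)) ^ 2 := by gcongr
      _ = _ := by ring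
  have hmD4 : Measurable fun μ => dens4 a₁ μ + dens4 b₁ μ := (mD4 hA.measurable₁).add (mD4 hB.measurable₁)
  have i1 : ∫⁻ μ, (dens A a₁ a₂ μ + dens B b₁ b₂ μ) = DA + DB := lintegral_add_right _ hB.measurable_dens
  have i2 : ∫⁻ μ, (dens4 a₁ μ + dens4 b₁ μ) ≤ 4 * c₄ * (DA + DB) ^ 2 := by
    rw [lintegral_add_right _ (mD4 hB.measurable₁)]
    calc _ ≤ 2 * c₄ * DA ^ 2 + 2 * c₄ * DB ^ 2 := add_le_add (iD4 hA) (iD4 hB)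
      _ ≤ 2 * c₄ * (DA + DB) ^ 2 + 2 * c₄ * (DA + DB) ^ 2 := by
          gcongr
          · exact le_self_add
          · exact le_add_self
      _ = _ := by ring
  calc ∫⁻ μ, ofReal (jetSize μ (jetPair A B a₁ b₁ a₂ b₂ μ) ^ 2)
      ≤ ∫⁻ μ, ofReal (81 * (1 + m) ^ 4) * (ofReal (1 + m ^ 2) *
          (dens A a₁ a₂ μ + dens B b₁ b₂ μ) + (dens4 a₁ μ + dens4 b₁ μ)) :=
        lintegral_mono fun μ => ofReal_jetSize_sq_le (hmA μ) (hmB μ)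
    _ = ofReal (81 * (1 + m) ^ 4) * (ofReal (1 + m ^ 2) * (DA + DB) +
          ∫⁻ μ, (dens4 a₁ μ + dens4 b₁ μ)) := by
        rw [lintegral_const_mul' _ _ ofReal_ne_top, lintegral_add_right _ hmD4,
          lintegral_const_mul' _ _ ofReal_ne_top, i1]
    _ ≤ 324 * (1 + c₀ * (DA + DB)) ^ 2 * ((1 + c₀ * (DA + DB)) * (DA + DB) + 4 * c₄ * (DA + DB) ^ 2) := by
        rw [hone]; gcongr
    _ ≤ 324 * (1 + c₀ * (7 * M ^ 2)) ^ 2 * ((1 + c₀ * (7 * M ^ 2)) * (7 * M ^ 2) +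
          4 * c₄ * (7 * M ^ 2) ^ 2) := by gcongr
    _ ≤ _ := by
        have q0 : 1 + c₀ * (7 * M ^ 2) ≤ (1 + 7 * c₀) * (1 + M ^ 2) := by
          calc 1 + c₀ * (7 * M ^ 2) ≤ 1 + c₀ * (7 * M ^ 2) + (7 * c₀ + M ^ 2) := le_self_add
            _ = _ := by ring
        have q1 : 1 ≤ 1 + 7 * c₀ := le_self_add
        have q2 : M ^ 2 ≤ (1 + 7 * c₀) * (1 + M ^ 2) :=
          le_add_self.trans (le_mul_of_one_le_left zero_le q1)
        calc _ = 324 * (1 + c₀ * (7 * M ^ 2)) ^ 2 * (7 * (1 + c₀ * (7 * M ^ 2)) + 4 * c₄ * 49 * M ^ 2) *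
              M ^ 2 := by ring
          _ ≤ 324 * ((1 + 7 * c₀) * (1 + M ^ 2)) ^ 2 * (7 * ((1 + 7 * c₀) * (1 + M ^ 2)) +
              4 * c₄ * 49 * ((1 + 7 * c₀) * (1 + M ^ 2))) * M ^ 2 := by gcongr
          _ = _ := by ring

end JetNorm

/-! ### The estimates for the profile -/

lemma japE_sq (r : ℝ≥0∞) : japE r ^ 2 = 1 + r ^ 2 := by
  rw [japE, ← ENNReal.rpow_natCast, ← ENNReal.rpow_mul]; norm_num

lemma lintegral_enorm_sq_coneExt (Φ : ℝ × Plane → ℂ) {t : ℝ} (ht : 0 < t) :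
    ∫⁻ x, ‖coneExt Φ t x‖ₑ ^ 2 = ∫⁻ μ, ofReal (t ^ 2 * rinv μ ^ 4) * ‖Φ (t, μ)‖ₑ ^ 2 :=
  lintegral_comp_coneExt Φ ht (g := fun z => ‖z‖ₑ ^ 2) (by simp)

lemma eLpNorm_two_le {f : Plane → ℂ} {X : ℝ≥0∞} (h : ∫⁻ x, ‖f x‖ₑ ^ 2 ≤ X ^ 2) :
    eLpNorm f 2 volume ≤ X := by
  have e := eLpNorm_nnreal_pow_eq_lintegral (f := f) (μ := volume) (p := 2) two_ne_zero
  simp only [NNReal.coe_ofNat, ENNReal.rpow_two] at e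
  change eLpNorm f 2 volume ^ 2 = _ at e
  rw [← e] at h
  exact (ENNReal.pow_le_pow_left_iff two_ne_zero).1 h

section Estimates

variable {lam ρ : ℝ} {A B : Plane → ℂ} {ζ : Plane → ℝ}

lemma Admissible.profile_eq_coneExt (hρ : 1 ≤ ρ) (h : Admissible ρ A B ζ) (lam : ℝ) :
    profile lam A B ζ = coneExt (profH (mainSymb lam ρ) fun z => (A z, B z)) := by
  funext t x
  by_cases hx : ‖x‖ < t
  · rw [coneExt_of_mem _ hx, h.profile_eq hρ lam hx,
      slowAt_eq_slowPt _ (show (t, x) ∈ lightCone from hx)]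
    rfl
  · rw [coneExt_of_notMem _ hx, profile, uap, vap, if_neg hx, if_neg hx, add_zero]

lemma Admissible.sobolevNorm_ne_top (h : Admissible ρ A B ζ) :
    sobolevNorm 2 2 A + sobolevNorm 2 2 B ≠ ⊤ :=
  add_ne_top.2 ⟨h.mem_A.2.ne, h.mem_B.2.ne⟩

lemma WeakJet.lintegral_dens_ne_top {f : Plane → ℂ} {g₁ : Fin 2 → Plane → ℂ}
    {g₂ : Fin 2 → Fin 2 → Plane → ℂ} (h : WeakJet f g₁ g₂) (hf : MemSobolev 2 2 f) :
    ∫⁻ x, dens f g₁ g₂ x ≠ ⊤ :=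
  ne_top_of_le_ne_top (mul_ne_top (by norm_num) (ENNReal.pow_ne_top hf.2.ne))
    h.lintegral_dens_le

lemma WeakJet.exists_norm_le {f : Plane → ℂ} {g₁ : Fin 2 → Plane → ℂ}
    {g₂ : Fin 2 → Fin 2 → Plane → ℂ} (h : WeakJet f g₁ g₂) (hf : MemSobolev 2 2 f) :
    ∃ m : ℝ, ∀ x, ‖f x‖ ≤ m := by
  obtain ⟨c, hc, hsup⟩ := exists_sup_bound
  have hfin : c * ∫⁻ x, dens f g₁ g₂ x ≠ ⊤ := mul_ne_top hc (h.lintegral_dens_ne_top hf)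
  refine ⟨sqrt (c * ∫⁻ x, dens f g₁ g₂ x).toReal, fun x => ?_⟩
  refine Real.le_sqrt_of_sq_le ?_
  rw [← ENNReal.ofReal_le_iff_le_toReal hfin, ofReal_pow (norm_nonneg _), ofReal_norm]
  exact hsup h x

/-- The profile solves the Klein-Gordon equation up to a small error. -/
lemma exists_residual_bound (lam ρ : ℝ) (hρ : 1 ≤ ρ) : ∃ C : ℝ, 0 < C ∧
    ∀ (A B : Plane → ℂ) (ζ : Plane → ℝ), Admissible ρ A B ζ →
    ∃ F : ℝ → Plane → ℂ, IsKleinGordonOf (profile lam A B ζ) F ∧ ∀ t : ℝ, 3 ≤ t →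
      eLpNorm (fun x => F t x - nonlin lam (profile lam A B ζ t x)) 2 volume ≤
        ofReal (C * (t ^ 2)⁻¹ * log t ^ 2) *
          (sobolevNorm 2 2 A + sobolevNorm 2 2 B) *
          japE (sobolevNorm 2 2 A + sobolevNorm 2 2 B) ^ 3 := by
  obtain ⟨K, hK, hpt⟩ := exists_pointwise_bound lam ρ
  obtain ⟨c, hc, hjet⟩ := exists_lintegral_jetSize_le
  refine ⟨4 * K * (sqrt c.toReal + 1), by positivity, fun A B ζ h => ?_⟩
  obtain ⟨a₁, a₂, hA⟩ := h.mem_A.exists_weakJet h.continuous_A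
  obtain ⟨b₁, b₂, hB⟩ := h.mem_B.exists_weakJet h.continuous_B
  obtain ⟨mA, hmA⟩ := hA.exists_norm_le h.mem_A
  obtain ⟨mB, hmB⟩ := hB.exists_norm_le h.mem_B
  refine ⟨coneExt fun q => kgLim lam ρ q.1 q.2 (jetPair A B a₁ b₁ a₂ b₂ q.2), ?_, fun t ht => ?_⟩
  · rw [h.profile_eq_coneExt hρ]
    exact isKleinGordonOf_mainSymb lam ρ hA hB (m := max mA mB)
      (fun x => (hmA x).trans (le_max_left _ _)) (fun x => (hmB x).trans (le_max_right _ _))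
      (hA.lintegral_dens_ne_top h.mem_A) (hB.lintegral_dens_ne_top h.mem_B)
  have ht1 : 1 ≤ t := by linarith
  have ht0 : 0 < t := by linarith
  set M := sobolevNorm 2 2 A + sobolevNorm 2 2 B
  have hlog : 1 ≤ log t := by
    rw [Real.le_log_iff_exp_le ht0]
    exact (Real.exp_one_lt_d9.le.trans (by norm_num)).trans ht
  have heq : ∀ x, coneExt (fun q => kgLim lam ρ q.1 q.2 (jetPair A B a₁ b₁ a₂ b₂ q.2)) t x -
      nonlin lam (profile lam A B ζ t x) =
      coneExt (fun q => kgLim lam ρ q.1 q.2 (jetPair A B a₁ b₁ a₂ b₂ q.2) -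
        nonlin lam (profH (mainSymb lam ρ) (fun z => (A z, B z)) q)) t x := fun x => by
    rw [h.profile_eq_coneExt hρ]
    by_cases hx : ‖x‖ < t
    · rw [coneExt_of_mem _ hx, coneExt_of_mem _ hx, coneExt_of_mem _ hx]
    · rw [coneExt_of_notMem _ hx, coneExt_of_notMem _ hx, coneExt_of_notMem _ hx]
      simp [nonlin]
  simp only [heq]
  refine eLpNorm_two_le ?_
  rw [lintegral_enorm_sq_coneExt _ ht0]
  set Q := K * (t ^ 2)⁻¹ * (1 + log t) ^ 2 with hQ
  have hQ0 : 0 ≤ Q := by positivity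
  have hb : ∀ μ, ofReal (t ^ 2 * rinv μ ^ 4) * ‖kgLim lam ρ t μ (jetPair A B a₁ b₁ a₂ b₂ μ) -
        nonlin lam (profH (mainSymb lam ρ) (fun z => (A z, B z)) (t, μ))‖ₑ ^ 2 ≤
      ofReal (Q ^ 2) * ofReal (jetSize μ (jetPair A B a₁ b₁ a₂ b₂ μ) ^ 2) := fun μ => by
    have hp := hpt t μ (jetPair A B a₁ b₁ a₂ b₂ μ) ht1 (h.inCone hρ μ)
    have hr := rinv_pos μ
    rw [← ofReal_norm, ← ofReal_pow (norm_nonneg _), ← ofReal_mul (by positivity),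
      ← ofReal_mul (by positivity)]
    refine ofReal_le_ofReal ?_
    have hJ := jetSize_nonneg μ (jetPair A B a₁ b₁ a₂ b₂ μ)
    calc _ ≤ t ^ 2 * rinv μ ^ 4 * (K * (((t * rinv μ) ^ 2)⁻¹ * t⁻¹ * (1 + log t) ^ 2 *
          jetSize μ (jetPair A B a₁ b₁ a₂ b₂ μ))) ^ 2 := by
          gcongr; exact hp
      _ = _ := by rw [hQ]; field_simp
  have hcr : c = ofReal (sqrt c.toReal) ^ 2 := by
    rw [← ofReal_pow (Real.sqrt_nonneg _), Real.sq_sqrt ENNReal.toReal_nonneg,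
      ofReal_toReal hc]
  have hcle : ofReal (sqrt c.toReal) ≤ ofReal (sqrt c.toReal + 1) :=
    ofReal_le_ofReal (by linarith)
  have hQle : Q * (sqrt c.toReal + 1) ≤
      4 * K * (sqrt c.toReal + 1) * (t ^ 2)⁻¹ * log t ^ 2 := by
    have : (1 + log t) ^ 2 ≤ (2 * log t) ^ 2 := by gcongr; linarith
    calc _ = K * (t ^ 2)⁻¹ * (sqrt c.toReal + 1) * (1 + log t) ^ 2 := by rw [hQ]; ring
      _ ≤ K * (t ^ 2)⁻¹ * (sqrt c.toReal + 1) * (2 * log t) ^ 2 := by gcongr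
      _ = _ := by ring
  calc _ ≤ ∫⁻ μ, ofReal (Q ^ 2) *
        ofReal (jetSize μ (jetPair A B a₁ b₁ a₂ b₂ μ) ^ 2) := lintegral_mono hb
    _ = ofReal (Q ^ 2) * ∫⁻ μ, ofReal (jetSize μ (jetPair A B a₁ b₁ a₂ b₂ μ) ^ 2) :=
        lintegral_const_mul' _ _ ofReal_ne_top
    _ ≤ ofReal (Q ^ 2) * (c * (M ^ 2 * (1 + M ^ 2) ^ 3)) := by
        gcongr; exact hjet hA hB h.sobolevNorm_ne_top
    _ = (ofReal Q * ofReal (sqrt c.toReal) * M * japE M ^ 3) ^ 2 := by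
        rw [← japE_sq, ofReal_pow hQ0]
        nth_rewrite 1 [hcr]
        ring
    _ ≤ (ofReal Q * ofReal (sqrt c.toReal + 1) * M * japE M ^ 3) ^ 2 := by
        gcongr
    _ ≤ _ := by
        rw [← ofReal_mul hQ0]
        gcongr

lemma enorm_le_eLpNorm_top {f : Plane → ℂ} (hf : Continuous f) (x : Plane) :
    ‖f x‖ₑ ≤ eLpNorm f ⊤ volume := by
  rw [eLpNorm_exponent_top]
  have h : ∀ᵐ y, ‖f y‖ₑ ≤ eLpNormEssSup f volume := ae_le_eLpNormEssSup
  have hd := Measure.dense_of_ae h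
  exact (isClosed_le hf.enorm continuous_const).closure_subset_iff.2 (fun y hy => hy) (hd x)

/-- The supremum bound for the profile. -/
lemma exists_profile_sup_bound (lam ρ : ℝ) (hρ : 1 ≤ ρ) : ∃ C : ℝ, 1 ≤ C ∧
    ∀ (A B : Plane → ℂ) (ζ : Plane → ℝ), Admissible ρ A B ζ → ∀ t : ℝ, 1 ≤ t →
      eLpNorm (profile lam A B ζ t) ⊤ volume ≤
        ofReal (C * t⁻¹) * (eLpNorm A ⊤ volume + eLpNorm B ⊤ volume) *
          (1 + (eLpNorm A ⊤ volume + eLpNorm B ⊤ volume)) := by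
  obtain ⟨C, hC, hS⟩ := exists_regSeq_good lam ρ
  refine ⟨C, hC, fun A B ζ h t ht => ?_⟩
  have ht0 : 0 < t := by linarith
  set m := eLpNorm A ⊤ volume + eLpNorm B ⊤ volume
  rw [eLpNorm_exponent_top]
  refine essSup_le_of_ae_le _ (.of_forall fun x => ?_)
  change ‖profile lam A B ζ t x‖ₑ ≤ _
  rw [h.profile_eq_coneExt hρ]
  by_cases hx : ‖x‖ < t
  swap
  · rw [coneExt_of_notMem _ hx, enorm_zero]; exact zero_le
  rw [coneExt_of_mem _ hx]
  set μ := mu t x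
  obtain ⟨n, hn⟩ := (eventually_regSeq_prof_eq lam ρ hS (slowPt t μ (A μ, B μ))).exists
  change ‖(mainSymb lam ρ).prof (slowPt t μ (A μ, B μ))‖ₑ ≤ _
  rw [← hn]
  have h1 := (hS n).norm_prof_le ht0 μ (A μ, B μ)
  have h2 : ‖(t⁻¹ : ℝ) * (regSeq lam ρ n).sumw (slowPt t μ (A μ, B μ))‖ ≤ t⁻¹ * (‖A μ‖ + ‖B μ‖) := by
    rw [norm_mul, norm_real, norm_of_nonneg (by positivity), Symb.sumw_eq]
    gcongr
    refine (norm_add_le _ _).trans_eq ?_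
    rw [norm_wave_fst, norm_wave_snd]
    rfl
  have hp : ‖(A μ, B μ)‖ ≤ ‖A μ‖ + ‖B μ‖ := by
    rw [Prod.norm_mk]
    exact max_le (le_add_of_nonneg_right (norm_nonneg _)) (le_add_of_nonneg_left (norm_nonneg _))
  set s := ‖A μ‖ + ‖B μ‖ with hs
  have hs0 : 0 ≤ s := by positivity
  have hb : ‖(regSeq lam ρ n).prof (slowPt t μ (A μ, B μ))‖ ≤ C * t⁻¹ * (s * (1 + s)) := by
    have h3 := norm_le_norm_sub_add ((regSeq lam ρ n).prof (slowPt t μ (A μ, B μ)))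
      ((t⁻¹ : ℝ) * (regSeq lam ρ n).sumw (slowPt t μ (A μ, B μ)))
    have h4 : C * (t ^ 2)⁻¹ * ‖(A μ, B μ)‖ ^ 2 ≤ C * t⁻¹ * s ^ 2 := by
      have : (t ^ 2)⁻¹ ≤ t⁻¹ := inv_anti₀ ht0 (by nlinarith)
      gcongr
    have h5 : t⁻¹ * s ≤ C * t⁻¹ * s := by
      have : 0 ≤ t⁻¹ * s := by positivity
      nlinarith
    calc _ ≤ C * t⁻¹ * s ^ 2 + C * t⁻¹ * s := by linarith
      _ = _ := by ring
  have hsm : ofReal s ≤ m := by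
    rw [hs, ofReal_add (norm_nonneg _) (norm_nonneg _), ofReal_norm, ofReal_norm]
    exact add_le_add (enorm_le_eLpNorm_top h.continuous_A μ) (enorm_le_eLpNorm_top h.continuous_B μ)
  rw [← ofReal_norm]
  refine (ofReal_le_ofReal hb).trans ?_
  rw [ofReal_mul (by positivity), ofReal_mul hs0,
    ofReal_add zero_le_one hs0, ENNReal.ofReal_one, mul_assoc]
  change _ ≤ ofReal (C * t⁻¹) * (m * (1 + m))
  gcongr

lemma one_add_le_two_japE_sq (r : ℝ≥0∞) : 1 + r ≤ 2 * japE r ^ 2 := by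
  rw [japE_sq]
  rcases le_total r 1 with h | h
  · calc 1 + r ≤ 1 + 1 := by gcongr
      _ = 2 * 1 := by norm_num
      _ ≤ _ := by gcongr; exact le_self_add
  · calc 1 + r ≤ 1 + r * r := by gcongr; exact le_mul_of_one_le_left zero_le h
      _ = 1 * (1 + r ^ 2) := by rw [one_mul, pow_two]
      _ ≤ _ := by gcongr; norm_num

lemma eventually_log_sq_le {c ε δ : ℝ} (hε : 0 < ε) (hδ : δ < 1) :
    ∀ᶠ t : ℝ in atTop, c * (t ^ 2)⁻¹ * log t ^ 2 ≤ ε * t ^ (-1 - δ) := by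
  have h1 := (isLittleO_log_rpow_rpow_atTop (2 : ℝ) (sub_pos.2 hδ)).def
    (show 0 < ε / (|c| + 1) by positivity)
  filter_upwards [h1, eventually_ge_atTop 1] with t h2 ht
  have ht0 : 0 < t := by linarith
  have hl := Real.log_nonneg ht
  rw [Real.rpow_two, norm_of_nonneg (by positivity), norm_of_nonneg (by positivity)] at h2
  have e : t ^ (1 - δ) * (t ^ 2)⁻¹ = t ^ (-1 - δ) := by
    rw [← Real.rpow_natCast t 2, ← Real.rpow_neg ht0.le, ← Real.rpow_add ht0]
    congr 1; push_cast; ring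
  calc c * (t ^ 2)⁻¹ * log t ^ 2 ≤ (|c| + 1) * (t ^ 2)⁻¹ * log t ^ 2 := by
        gcongr; linarith [le_abs_self c]
    _ ≤ (|c| + 1) * (t ^ 2)⁻¹ * (ε / (|c| + 1) * t ^ (1 - δ)) := by gcongr
    _ = ε * (t ^ (1 - δ) * (t ^ 2)⁻¹) := by field_simp
    _ = _ := by rw [e]

end Estimates

/-! ### Lower bounds for the imaginary part -/

/-- The map `(a, b) ↦ a - \bar b`. -/
def mismCLM : ℂ × ℂ →L[ℝ] ℂ :=
  fst ℝ ℂ ℂ - (Complex.conjCLE : ℂ →L[ℝ] ℂ).comp (snd ℝ ℂ ℂ)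

lemma mismCLM_apply (p : ℂ × ℂ) : mismCLM p = p.1 - (starRingEnd ℂ) p.2 := rfl

lemma norm_mismCLM_le (p : ℂ × ℂ) : ‖mismCLM p‖ ≤ 2 * ‖p‖ := by
  rw [mismCLM_apply, two_mul]
  refine (norm_sub_le _ _).trans (add_le_add (norm_fst_le p) ?_)
  rw [RCLike.norm_conj]
  exact norm_snd_le p

/-- The obstruction to the sum of the two waves being real. -/
def Symb.mism (S : Symb) (e : Slow) : ℂ := mismCLM (S.wave e)

lemma Symb.im_sumw_sq (S : Symb) (e : Slow) :
    (S.sumw e).im ^ 2 = ‖S.mism e‖ ^ 2 / 2 - (S.mism e ^ 2).re / 2 := by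
  have h : (S.sumw e).im = (S.mism e).im := by
    rw [S.sumw_eq, Symb.mism, mismCLM_apply]; simp
  rw [h, ← normSq_eq_norm_sq, Complex.normSq_apply, pow_two (S.mism e), Complex.mul_re]
  ring

lemma Symb.sub_sq_le_norm_mism (S : Symb) (e : Slow) :
    (‖e.2.2.2.1‖ - ‖e.2.2.2.2‖) ^ 2 ≤ ‖S.mism e‖ ^ 2 := by
  rw [← norm_wave_fst S, ← norm_wave_snd S, ← sq_abs]
  have := abs_norm_sub_norm_le (S.wave e).1 ((starRingEnd ℂ) (S.wave e).2)
  rw [RCLike.norm_conj] at this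
  exact pow_le_pow_left₀ (abs_nonneg _) this 2

lemma Symb.norm_mism_le (S : Symb) (e : Slow) : ‖S.mism e‖ ≤ 2 * ‖prP e‖ := by
  have := norm_mismCLM_le (S.wave e)
  rwa [norm_wave] at this

section Oscillation

variable {C : ℝ} {S : Symb}

lemma Symb.Good.contDiff_mism (hS : S.Good C) : ContDiff ℝ 2 S.mism :=
  mismCLM.contDiff.comp hS.contDiff_wave

lemma Symb.Good.fderiv_mism (hS : S.Good C) (e v : Slow) :
    fderiv ℝ S.mism e v = mismCLM (fderiv ℝ S.wave e v) := by
  have := (mismCLM.hasFDerivAt (x := S.wave e)).comp e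
    (hS.contDiff_wave.differentiable two_ne_zero e).hasFDerivAt
  rw [show fderiv ℝ S.mism e = _ from this.fderiv]; rfl

lemma Symb.Good.fderiv_mism_eS (hS : S.Good C) (e : Slow) :
    fderiv ℝ S.mism e eS = -(I * S.mism e) := by
  rw [hS.fderiv_mism, hS.fderiv_wave, fderiv_gwave_eS _ hS.contDiff_phA,
    fderiv_gwave_eS _ hS.contDiff_phB, Symb.mism, mismCLM_apply, mismCLM_apply, S.wave_fst_eq, S.wave_snd_eq]
  simp; ring

lemma hasFDerivAt_slowPt (t : ℝ) {P : Plane → ℂ × ℂ} (hP : ContDiff ℝ 2 P) (μ : Plane) :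
    ∃ L : Plane →L[ℝ] Slow, HasFDerivAt (fun μ => slowPt t μ (P μ)) L μ ∧
      ∀ i, L (basisVec i) = (-(t * (μ i * rinv μ ^ 3))) • eS + dirJet μ (jetOf P μ) i := by
  have hr := hasFDerivAt_rinv μ
  refine ⟨_, (hr.const_mul t).prodMk ((hasFDerivAt_const (log t) μ).prodMk
    (hr.prodMk (hP.differentiable two_ne_zero μ).hasFDerivAt)), fun i => ?_⟩
  ext <;> simp [eS, dirJet, jetOf, inner_basisVec, mul_comm]

/-- Non-stationary phase for the square of the mismatch. -/
lemma Symb.Good.norm_integral_mism_sq_le (hS : S.Good C) (hC : 1 ≤ C) {P : Plane → ℂ × ℂ}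
    (hP : ContDiff ℝ 2 P) {m b t : ℝ} (hm : ∀ μ, ‖P μ‖ ≤ m) (ht : 1 ≤ t) {ψ : Plane → ℝ}
    (hψ : ContDiff ℝ 2 ψ) (hcs : HasCompactSupport ψ) (hb : ∀ μ, |ψ μ| ≤ b)
    (hb' : ∀ μ, |fderiv ℝ ψ μ (basisVec 0)| ≤ b) :
    2 * t * ‖∫ μ, (ψ μ * (μ 0 * rinv μ ^ 3)) • S.mism (slowPt t μ (P μ)) ^ 2‖ ≤
      20 * b * C * (1 + log t) * (1 + m) ^ 3 *
        ∫ μ in tsupport ψ, (1 + ‖fderiv ℝ P μ (basisVec 0)‖ ^ 2) := by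
  have ht0 : 0 < t := by linarith
  have hL := Real.log_nonneg ht
  have hm0 : 0 ≤ m := (norm_nonneg _).trans (hm 0)
  have hb0 : 0 ≤ b := (abs_nonneg _).trans (hb 0)
  set f : Plane → ℂ := fun μ => S.mism (slowPt t μ (P μ)) with hf
  set D : Plane → ℂ := fun μ => fderiv ℝ S.mism (slowPt t μ (P μ)) (dirJet μ (jetOf P μ) 0) with hD
  have hcf : ContDiff ℝ 2 f := hS.contDiff_mism.comp
    ((contDiff_const.mul contDiff_rinv).prodMk (contDiff_const.prodMk (contDiff_rinv.prodMk hP)))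
  have hdf : ∀ μ, fderiv ℝ f μ (basisVec 0) = D μ + I * (t * (μ 0 * rinv μ ^ 3) : ℝ) * f μ := fun μ => by
    obtain ⟨L, h1, h2⟩ := hasFDerivAt_slowPt t hP μ
    have h3 := (hS.contDiff_mism.differentiable two_ne_zero _).hasFDerivAt.comp μ h1
    rw [show fderiv ℝ f μ = _ from h3.fderiv, ContinuousLinearMap.comp_apply, h2, map_add, map_smul,
      hS.fderiv_mism_eS, hD]
    simp only [real_smul, hf]
    push_cast; ring
  have hdf2 : ∀ μ, fderiv ℝ (fun μ => f μ ^ 2) μ (basisVec 0) =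
      2 * f μ * D μ + I * (2 * t * (μ 0 * rinv μ ^ 3) : ℝ) * f μ ^ 2 := fun μ => by
    have h1 := (hcf.differentiable two_ne_zero μ).hasFDerivAt.pow 2
    rw [h1.fderiv]
    simp only [smul_apply, hdf μ, smul_eq_mul]
    push_cast; ring
  have cf := hcf.continuous
  have cdf : Continuous fun μ => fderiv ℝ f μ (basisVec 0) :=
    (hcf.continuous_fderiv two_ne_zero).clm_apply continuous_const
  have cr := (contDiff_rinv (n := 0)).continuous
  have c0 : Continuous fun μ : Plane => μ 0 := by fun_prop
  have cD : Continuous D := by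
    have : D = fun μ => fderiv ℝ f μ (basisVec 0) - I * (t * (μ 0 * rinv μ ^ 3) : ℝ) * f μ := by
      funext μ; rw [hdf μ]; ring
    rw [this]; fun_prop
  have cdψ : Continuous fun μ => fderiv ℝ ψ μ (basisVec 0) :=
    (hψ.continuous_fderiv two_ne_zero).clm_apply continuous_const
  have hItg : ∀ (κ : Plane → ℝ) (g : Plane → ℂ), Continuous κ → Continuous g → HasCompactSupport κ →
      Integrable fun μ => κ μ • g μ := fun κ g h1 h2 h3 => by
    refine (h1.smul h2).integrable_of_hasCompactSupport (h3.mono' fun x hx => subset_tsupport _ ?_)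
    intro h0; apply hx; simp [h0]
  have hcs' : HasCompactSupport fun μ => fderiv ℝ ψ μ (basisVec 0) := hcs.fderiv_apply (𝕜 := ℝ) _
  have i1 := hItg _ (fun μ => f μ ^ 2) cdψ (cf.pow 2) hcs'
  have i2 := hItg ψ (fun μ => 2 * f μ * D μ) hψ.continuous (by fun_prop) hcs
  have i3 := hItg ψ (fun μ => I * (2 * t * (μ 0 * rinv μ ^ 3) : ℝ) * f μ ^ 2) hψ.continuous
    (by fun_prop) hcs
  have ibp := integral_smul_fderiv_eq_neg_fderiv_smul_of_integrable (μ := volume) (𝕜 := ℝ) (f := ψ)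
    (g := fun μ => f μ ^ 2) (v := basisVec 0) i1
    (by simp only [hdf2, smul_add]; exact i2.add i3) (hItg ψ _ hψ.continuous (cf.pow 2) hcs)
    (fun x _ => hψ.differentiable two_ne_zero x) (fun x _ => (hcf.pow 2).differentiable two_ne_zero x)
  simp only [hdf2, smul_add] at ibp
  rw [integral_add i2 i3] at ibp
  have e3 : ∫ μ, ψ μ • (I * (2 * t * (μ 0 * rinv μ ^ 3) : ℝ) * f μ ^ 2) =
      (I * (2 * t : ℝ)) * ∫ μ, (ψ μ * (μ 0 * rinv μ ^ 3)) • f μ ^ 2 := by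
    rw [← integral_const_mul]
    refine integral_congr_ae (.of_forall fun μ => ?_)
    simp only [real_smul]; push_cast; ring
  rw [e3] at ibp
  have key : ((I * (2 * t : ℝ)) * ∫ μ, (ψ μ * (μ 0 * rinv μ ^ 3)) • f μ ^ 2) =
      -∫ μ, (fderiv ℝ ψ μ (basisVec 0) • f μ ^ 2 + ψ μ • (2 * f μ * D μ)) := by
    rw [integral_add i1 i2]; linear_combination ibp
  have hn : 2 * t * ‖∫ μ, (ψ μ * (μ 0 * rinv μ ^ 3)) • f μ ^ 2‖ =
      ‖∫ μ, (fderiv ℝ ψ μ (basisVec 0) • f μ ^ 2 + ψ μ • (2 * f μ * D μ))‖ := by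
    rw [← norm_neg (∫ μ, (fderiv ℝ ψ μ (basisVec 0) • f μ ^ 2 + ψ μ • (2 * f μ * D μ))), ← key,
      norm_mul, norm_mul, norm_I, one_mul, norm_real, norm_of_nonneg (by positivity)]
  rw [hn, ← setIntegral_eq_integral_of_forall_compl_eq_zero (s := tsupport ψ), ← integral_const_mul]
  · have cP : Continuous fun μ => fderiv ℝ P μ (basisVec 0) :=
      (hP.continuous_fderiv two_ne_zero).clm_apply continuous_const
    refine norm_integral_le_of_norm_le
      (ContinuousOn.integrableOn_compact hcs.isCompact (by fun_prop)) (.of_forall fun μ => ?_)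
    set y := ‖fderiv ℝ P μ (basisVec 0)‖
    have hy0 : 0 ≤ y := norm_nonneg _
    have n1 : ‖f μ‖ ≤ 2 * m := (S.norm_mism_le _).trans (by gcongr; exact hm μ)
    have n2 : ‖D μ‖ ≤ 2 * (2 * C * (1 + log t) * (m + y) * (1 + m)) := by
      rw [hD]; simp only []
      rw [hS.fderiv_mism]
      refine (norm_mismCLM_le _).trans ?_
      gcongr
      refine (hS.norm_fderiv_wave_le hC (slowPt_mem ht μ (P μ)) (slowDir_dirJet μ _ 0)).trans ?_
      change 2 * C * (1 + log t) * (‖P μ‖ + y) * (1 + ‖P μ‖) ≤ _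
      gcongr <;> exact hm μ
    have hw : m * (m + y) ≤ (1 + m) ^ 2 * (1 + y ^ 2) := by
      nlinarith [sq_nonneg (y - 1), mul_nonneg hm0 hy0,
        mul_nonneg hm0 (sq_nonneg (y - 1)), mul_nonneg (sq_nonneg m) (sq_nonneg y)]
    have hm2 : m ^ 2 ≤ (1 + m) ^ 3 * (1 + y ^ 2) := by
      calc m ^ 2 ≤ (1 + m) ^ 3 * 1 := by nlinarith [pow_nonneg hm0 3]
        _ ≤ _ := by gcongr; nlinarith [sq_nonneg y]
    have hCL : 1 ≤ C * (1 + log t) := by nlinarith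
    calc ‖fderiv ℝ ψ μ (basisVec 0) • f μ ^ 2 + ψ μ • (2 * f μ * D μ)‖
        ≤ |fderiv ℝ ψ μ (basisVec 0)| * ‖f μ‖ ^ 2 + |ψ μ| * (2 * ‖f μ‖ * ‖D μ‖) := by
          refine (norm_add_le _ _).trans (le_of_eq ?_)
          simp
      _ ≤ b * (2 * m) ^ 2 + b * (2 * (2 * m) * (2 * (2 * C * (1 + log t) * (m + y) * (1 + m)))) := by
          gcongr
          · exact hb' μ
          · exact hb μ
      _ = 4 * b * (1 * m ^ 2) + 16 * b * (C * (1 + log t)) * (1 + m) * (m * (m + y)) := by ring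
      _ ≤ 4 * b * ((C * (1 + log t)) * ((1 + m) ^ 3 * (1 + y ^ 2))) +
          16 * b * (C * (1 + log t)) * (1 + m) * ((1 + m) ^ 2 * (1 + y ^ 2)) := by gcongr
      _ = _ := by ring
  · intro μ hμ
    rw [image_eq_zero_of_notMem_tsupport hμ,
      show fderiv ℝ ψ μ = 0 from image_eq_zero_of_notMem_tsupport fun h => hμ (tsupport_fderiv_subset ℝ h)]
    simp

end Oscillation

section ImaginaryPart

variable {A B : Plane → ℂ} {a₁ b₁ : Fin 2 → Plane → ℂ} {a₂ b₂ : Fin 2 → Fin 2 → Plane → ℂ}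

lemma exists_setIntegral_fderiv_approxPair_le (hA : WeakJet A a₁ a₂) (hB : WeakJet B b₁ b₂)
    (fA : ∫⁻ x, dens A a₁ a₂ x ≠ ⊤) (fB : ∫⁻ x, dens B b₁ b₂ x ≠ ⊤) (i : Fin 2) :
    ∃ E : ℝ, ∀ (k : ℕ) (K : Set Plane),
      ∫ μ in K, ‖fderiv ℝ (approxPair k A B) μ (basisVec i)‖ ^ 2 ≤ E := by
  obtain ⟨c, hc, hb⟩ := exists_enorm_approx_bound
  have hcont : ∀ k, Continuous fun μ => fderiv ℝ (approxPair k A B) μ (basisVec i) := fun k =>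
    (((hA.contDiff_approx k).prodMk (hB.contDiff_approx k)).continuous_fderiv two_ne_zero).clm_apply
      continuous_const
  refine ⟨(c * ((∫⁻ x, dens A a₁ a₂ x) + ∫⁻ x, dens B b₁ b₂ x)).toReal, fun k K => ?_⟩
  rw [integral_eq_lintegral_of_nonneg_ae
    (f := fun μ => ‖fderiv ℝ (approxPair k A B) μ (basisVec i)‖ ^ 2) (.of_forall fun μ => by positivity)
    ((hcont k).norm.pow 2).aestronglyMeasurable]
  refine ENNReal.toReal_mono (mul_ne_top hc (add_ne_top.2 ⟨fA, fB⟩))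
    ((setLIntegral_le_lintegral _ _).trans ?_)
  have hj : ∀ (x : Plane) (z : ℝ≥0∞), z ≤ ofReal (jap ‖x‖ ^ 4) * z := fun x z =>
    le_mul_of_one_le_left zero_le (by
      rw [← ENNReal.ofReal_one]; exact ofReal_le_ofReal (one_le_pow₀ (one_le_jap _)))
  have hmB : Measurable fun x => c * mollE k (dens B b₁ b₂) x :=
    (measurable_mollE k hB.measurable_dens).const_mul c
  calc _ ≤ ∫⁻ x, (c * mollE k (dens A a₁ a₂) x + c * mollE k (dens B b₁ b₂) x) := by
        refine lintegral_mono fun x => ?_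
        have e : fderiv ℝ (approxPair k A B) x (basisVec i) =
            (fderiv ℝ (approx k A) x (basisVec i), fderiv ℝ (approx k B) x (basisVec i)) :=
          congrFun (congrArg (fun J : Jet => J.2.1) (jetOf_approxPair hA hB k x)) i
        rw [e]
        refine (ofReal_le_ofReal (norm_pair_pow_le _ _ 2)).trans ?_
        rw [ofReal_add (by positivity) (by positivity), ofReal_pow (norm_nonneg _),
          ofReal_pow (norm_nonneg _), ofReal_norm, ofReal_norm]
        exact add_le_add ((hj x _).trans ((hb hA k x).1 i)) ((hj x _).trans ((hb hB k x).1 i))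
    _ = _ := by
        rw [lintegral_add_right _ hmB, lintegral_const_mul _ (measurable_mollE k hA.measurable_dens),
          lintegral_const_mul _ (measurable_mollE k hB.measurable_dens), lintegral_mollE k hA.measurable_dens,
          lintegral_mollE k hB.measurable_dens, mul_add]

lemma Symb.Good.continuous_mism_slowPt {C : ℝ} {S : Symb} (hS : S.Good C) (t : ℝ) {P : Plane → ℂ × ℂ}
    (hP : Continuous P) : Continuous fun μ => S.mism (slowPt t μ (P μ)) := by
  have cr := (contDiff_rinv (n := 0)).continuous
  refine hS.contDiff_mism.continuous.comp ?_
  unfold slowPt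
  fun_prop

/-- The oscillating part of the square of the mismatch decays. -/
lemma Symb.Good.exists_norm_integral_mism_sq_le {C : ℝ} {S : Symb} (hS : S.Good C) (hC : 1 ≤ C)
    (hA : WeakJet A a₁ a₂) (hB : WeakJet B b₁ b₂) {m : ℝ} (hmA : ∀ x, ‖A x‖ ≤ m) (hmB : ∀ x, ‖B x‖ ≤ m)
    (fA : ∫⁻ x, dens A a₁ a₂ x ≠ ⊤) (fB : ∫⁻ x, dens B b₁ b₂ x ≠ ⊤) {ψ : Plane → ℝ}
    (hψ : ContDiff ℝ 2 ψ) (hcs : HasCompactSupport ψ) :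
    ∃ K : ℝ, ∀ t : ℝ, 1 ≤ t →
      ‖∫ μ, (ψ μ * (μ 0 * rinv μ ^ 3)) • S.mism (slowPt t μ (A μ, B μ)) ^ 2‖ ≤
        K * ((1 + log t) / t) := by
  obtain ⟨E, hE⟩ := exists_setIntegral_fderiv_approxPair_le hA hB fA fB 0
  obtain ⟨b, hb⟩ := hψ.continuous.bounded_above_of_compact_support hcs
  obtain ⟨b', hb'⟩ := ((hψ.continuous_fderiv two_ne_zero).clm_apply
    continuous_const).bounded_above_of_compact_support (hcs.fderiv_apply (𝕜 := ℝ) (basisVec 0))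
  have hm0 : 0 ≤ m := (norm_nonneg _).trans (hmA 0)
  have cP : ∀ k, ContDiff ℝ 2 (approxPair k A B) := fun k =>
    (hA.contDiff_approx k).prodMk (hB.contDiff_approx k)
  have hmk : ∀ k μ, ‖approxPair k A B μ‖ ≤ m := fun k μ =>
    max_le (norm_approx_le hmA k μ) (norm_approx_le hmB k μ)
  have cr := (contDiff_rinv (n := 0)).continuous
  have cw : Continuous fun μ => ψ μ * (μ 0 * rinv μ ^ 3) := by have := hψ.continuous; fun_prop
  have hw : HasCompactSupport fun μ => ψ μ * (μ 0 * rinv μ ^ 3) := hcs.mul_right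
  set β := max b b'
  have hβ0 : 0 ≤ β := (norm_nonneg _).trans ((hb 0).trans (le_max_left _ _))
  refine ⟨10 * β * C * (1 + m) ^ 3 * (volume.real (tsupport ψ) + E), fun t ht => ?_⟩
  have ht0 : 0 < t := by linarith
  have hL := Real.log_nonneg ht
  have hlim : Tendsto (fun k => ∫ μ, (ψ μ * (μ 0 * rinv μ ^ 3)) • S.mism (slowPt t μ (approxPair k A B μ)) ^ 2)
      atTop (𝓝 (∫ μ, (ψ μ * (μ 0 * rinv μ ^ 3)) • S.mism (slowPt t μ (A μ, B μ)) ^ 2)) := by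
    refine tendsto_integral_of_dominated_convergence
      (fun μ => ‖ψ μ * (μ 0 * rinv μ ^ 3)‖ * (2 * m) ^ 2) (fun k => ?_) ?_ (fun k => ?_) ?_
    · exact (cw.smul ((hS.continuous_mism_slowPt t (cP k).continuous).pow 2)).aestronglyMeasurable
    · exact ((cw.integrable_of_hasCompactSupport hw).norm).mul_const _
    · refine .of_forall fun μ => ?_
      rw [norm_smul, norm_pow]
      gcongr
      exact (S.norm_mism_le _).trans (by gcongr; exact hmk k μ)
    · refine .of_forall fun μ => ?_
      refine tendsto_const_nhds.smul (Tendsto.pow ?_ 2)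
      exact ((hS.contDiff_mism.continuous.comp (continuous_slowPt t μ)).tendsto _).comp
        ((hA.tendsto_approx.1 μ).prodMk_nhds (hB.tendsto_approx.1 μ))
  refine le_of_tendsto hlim.norm (.of_forall fun k => ?_)
  have h := hS.norm_integral_mism_sq_le hC (cP k) (hmk k) ht hψ hcs (b := β)
    (fun μ => (hb μ).trans (le_max_left _ _)) (fun μ => (hb' μ).trans (le_max_right _ _))
  have cD : Continuous fun μ => fderiv ℝ (approxPair k A B) μ (basisVec 0) :=
    ((cP k).continuous_fderiv two_ne_zero).clm_apply continuous_const
  have i2 : IntegrableOn (fun μ => ‖fderiv ℝ (approxPair k A B) μ (basisVec 0)‖ ^ 2) (tsupport ψ) :=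
    (cD.norm.pow 2).continuousOn.integrableOn_compact hcs.isCompact
  have hi : ∫ μ in tsupport ψ, (1 + ‖fderiv ℝ (approxPair k A B) μ (basisVec 0)‖ ^ 2) ≤
      volume.real (tsupport ψ) + E := by
    rw [integral_add (continuous_const.continuousOn.integrableOn_compact hcs.isCompact) i2]
    refine add_le_add (le_of_eq ?_) (hE k _)
    simp
  have h2 := h.trans (mul_le_mul_of_nonneg_left hi (by positivity))
  rw [show ∀ a b c d : ℝ, 10 * β * C * a * b * (c / d) = (20 * β * C * c * a * b) / (2 * d) from
    fun a b c d => by ring, le_div_iff₀ (by positivity)]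
  linarith

lemma ofReal_integral_le_lintegral {α : Type*} [MeasurableSpace α] {ν : Measure α} {g : α → ℝ}
    (hg : Integrable g ν) : ofReal (∫ x, g x ∂ν) ≤ ∫⁻ x, ofReal (g x) ∂ν := by
  have h : ∫ x, g x ∂ν ≤ ∫ x, max (g x) 0 ∂ν := integral_mono hg hg.pos_part fun x => le_max_left _ _
  refine (ofReal_le_ofReal h).trans (le_of_eq ?_)
  rw [ofReal_integral_eq_lintegral_ofReal hg.pos_part (.of_forall fun x => le_max_right _ _)]
  simp

lemma tendsto_one_add_log_div : Tendsto (fun t : ℝ => (1 + log t) / t) atTop (𝓝 0) := by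
  have h := tendsto_inv_atTop_zero.add Real.isLittleO_log_id_atTop.tendsto_div_nhds_zero
  rw [add_zero] at h
  exact h.congr fun t => by simp only [id]; ring

lemma exists_coord_ne_zero_mem {U : Set Plane} (hU : IsOpen U) (hne : U.Nonempty) :
    ∃ ξ ∈ U, ξ 0 ≠ 0 := by
  obtain ⟨ξ, hξ⟩ := hne
  by_cases h0 : ξ 0 = 0
  · have hc : Continuous fun δ : ℝ => ξ + δ • basisVec 0 := by fun_prop
    have h1 : ∀ᶠ δ in 𝓝 (0 : ℝ), ξ + δ • basisVec 0 ∈ U :=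
      hc.continuousAt.eventually (hU.mem_nhds (by simpa using hξ))
    obtain ⟨δ, h2, h3⟩ := ((h1.filter_mono nhdsWithin_le_nhds).and
      (self_mem_nhdsWithin (s := {(0 : ℝ)}ᶜ))).exists
    refine ⟨_, h2, ?_⟩
    simpa [h0, basisVec] using h3
  · exact ⟨ξ, hξ, h0⟩

lemma Symb.Good.le_sq_mul_im_prof_sq {C : ℝ} {S : Symb} (hS : S.Good C) {t m : ℝ} (ht : 0 < t)
    (μ : Plane) {p : ℂ × ℂ} (hp : ‖p‖ ≤ m) :
    (‖p.1‖ - ‖p.2‖) ^ 2 / 4 - (S.mism (slowPt t μ p) ^ 2).re / 4 - (C * m ^ 2 * t⁻¹) ^ 2 ≤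
      t ^ 2 * (S.prof (slowPt t μ p)).im ^ 2 := by
  set e := slowPt t μ p with he
  have h1 := hS.norm_prof_le ht μ p
  rw [← he] at h1
  have h2 : |t * (S.prof e).im - (S.sumw e).im| ≤ C * m ^ 2 * t⁻¹ := by
    have h3 := (Complex.abs_im_le_norm _).trans h1
    rw [Complex.sub_im, Complex.im_ofReal_mul] at h3
    calc |t * (S.prof e).im - (S.sumw e).im| = t * |(S.prof e).im - t⁻¹ * (S.sumw e).im| := by
          rw [← abs_of_pos ht, ← abs_mul, abs_of_pos ht]; congr 1; field_simp
      _ ≤ t * (C * (t ^ 2)⁻¹ * ‖p‖ ^ 2) := by gcongr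
      _ = C * ‖p‖ ^ 2 * t⁻¹ := by field_simp
      _ ≤ _ := by have := (norm_nonneg _).trans (hS.fderiv_phA_le 0); gcongr
  have h4 := sq_le_sq' (abs_le.1 h2).1 (abs_le.1 h2).2
  have h5 := S.im_sumw_sq e
  have h6 : (‖p.1‖ - ‖p.2‖) ^ 2 ≤ ‖S.mism e‖ ^ 2 := S.sub_sq_le_norm_mism e
  nlinarith [sq_nonneg (2 * (t * (S.prof e).im) - (S.sumw e).im)]

/-- The imaginary part does not vanish in the limit if the two amplitudes have different moduli. -/
theorem Admissible.liminf_im_profile_pos {ρ : ℝ} {ζ : Plane → ℝ} (hρ : 1 ≤ ρ) (h : Admissible ρ A B ζ)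
    (lam : ℝ) (hpos : 0 < volume {ξ : Plane | ‖A ξ‖ ≠ ‖B ξ‖}) :
    0 < liminf (fun t : ℝ => eLpNorm (fun x => (profile lam A B ζ t x).im) 2 volume) atTop := by
  have cA := h.continuous_A
  have cB := h.continuous_B
  obtain ⟨a₁, a₂, hA⟩ := h.mem_A.exists_weakJet cA
  obtain ⟨b₁, b₂, hB⟩ := h.mem_B.exists_weakJet cB
  obtain ⟨mA, hmA⟩ := hA.exists_norm_le h.mem_A
  obtain ⟨mB, hmB⟩ := hB.exists_norm_le h.mem_B
  set m := max mA mB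
  have hmA' : ∀ x, ‖A x‖ ≤ m := fun x => (hmA x).trans (le_max_left _ _)
  have hmB' : ∀ x, ‖B x‖ ≤ m := fun x => (hmB x).trans (le_max_right _ _)
  obtain ⟨ξ, hξ, hξ0⟩ := exists_coord_ne_zero_mem (isOpen_ne_fun cA.norm cB.norm)
    (nonempty_of_measure_ne_zero hpos.ne')
  have hp : (A ξ, B ξ) ≠ 0 := fun h0 => hξ (by
    rw [show A ξ = 0 from (Prod.ext_iff.1 h0).1, show B ξ = 0 from (Prod.ext_iff.1 h0).2])
  obtain ⟨N, hN⟩ := (eventually_cut_cScale hp).exists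
  have cP : Continuous fun μ => (A μ, B μ) := cA.prodMk cB
  obtain ⟨ε, hε, hball⟩ := Metric.mem_nhds_iff.1 ((isOpen_lt continuous_const
    ((contDiff_sqNorm (n := 0)).continuous.comp cP)).mem_nhds hN)
  obtain ⟨C, hC, hgood⟩ := exists_regSeq_good lam ρ
  have hS := hgood N
  set S := regSeq lam ρ N
  set χ : ContDiffBump ξ := ⟨ε / 4, ε / 2, by positivity, by linarith⟩
  have c0 : ContDiff ℝ 2 fun μ : Plane => μ 0 := by fun_prop
  set ψ : Plane → ℝ := fun μ => μ 0 * rinv μ ^ 3 * χ μ with hψd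
  have hψ : ContDiff ℝ 2 ψ := (c0.mul (contDiff_rinv.pow 3)).mul χ.contDiff
  have hcs : HasCompactSupport ψ := χ.hasCompactSupport.mul_left
  obtain ⟨K, hK⟩ := hS.exists_norm_integral_mism_sq_le hC hA hB hmA' hmB'
    (hA.lintegral_dens_ne_top h.mem_A) (hB.lintegral_dens_ne_top h.mem_B) hψ hcs
  set w : Plane → ℝ := fun μ => ψ μ * (μ 0 * rinv μ ^ 3) with hw
  have cw : Continuous w := hψ.continuous.mul (c0.continuous.mul
    ((contDiff_rinv (n := 0)).continuous.pow 3))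
  have sw : HasCompactSupport w := hcs.mul_right
  have hwe : ∀ μ, w μ = (μ 0 * rinv μ ^ 3) ^ 2 * χ μ := fun μ => by simp only [hw, hψd]; ring
  have hw0 : ∀ μ, 0 ≤ w μ := fun μ => by rw [hwe]; exact mul_nonneg (sq_nonneg _) χ.nonneg
  have hw1 : ∀ μ, w μ ≤ rinv μ ^ 4 := fun μ => by
    have h1 : |μ 0 * rinv μ| ≤ 1 := by
      rw [abs_mul, abs_of_pos (rinv_pos μ)]
      exact (mul_le_mul_of_nonneg_right (abs_coord_le μ 0) (rinv_pos μ).le).trans (norm_mul_rinv_le μ)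
    have h2 : (μ 0 * rinv μ) ^ 2 ≤ 1 := by rw [← sq_abs]; exact pow_le_one₀ (abs_nonneg _) h1
    calc w μ = (μ 0 * rinv μ) ^ 2 * rinv μ ^ 4 * χ μ := by rw [hwe]; ring
      _ ≤ 1 * rinv μ ^ 4 * 1 := by
          have := rinv_pos μ
          gcongr
          · exact χ.nonneg
          · exact χ.le_one
      _ = _ := by ring
  have hwi : ∀ g : Plane → ℝ, Continuous g → Integrable fun μ => w μ * g μ := fun g hg =>
    (cw.mul hg).integrable_of_hasCompactSupport sw.mul_right
  set κ := ∫ μ, w μ * (‖A μ‖ - ‖B μ‖) ^ 2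
  have hκ0 : 0 < κ := by
    refine (show Continuous fun μ => w μ * (‖A μ‖ - ‖B μ‖) ^ 2 by fun_prop).integral_pos_of_hasCompactSupport_nonneg_nonzero
      sw.mul_right (fun μ => mul_nonneg (hw0 μ) (sq_nonneg _)) (x := ξ) ?_
    rw [hwe, χ.one_of_mem_closedBall (by simp [χ.rIn_pos.le])]
    have := (rinv_pos ξ).ne'
    have := sub_ne_zero.2 hξ
    positivity
  set W := ∫ μ, w μ with hW
  have hbound : ∀ t : ℝ, 1 ≤ t → ofReal (κ / 4 - K * ((1 + log t) / t) / 4 -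
      (C * m ^ 2 * t⁻¹) ^ 2 * W) ≤ eLpNorm (fun x => (profile lam A B ζ t x).im) 2 volume ^ 2 := fun t ht => by
    have ht0 : 0 < t := by linarith
    have e1 : eLpNorm (fun x => (profile lam A B ζ t x).im) 2 volume ^ 2 =
        ∫⁻ μ, ofReal (t ^ 2 * rinv μ ^ 4) *
          ‖(((profH (mainSymb lam ρ) fun z => (A z, B z)) (t, μ)).im : ℂ)‖ₑ ^ 2 := by
      have e := eLpNorm_nnreal_pow_eq_lintegral (f := fun x => (profile lam A B ζ t x).im) (μ := volume)
        (p := 2) two_ne_zero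
      simp only [NNReal.coe_ofNat, ENNReal.rpow_two] at e
      rw [← lintegral_enorm_sq_coneExt (fun q => (((profH (mainSymb lam ρ) fun z => (A z, B z)) q).im : ℂ)) ht0]
      refine Eq.trans e (lintegral_congr fun x => ?_)
      rw [h.profile_eq_coneExt hρ lam]
      by_cases hx : ‖x‖ < t
      · rw [coneExt_of_mem _ hx, coneExt_of_mem _ hx]
        congr 1
        rw [← ofReal_norm, ← ofReal_norm, norm_real]
      · rw [coneExt_of_notMem _ hx, coneExt_of_notMem _ hx]; simp
    have cm := hS.continuous_mism_slowPt t cP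
    have j1 := hwi (fun μ => (‖A μ‖ - ‖B μ‖) ^ 2 / 4) (by fun_prop)
    have j2 := hwi (fun μ => (S.mism (slowPt t μ (A μ, B μ)) ^ 2).re / 4)
      ((Complex.continuous_re.comp (cm.pow 2)).div_const 4)
    have j12 : Integrable fun μ => w μ * ((‖A μ‖ - ‖B μ‖) ^ 2 / 4) -
        w μ * ((S.mism (slowPt t μ (A μ, B μ)) ^ 2).re / 4) := j1.sub j2
    have j3 := hwi (fun _ => (C * m ^ 2 * t⁻¹) ^ 2) continuous_const
    rw [e1]
    calc _ ≤ ofReal (∫ μ, (w μ * ((‖A μ‖ - ‖B μ‖) ^ 2 / 4) -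
          w μ * ((S.mism (slowPt t μ (A μ, B μ)) ^ 2).re / 4) - w μ * (C * m ^ 2 * t⁻¹) ^ 2)) := by
          refine ofReal_le_ofReal ?_
          rw [integral_sub j12 j3, integral_sub j1 j2, integral_mul_const]
          have k1 : ∫ μ, w μ * ((‖A μ‖ - ‖B μ‖) ^ 2 / 4) = κ / 4 := by
            simp only [← mul_div_assoc]; rw [integral_div]
          have k2 : ∫ μ, w μ * ((S.mism (slowPt t μ (A μ, B μ)) ^ 2).re / 4) =
              (∫ μ, w μ • S.mism (slowPt t μ (A μ, B μ)) ^ 2).re / 4 := by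
            have hItg : Integrable fun μ => w μ • S.mism (slowPt t μ (A μ, B μ)) ^ 2 := by
              refine (cw.smul (cm.pow 2)).integrable_of_hasCompactSupport
                (sw.mono' fun x hx => subset_tsupport _ fun h0 => hx ?_)
              simp [h0]
            have := integral_re hItg
            simp only [← mul_div_assoc]
            rw [integral_div]
            congr 1
            refine Eq.trans (integral_congr_ae (.of_forall fun μ => ?_)) this
            simp
          rw [k1, k2]
          have := (Complex.re_le_norm _).trans (hK t ht)
          linarith
      _ ≤ ∫⁻ μ, ofReal (w μ * ((‖A μ‖ - ‖B μ‖) ^ 2 / 4) -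
          w μ * ((S.mism (slowPt t μ (A μ, B μ)) ^ 2).re / 4) - w μ * (C * m ^ 2 * t⁻¹) ^ 2) :=
          ofReal_integral_le_lintegral (j12.sub j3)
      _ ≤ _ := by
          refine lintegral_mono fun μ => ?_
          rw [← ofReal_norm, norm_real, ← ofReal_pow (norm_nonneg _),
            ← ofReal_mul (by have := rinv_pos μ; positivity), norm_eq_abs, sq_abs]
          refine ofReal_le_ofReal ?_
          change _ ≤ t ^ 2 * rinv μ ^ 4 * ((mainSymb lam ρ).prof (slowPt t μ (A μ, B μ))).im ^ 2
          by_cases hx : χ μ = 0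
          · rw [hwe, hx]; simp only [mul_zero, zero_mul, sub_zero]
            have := rinv_pos μ; positivity
          · have hμ : μ ∈ Metric.ball ξ ε := by
              have : μ ∈ Function.support χ := hx
              rw [χ.support_eq] at this
              exact Metric.ball_subset_ball (by change ε / 2 ≤ ε; linarith) this
            have hcut : cut (cScale N) (prP (slowPt t μ (A μ, B μ))) = 1 :=
              cut_eq_one (cScale_pos N) (le_of_lt (hball hμ))
            rw [← regSymb_prof_eq hcut]
            have := hS.le_sq_mul_im_prof_sq (m := m) ht0 μ (p := (A μ, B μ)) (max_le (hmA' μ) (hmB' μ))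
            calc _ = w μ * ((‖A μ‖ - ‖B μ‖) ^ 2 / 4 - (S.mism (slowPt t μ (A μ, B μ)) ^ 2).re / 4 -
                  (C * m ^ 2 * t⁻¹) ^ 2) := by ring
              _ ≤ w μ * (t ^ 2 * (S.prof (slowPt t μ (A μ, B μ))).im ^ 2) :=
                  mul_le_mul_of_nonneg_left this (hw0 μ)
              _ ≤ rinv μ ^ 4 * (t ^ 2 * (S.prof (slowPt t μ (A μ, B μ))).im ^ 2) :=
                  mul_le_mul_of_nonneg_right (hw1 μ) (by positivity)
              _ = t ^ 2 * rinv μ ^ 4 * (S.prof (slowPt t μ (A μ, B μ))).im ^ 2 := by ring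
  have hlim : Tendsto (fun t : ℝ => κ / 4 - K * ((1 + log t) / t) / 4 - (C * m ^ 2 * t⁻¹) ^ 2 * W)
      atTop (𝓝 (κ / 4 - K * 0 / 4 - (C * m ^ 2 * 0) ^ 2 * W)) :=
    (tendsto_const_nhds.sub ((tendsto_one_add_log_div.const_mul K).div_const 4)).sub
      (((tendsto_inv_atTop_zero.const_mul _).pow 2).mul_const W)
  have hev := hlim.eventually (lt_mem_nhds (show κ / 8 < _ by simp; linarith))
  refine lt_of_lt_of_le (show 0 < ofReal (sqrt (κ / 8)) by
    rw [ENNReal.ofReal_pos]; positivity) (le_liminf_of_le isCobounded_ge_of_top ?_)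
  filter_upwards [hev, eventually_ge_atTop 1] with t h1 h2
  have h3 := (ofReal_le_ofReal h1.le).trans (hbound t h2)
  rw [← Real.sq_sqrt (show 0 ≤ κ / 8 by positivity), ofReal_pow (Real.sqrt_nonneg _)] at h3
  exact (ENNReal.pow_le_pow_left_iff two_ne_zero).1 h3

end ImaginaryPart

end KG

end

theorem propositionP (lam ρ₀ : ℝ) (hρ₀ : 1 ≤ ρ₀) :
    -- the series converges, and the two estimates, with a constant depending on `lam`, `ρ₀` only
    (∃ C : ℝ, 0 < C ∧ ∀ (A B : KG.Plane → ℂ) (ζ : KG.Plane → ℝ), KG.Admissible ρ₀ A B ζ →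
      (∀ (t : ℝ) (x : KG.Plane), 1 ≤ t → ‖x‖ < t →
        Summable fun n : ℕ => KG.harmonic lam A B ζ (n + 2) t x) ∧
      (∀ t : ℝ, 3 ≤ t →
        eLpNorm (KG.profile lam A B ζ t) ⊤ volume ≤
          ENNReal.ofReal (C * t⁻¹) * (eLpNorm A ⊤ volume + eLpNorm B ⊤ volume) *
            KG.japE (eLpNorm A ⊤ volume + eLpNorm B ⊤ volume) ^ 2) ∧
      ∃ F : ℝ → KG.Plane → ℂ, KG.IsKleinGordonOf (KG.profile lam A B ζ) F ∧
        ∀ t : ℝ, 3 ≤ t →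
          eLpNorm (fun x => F t x - KG.nonlin lam (KG.profile lam A B ζ t x)) 2 volume ≤
            ENNReal.ofReal (C * (t ^ 2)⁻¹ * Real.log t ^ 2) *
              (KG.sobolevNorm 2 2 A + KG.sobolevNorm 2 2 B) *
              KG.japE (KG.sobolevNorm 2 2 A + KG.sobolevNorm 2 2 B) ^ 3) ∧
    -- consequence for data that are small in `L^∞`
    (∀ ε₀ : ℝ, 0 < ε₀ → ∃ η : ℝ, 0 < η ∧
      ∀ (A B : KG.Plane → ℂ) (ζ : KG.Plane → ℝ), KG.Admissible ρ₀ A B ζ →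
        eLpNorm A ⊤ volume + eLpNorm B ⊤ volume ≤ ENNReal.ofReal η →
        ∃ F : ℝ → KG.Plane → ℂ, KG.IsKleinGordonOf (KG.profile lam A B ζ) F ∧
          ∀ δ₀ : ℝ, δ₀ < 1 → ∃ T : ℝ, 1 ≤ T ∧ ∀ t : ℝ, T ≤ t →
            eLpNorm (KG.profile lam A B ζ t) ⊤ volume ≤ ENNReal.ofReal (ε₀ * t⁻¹) ∧
            eLpNorm (fun x => F t x - KG.nonlin lam (KG.profile lam A B ζ t x)) 2 volume ≤
              ENNReal.ofReal (ε₀ * t ^ (-1 - δ₀))) ∧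
    -- the profile stays complex-valued
    (∀ (A B : KG.Plane → ℂ) (ζ : KG.Plane → ℝ), KG.Admissible ρ₀ A B ζ →
      0 < volume {ξ : KG.Plane | ‖A ξ‖ ≠ ‖B ξ‖} →
      0 < liminf (fun t : ℝ =>
        eLpNorm (fun x => (KG.profile lam A B ζ t x).im) 2 volume) atTop) ∧
    (∀ z : ℝ, 0 < z →
      (KG.fourierL 0 z - (z : ℂ) * KG.fourierL 0 (1 / z) = 0 ↔ z = 1)) := by
  obtain ⟨C₁, hC₁, hres⟩ := KG.exists_residual_bound lam ρ₀ hρ₀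
  obtain ⟨C₂, hC₂, hsup⟩ := KG.exists_profile_sup_bound lam ρ₀ hρ₀
  refine ⟨⟨max C₁ (2 * C₂), lt_max_of_lt_left hC₁, fun A B ζ h => ⟨?_, ?_, ?_⟩⟩, ?_,
    fun A B ζ h hpos => h.liminf_im_profile_pos hρ₀ lam hpos, KG.fourierL_zero_sub_eq_zero_iff⟩
  · exact fun t x _ _ => (h.hasSum_harmonic hρ₀ lam t x).summable
  · intro t ht
    have ht0 : 0 < t := by linarith
    refine (hsup A B ζ h t (by linarith)).trans ?_
    set m := eLpNorm A ⊤ volume + eLpNorm B ⊤ volume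
    calc ENNReal.ofReal (C₂ * t⁻¹) * m * (1 + m)
        ≤ ENNReal.ofReal (C₂ * t⁻¹) * m * (2 * KG.japE m ^ 2) := by
          gcongr; exact KG.one_add_le_two_japE_sq m
      _ = ENNReal.ofReal (2 * C₂ * t⁻¹) * m * KG.japE m ^ 2 := by
          rw [show 2 * C₂ * t⁻¹ = 2 * (C₂ * t⁻¹) by ring, ENNReal.ofReal_mul zero_le_two,
            ENNReal.ofReal_ofNat]
          ring
      _ ≤ _ := by gcongr; exact le_max_right _ _
  · obtain ⟨F, hF, hb⟩ := hres A B ζ h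
    refine ⟨F, hF, fun t ht => (hb t ht).trans ?_⟩
    have ht0 : 0 < t := by linarith
    gcongr
    exact le_max_left _ _
  · intro ε hε
    have hC₂0 : 0 < C₂ := by linarith
    refine ⟨min 1 (ε / (2 * C₂)), by positivity, fun A B ζ h hη => ?_⟩
    obtain ⟨F, hF, hb⟩ := hres A B ζ h
    refine ⟨F, hF, fun δ hδ => ?_⟩
    set M := KG.sobolevNorm 2 2 A + KG.sobolevNorm 2 2 B
    have hM : M * KG.japE M ^ 3 ≠ ⊤ := by
      have h0 : M ≠ ⊤ := h.sobolevNorm_ne_top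
      refine ENNReal.mul_ne_top h0 (ENNReal.pow_ne_top fun h1 => ?_)
      have h2 := KG.japE_sq M
      rw [h1] at h2
      exact ENNReal.add_ne_top.2 ⟨ENNReal.one_ne_top, ENNReal.pow_ne_top h0⟩ (h2.symm.trans (by simp))
    obtain ⟨T, hT⟩ := eventually_atTop.1
      (KG.eventually_log_sq_le (c := C₁ * (M * KG.japE M ^ 3).toReal) hε hδ)
    refine ⟨max T 3, le_trans (by norm_num) (le_max_right _ _), fun t ht => ?_⟩
    have ht3 : 3 ≤ t := (le_max_right _ _).trans ht
    have ht0 : 0 < t := by linarith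
    constructor
    · refine (hsup A B ζ h t (by linarith)).trans ?_
      set m := eLpNorm A ⊤ volume + eLpNorm B ⊤ volume
      have hm1 : m ≤ 1 := hη.trans (by
        rw [← ENNReal.ofReal_one]; exact ENNReal.ofReal_le_ofReal (min_le_left _ _))
      have hm2 : m ≤ ENNReal.ofReal (ε / (2 * C₂)) :=
        hη.trans (ENNReal.ofReal_le_ofReal (min_le_right _ _))
      calc ENNReal.ofReal (C₂ * t⁻¹) * m * (1 + m)
          ≤ ENNReal.ofReal (C₂ * t⁻¹) * ENNReal.ofReal (ε / (2 * C₂)) * (1 + 1) := by gcongr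
        _ = ENNReal.ofReal (C₂ * t⁻¹ * (ε / (2 * C₂)) * 2) := by
            rw [ENNReal.ofReal_mul (p := C₂ * t⁻¹ * _) (by positivity),
              ENNReal.ofReal_mul (p := C₂ * t⁻¹) (by positivity), ENNReal.ofReal_ofNat, one_add_one_eq_two]
        _ = ENNReal.ofReal (ε * t⁻¹) := by congr 1; field_simp
    · refine (hb t ht3).trans ?_
      rw [mul_assoc, ← ENNReal.ofReal_toReal hM, ← ENNReal.ofReal_mul (by positivity)]
      refine ENNReal.ofReal_le_ofReal (le_of_eq_of_le ?_ (hT t ((le_max_left _ _).trans ht)))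
      ring
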